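/- **Theorem (convergence rate of the MAC scheme).** *Continuous problem.* Let $d\in\{2,3\}$, let $\Omega=([0,1]|_{\{0,1\}})^d$ be the flat torus, $T>0$, $\mu>0$, $\mu+\lambda\ge 0$, $a>0$, and $p(\varrho)=a\varrho^\gamma$ with $\gamma>1$ and $\gamma\ge d/2$. Let $H(\varrho)=\varrho\int_1^\varrho p(z)z^{-2}\,dz$, $\mathbb E(\varrho|r)=H(\varrho)-H'(r)(\varrho-r)-H(r)$ and $$\mathfrak E(\varrho,u|r,U)=\int_\Omega\Big(\tfrac12\varrho|u-U|^2+\mathbb E(\varrho|r)\Big)\,dx .$$ Let $(r,U)$, with $r\in C^2([0,T]\times\Omega)$, $U\in C^2([0,T]\times\Omega;\mathbb R^d)$ and $0<\underline r\le r\le\overline r$, be a classical space-periodic solution on $[0,T]$ of $$\partial_t r+\operatorname{div}(rU)=0,\qquad \partial_t(rU)+\operatorname{div}(rU\otimes U)+\nabla p(r)=\operatorname{div}\big(\mu(\nabla U+\nabla^{T}U)+\lambda\operatorname{div}U\,\mathbb I\big).$$ *Grid.* Let $N\ge1$, $h=1/N$, and divide $\Omega$ into $N^d$ cubes $K$ of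 side $h$. For $1\le i\le d$ let $\mathcal E_i$ be the set of faces orthogonal to $e_i$; the cell $K$ has the faces $\sigma_{K,i\pm}\in\mathcal E_i$ with centres $x_K\pm\frac h2e_i$. For $\sigma\in\mathcal E_i$ write $\sigma=\overrightarrow{K|L}$ if $x_L-x_K=he_i$. Densities have one value $r_K$ per cell; velocities $v=(v_1,\dots,v_d)$ have one value $v_{i,\sigma}$ of $v_i$ per face $\sigma\in\mathcal E_i$; everything is periodic. Cell values are identified with piecewise constant functions. For a cell quantity $r$, a velocity $v$ and $\sigma=\overrightarrow{K|L}\in\mathcal E_i$, put $$\{r\}^{(i)}_\sigma=\tfrac{r_K+r_L}2,\quad (\partial^{(i)}_{\mathcal E}r)_\sigma=\tfrac{r_L-r_K}h,\quad (\overline v_i)_K=\tfrac{v_{i,\sigma_{K,i+}}+v_{i,\sigma_{K,i-}}}2,\quad (\partial^{(i)}_{\mathcal M}v_i)_K=\tfrac{v_{i,\sigma_{K,i+}}-v_{i,\sigma_{K,i-}}}h,$$ $\operatorname{div}_hv=\sum_i\partial^{(i)}_{\mathcal M}v_i$, $\Delta_{\mathcal M}r=\sum_i\partial_{\mathcal M}^{(i)}\partial_{\mathcal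 E}^{(i)}r$, and $\operatorname{div}_{\rm Up}[r,v]=\sum_i\partial_{\mathcal M}^{(i)}\mathrm{Up}^{(i)}[r,v]$ with $\mathrm{Up}^{(i)}[r,v]_\sigma=r_K\max(v_{i,\sigma},0)+r_L\min(v_{i,\sigma},0)$. For faces $\sigma,\sigma'\in\mathcal E_i$ with $x_{\sigma'}-x_\sigma=he_j$ let $\eth_jv_i=(v_{i,\sigma'}-v_{i,\sigma})/h$, a constant on the cube of side $h$ centred at the midpoint of $x_\sigma$ and $x_{\sigma'}$, let $\nabla_\epsilon v=(\eth_jv_i)_{i,j}$, and let $\Delta_{\mathcal E}v_i$ be the usual $(2d+1)$-point Laplacian of $v_i$ on the grid $\mathcal E_i$. Let $\Pi_{\mathcal M}$ denote cell averages, and let $\Pi_{\mathcal E}$ denote the averages of the $i$-th component over the faces in $\mathcal E_i$. *Scheme.* Let $N_t\ge1$, $\Delta t=T/N_t$, $t^n=n\Delta t$, and let $\alpha>1$, with in addition $\alpha<2\gamma-d/3$ if $\gamma<2$. Let $\varrho_0\in L^1(\Omega)$ with $\varrho_0>0$ a.e., $u_0\in L^1(\Omega;\mathbb R^d)$, and put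 $\varrho_h^0=\Pi_{\mathcal M}\varrho_0$, $\overline u_h^0=\Pi_{\mathcal M}u_0$. Let $(\varrho_h^n,u_h^n)_{1\le n\le N_t}$ satisfy, for $1\le n\le N_t$ and $1\le i\le d$, with $D_tf^n=(f^n-f^{n-1})/\Delta t$, $$D_t\varrho_h^n+\operatorname{div}_{\rm Up}[\varrho_h^n,u_h^n]-h^\alpha\Delta_{\mathcal M}\varrho_h^n=0,$$ $$D_t\{\varrho_h^n\overline u_{i,h}^n\}^{(i)}+\{\operatorname{div}_{\rm Up}[\varrho_h^n\overline u_{i,h}^n,u_h^n]\}^{(i)}+\partial_{\mathcal E}^{(i)}p(\varrho_h^n)-\mu\Delta_{\mathcal E}u_{i,h}^n-(\mu+\lambda)\partial_{\mathcal E}^{(i)}\operatorname{div}_hu_h^n=h^\alpha\sum_{j=1}^d\Big\{\partial_{\mathcal M}^{(j)}\big(\{\overline u_{i,h}^n\}^{(j)}\partial_{\mathcal E}^{(j)}\varrho_h^n\big)\Big\}^{(i)} .$$ Let $M_0=\int_\Omega\varrho_h^0\,dx$, let $E_0$ be an upper bound of $\int_\Omega(\frac12\varrho_h^0|\overline u_h^0|^2+H(\varrho_h^0))\,dx$,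 and let $r_h^n=\Pi_{\mathcal M}r(t^n)$, $U_h^n=\Pi_{\mathcal E}U(t^n)$. *Conclusion.* There is a constant $c>0$ that depends only on $d,T,\gamma,a,\mu,\lambda,M_0,E_0,\underline r,\overline r$ and on an upper bound of $$\|(\nabla r,\partial_tr,\partial_t\nabla r,\partial_t^2r,U,\nabla U,\nabla^2U,\partial_tU,\partial_t\nabla U)\|_{L^\infty((0,T)\times\Omega)}$$ (in particular, not on $h$ and $\Delta t$) such that $$\sup_{0\le n\le N_t}\mathfrak E(\varrho_h^n,\overline u_h^n|r_h^n,\overline U_h^n)+\Delta t\sum_{n=1}^{N_t}\frac\mu2\int_\Omega|\nabla_\epsilon(u_h^n-U_h^n)|^2dx+\Delta t\sum_{n=1}^{N_t}(\mu+\lambda)\int_\Omega|\operatorname{div}_h(u_h^n-U_h^n)|^2dx$$ $$\le c\Big(h^A+\sqrt{\Delta t}+\mathfrak E(\varrho_h^0,\overline u_h^0|r(0),U(0))\Big),\qquad A=\min\Big\{\frac{2\gamma-d}\gamma,\frac12\Big\}.$$ -/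

import Mathlib

namespace MACNS

open MeasureTheory Set

noncomputable section

/-! ## The continuous problem on the flat torus

Functions on the torus `([0,1]|_{0,1})^d` are functions on `ℝ^d` that are `1`-periodic in every
coordinate; integrals over the torus are integrals over the unit cube. -/

/-- The unit cube `[0,1]^d`, a fundamental domain of the torus. -/
def cube (d : ℕ) : Set (Fin d → ℝ) := Icc 0 1

/-- Spatial partial derivative `∂_i f`. -/
def pd {d : ℕ} (i : Fin d) (f : (Fin d → ℝ) → ℝ) (x : Fin d → ℝ) : ℝ :=
  fderiv ℝ f x (Pi.single i 1)

/-- Time derivative on `[0,T]` (one-sided at the end points). -/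
def td (T : ℝ) (f : ℝ → ℝ) (t : ℝ) : ℝ := derivWithin f (Icc 0 T) t

/-- The isentropic pressure law `p(ρ) = a ρ^γ`. -/
def pressure (a γ ρ : ℝ) : ℝ := a * ρ ^ γ

/-- The pressure potential `H(ρ) = ρ ∫_1^ρ p(z) / z² dz`. -/
def potential (a γ ρ : ℝ) : ℝ := ρ * ∫ z in (1 : ℝ)..ρ, pressure a γ z / z ^ 2

/-- `𝔼(ρ|r) = H(ρ) - H'(r) (ρ - r) - H(r)`. -/
def relPotential (a γ ρ r : ℝ) : ℝ :=
  potential a γ ρ - deriv (potential a γ) r * (ρ - r) - potential a γ r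

/-- The relative energy `𝔈(ρ,u|r,U) = ∫_Ω (½ ρ |u - U|² + 𝔼(ρ|r)) dx`. -/
def relEnergy {d : ℕ} (a γ : ℝ) (ρ : (Fin d → ℝ) → ℝ) (u : (Fin d → ℝ) → Fin d → ℝ)
    (r : (Fin d → ℝ) → ℝ) (U : (Fin d → ℝ) → Fin d → ℝ) : ℝ :=
  ∫ x in cube d, (1 / 2 * ρ x * ∑ i, (u x i - U x i) ^ 2 + relPotential a γ (ρ x) (r x))

/-- The viscous stress tensor `𝕊 = μ (∇V + ∇ᵀV) + lam (div V) 𝕀`. -/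
def stress {d : ℕ} (μ lam : ℝ) (V : (Fin d → ℝ) → Fin d → ℝ) (i j : Fin d)
    (x : Fin d → ℝ) : ℝ :=
  μ * (pd j (fun y => V y i) x + pd i (fun y => V y j) x) +
    if i = j then lam * ∑ k, pd k (fun y => V y k) x else 0

/-- `(r,U)` is a classical space-periodic solution of the compressible Navier--Stokes system on
`[0,T]` of class `C²([0,T] × Ω)`. -/
structure IsStrongSolution {d : ℕ} (T a γ μ lam : ℝ) (r : ℝ → (Fin d → ℝ) → ℝ)
    (U : ℝ → (Fin d → ℝ) → Fin d → ℝ) : Prop where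
  smooth_density : ContDiffOn ℝ 2 (fun q : ℝ × (Fin d → ℝ) => r q.1 q.2) (Icc 0 T ×ˢ univ)
  smooth_velocity : ContDiffOn ℝ 2 (fun q : ℝ × (Fin d → ℝ) => U q.1 q.2) (Icc 0 T ×ˢ univ)
  periodic_density : ∀ t ∈ Icc 0 T, ∀ x i, r t (x + Pi.single i 1) = r t x
  periodic_velocity : ∀ t ∈ Icc 0 T, ∀ x i, U t (x + Pi.single i 1) = U t x
  continuity_eq : ∀ t ∈ Icc 0 T, ∀ x,
    td T (fun s => r s x) t + ∑ j, pd j (fun y => r t y * U t y j) x = 0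
  momentum_eq : ∀ t ∈ Icc 0 T, ∀ x i,
    td T (fun s => r s x * U s x i) t + ∑ j, pd j (fun y => r t y * U t y i * U t y j) x
        + pd i (fun y => pressure a γ (r t y)) x
      = ∑ j, pd j (stress μ lam (U t) i j) x

/-- All components of `∇r, ∂_t r, ∂_t ∇r, ∂_t² r, U, ∇U, ∇²U, ∂_t U, ∂_t ∇U` are bounded by `K`
in absolute value. -/
structure DerivBound {d : ℕ} (T K : ℝ) (r : ℝ → (Fin d → ℝ) → ℝ)
    (U : ℝ → (Fin d → ℝ) → Fin d → ℝ) : Prop where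
  grad_r : ∀ t ∈ Icc 0 T, ∀ x i, |pd i (r t) x| ≤ K
  dt_r : ∀ t ∈ Icc 0 T, ∀ x, |td T (fun s => r s x) t| ≤ K
  dt_grad_r : ∀ t ∈ Icc 0 T, ∀ x i, |td T (fun s => pd i (r s) x) t| ≤ K
  dt_dt_r : ∀ t ∈ Icc 0 T, ∀ x, |td T (td T (fun s => r s x)) t| ≤ K
  vel : ∀ t ∈ Icc 0 T, ∀ x i, |U t x i| ≤ K
  grad_vel : ∀ t ∈ Icc 0 T, ∀ x i j, |pd j (fun y => U t y i) x| ≤ K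
  grad_grad_vel : ∀ t ∈ Icc 0 T, ∀ x i j k, |pd k (pd j (fun y => U t y i)) x| ≤ K
  dt_vel : ∀ t ∈ Icc 0 T, ∀ x i, |td T (fun s => U s x i) t| ≤ K
  dt_grad_vel : ∀ t ∈ Icc 0 T, ∀ x i j, |td T (fun s => pd j (fun y => U s y i) x) t| ≤ K

/-! ## The periodic MAC grid with `N` cells in each direction, `h = 1 / N`

Cells `K` are indexed by `k ∈ (ℤ/N)^d`. The face `σ = K|L` orthogonal to `e_i`, with `L` the
neighbour of `K` in direction `+e_i`, carries the index `k` of `K`; so `σ_{K,i+}` has index `k` and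
`σ_{K,i-}` has index `k - e_i`. The dual cells `D_σ` and, for fixed `i` and `j`, the bidual cells
are indexed likewise; all these cells have volume `h^d`. -/

/-- Index set of the cells (and of the faces orthogonal to a fixed `e_i`). -/
abbrev Grid (d N : ℕ) : Type := Fin d → ZMod N

variable {d N : ℕ}

/-- Mesh size. -/
def mesh (N : ℕ) : ℝ := 1 / N

/-- The unit index vector `e_i`. -/
def e (i : Fin d) : Grid d N := Pi.single i 1

/-- The closed cell `K` with index `k`. -/
def cell (k : Grid d N) : Set (Fin d → ℝ) :=
  Icc (fun i => ((k i).val : ℝ) * mesh N) (fun i => (((k i).val : ℝ) + 1) * mesh N)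

/-- Index of the (half-open) cell that contains the point `x` of the torus. -/
def cellIndex (N : ℕ) (x : Fin d → ℝ) : Grid d N := fun i => ((⌊x i * N⌋ : ℤ) : ZMod N)

/-- Piecewise constant extension of cell values. -/
def pc (f : Grid d N → ℝ) (x : Fin d → ℝ) : ℝ := f (cellIndex N x)

/-- Piecewise constant extension of vector-valued cell values (first argument: component). -/
def pcVec (v : Fin d → Grid d N → ℝ) (x : Fin d → ℝ) (i : Fin d) : ℝ := v i (cellIndex N x)

/-- `∑ h^d f_k`: the integral over the torus of a function that is constant on the cells
(or on the dual, or on the bidual cells). -/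
def gridInt [NeZero N] (f : Grid d N → ℝ) : ℝ := mesh N ^ d * ∑ k, f k

/-- Projection to the primary grid: cell averages. -/
def cellProj (N : ℕ) (φ : (Fin d → ℝ) → ℝ) (k : Grid d N) : ℝ := ⨍ x in cell k, φ x

/-- Projection to the dual grid: averages over the faces `σ_{K,i+}`. The integrand does not depend
on the `i`-th coordinate of the variable, so that the average over `K` is the average over the
face. -/
def faceProj (N : ℕ) (i : Fin d) (φ : (Fin d → ℝ) → ℝ) (k : Grid d N) : ℝ :=
  ⨍ x in cell k, φ (Function.update x i ((((k i).val : ℝ) + 1) * mesh N))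

/-- Face averages in direction `i` of cell values. -/
def avgFace (i : Fin d) (r : Grid d N → ℝ) (k : Grid d N) : ℝ := (r k + r (k + e i)) / 2

/-- Cell averages of the `i`-th component of a face-based vector field. -/
def avgCell (v : Fin d → Grid d N → ℝ) (i : Fin d) (k : Grid d N) : ℝ :=
  (v i k + v i (k - e i)) / 2

/-- Difference of cell values across a face, `∂_𝓔^{(i)}`. -/
def diffFace (i : Fin d) (r : Grid d N → ℝ) (k : Grid d N) : ℝ := (r (k + e i) - r k) / mesh N

/-- Difference of face values across a cell, `∂_𝓜^{(i)}`. -/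
def diffCell (i : Fin d) (v : Grid d N → ℝ) (k : Grid d N) : ℝ := (v k - v (k - e i)) / mesh N

/-- Discrete divergence. -/
def divh (v : Fin d → Grid d N → ℝ) (k : Grid d N) : ℝ := ∑ i, diffCell i (v i) k

/-- Discrete Laplacian of cell values. -/
def lapCell (r : Grid d N → ℝ) (k : Grid d N) : ℝ :=
  1 / mesh N ^ 2 * ∑ j, ((r (k + e j) - r k) + (r (k - e j) - r k))

/-- Discrete Laplacian of the values of one velocity component on its dual grid. -/
def lapFace (v : Grid d N → ℝ) (k : Grid d N) : ℝ :=
  1 / mesh N ^ 2 * ∑ j, ((v (k + e j) - v k) + (v (k - e j) - v k))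

/-- The bidual difference quotient `ð_j v` of one velocity component. -/
def bidualDiff (j : Fin d) (v : Grid d N → ℝ) (k : Grid d N) : ℝ := (v (k + e j) - v k) / mesh N

/-- Upwind flux through the faces orthogonal to `e_i`. -/
def upFlux (r : Grid d N → ℝ) (v : Fin d → Grid d N → ℝ) (i : Fin d) (k : Grid d N) : ℝ :=
  r k * max 0 (v i k) + r (k + e i) * min 0 (v i k)

/-- Upwind divergence. -/
def divUp (r : Grid d N → ℝ) (v : Fin d → Grid d N → ℝ) : Grid d N → ℝ := divh (upFlux r v)

/-- The cell-based velocities `ū^n`: the given data `w` at time level `0`, and the cell averages of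
the face-based velocity `u^n` at the later time levels. -/
def cellVel (w : Fin d → Grid d N → ℝ) (u : ℕ → Fin d → Grid d N → ℝ) :
    ℕ → Fin d → Grid d N → ℝ
  | 0 => w
  | n + 1 => avgCell (u (n + 1))

/-- Solutions of the implicit MAC scheme with `Nt` steps of size `dt` and initial data `ρ₀, u₀`.
The initial velocity enters the scheme only through the cell values `ū^0 = Π_𝓜 u₀`; the value
`u 0` plays no role. -/
structure IsMACSolution (a γ μ lam α dt : ℝ) (Nt : ℕ) (ρ₀ : (Fin d → ℝ) → ℝ)
    (u₀ : (Fin d → ℝ) → Fin d → ℝ) (ρ : ℕ → Grid d N → ℝ)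
    (u : ℕ → Fin d → Grid d N → ℝ) (ubar : ℕ → Fin d → Grid d N → ℝ) : Prop where
  cell_velocity : ubar = cellVel (fun i => cellProj N (fun x => u₀ x i)) u
  initial_density : ρ 0 = cellProj N ρ₀
  density_eq : ∀ n, 1 ≤ n → n ≤ Nt → ∀ k : Grid d N,
    (ρ n k - ρ (n - 1) k) / dt + divUp (ρ n) (u n) k - mesh N ^ α * lapCell (ρ n) k = 0
  momentum_eq : ∀ n, 1 ≤ n → n ≤ Nt → ∀ (i : Fin d) (k : Grid d N),
    avgFace i (fun l => (ρ n l * ubar n i l - ρ (n - 1) l * ubar (n - 1) i l) / dt) k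
        + avgFace i (divUp (fun l => ρ n l * ubar n i l) (u n)) k
        + diffFace i (fun l => pressure a γ (ρ n l)) k
        - μ * lapFace (u n i) k
        - (μ + lam) * diffFace i (divh (u n)) k
      = mesh N ^ α * ∑ j, avgFace i
          (diffCell j (fun l => avgFace j (ubar n i) l * diffFace j (ρ n) l)) k

/-- The discrete initial mass `M₀`. -/
def initMass [NeZero N] (ρ : Grid d N → ℝ) : ℝ := gridInt ρ

/-- The discrete initial energy `E₀ = ∫ (½ ρ |ū|² + H(ρ))`. -/
def initEnergy [NeZero N] (a γ : ℝ) (ρ : Grid d N → ℝ) (w : Fin d → Grid d N → ℝ) : ℝ :=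
  gridInt (fun k => 1 / 2 * ρ k * ∑ i, (w i k) ^ 2 + potential a γ (ρ k))

/-- `∫_Ω |∇_ε v|²`. -/
def gradSq [NeZero N] (v : Fin d → Grid d N → ℝ) : ℝ :=
  gridInt (fun k => ∑ i, ∑ j, (bidualDiff j (v i) k) ^ 2)

/-- `∫_Ω |div_h v|²`. -/
def divSq [NeZero N] (v : Fin d → Grid d N → ℝ) : ℝ := gridInt (fun k => (divh v k) ^ 2)

/-- The relative energy `𝔈(ρ,u|r,U)` of discrete states; `ρ, r` are cell values, `w, W` the
cell averages of the velocities. -/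
def discreteRelEnergy (a γ : ℝ) (ρ : Grid d N → ℝ) (w : Fin d → Grid d N → ℝ)
    (r : Grid d N → ℝ) (W : Fin d → Grid d N → ℝ) : ℝ :=
  relEnergy a γ (pc ρ) (pcVec w) (pc r) (pcVec W)

/-- The projected density `r_h^n = Π_𝓜 r(t^n)` with `t^n = n dt`. -/
def projDensity (N : ℕ) (dt : ℝ) (r : ℝ → (Fin d → ℝ) → ℝ) (n : ℕ) : Grid d N → ℝ :=
  cellProj N (r (n * dt))

/-- The projected velocity `U_h^n = Π_𝓔 U(t^n)` with `t^n = n dt`. -/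
def projVelocity (N : ℕ) (dt : ℝ) (U : ℝ → (Fin d → ℝ) → Fin d → ℝ) (n : ℕ) :
    Fin d → Grid d N → ℝ :=
  fun i => faceProj N i (fun x => U (n * dt) x i)

end

end MACNS

open MACNS

open MACNS

set_option linter.unusedSectionVars false

namespace MACNS
open MeasureTheory Set

/-! ### Summation by parts on the periodic grid. -/

section GridCalculus

variable {d N : ℕ} [NeZero N]

/-! The proof is the relative energy method carried out on the grid. Let `(R, V)` be the projected
strong solution, `Rm` its density one step earlier, and `H` the pressure potential. The momentum
equation is tested with the velocity error `u - V`, and the density equation with `H'(ρ) - H'(Rm) -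
(|ū|² - |V̄|²)/2`. This gives `relative_energy_inequality`, valid for arbitrary discrete states: the
increment of the relative energy, plus the viscous dissipation of the error, plus three numerical
dissipations, is bounded by explicit remainders. The numerical dissipations are essential, for each
absorbs the error created by its own part of the discretisation. The upwind dissipation pays for
density jumps across faces (`flux_face_le`), the artificial diffusion pays for its own flux
(`diffusion_budget_le`), and the dissipation of the implicit time step pays for the mismatch between
the old density and the new velocity (`remainder_cell_le`).

No uniform upper or lower bound for the discrete density is used. For large densities the energy
bounds `ρ` in `L^γ`, and `inverse_estimate` gives `h² ρ ≤ C h^((2γ-d)/γ)`, which is the origin of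
this exponent. Near the vacuum the relative potential with respect to a state bounded below is
itself bounded below. The velocity error without a density weight is recovered from its gradient and
the kinetic energy by a Poincaré inequality weighted with the density (`density_poincare`).

Consistency of the projections is isolated in `StepData` and proved in `exists_stepData`. The
available bounds contain neither second space derivatives of the density nor second time derivatives
of the velocity. Three devices compensate. Differences of face averages across a cell are exactly
cell averages of partial derivatives (`diffCell_faceProj`), so that the differential equations can
be inserted pointwise under an average. The potential `H'(r)` is represented by face values. The
time quotient of the velocity is replaced, after testing, by the derivative at one intermediate time
common to all cells (`exists_time_slope`).

Together this yields `step_estimate`, with error size `ε = h + dt + h^((2γ-d)/γ)`. Its right side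
contains `ε` times the squared gradient of the velocity error. Since `ε` need not be small, this
term is not absorbed; the energy estimate of the scheme bounds its sum over the time steps, so it
acts as a source in the discrete Gronwall inequality. Gronwall needs `C * dt ≤ 1/2`. For larger
steps `√dt` is bounded below, and the a priori bounds alone give the claim. -/

lemma mesh_pos (N : ℕ) [NeZero N] : 0 < mesh N := by
  unfold mesh
  have : 0 < (N : ℝ) := by exact_mod_cast Nat.pos_of_ne_zero (NeZero.ne N)
  positivity

lemma mesh_le_one (N : ℕ) [NeZero N] : mesh N ≤ 1 := by
  unfold mesh
  have : (1 : ℝ) ≤ N := by exact_mod_cast Nat.one_le_iff_ne_zero.mpr (NeZero.ne N)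
  rw [div_le_one (by linarith)]
  exact this

lemma natCast_mul_mesh (N : ℕ) [NeZero N] : (N : ℝ) * mesh N = 1 := by
  unfold mesh
  have : (N : ℝ) ≠ 0 := by exact_mod_cast NeZero.ne N
  field_simp

lemma gridInt_add (f g : Grid d N → ℝ) :
    gridInt (fun k => f k + g k) = gridInt f + gridInt g := by
  simp only [gridInt, Finset.sum_add_distrib, mul_add]

lemma gridInt_sub (f g : Grid d N → ℝ) :
    gridInt (fun k => f k - g k) = gridInt f - gridInt g := by
  simp only [gridInt, Finset.sum_sub_distrib, mul_sub]

lemma gridInt_neg (f : Grid d N → ℝ) : gridInt (fun k => - f k) = - gridInt f := by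
  simp only [gridInt, Finset.sum_neg_distrib, mul_neg]

lemma gridInt_mul_left (c : ℝ) (f : Grid d N → ℝ) :
    gridInt (fun k => c * f k) = c * gridInt f := by
  simp only [gridInt, ← Finset.mul_sum]; ring

lemma gridInt_sum {ι : Type*} (s : Finset ι) (f : ι → Grid d N → ℝ) :
    gridInt (fun k => ∑ i ∈ s, f i k) = ∑ i ∈ s, gridInt (f i) := by
  simp only [gridInt, ← Finset.mul_sum]
  rw [Finset.sum_comm]

lemma gridInt_mono {f g : Grid d N → ℝ} (hfg : ∀ k, f k ≤ g k) : gridInt f ≤ gridInt g := by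
  unfold gridInt
  have := mesh_pos N
  gcongr with k
  exact hfg k

lemma gridInt_nonneg {f : Grid d N → ℝ} (hf : ∀ k, 0 ≤ f k) : 0 ≤ gridInt f := by
  unfold gridInt
  have := mesh_pos N
  exact mul_nonneg (by positivity) (Finset.sum_nonneg fun k _ => hf k)

lemma gridInt_const (c : ℝ) : gridInt (fun _ : Grid d N => c) = c := by
  have h1 : (mesh N) ^ d * (N : ℝ) ^ d = 1 := by
    rw [← mul_pow, mul_comm, natCast_mul_mesh, one_pow]
  simp only [gridInt, Finset.sum_const, Finset.card_univ, Fintype.card_fun, ZMod.card,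
    Fintype.card_fin, nsmul_eq_mul, Nat.cast_pow]
  rw [← mul_assoc, h1, one_mul]

lemma gridInt_shift (t : Grid d N) (f : Grid d N → ℝ) :
    gridInt (fun k => f (k + t)) = gridInt f := by
  unfold gridInt
  congr 1
  exact Fintype.sum_equiv (Equiv.addRight t) _ _ fun _ => rfl

lemma gridInt_shift_sub (t : Grid d N) (f : Grid d N → ℝ) :
    gridInt (fun k => f (k - t)) = gridInt f := by
  unfold gridInt
  congr 1
  exact Fintype.sum_equiv (Equiv.subRight t) _ _ fun _ => rfl

lemma abs_gridInt_le (f : Grid d N → ℝ) : |gridInt f| ≤ gridInt (fun k => |f k|) := by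
  rw [abs_le]
  constructor
  · rw [← gridInt_neg]
    exact gridInt_mono fun k => neg_abs_le _
  · exact gridInt_mono fun k => le_abs_self _

/-- Two grid functions whose difference telescopes in one direction have the same integral. -/
lemma gridInt_eq_of_telescope (j : Fin d) {A B : Grid d N → ℝ} (T : Grid d N → ℝ)
    (hT : ∀ k, A k = B k + (T (k + e j) - T k)) : gridInt A = gridInt B := by
  have : A = fun k => B k + ((fun k => T (k + e j)) k - T k) := funext hT
  rw [this, gridInt_add, gridInt_sub, gridInt_shift, sub_self, add_zero]

/-- The product rule leaves a difference of one shifted function, which integrates to zero by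
periodicity; no boundary terms arise. -/
lemma gridInt_diffCell_mul (j : Fin d) (f g : Grid d N → ℝ) :
    gridInt (fun k => diffCell j f k * g k) = gridInt (fun k => -(f k * diffFace j g k)) := by
  refine gridInt_eq_of_telescope j (fun k => f (k - e j) * g k / mesh N) fun k => ?_
  simp only [diffCell, diffFace, add_sub_cancel_right]
  ring

lemma gridInt_diffFace_mul (j : Fin d) (f g : Grid d N → ℝ) :
    gridInt (fun k => diffFace j f k * g k) = gridInt (fun k => -(f k * diffCell j g k)) := by
  refine gridInt_eq_of_telescope j (fun k => f k * g (k - e j) / mesh N) fun k => ?_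
  simp only [diffCell, diffFace, add_sub_cancel_right]
  ring

/-- The averages from cells to faces and from faces to cells are adjoint. This turns the
face-averaged terms of the momentum equation, tested with a face field, into cell sums against the
cell averages of that field. -/
lemma gridInt_avgFace_mul (i : Fin d) (f : Grid d N → ℝ) (v : Fin d → Grid d N → ℝ) :
    gridInt (fun k => avgFace i f k * v i k) = gridInt (fun k => f k * avgCell v i k) := by
  refine gridInt_eq_of_telescope i (fun k => f k * v i (k - e i) / 2) fun k => ?_
  simp only [avgFace, avgCell, add_sub_cancel_right]
  ring

lemma gridInt_lap_mul (f g : Grid d N → ℝ) :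
    gridInt (fun k => lapCell f k * g k)
      = gridInt (fun k => -∑ j, diffFace j f k * diffFace j g k) := by
  have h0 := (mesh_pos N).ne'
  have h1 : (fun k => lapCell f k * g k)
      = fun k => ∑ j, diffCell j (diffFace j f) k * g k := by
    funext k
    simp only [lapCell, diffCell, diffFace, Finset.mul_sum, Finset.sum_mul, sub_add_cancel]
    refine Finset.sum_congr rfl fun j _ => ?_
    field_simp
    ring
  have h2 : (fun k => -∑ j, diffFace j f k * diffFace j g k)
      = fun k => ∑ j, -(diffFace j f k * diffFace j g k) := by
    funext k; rw [Finset.sum_neg_distrib]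
  rw [h1, h2, gridInt_sum, gridInt_sum]
  exact Finset.sum_congr rfl fun j _ => gridInt_diffCell_mul j _ _

lemma lapFace_eq_lapCell : (lapFace : (Grid d N → ℝ) → Grid d N → ℝ) = lapCell := rfl

lemma bidualDiff_eq_diffFace (j : Fin d) :
    (bidualDiff j : (Grid d N → ℝ) → Grid d N → ℝ) = diffFace j := rfl

lemma gridInt_divh_mul (v : Fin d → Grid d N → ℝ) (g : Grid d N → ℝ) :
    gridInt (fun k => divh v k * g k) = gridInt (fun k => -∑ j, v j k * diffFace j g k) := by
  have h1 : (fun k => divh v k * g k) = fun k => ∑ j, diffCell j (v j) k * g k := by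
    funext k; simp only [divh, Finset.sum_mul]
  have h2 : (fun k => -∑ j, v j k * diffFace j g k)
      = fun k => ∑ j, -(v j k * diffFace j g k) := by
    funext k; rw [Finset.sum_neg_distrib]
  rw [h1, h2, gridInt_sum, gridInt_sum]
  exact Finset.sum_congr rfl fun j _ => gridInt_diffCell_mul j _ _

lemma avgCell_sub (u V : Fin d → Grid d N → ℝ) (i : Fin d) (k : Grid d N) :
    avgCell (u - V) i k = avgCell u i k - avgCell V i k := by
  simp only [avgCell, Pi.sub_apply]; ring

lemma divh_sub (u V : Fin d → Grid d N → ℝ) (k : Grid d N) :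
    divh (u - V) k = divh u k - divh V k := by
  simp only [divh, diffCell, Pi.sub_apply, ← Finset.sum_sub_distrib]
  exact Finset.sum_congr rfl fun j _ => by ring

lemma diffFace_sub (j : Fin d) (u V : Fin d → Grid d N → ℝ) (i : Fin d) (k : Grid d N) :
    diffFace j ((u - V) i) k = diffFace j (u i) k - diffFace j (V i) k := by
  simp only [diffFace, Pi.sub_apply]; ring

end GridCalculus

/-! ### The pressure potential: closed form, convexity and coercivity. -/

section Potential

/-- Closed form of the pressure potential. -/
noncomputable def potentialFn (a γ x : ℝ) : ℝ := a / (γ - 1) * (x ^ γ - x)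

/-- Closed form of the derivative of the pressure potential. -/
noncomputable def potentialDeriv (a γ x : ℝ) : ℝ := a / (γ - 1) * (γ * x ^ (γ - 1) - 1)

variable {a γ : ℝ}

lemma potential_eq (hγ : 1 < γ) {x : ℝ} (hx : 0 < x) : potential a γ x = potentialFn a γ x := by
  have h0 : (0 : ℝ) ∉ uIcc 1 x := by
    rw [mem_uIcc]
    push Not
    constructor <;> intro h <;> linarith
  have h1 : ∫ z in (1 : ℝ)..x, pressure a γ z / z ^ 2 = ∫ z in (1 : ℝ)..x, a * z ^ (γ - 2) := by
    refine intervalIntegral.integral_congr fun z hz => ?_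
    have hz0 : 0 < z := by
      rcases mem_uIcc.1 hz with h | h <;> linarith [h.1]
    simp only [pressure]
    rw [Real.rpow_sub hz0, Real.rpow_two]
    ring
  have hγ1 : γ - 1 ≠ 0 := by linarith
  rw [potential, h1, intervalIntegral.integral_const_mul, integral_rpow (Or.inl (by linarith)),
    potentialFn, Real.one_rpow, show γ - 2 + 1 = γ - 1 by ring, Real.rpow_sub_one hx.ne']
  field_simp

lemma hasDerivAt_potentialFn {x : ℝ} (hx : 0 < x) :
    HasDerivAt (potentialFn a γ) (potentialDeriv a γ x) x :=
  ((Real.hasDerivAt_rpow_const (Or.inl hx.ne')).sub (hasDerivAt_id x)).const_mul _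

lemma deriv_potential (hγ : 1 < γ) {x : ℝ} (hx : 0 < x) :
    deriv (potential a γ) x = potentialDeriv a γ x := by
  rw [← (hasDerivAt_potentialFn hx).deriv]
  refine Filter.EventuallyEq.deriv_eq ?_
  filter_upwards [lt_mem_nhds hx] with y hy using potential_eq hγ hy

lemma relPotential_eq (hγ : 1 < γ) {x y : ℝ} (hx : 0 < x) (hy : 0 < y) :
    relPotential a γ x y
      = potentialFn a γ x - potentialDeriv a γ y * (x - y) - potentialFn a γ y := by
  rw [relPotential, potential_eq hγ hx, potential_eq hγ hy, deriv_potential hγ hy]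

lemma pressure_eq (hγ : 1 < γ) {x : ℝ} (hx : 0 < x) :
    pressure a γ x = x * potentialDeriv a γ x - potentialFn a γ x := by
  have hγ1 : γ - 1 ≠ 0 := by linarith
  rw [potentialDeriv, potentialFn, pressure, Real.rpow_sub_one hx.ne']
  field_simp
  ring

/-- Bernoulli's inequality for two points. -/
lemma rpow_tangent_le {s x y : ℝ} (hs : 1 ≤ s) (hx : 0 < x) (hy : 0 < y) :
    y ^ s + s * y ^ (s - 1) * (x - y) ≤ x ^ s := by
  have h1 := one_add_mul_self_le_rpow_one_add (s := x / y - 1)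
    (by have := div_pos hx hy; linarith) hs
  have h2 : x ^ s = y ^ s * (1 + (x / y - 1)) ^ s := by
    rw [← Real.mul_rpow hy.le (by have := div_pos hx hy; linarith)]
    congr 1; field_simp; ring
  have hys : 0 < y ^ s := Real.rpow_pos_of_pos hy _
  rw [h2, Real.rpow_sub_one hy.ne']
  calc y ^ s + s * (y ^ s / y) * (x - y) = y ^ s * (1 + s * (x / y - 1)) := by field_simp
    _ ≤ _ := by gcongr

/-- The linear parts cancel, and what remains is `a / (γ - 1)` times the gap between `x ^ γ` and its
tangent at `y`. -/
lemma relPotential_nonneg (ha : 0 < a) (hγ : 1 < γ) {x y : ℝ} (hx : 0 < x) (hy : 0 < y) :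
    0 ≤ relPotential a γ x y := by
  rw [relPotential_eq hγ hx hy, potentialFn, potentialDeriv, potentialFn]
  have h := rpow_tangent_le hγ.le hx hy
  have : 0 < a / (γ - 1) := div_pos ha (by linarith)
  have h2 : a / (γ - 1) * (x ^ γ - x) - a / (γ - 1) * (γ * y ^ (γ - 1) - 1) * (x - y)
      - a / (γ - 1) * (y ^ γ - y)
      = a / (γ - 1) * (x ^ γ - (y ^ γ + γ * y ^ (γ - 1) * (x - y))) := by ring
  rw [h2]
  exact mul_nonneg this.le (by linarith)

/-- The three-point identity of the relative potential. -/
lemma relPotential_three_point (hγ : 1 < γ) {x y m : ℝ} (hx : 0 < x) (hy : 0 < y) (hm : 0 < m) :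
    relPotential a γ x y = relPotential a γ x m + relPotential a γ m y
      + (potentialDeriv a γ m - potentialDeriv a γ y) * (x - m) := by
  rw [relPotential_eq hγ hx hy, relPotential_eq hγ hx hm, relPotential_eq hγ hm hy]
  ring

/-- For a power law the potential is `p / (γ - 1)` up to a linear term, so the Taylor remainders of
the two functions are proportional. Hence the quadratic pressure remainder is controlled by the
relative energy. -/
lemma pressure_rel_eq (hγ : 1 < γ) {x y : ℝ} (hx : 0 < x) (hy : 0 < y) :
    pressure a γ x - a * γ * y ^ (γ - 1) * (x - y) - pressure a γ y
      = (γ - 1) * relPotential a γ x y := by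
  have hγ1 : γ - 1 ≠ 0 := by linarith
  rw [relPotential_eq hγ hx hy, potentialFn, potentialDeriv, potentialFn, pressure, pressure]
  field_simp
  ring

/-- Quantitative monotonicity of the derivative of the potential away from the vacuum. -/
lemma potentialDeriv_strong_mono (ha : 0 < a) (hγ : 1 < γ) {c₀ : ℝ} (hc₀ : 0 < c₀) :
    ∃ c : ℝ, 0 < c ∧ ∀ x y m : ℝ, 0 < x → x ≤ y → c₀ ≤ y → y ≤ m →
      c * (y - x) / (1 + m) ≤ potentialDeriv a γ y - potentialDeriv a γ x := by
  set s := γ - 1 with hs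
  have hs0 : 0 < s := by linarith
  refine ⟨a / s * γ * (min 1 s * c₀ ^ s), by positivity, fun x y m hx hxy hcy hym => ?_⟩
  have hy : 0 < y := by linarith
  have key : min 1 s * (y ^ s / y) * (y - x) ≤ y ^ s - x ^ s := by
    have hys : 0 < y ^ s := Real.rpow_pos_of_pos hy _
    -- For `s ≥ 1` the bound follows from monotonicity of `t ^ (s - 1)`, for `s ≤ 1` from concavity
    -- of `t ^ s`, that is, from Bernoulli's inequality with exponent at most one.
    rcases le_total 1 s with h | h
    · rw [min_eq_left h]
      have h1 : x ^ s ≤ x * (y ^ s / y) := by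
        have : x ^ (s - 1) ≤ y ^ (s - 1) :=
          Real.rpow_le_rpow hx.le hxy (by linarith)
        rw [Real.rpow_sub_one hx.ne', Real.rpow_sub_one hy.ne'] at this
        calc x ^ s = x * (x ^ s / x) := by field_simp
          _ ≤ _ := by gcongr
      have h2 : y ^ s = y * (y ^ s / y) := by field_simp
      nlinarith
    · rw [min_eq_right h]
      have h1 := rpow_one_add_le_one_add_mul_self (s := x / y - 1) (p := s)
        (by have := div_pos hx hy; linarith) hs0.le h
      have h2 : x ^ s = y ^ s * (1 + (x / y - 1)) ^ s := by
        rw [← Real.mul_rpow hy.le (by have := div_pos hx hy; linarith)]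
        congr 1; field_simp; ring
      have h3 : y ^ s * (1 + (x / y - 1)) ^ s ≤ y ^ s * (1 + s * (x / y - 1)) := by gcongr
      have h4 : y ^ s * (1 + s * (x / y - 1)) = y ^ s - s * (y ^ s / y) * (y - x) := by
        field_simp; ring
      linarith
  have h5 : c₀ ^ s / (1 + m) ≤ y ^ s / y := by
    have : c₀ ^ s ≤ y ^ s := Real.rpow_le_rpow hc₀.le hcy hs0.le
    apply div_le_div₀ (by positivity) this hy (by linarith)
  have h6 : min 1 s * (c₀ ^ s / (1 + m)) * (y - x) ≤ y ^ s - x ^ s := by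
    refine le_trans ?_ key
    have : 0 ≤ y - x := by linarith
    have : 0 ≤ min 1 s := by positivity
    gcongr
  have h7 : 0 < a / s * γ := by positivity
  calc a / s * γ * (min 1 s * c₀ ^ s) * (y - x) / (1 + m)
      = a / s * γ * (min 1 s * (c₀ ^ s / (1 + m)) * (y - x)) := by ring
    _ ≤ a / s * γ * (y ^ s - x ^ s) := by gcongr
    _ = _ := by simp only [potentialDeriv]; ring

/-- Coercivity of the relative potential away from the vacuum. -/
lemma relPotential_coercive (ha : 0 < a) (hγ : 1 < γ) {c₀ : ℝ} (hc₀ : 0 < c₀) :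
    ∃ c : ℝ, 0 < c ∧ ∀ x y : ℝ, 0 < x → 0 < y → c₀ ≤ max x y →
      c * (x - y) ^ 2 / (1 + x + y) ≤ relPotential a γ x y := by
  obtain ⟨c, hc, h⟩ := potentialDeriv_strong_mono ha hγ (half_pos hc₀)
  refine ⟨c / 4, by positivity, fun x y hx hy hmax => ?_⟩
  -- At the midpoint the three-point identity leaves the monotonicity of `H'` over half of the
  -- interval. If `max x y ≥ c₀` then `m ≥ c₀ / 2`, so the strong monotonicity applies even when the
  -- other point is close to the vacuum.
  set m := (x + y) / 2 with hm
  have hm0 : 0 < m := by positivity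
  rw [relPotential_three_point hγ hx hy hm0]
  have h1 := relPotential_nonneg ha hγ hx hm0
  have h2 := relPotential_nonneg ha hγ hm0 hy
  have hmm : c₀ / 2 ≤ m := by
    rcases le_max_iff.1 hmax with h | h <;> linarith
  suffices c / 4 * (x - y) ^ 2 / (1 + x + y)
      ≤ (potentialDeriv a γ m - potentialDeriv a γ y) * (x - m) by linarith
  have hp : 0 < 1 + x + y := by linarith
  rcases le_total x y with hxy | hxy
  · have hcy : c₀ ≤ y := by rwa [max_eq_right hxy] at hmax
    have h3 := h m y (x + y) hm0 (by linarith) (by linarith) (by linarith)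
    have h4 : 0 ≤ m - x := by linarith
    have := mul_le_mul_of_nonneg_right h3 h4
    calc c / 4 * (x - y) ^ 2 / (1 + x + y) = c * (y - m) / (1 + (x + y)) * (m - x) := by
          rw [hm]; ring_nf
      _ ≤ _ := by linarith
  · have h3 := h y m (x + y) hy (by linarith) hmm (by linarith)
    have h4 : 0 ≤ x - m := by linarith
    have := mul_le_mul_of_nonneg_right h3 h4
    calc c / 4 * (x - y) ^ 2 / (1 + x + y) = c * (m - y) / (1 + (x + y)) * (x - m) := by
          rw [hm]; ring_nf
      _ ≤ _ := by linarith

/-- The potential relative to a state in a compact range controls the density power. -/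
lemma rpow_le_relPotential (ha : 0 < a) (hγ : 1 < γ) (rhi : ℝ) :
    ∃ C : ℝ, 0 < C ∧ ∀ x y : ℝ, 0 < x → 0 < y → y ≤ rhi →
      x ^ γ ≤ C * (1 + relPotential a γ x y) := by
  set b := a / (γ - 1) with hb
  have hγ1 : 0 < γ - 1 := by linarith
  have hb0 : 0 < b := by positivity
  set A := γ * (max rhi 0 + 1) ^ (γ - 1) with hA
  have hA0 : 0 < A := by positivity
  -- Beyond this threshold `x ^ (γ - 1) ≥ 2 * A`, so that the linear term `A * x` is at most half of
  -- `x ^ γ`.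
  set B := (2 * A) ^ (1 / (γ - 1)) with hB
  have hB0 : 0 < B := by positivity
  refine ⟨2 * A * B + 2 / b, by positivity, fun x y hx hy hyr => ?_⟩
  have hE := relPotential_nonneg ha hγ hx hy
  have h1 : γ * y ^ (γ - 1) ≤ A := by
    rw [hA]
    have : y ≤ max rhi 0 + 1 := by linarith [le_max_left rhi 0]
    gcongr
  have h2 : b * (x ^ γ - A * x) ≤ relPotential a γ x y := by
    have e1 : relPotential a γ x y = b * (x ^ γ - γ * y ^ (γ - 1) * x + (γ - 1) * y ^ γ) := by
      rw [relPotential_eq hγ hx hy, potentialFn, potentialDeriv, potentialFn,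
        Real.rpow_sub_one hy.ne', ← hb]
      field_simp
      ring
    rw [e1]
    have h3 : 0 ≤ (γ - 1) * y ^ γ := by positivity
    have h4 : γ * y ^ (γ - 1) * x ≤ A * x := by gcongr
    gcongr
    linarith
  have h5 : A * x ≤ A * B + x ^ γ / 2 := by
    rcases le_total x B with h | h
    · have : A * x ≤ A * B := by gcongr
      have := Real.rpow_nonneg hx.le γ
      linarith
    · have h6 : 2 * A ≤ x ^ (γ - 1) := by
        calc 2 * A = B ^ (γ - 1) := by
              rw [hB, ← Real.rpow_mul (by positivity), one_div_mul_cancel hγ1.ne', Real.rpow_one]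
          _ ≤ _ := Real.rpow_le_rpow hB0.le h hγ1.le
      have h7 : x ^ γ = x ^ (γ - 1) * x := by
        rw [Real.rpow_sub_one hx.ne']; field_simp
      rw [h7]
      have : 0 < A * B := by positivity
      nlinarith
  have h8 : x ^ γ ≤ 2 * A * B + 2 / b * relPotential a γ x y := by
    have : x ^ γ - A * x ≤ relPotential a γ x y / b := by
      rw [le_div_iff₀ hb0]; linarith
    have e2 : 2 / b * relPotential a γ x y = 2 * (relPotential a γ x y / b) := by ring
    rw [e2]; linarith
  have : 0 ≤ 2 * A * B * relPotential a γ x y := by positivity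
  have : 0 < 2 / b := by positivity
  nlinarith

/-- On a compact range of positive numbers a power is bounded and Lipschitz continuous. -/
lemma rpow_bounded_lipschitz (s : ℝ) {lo : ℝ} (hi : ℝ) (hlo : 0 < lo) :
    ∃ B : ℝ, 0 < B ∧ (∀ x ∈ Icc lo hi, |x ^ s| ≤ B) ∧
      ∀ x ∈ Icc lo hi, ∀ y ∈ Icc lo hi, |x ^ s - y ^ s| ≤ B * |x - y| := by
  have hbd : ∀ s : ℝ, ∃ B : ℝ, 0 < B ∧ ∀ x ∈ Icc lo hi, |x ^ s| ≤ B := by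
    intro s
    have hc : ContinuousOn (fun x : ℝ => x ^ s) (Icc lo hi) := fun x hx =>
      (Real.continuousAt_rpow_const x s (Or.inl (by linarith [hx.1]))).continuousWithinAt
    obtain ⟨B, hB⟩ := isCompact_Icc.exists_bound_of_continuousOn hc
    exact ⟨max B 1, by positivity, fun x hx => (hB x hx).trans (le_max_left _ _)⟩
  obtain ⟨B₁, hB₁, h₁⟩ := hbd s
  obtain ⟨B₂, hB₂, h₂⟩ := hbd (s - 1)
  refine ⟨max B₁ (|s| * B₂), by positivity, fun x hx => (h₁ x hx).trans (le_max_left _ _),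
    fun x hx y hy => ?_⟩
  have := (convex_Icc lo hi).norm_image_sub_le_of_norm_hasDerivWithin_le
    (f := fun x : ℝ => x ^ s) (f' := fun x => s * x ^ (s - 1)) (C := |s| * B₂)
    (fun z hz => (Real.hasDerivAt_rpow_const
      (Or.inl (by linarith [hz.1] : z ≠ 0))).hasDerivWithinAt)
    (fun z hz => by
      rw [norm_mul, Real.norm_eq_abs, Real.norm_eq_abs]
      have := h₂ z hz
      gcongr) hy hx
  refine this.trans ?_
  rw [Real.norm_eq_abs]
  gcongr
  exact le_max_right _ _

end Potential

/-! ### Tested equations, positivity, and the discrete relative energy inequality. -/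

section Scheme

variable {d N : ℕ} [NeZero N] {a γ μ lam dt κ : ℝ}

/-- The density equation tested with a cell function. -/
lemma density_test {ρ ρm : Grid d N → ℝ} {u : Fin d → Grid d N → ℝ}
    (hden : ∀ k, (ρ k - ρm k) / dt + divUp ρ u k - κ * lapCell ρ k = 0) (φ : Grid d N → ℝ) :
    gridInt (fun k => (ρ k - ρm k) / dt * φ k)
      = gridInt (fun k => ∑ j, (upFlux ρ u j k * diffFace j φ k
          - κ * (diffFace j ρ k * diffFace j φ k))) := by
  have h1 : (fun k => (ρ k - ρm k) / dt * φ k)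
      = fun k => κ * (lapCell ρ k * φ k) - divh (upFlux ρ u) k * φ k := by
    funext k
    have := hden k
    rw [divUp] at this
    linear_combination φ k * this
  rw [h1, gridInt_sub, gridInt_mul_left, gridInt_lap_mul, gridInt_divh_mul, ← gridInt_mul_left,
    ← gridInt_sub]
  congr 1
  funext k
  rw [Finset.sum_sub_distrib, ← Finset.mul_sum]
  ring

/-- Conservation of mass: the constant test function annihilates the upwind flux and the diffusion.
-/
lemma gridInt_eq_of_density {ρ ρm : Grid d N → ℝ} {u : Fin d → Grid d N → ℝ} (hdt : 0 < dt)
    (hden : ∀ k, (ρ k - ρm k) / dt + divUp ρ u k - κ * lapCell ρ k = 0) :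
    gridInt ρ = gridInt ρm := by
  have h := density_test hden (fun _ => 1)
  simp only [mul_one, diffFace, sub_self, zero_div, mul_zero, Finset.sum_const_zero,
    gridInt_const] at h
  have h2 : (fun k => (ρ k - ρm k) / dt) = fun k => dt⁻¹ * (ρ k - ρm k) := by
    funext k; ring
  rw [h2, gridInt_mul_left, gridInt_sub] at h
  have : dt⁻¹ ≠ 0 := by positivity
  have := (mul_eq_zero.1 h).resolve_left this
  linarith

/-- The implicit upwind scheme preserves the positivity of the density. -/
lemma density_pos {ρ ρm : Grid d N → ℝ} {u : Fin d → Grid d N → ℝ} (hdt : 0 < dt) (hκ : 0 ≤ κ)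
    (hden : ∀ k, (ρ k - ρm k) / dt + divUp ρ u k - κ * lapCell ρ k = 0)
    (hρm : ∀ k, 0 < ρm k) (k : Grid d N) : 0 < ρ k := by
  classical
  -- Tested with the indicator of `{ρ ≤ 0}`, the flux and diffusion terms are nonnegative on every
  -- face by upwinding and by monotonicity, whereas `(ρ - ρm) / dt` is strictly negative on that
  -- set. So the set is empty.
  set φ : Grid d N → ℝ := fun k => if ρ k ≤ 0 then 1 else 0 with hφ
  have hm := mesh_pos N
  have h := density_test hden φ
  have h1 : 0 ≤ gridInt (fun k => (ρ k - ρm k) / dt * φ k) := by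
    rw [h]
    refine gridInt_nonneg fun k => Finset.sum_nonneg fun j _ => ?_
    have hp : 0 ≤ max 0 (u j k) := le_max_left _ _
    have hn : min 0 (u j k) ≤ 0 := min_le_left _ _
    simp only [upFlux, diffFace, hφ]
    have key : 0 ≤ (ρ k * max 0 (u j k) + ρ (k + e j) * min 0 (u j k)) *
        ((if ρ (k + e j) ≤ 0 then 1 else 0) - (if ρ k ≤ 0 then 1 else 0)) := by
      split_ifs with h1 h2 h2
      · simp
      · push Not at h2
        nlinarith [mul_nonneg h2.le hp, mul_nonneg_of_nonpos_of_nonpos h1 hn]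
      · push Not at h1
        nlinarith [mul_nonneg (neg_nonneg.2 h2) hp, mul_nonneg h1.le (neg_nonneg.2 hn)]
      · simp
    have key2 : (ρ (k + e j) - ρ k) *
        ((if ρ (k + e j) ≤ 0 then 1 else 0) - (if ρ k ≤ 0 then 1 else 0)) ≤ 0 := by
      split_ifs with h1 h2 h2 <;> simp <;> linarith
    have e1 : ∀ A B s : ℝ, A * (s / mesh N) - κ * (B / mesh N * (s / mesh N))
        = A * s / mesh N + κ * (-(B * s) / mesh N ^ 2) := by
      intro A B s; field_simp; ring
    rw [e1]
    have := div_nonneg key hm.le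
    have h3 : 0 ≤ κ * (-((ρ (k + e j) - ρ k) *
        ((if ρ (k + e j) ≤ 0 then 1 else 0) - (if ρ k ≤ 0 then 1 else 0))) / mesh N ^ 2) :=
      mul_nonneg hκ (div_nonneg (by linarith) (by positivity))
    linarith
  have hterm : ∀ k, (ρ k - ρm k) / dt * φ k ≤ 0 := by
    intro k
    simp only [hφ]
    split_ifs with h2
    · rw [mul_one]
      exact div_nonpos_of_nonpos_of_nonneg (by linarith [hρm k]) hdt.le
    · simp
  by_contra hk
  push Not at hk
  have h2 : gridInt (fun k => (ρ k - ρm k) / dt * φ k) < 0 := by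
    unfold gridInt
    refine mul_neg_of_pos_of_neg (by positivity) ?_
    refine Finset.sum_neg' (fun k _ => hterm k) ⟨k, Finset.mem_univ _, ?_⟩
    simp only [hφ, if_pos hk, mul_one]
    exact div_neg_of_neg_of_pos (by linarith [hρm k]) hdt
  linarith

/-- The momentum equation tested with a face-based vector field. -/
lemma momentum_test {ρ ρm : Grid d N → ℝ} {u w wm : Fin d → Grid d N → ℝ}
    (hmom : ∀ (i : Fin d) (k : Grid d N),
      avgFace i (fun l => (ρ l * w i l - ρm l * wm i l) / dt) k
        + avgFace i (divUp (fun l => ρ l * w i l) u) k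
        + diffFace i (fun l => pressure a γ (ρ l)) k
        - μ * lapFace (u i) k
        - (μ + lam) * diffFace i (divh u) k
      = κ * ∑ j, avgFace i (diffCell j (fun l => avgFace j (w i) l * diffFace j ρ l)) k)
    (v : Fin d → Grid d N → ℝ) :
    gridInt (fun k => ∑ i, (ρ k * w i k - ρm k * wm i k) / dt * avgCell v i k)
      = gridInt (fun k => ∑ i, ∑ j,
          upFlux (fun l => ρ l * w i l) u j k * diffFace j (avgCell v i) k)
        + gridInt (fun k => pressure a γ (ρ k) * divh v k)
        - μ * gridInt (fun k => ∑ i, ∑ j, diffFace j (u i) k * diffFace j (v i) k)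
        - (μ + lam) * gridInt (fun k => divh u k * divh v k)
        - κ * gridInt (fun k => ∑ i, ∑ j,
          avgFace j (w i) k * diffFace j ρ k * diffFace j (avgCell v i) k) := by
  have hi : ∀ i : Fin d,
      gridInt (fun k => (ρ k * w i k - ρm k * wm i k) / dt * avgCell v i k)
      = gridInt (fun k => ∑ j,
          upFlux (fun l => ρ l * w i l) u j k * diffFace j (avgCell v i) k)
        + gridInt (fun k => pressure a γ (ρ k) * diffCell i (v i) k)
        - μ * gridInt (fun k => ∑ j, diffFace j (u i) k * diffFace j (v i) k)
        - (μ + lam) * gridInt (fun k => divh u k * diffCell i (v i) k)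
        - κ * gridInt (fun k => ∑ j,
          avgFace j (w i) k * diffFace j ρ k * diffFace j (avgCell v i) k) := by
    intro i
    rw [← gridInt_avgFace_mul i (fun k => (ρ k * w i k - ρm k * wm i k) / dt) v]
    have h1 : (fun k => avgFace i (fun l => (ρ l * w i l - ρm l * wm i l) / dt) k * v i k)
        = fun k => κ * (∑ j, avgFace i
              (diffCell j (fun l => avgFace j (w i) l * diffFace j ρ l)) k * v i k)
          - avgFace i (divUp (fun l => ρ l * w i l) u) k * v i k
          - diffFace i (fun l => pressure a γ (ρ l)) k * v i k
          + μ * (lapFace (u i) k * v i k)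
          + (μ + lam) * (diffFace i (divh u) k * v i k) := by
      funext k
      rw [← Finset.sum_mul]
      linear_combination v i k * hmom i k
    rw [h1, gridInt_add, gridInt_add, gridInt_sub, gridInt_sub, gridInt_mul_left,
      gridInt_mul_left, gridInt_mul_left, gridInt_sum, gridInt_diffFace_mul, gridInt_diffFace_mul,
      gridInt_avgFace_mul, lapFace_eq_lapCell, gridInt_lap_mul, divUp, gridInt_divh_mul]
    simp only [gridInt_avgFace_mul, gridInt_diffCell_mul, gridInt_neg, gridInt_sum,
      Finset.sum_neg_distrib]
    ring
  simp only [gridInt_sum] at hi ⊢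
  simp only [divh, Finset.mul_sum, gridInt_sum] at hi ⊢
  rw [Finset.sum_congr rfl fun i _ => hi i]
  simp only [Finset.sum_add_distrib, Finset.sum_sub_distrib, ← Finset.mul_sum]

/-- The convective terms of the relative energy balance on one face. -/
lemma convective_face_le {ρK ρL up um wK wL zK zL WK WL h : ℝ} (hh : 0 < h) (hK : 0 ≤ ρK)
    (hL : 0 ≤ ρL) (hup : 0 ≤ up) (hum : um ≤ 0) (hwK : wK = WK + zK) (hwL : wL = WL + zL) :
    (ρK * wK * up + ρL * wL * um) * ((zL - zK) / h)
      - (ρK * up + ρL * um) * ((WL * zL + 1 / 2 * zL ^ 2 - (WK * zK + 1 / 2 * zK ^ 2)) / h)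
    ≤ -((ρK * up * zK + ρL * um * zL) * ((WL - WK) / h))
      + h / 2 * ((ρK * up - ρL * um) * ((WL - WK) / h) ^ 2) := by
  subst hwK hwL
  rw [← sub_nonneg]
  -- The gap between the two sides is the upwind dissipation of kinetic energy, a nonnegative weight
  -- times `(wL - wK) ^ 2 / (2 * h)`; it is discarded.
  have : -((ρK * up * zK + ρL * um * zL) * ((WL - WK) / h))
      + h / 2 * ((ρK * up - ρL * um) * ((WL - WK) / h) ^ 2)
      - ((ρK * (WK + zK) * up + ρL * (WL + zL) * um) * ((zL - zK) / h)
      - (ρK * up + ρL * um) * ((WL * zL + 1 / 2 * zL ^ 2 - (WK * zK + 1 / 2 * zK ^ 2)) / h))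
      = (ρK * up + ρL * (-um)) * ((WL - WK) + (zL - zK)) ^ 2 / (2 * h) := by
    field_simp
    ring
  rw [this]
  have : 0 ≤ -um := by linarith
  positivity

/-- The renormalised upwind flux on one face. -/
lemma renormalised_face_eq (hγ : 1 < γ) {ρK ρL up um h : ℝ} (hK : 0 < ρK) (hL : 0 < ρL) :
    (ρK * up + ρL * um) * ((potentialDeriv a γ ρL - potentialDeriv a γ ρK) / h)
      = (up + um) * ((pressure a γ ρL - pressure a γ ρK) / h)
        - 1 / h * (up * relPotential a γ ρK ρL - um * relPotential a γ ρL ρK) := by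
  rw [pressure_eq hγ hK, pressure_eq hγ hL, relPotential_eq hγ hK hL, relPotential_eq hγ hL hK]
  ring

/-- The time-difference terms of the relative energy balance in one cell. -/
lemma time_cell_le (ha : 0 < a) (hγ : 1 < γ) (hdt : 0 < dt) {ρ ρm R Rm : ℝ} (hρ : 0 < ρ)
    (hρm : 0 < ρm) (hR : 0 < R) (hRm : 0 < Rm) {w wm W Wm z : Fin d → ℝ}
    (hz : ∀ i, w i = W i + z i) :
    ((1 / 2 * ρ * ∑ i, (w i - W i) ^ 2 + relPotential a γ ρ R)
      - (1 / 2 * ρm * ∑ i, (wm i - Wm i) ^ 2 + relPotential a γ ρm Rm)) / dt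
      + 1 / (2 * dt) * (ρm * ∑ i, (z i - (wm i - Wm i)) ^ 2)
    ≤ ∑ i, (ρ * w i - ρm * wm i) / dt * z i
      + (ρ - ρm) / dt * (potentialDeriv a γ ρ - potentialDeriv a γ Rm
          - ∑ i, (W i * z i + 1 / 2 * z i ^ 2))
      - ρm * ∑ i, (W i - Wm i) / dt * z i
      - (ρ - R) * ((potentialDeriv a γ R - potentialDeriv a γ Rm) / dt) := by
  -- The loss in this inequality is exactly the sum of the convexity gaps `𝔼(ρm|ρ)` and `𝔼(R|Rm)`,
  -- divided by `dt`. The second one has the right sign because `H'` of the test state is taken at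
  -- the old time level.
  have h1 := relPotential_nonneg ha hγ hρm hρ
  have h2 := relPotential_nonneg ha hγ hR hRm
  rw [relPotential_eq hγ hρm hρ] at h1
  rw [relPotential_eq hγ hR hRm] at h2
  rw [relPotential_eq hγ hρ hR, relPotential_eq hγ hρm hRm]
  have h3 : ∀ i, w i - W i = z i := fun i => by rw [hz i]; ring
  have e1 : 1 / 2 * ρ * ∑ i, (w i - W i) ^ 2 - 1 / 2 * ρm * ∑ i, (wm i - Wm i) ^ 2
      + 1 / 2 * (ρm * ∑ i, (z i - (wm i - Wm i)) ^ 2)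
      = ∑ i, (ρ * w i - ρm * wm i) * z i - (ρ - ρm) * ∑ i, (W i * z i + 1 / 2 * z i ^ 2)
        - ρm * ∑ i, (W i - Wm i) * z i := by
    simp only [Finset.mul_sum, ← Finset.sum_sub_distrib, ← Finset.sum_add_distrib]
    refine Finset.sum_congr rfl fun i _ => ?_
    rw [hz i]
    ring
  have e2 : ∑ i, (ρ * w i - ρm * wm i) / dt * z i = (∑ i, (ρ * w i - ρm * wm i) * z i) / dt := by
    rw [Finset.sum_div]; exact Finset.sum_congr rfl fun i _ => by ring
  have e3 : ∑ i, (W i - Wm i) / dt * z i = (∑ i, (W i - Wm i) * z i) / dt := by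
    rw [Finset.sum_div]; exact Finset.sum_congr rfl fun i _ => by ring
  rw [e2, e3, ← sub_nonneg]
  have e4 : ∀ A B S Z P Q T : ℝ, 1 / 2 * ρ * A - 1 / 2 * ρm * B + 1 / 2 * (ρm * Z) = S - T → 
      ((1 / 2 * ρ * A + P) - (1 / 2 * ρm * B + Q)) / dt + 1 / (2 * dt) * (ρm * Z)
        = (S - T + P - Q) / dt := by
    intro A B S Z P Q T h
    rw [← h]; field_simp; ring
  rw [e4 _ _ (∑ i, (ρ * w i - ρm * wm i) * z i) _ _ _
    ((ρ - ρm) * ∑ i, (W i * z i + 1 / 2 * z i ^ 2) + ρm * ∑ i, (W i - Wm i) * z i)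
    (by rw [e1]; ring)]
  set S := ∑ i, (ρ * w i - ρm * wm i) * z i
  set P := ∑ i, (W i * z i + 1 / 2 * z i ^ 2)
  set T := ∑ i, (W i - Wm i) * z i
  have : 0 ≤ ((potentialFn a γ ρm - potentialDeriv a γ ρ * (ρm - ρ) - potentialFn a γ ρ)
    + (potentialFn a γ R - potentialDeriv a γ Rm * (R - Rm) - potentialFn a γ Rm)) / dt := by
    positivity
  refine this.trans (le_of_eq ?_)
  field_simp
  ring

/-- The discrete relative energy on the grid. -/
noncomputable def gridRelEnergy (a γ : ℝ) (ρ : Grid d N → ℝ) (w : Fin d → Grid d N → ℝ)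
    (R : Grid d N → ℝ) (W : Fin d → Grid d N → ℝ) : ℝ :=
  gridInt (fun k => 1 / 2 * ρ k * ∑ i, (w i k - W i k) ^ 2 + relPotential a γ (ρ k) (R k))

/-- The discrete relative energy inequality of the MAC scheme for arbitrary discrete test
states. -/
theorem relative_energy_inequality (ha : 0 < a) (hγ : 1 < γ) (hdt : 0 < dt)
    {ρ ρm R Rm : Grid d N → ℝ} {u V wm Wm : Fin d → Grid d N → ℝ}
    (hρ : ∀ k, 0 < ρ k) (hρm : ∀ k, 0 < ρm k) (hR : ∀ k, 0 < R k) (hRm : ∀ k, 0 < Rm k)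
    (hden : ∀ k, (ρ k - ρm k) / dt + divUp ρ u k - κ * lapCell ρ k = 0)
    (hmom : ∀ (i : Fin d) (k : Grid d N),
      avgFace i (fun l => (ρ l * avgCell u i l - ρm l * wm i l) / dt) k
        + avgFace i (divUp (fun l => ρ l * avgCell u i l) u) k
        + diffFace i (fun l => pressure a γ (ρ l)) k
        - μ * lapFace (u i) k
        - (μ + lam) * diffFace i (divh u) k
      = κ * ∑ j, avgFace i
          (diffCell j (fun l => avgFace j (avgCell u i) l * diffFace j ρ l)) k) :
    (gridRelEnergy a γ ρ (avgCell u) R (avgCell V) - gridRelEnergy a γ ρm wm Rm Wm) / dt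
      + μ * gradSq (u - V) + (μ + lam) * divSq (u - V)
      + 1 / (2 * dt) * gridInt (fun k =>
          ρm k * ∑ i, (avgCell (u - V) i k - (wm i k - Wm i k)) ^ 2)
      + gridInt (fun k => ∑ j, 1 / mesh N * (max 0 (u j k) * relPotential a γ (ρ k) (ρ (k + e j))
          - min 0 (u j k) * relPotential a γ (ρ (k + e j)) (ρ k)))
      + κ * gridInt (fun k => ∑ j,
          diffFace j ρ k * diffFace j (fun l => potentialDeriv a γ (ρ l)) k)
    ≤ gridInt (fun k => ∑ i, ∑ j,
          (-((ρ k * max 0 (u j k) * avgCell (u - V) i k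
              + ρ (k + e j) * min 0 (u j k) * avgCell (u - V) i (k + e j))
                * diffFace j (avgCell V i) k)
            + mesh N / 2 * ((ρ k * max 0 (u j k) - ρ (k + e j) * min 0 (u j k))
                * (diffFace j (avgCell V i) k) ^ 2)))
      - gridInt (fun k => ρm k * ∑ i, (avgCell V i k - Wm i k) / dt * avgCell (u - V) i k)
      - gridInt (fun k => pressure a γ (ρ k) * divh V k)
      - gridInt (fun k => ∑ j,
          upFlux ρ u j k * diffFace j (fun l => potentialDeriv a γ (Rm l)) k)
      - gridInt (fun k => (ρ k - R k)
          * ((potentialDeriv a γ (R k) - potentialDeriv a γ (Rm k)) / dt))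
      - μ * gridInt (fun k => ∑ i, ∑ j, diffFace j (V i) k * diffFace j ((u - V) i) k)
      - (μ + lam) * gridInt (fun k => divh V k * divh (u - V) k)
      + κ * gridInt (fun k => ∑ j, diffFace j ρ k *
          (∑ i, avgFace j (avgCell (u - V) i) k * diffFace j (avgCell V i) k
            + diffFace j (fun l => potentialDeriv a γ (Rm l)) k)) := by
  have hm := mesh_pos N
  set w := avgCell u with hw
  set W := avgCell V with hW
  set z := avgCell (u - V) with hz
  have hzw : ∀ i k, w i k = W i k + z i k := fun i k => by
    rw [hw, hW, hz, avgCell_sub]; ring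
  -- Since `w = W + z`, this is `(|w|² - |W|²) / 2`. It converts the conservative momentum terms
  -- into derivatives of the relative kinetic energy.
  set φ : Grid d N → ℝ := fun k => ∑ i, (W i k * z i k + 1 / 2 * z i k ^ 2) with hφ
  set ψ : Grid d N → ℝ := fun k =>
    potentialDeriv a γ (ρ k) - potentialDeriv a γ (Rm k) - φ k with hψ
  -- time differences
  have hA : (gridRelEnergy a γ ρ w R W - gridRelEnergy a γ ρm wm Rm Wm) / dt
      + 1 / (2 * dt) * gridInt (fun k => ρm k * ∑ i, (z i k - (wm i k - Wm i k)) ^ 2)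
      ≤ gridInt (fun k => ∑ i, (ρ k * w i k - ρm k * wm i k) / dt * z i k)
        + gridInt (fun k => (ρ k - ρm k) / dt * ψ k)
        - gridInt (fun k => ρm k * ∑ i, (W i k - Wm i k) / dt * z i k)
        - gridInt (fun k => (ρ k - R k)
          * ((potentialDeriv a γ (R k) - potentialDeriv a γ (Rm k)) / dt)) := by
    rw [gridRelEnergy, gridRelEnergy, ← gridInt_sub, div_eq_inv_mul, ← gridInt_mul_left,
      ← gridInt_mul_left, ← gridInt_add, ← gridInt_add, ← gridInt_sub, ← gridInt_sub]
    refine gridInt_mono fun k => ?_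
    have := time_cell_le ha hγ hdt (hρ k) (hρm k) (hR k) (hRm k)
      (w := fun i => w i k) (wm := fun i => wm i k) (W := fun i => W i k)
      (Wm := fun i => Wm i k) (z := fun i => z i k) (fun i => hzw i k)
    rw [div_eq_inv_mul] at this
    exact this
  rw [momentum_test hmom (u - V), density_test hden ψ] at hA
  -- the faces
  have hB : gridInt (fun k => ∑ i, ∑ j,
          upFlux (fun l => ρ l * w i l) u j k * diffFace j (z i) k)
        - κ * gridInt (fun k => ∑ i, ∑ j,
          avgFace j (w i) k * diffFace j ρ k * diffFace j (z i) k)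
        + gridInt (fun k => ∑ j, (upFlux ρ u j k * diffFace j ψ k
          - κ * (diffFace j ρ k * diffFace j ψ k)))
      ≤ gridInt (fun k => ∑ i, ∑ j,
          (-((ρ k * max 0 (u j k) * z i k
              + ρ (k + e j) * min 0 (u j k) * z i (k + e j)) * diffFace j (W i) k)
            + mesh N / 2 * ((ρ k * max 0 (u j k) - ρ (k + e j) * min 0 (u j k))
                * (diffFace j (W i) k) ^ 2)))
        - gridInt (fun k => ∑ j,
          upFlux ρ u j k * diffFace j (fun l => potentialDeriv a γ (Rm l)) k)
        + κ * gridInt (fun k => ∑ j, diffFace j ρ k *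
          (∑ i, avgFace j (z i) k * diffFace j (W i) k
            + diffFace j (fun l => potentialDeriv a γ (Rm l)) k))
        - gridInt (fun k => ∑ j, 1 / mesh N * (max 0 (u j k)
            * relPotential a γ (ρ k) (ρ (k + e j))
          - min 0 (u j k) * relPotential a γ (ρ (k + e j)) (ρ k)))
        - κ * gridInt (fun k => ∑ j,
          diffFace j ρ k * diffFace j (fun l => potentialDeriv a γ (ρ l)) k)
        + gridInt (fun k => ∑ j, u j k * diffFace j (fun l => pressure a γ (ρ l)) k) := by
    simp only [← gridInt_mul_left, ← gridInt_add, ← gridInt_sub]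
    refine gridInt_mono fun k => ?_
    rw [Finset.sum_comm, Finset.sum_comm (f := fun i j =>
        avgFace j (w i) k * diffFace j ρ k * diffFace j (z i) k),
      Finset.sum_comm (f := fun i j =>
          (-((ρ k * max 0 (u j k) * z i k
              + ρ (k + e j) * min 0 (u j k) * z i (k + e j)) * diffFace j (W i) k)
            + mesh N / 2 * ((ρ k * max 0 (u j k) - ρ (k + e j) * min 0 (u j k))
                * (diffFace j (W i) k) ^ 2)))]
    simp only [Finset.mul_sum (s := (Finset.univ : Finset (Fin d))) (a := κ),
      ← Finset.sum_add_distrib, ← Finset.sum_sub_distrib]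
    refine Finset.sum_le_sum fun j _ => ?_
    have hup : 0 ≤ max 0 (u j k) := le_max_left _ _
    have hum : min 0 (u j k) ≤ 0 := min_le_left _ _
    have hupm : max 0 (u j k) + min 0 (u j k) = u j k := by rw [max_add_min, zero_add]
    have h1 : ∑ i, upFlux (fun l => ρ l * w i l) u j k * diffFace j (z i) k
        - upFlux ρ u j k * diffFace j φ k ≤ ∑ i,
          (-((ρ k * max 0 (u j k) * z i k
              + ρ (k + e j) * min 0 (u j k) * z i (k + e j)) * diffFace j (W i) k)
            + mesh N / 2 * ((ρ k * max 0 (u j k) - ρ (k + e j) * min 0 (u j k))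
                * (diffFace j (W i) k) ^ 2)) := by
      have e1 : upFlux ρ u j k * diffFace j φ k = ∑ i, upFlux ρ u j k *
          ((W i (k + e j) * z i (k + e j) + 1 / 2 * z i (k + e j) ^ 2
            - (W i k * z i k + 1 / 2 * z i k ^ 2)) / mesh N) := by
        simp only [diffFace, hφ]
        rw [← Finset.sum_sub_distrib, Finset.sum_div, Finset.mul_sum]
      rw [e1, ← Finset.sum_sub_distrib]
      refine Finset.sum_le_sum fun i _ => ?_
      exact convective_face_le hm (hρ k).le (hρ (k + e j)).le hup hum (hzw i k)
        (hzw i (k + e j))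
    have h2 := renormalised_face_eq (a := a) hγ (up := max 0 (u j k)) (um := min 0 (u j k))
      (h := mesh N) (hρ k) (hρ (k + e j))
    rw [hupm] at h2
    have h3 : diffFace j ψ k = diffFace j (fun l => potentialDeriv a γ (ρ l)) k
        - diffFace j (fun l => potentialDeriv a γ (Rm l)) k - diffFace j φ k := by
      simp only [diffFace, hψ]; ring
    -- The correction on the right of the momentum equation is built for this cancellation: by the
    -- discrete product rule, the mean of `w` times the difference of `z` is the difference of `φ`
    -- minus the mean of `z` times the difference of `W`. The part with `φ` cancels against the
    -- diffusion of the density equation.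
    have h4 : ∑ i, κ * (avgFace j (w i) k * diffFace j ρ k * diffFace j (z i) k)
        = κ * (diffFace j ρ k * (diffFace j φ k
          - ∑ i, avgFace j (z i) k * diffFace j (W i) k)) := by
      have e1 : diffFace j φ k = ∑ i, 
          ((W i (k + e j) * z i (k + e j) + 1 / 2 * z i (k + e j) ^ 2
            - (W i k * z i k + 1 / 2 * z i k ^ 2)) / mesh N) := by
        simp only [diffFace, hφ]
        rw [← Finset.sum_sub_distrib, Finset.sum_div]
      rw [e1, ← Finset.sum_sub_distrib, Finset.mul_sum, Finset.mul_sum]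
      refine Finset.sum_congr rfl fun i _ => ?_
      simp only [avgFace, diffFace, hzw]
      ring
    have h5 : upFlux ρ u j k * diffFace j (fun l => potentialDeriv a γ (ρ l)) k
        = u j k * diffFace j (fun l => pressure a γ (ρ l)) k
        - 1 / mesh N * (max 0 (u j k) * relPotential a γ (ρ k) (ρ (k + e j))
          - min 0 (u j k) * relPotential a γ (ρ (k + e j)) (ρ k)) := h2
    rw [Finset.sum_sub_distrib, h4, h3]
    linear_combination h1 + h5
  -- The pressure work produced by the renormalised density equation cancels the pressure term of
  -- the momentum equation, up to the divergence of the test field.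
  have hC : gridInt (fun k => ∑ j, u j k * diffFace j (fun l => pressure a γ (ρ l)) k)
      = - gridInt (fun k => pressure a γ (ρ k) * divh u k) := by
    have := gridInt_divh_mul u (fun l => pressure a γ (ρ l))
    rw [gridInt_neg] at this
    simp only [mul_comm (pressure a γ _)]
    linarith
  have hD : gridInt (fun k => pressure a γ (ρ k) * divh (u - V) k)
      = gridInt (fun k => pressure a γ (ρ k) * divh u k)
        - gridInt (fun k => pressure a γ (ρ k) * divh V k) := by
    rw [← gridInt_sub]
    congr 1; funext k; rw [divh_sub]; ring
  have hE : gridInt (fun k => ∑ i, ∑ j, diffFace j (u i) k * diffFace j ((u - V) i) k)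
      = gradSq (u - V)
        + gridInt (fun k => ∑ i, ∑ j, diffFace j (V i) k * diffFace j ((u - V) i) k) := by
    rw [gradSq, ← gridInt_add]
    congr 1; funext k
    simp only [← Finset.sum_add_distrib, bidualDiff_eq_diffFace, diffFace_sub]
    exact Finset.sum_congr rfl fun i _ => Finset.sum_congr rfl fun j _ => by ring
  have hF : gridInt (fun k => divh u k * divh (u - V) k)
      = divSq (u - V) + gridInt (fun k => divh V k * divh (u - V) k) := by
    rw [divSq, ← gridInt_add]
    congr 1; funext k
    simp only [divh_sub]; ring
  rw [hD, hE, hF] at hA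
  linarith

end Scheme

/-! ### Density-weighted Poincaré inequality and inverse estimate. -/

section Poincare

variable {d N : ℕ} [NeZero N]

/-- The increment over `m` steps telescopes, the Cauchy-Schwarz inequality costs a factor `m`, and
the `m` single steps have the same integral by translation invariance. -/
lemma gridInt_sq_shift_nsmul_le (f : Grid d N → ℝ) (j : Fin d) (m : ℕ) :
    gridInt (fun k => (f (k + m • e j) - f k) ^ 2)
      ≤ (m : ℝ) ^ 2 * gridInt (fun k => (f (k + e j) - f k) ^ 2) := by
  have h1 : ∀ k, (f (k + m • e j) - f k) ^ 2
      ≤ m * ∑ i ∈ Finset.range m, (f (k + i • e j + e j) - f (k + i • e j)) ^ 2 := by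
    intro k
    have h2 : f (k + m • e j) - f k
        = ∑ i ∈ Finset.range m, (f (k + i • e j + e j) - f (k + i • e j)) := by
      have := Finset.sum_range_sub (fun i : ℕ => f (k + i • e j)) m
      simp only [zero_smul, add_zero, succ_nsmul, ← add_assoc] at this
      rw [this]
    rw [h2]
    have := sq_sum_le_card_mul_sum_sq (s := Finset.range m)
      (f := fun i => f (k + i • e j + e j) - f (k + i • e j))
    simpa using this
  refine (gridInt_mono h1).trans (le_of_eq ?_)
  rw [gridInt_mul_left, gridInt_sum]
  have h3 : ∀ i ∈ Finset.range m,
      gridInt (fun k => (f (k + i • e j + e j) - f (k + i • e j)) ^ 2)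
        = gridInt (fun k => (f (k + e j) - f k) ^ 2) := fun i _ =>
    gridInt_shift (i • e j) (fun k => (f (k + e j) - f k) ^ 2)
  rw [Finset.sum_congr rfl h3]
  simp
  ring

/-- The shift is performed axis by axis. Along one axis there are at most `N` steps, and the
resulting factor `N²` cancels the `h²` in squared differences; each additional axis costs a factor
two from `(a + b)² ≤ 2a² + 2b²`. -/
lemma gridInt_sq_shift_le (f : Grid d N → ℝ) (t : Grid d N) :
    gridInt (fun k => (f (k + t) - f k) ^ 2)
      ≤ 2 ^ d * gridInt (fun k => ∑ j, (diffFace j f k) ^ 2) := by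
  have hm := mesh_pos N
  have key : ∀ s : Finset (Fin d),
      gridInt (fun k => (f (k + ∑ j ∈ s, (t j).val • e j) - f k) ^ 2)
        ≤ 2 ^ s.card * ∑ j ∈ s, gridInt (fun k => (diffFace j f k) ^ 2) := by
    intro s
    induction s using Finset.induction_on with
    | empty => simp [gridInt]
    | insert i s hi ih =>
      rw [Finset.sum_insert hi, Finset.sum_insert hi, Finset.card_insert_of_notMem hi]
      set τ : Grid d N := ∑ j ∈ s, (t j).val • e j
      have h1 : ∀ k, (f (k + ((t i).val • e i + τ)) - f k) ^ 2
          ≤ 2 * (f (k + τ + (t i).val • e i) - f (k + τ)) ^ 2 + 2 * (f (k + τ) - f k) ^ 2 := by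
        intro k
        rw [show k + ((t i).val • e i + τ) = k + τ + (t i).val • e i by abel]
        nlinarith [sq_nonneg (f (k + τ + (t i).val • e i) - f (k + τ) - (f (k + τ) - f k))]
      have h2 := gridInt_sq_shift_nsmul_le f i (t i).val
      have h3 : ((t i).val : ℝ) ^ 2 * gridInt (fun k => (f (k + e i) - f k) ^ 2)
          ≤ gridInt (fun k => (diffFace i f k) ^ 2) := by
        have h4 : (fun k => (diffFace i f k) ^ 2)
            = fun k => (1 / mesh N) ^ 2 * (f (k + e i) - f k) ^ 2 := by
          funext k; simp only [diffFace]; ring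
        rw [h4, gridInt_mul_left]
        have h5 : 0 ≤ gridInt (fun k => (f (k + e i) - f k) ^ 2) :=
          gridInt_nonneg fun k => sq_nonneg _
        have h6 : ((t i).val : ℝ) ≤ 1 / mesh N := by
          have : ((t i).val : ℝ) ≤ N := by exact_mod_cast (ZMod.val_lt (t i)).le
          simpa [mesh] using this
        gcongr
      have h7 : 0 ≤ gridInt (fun k => (diffFace i f k) ^ 2) :=
        gridInt_nonneg fun k => sq_nonneg _
      have h8 := gridInt_shift τ (fun k => (f (k + (t i).val • e i) - f k) ^ 2)
      refine (gridInt_mono h1).trans ?_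
      rw [gridInt_add, gridInt_mul_left, gridInt_mul_left, h8, pow_succ]
      have h9 : (1 : ℝ) ≤ 2 ^ s.card := one_le_pow₀ (by norm_num)
      nlinarith [mul_nonneg (sub_nonneg.2 h9) h7]
  have h := key Finset.univ
  have ht : ∑ j, (t j).val • e j = t := by
    funext i
    simp only [Finset.sum_apply, Pi.smul_apply, e, Pi.single_apply, smul_ite, smul_zero,
      nsmul_one, Finset.sum_ite_eq, Finset.mem_univ, if_true, ZMod.natCast_zmod_val]
  rw [ht] at h
  simpa [gridInt_sum] using h

/-- A weighted discrete Poincaré inequality. -/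
lemma weighted_poincare {σ : Grid d N → ℝ} {B : ℝ} (hσ : ∀ k, 0 ≤ σ k) (hB : ∀ k, σ k ≤ B)
    (f : Grid d N → ℝ) :
    gridInt σ * gridInt (fun k => f k ^ 2)
      ≤ 2 * B * 2 ^ d * gridInt (fun k => ∑ j, (diffFace j f k) ^ 2)
        + 2 * gridInt (fun k => σ k * f k ^ 2) := by
  have hB0 : 0 ≤ B := (hσ 0).trans (hB 0)
  have h1 : ∀ t : Grid d N, gridInt (fun k => σ (k + t) * f k ^ 2)
      ≤ 2 * B * 2 ^ d * gridInt (fun k => ∑ j, (diffFace j f k) ^ 2)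
        + 2 * gridInt (fun k => σ k * f k ^ 2) := by
    intro t
    have h2 : ∀ k, σ (k + t) * f k ^ 2
        ≤ 2 * B * (f (k + t) - f k) ^ 2 + 2 * (σ (k + t) * f (k + t) ^ 2) := by
      intro k
      have h3 : f k ^ 2 ≤ 2 * (f (k + t) - f k) ^ 2 + 2 * f (k + t) ^ 2 := by
        nlinarith [sq_nonneg (f (k + t) - f k + f (k + t))]
      have h4 := mul_le_mul_of_nonneg_left h3 (hσ (k + t))
      have h5 := mul_le_mul_of_nonneg_right (hB (k + t)) (sq_nonneg (f (k + t) - f k))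
      linarith
    refine (gridInt_mono h2).trans ?_
    rw [gridInt_add, gridInt_mul_left, gridInt_mul_left,
      gridInt_shift t (fun k => σ k * f k ^ 2)]
    have := mul_le_mul_of_nonneg_left (gridInt_sq_shift_le f t)
      (by positivity : 0 ≤ 2 * B)
    linarith
  -- The bound is uniform in `t`, so it may be averaged over all shifts. The mean of `σ (k + t)`
  -- over `t` is the integral of `σ` for every `k`, so the left side factorises.
  have h6 := gridInt_mono h1
  rw [gridInt_const] at h6
  refine le_trans (le_of_eq ?_) h6
  have h7 : ∀ t, gridInt (fun k => σ (k + t) * f k ^ 2)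
      = mesh N ^ d * ∑ k, f k ^ 2 * σ (t + k) := by
    intro t
    unfold gridInt
    congr 1
    exact Finset.sum_congr rfl fun k _ => by rw [add_comm, mul_comm]
  simp only [h7]
  rw [gridInt_mul_left, gridInt_sum]
  simp only [gridInt_mul_left, gridInt_shift]
  rw [← Finset.sum_mul]
  simp only [gridInt]
  ring

/-- The discrete Poincaré inequality weighted by a density of given mass and bounded
`γ`-norm. -/
lemma density_poincare {γ M : ℝ} (hγ : 1 < γ) (hM : 0 < M) (CE : ℝ) :
    ∃ C : ℝ, 0 < C ∧ ∀ (d N : ℕ) [NeZero N] (ρ f : Grid d N → ℝ), (∀ k, 0 < ρ k) →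
      gridInt ρ = M → gridInt (fun k => ρ k ^ γ) ≤ CE →
      gridInt (fun k => f k ^ 2) ≤ C * 2 ^ d * (gridInt (fun k => ∑ j, (diffFace j f k) ^ 2)
        + gridInt (fun k => ρ k * f k ^ 2)) := by
  have hγ1 : 0 < γ - 1 := by linarith
  set CE' := max CE 1
  have hCE : 0 < CE' := lt_of_lt_of_le one_pos (le_max_right _ _)
  -- Chosen so that the part of the density above `B` carries at most half of the mass, by the bound
  -- on `ρ ^ γ`. The truncation `min ρ B` is then a bounded weight of mass at least `M / 2`.
  set B := (2 * CE' / M) ^ (1 / (γ - 1)) with hB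
  have hB0 : 0 < B := by positivity
  refine ⟨4 * (B + 1) / M, by positivity, fun d N _ ρ f hρ hmass hE => ?_⟩
  have hBp : B ^ (γ - 1) = 2 * CE' / M := by
    rw [hB, ← Real.rpow_mul (by positivity), one_div_mul_cancel hγ1.ne', Real.rpow_one]
  have h1 : ∀ k, ρ k ≤ min (ρ k) B + M / (2 * CE') * ρ k ^ γ := by
    intro k
    have h0 : 0 < ρ k ^ γ := Real.rpow_pos_of_pos (hρ k) _
    rcases le_total (ρ k) B with h | h
    · rw [min_eq_left h]
      have : 0 ≤ M / (2 * CE') * ρ k ^ γ := by positivity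
      linarith
    · have h2 : ρ k ^ γ = ρ k ^ (γ - 1) * ρ k := by
        rw [Real.rpow_sub_one (hρ k).ne']; field_simp [(hρ k).ne']
      have h3 : B ^ (γ - 1) ≤ ρ k ^ (γ - 1) := Real.rpow_le_rpow hB0.le h hγ1.le
      rw [hBp] at h3
      have h4 : 1 ≤ M / (2 * CE') * ρ k ^ (γ - 1) := by
        calc (1 : ℝ) = M / (2 * CE') * (2 * CE' / M) := by field_simp
          _ ≤ _ := by gcongr
      have h5 : 0 ≤ min (ρ k) B := le_min (hρ k).le hB0.le
      rw [h2]
      nlinarith [mul_le_mul_of_nonneg_right h4 (hρ k).le]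
  have h2 := gridInt_mono h1
  rw [gridInt_add, gridInt_mul_left, hmass] at h2
  have h3 : M / (2 * CE') * gridInt (fun k => ρ k ^ γ) ≤ M / 2 := by
    calc M / (2 * CE') * gridInt (fun k => ρ k ^ γ) ≤ M / (2 * CE') * CE' := by
          gcongr
          exact hE.trans (le_max_left _ _)
      _ = M / 2 := by field_simp
  have h4 := weighted_poincare (σ := fun k => min (ρ k) B) (B := B)
    (fun k => le_min (hρ k).le hB0.le) (fun k => min_le_right _ _) f
  have h5 : 0 ≤ gridInt (fun k => f k ^ 2) := gridInt_nonneg fun k => sq_nonneg _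
  have h6 : gridInt (fun k => min (ρ k) B * f k ^ 2) ≤ gridInt (fun k => ρ k * f k ^ 2) :=
    gridInt_mono fun k => mul_le_mul_of_nonneg_right (min_le_left _ _) (sq_nonneg _)
  have h7 : M / 2 * gridInt (fun k => f k ^ 2)
      ≤ gridInt (fun k => min (ρ k) B) * gridInt (fun k => f k ^ 2) := by
    gcongr
    linarith
  have h8 : 0 ≤ gridInt (fun k => ρ k * f k ^ 2) :=
    gridInt_nonneg fun k => mul_nonneg (hρ k).le (sq_nonneg _)
  have h9 : 0 ≤ gridInt (fun k => ∑ j, (diffFace j f k) ^ 2) :=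
    gridInt_nonneg fun k => Finset.sum_nonneg fun j _ => sq_nonneg _
  have h10 : (1 : ℝ) ≤ 2 ^ d := one_le_pow₀ (by norm_num)
  set A := gridInt (fun k => ∑ j, (diffFace j f k) ^ 2)
  set D := gridInt (fun k => ρ k * f k ^ 2)
  have h11 : M / 2 * gridInt (fun k => f k ^ 2) ≤ 2 * (B + 1) * 2 ^ d * (A + D) := by
    have e1 : 2 * D ≤ 2 * (B + 1) * 2 ^ d * D := by
      have : (1 : ℝ) ≤ (B + 1) * 2 ^ d := by nlinarith
      nlinarith
    have e2 : 2 * B * 2 ^ d * A ≤ 2 * (B + 1) * 2 ^ d * A := by gcongr; linarith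
    nlinarith
  calc gridInt (fun k => f k ^ 2) = 2 / M * (M / 2 * gridInt (fun k => f k ^ 2)) := by
        field_simp
    _ ≤ 2 / M * (2 * (B + 1) * 2 ^ d * (A + D)) := by gcongr
    _ = _ := by ring

/-- The inverse estimate for the density. -/
lemma inverse_estimate {γ CE : ℝ} (hγ : 1 < γ) (ρ : Grid d N → ℝ) (hρ : ∀ k, 0 < ρ k)
    (hE : gridInt (fun k => ρ k ^ γ) ≤ CE) (k : Grid d N) :
    mesh N ^ 2 * ρ k ≤ CE ^ (1 / γ) * mesh N ^ ((2 * γ - d) / γ) := by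
  have hm := mesh_pos N
  have hγ0 : 0 < γ := by linarith
  -- A single cell contributes no more than the whole integral. The power `1 / γ` gives `ρ k ≤ CE ^
  -- (1/γ) * h ^ (-d/γ)`, and the factor `h²` produces the exponent `(2γ - d) / γ`.
  have h1 : mesh N ^ d * ρ k ^ γ ≤ CE := by
    refine le_trans ?_ hE
    unfold gridInt
    gcongr
    exact Finset.single_le_sum (f := fun k => ρ k ^ γ)
      (fun l _ => (Real.rpow_pos_of_pos (hρ l) _).le) (Finset.mem_univ k)
  have h2 : 0 ≤ mesh N ^ d * ρ k ^ γ := by have := Real.rpow_pos_of_pos (hρ k) γ; positivity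
  have h3 := Real.rpow_le_rpow h2 h1 (by positivity : 0 ≤ 1 / γ)
  have h4 : (mesh N ^ d * ρ k ^ γ) ^ (1 / γ) = mesh N ^ ((d : ℝ) / γ) * ρ k := by
    rw [Real.mul_rpow (by positivity) (Real.rpow_pos_of_pos (hρ k) γ).le,
      ← Real.rpow_mul (hρ k).le, mul_one_div_cancel hγ0.ne', Real.rpow_one,
      ← Real.rpow_natCast, ← Real.rpow_mul hm.le]
    congr 2; ring
  rw [h4] at h3
  have h5 : mesh N ^ ((2 * γ - d) / γ) * mesh N ^ ((d : ℝ) / γ) = mesh N ^ 2 := by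
    rw [← Real.rpow_add hm, ← Real.rpow_two]
    congr 1; field_simp; ring
  calc mesh N ^ 2 * ρ k = mesh N ^ ((2 * γ - d) / γ) * (mesh N ^ ((d : ℝ) / γ) * ρ k) := by
        rw [← h5]; ring
    _ ≤ mesh N ^ ((2 * γ - d) / γ) * CE ^ (1 / γ) := by gcongr
    _ = _ := by ring

end Poincare

/-! ### Scalar inequalities for one face or one cell. -/

section ScalarEstimates

variable {a γ rlo rhi : ℝ}

lemma mul_le_sq_add_sq (δ x y : ℝ) (hδ : 0 < δ) : x * y ≤ δ * x ^ 2 + y ^ 2 / (4 * δ) := by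
  have : δ * x ^ 2 + y ^ 2 / (4 * δ) - x * y = (2 * δ * x - y) ^ 2 / (4 * δ) := by
    field_simp; ring
  have h2 : 0 ≤ (2 * δ * x - y) ^ 2 / (4 * δ) := by positivity
  linarith

lemma sq_le_relPotential (ha : 0 < a) (hγ : 1 < γ) (hlo : 0 < rlo) (rhi : ℝ) :
    ∃ C : ℝ, 0 < C ∧ ∀ ρ R : ℝ, 0 < ρ → rlo ≤ R → R ≤ rhi →
      (ρ - R) ^ 2 ≤ C * (1 + ρ) * relPotential a γ ρ R := by
  obtain ⟨c, hc, h⟩ := relPotential_coercive ha hγ hlo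
  refine ⟨(1 + max rhi 0) / c, by positivity, fun ρ R hρ hR hR' => ?_⟩
  have hR0 : 0 < R := by linarith
  have h1 := h ρ R hρ hR0 (hR.trans (le_max_right _ _))
  have h2 := relPotential_nonneg ha hγ hρ hR0
  rw [div_le_iff₀ (by linarith)] at h1
  have h3 : 1 + ρ + R ≤ (1 + max rhi 0) * (1 + ρ) := by
    have := le_max_left rhi 0
    have := le_max_right rhi 0
    nlinarith
  have h4 := mul_le_mul_of_nonneg_left h3 h2
  calc (ρ - R) ^ 2 = (c * (ρ - R) ^ 2) / c := by field_simp
    _ ≤ (relPotential a γ ρ R * ((1 + max rhi 0) * (1 + ρ))) / c := by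
        exact div_le_div_of_nonneg_right (h1.trans h4) hc.le
    _ = _ := by ring

/-- For large densities the relative potential controls `(ρ - R)²` only up to a factor `1 + ρ`.
Young's inequality shifts this factor to `z²`, where `ρ z²` is kinetic energy and `z²` is covered by
the Poincaré inequality. -/
lemma abs_sub_mul_le (ha : 0 < a) (hγ : 1 < γ) (hlo : 0 < rlo) (rhi : ℝ) (B δ : ℝ)
    (hδ : 0 < δ) :
    ∃ C : ℝ, 0 ≤ C ∧ ∀ ρ R z : ℝ, 0 < ρ → rlo ≤ R → R ≤ rhi →
      B * (|ρ - R| * |z|) ≤ C * relPotential a γ ρ R + δ * ((1 + ρ) * z ^ 2) := by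
  obtain ⟨C, hC, h⟩ := sq_le_relPotential ha hγ hlo rhi
  refine ⟨B ^ 2 * C / (4 * δ), by positivity, fun ρ R z hρ hR hR' => ?_⟩
  have h1 := h ρ R hρ hR hR'
  have h2 := mul_le_sq_add_sq (δ * (1 + ρ)) |z| (B * |ρ - R|) (by positivity)
  rw [sq_abs, mul_pow, sq_abs] at h2
  have h3 : B ^ 2 * (ρ - R) ^ 2 / (4 * (δ * (1 + ρ)))
      ≤ B ^ 2 * C / (4 * δ) * relPotential a γ ρ R := by
    rw [div_le_iff₀ (by positivity)]
    calc B ^ 2 * (ρ - R) ^ 2 ≤ B ^ 2 * (C * (1 + ρ) * relPotential a γ ρ R) := by gcongr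
      _ = _ := by field_simp
  linarith

/-- Away from a fixed positive density level the relative potential is bounded below. -/
lemma one_le_relPotential_of_lt (ha : 0 < a) (hγ : 1 < γ) (hlo : 0 < rlo) (rhi : ℝ) :
    ∃ C : ℝ, 0 < C ∧ ∀ x R : ℝ, 0 < x → x < rlo / 2 → rlo ≤ R → R ≤ rhi →
      1 ≤ C * min 1 (relPotential a γ x R) := by
  obtain ⟨C, hC, h⟩ := sq_le_relPotential ha hγ hlo rhi
  set c₁ := (rlo / 2) ^ 2 / (C * (1 + rlo)) with hc₁
  have hc₁0 : 0 < c₁ := by positivity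
  refine ⟨1 / min 1 c₁, by positivity, fun x R hx hxl hR hR' => ?_⟩
  have h1 := h x R hx hR hR'
  have h2 := relPotential_nonneg ha hγ hx (by linarith : 0 < R)
  have h3 : c₁ ≤ relPotential a γ x R := by
    rw [hc₁, div_le_iff₀ (by positivity)]
    have h4 : (rlo / 2) ^ 2 ≤ (x - R) ^ 2 := by nlinarith
    have h5 : C * (1 + x) * relPotential a γ x R ≤ C * (1 + rlo) * relPotential a γ x R := by
      gcongr; linarith
    linarith
  calc (1 : ℝ) = 1 / min 1 c₁ * min 1 c₁ := by field_simp
    _ ≤ _ := by gcongr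

/-- The density jump is controlled by the upwind dissipation away from the vacuum and by the
relative energy near the vacuum. -/
lemma jump_le_upwind (ha : 0 < a) (hγ : 1 < γ) (hlo : 0 < rlo) (rhi L : ℝ) (hL : 0 ≤ L) :
    ∃ C : ℝ, 0 ≤ C ∧ ∀ h x y R : ℝ, 0 < h → 0 < x → 0 < y → rlo ≤ R → R ≤ rhi →
      L * |y - x| ≤ 1 / h * relPotential a γ x y
          + C * (h * (1 + x + y) + min 1 (relPotential a γ x R)) ∧
      L * |y - x| ≤ 1 / h * relPotential a γ y x
          + C * (h * (1 + x + y) + min 1 (relPotential a γ x R)) := by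
  obtain ⟨c, hc, hcoer⟩ := relPotential_coercive ha hγ (half_pos hlo)
  obtain ⟨C₁, hC₁, hsmall⟩ := one_le_relPotential_of_lt ha hγ hlo rhi
  refine ⟨L ^ 2 / (4 * c) + L * rlo * C₁, by positivity, fun h x y R hh hx hy hR hR' => ?_⟩
  have hm : 0 ≤ min 1 (relPotential a γ x R) :=
    le_min zero_le_one (relPotential_nonneg ha hγ hx (by linarith))
  have hs : 0 < 1 + x + y := by linarith
  have hLL : 0 ≤ L * rlo * C₁ := by positivity
  have hLc : 0 ≤ L ^ 2 / (4 * c) := by positivity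
  -- If one of the densities is at least `rlo / 2`, coercivity and Young's inequality with weight `c
  -- / (h * (1 + x + y))` apply. Otherwise both are below half of the lower bound of `R`; the jump
  -- is then bounded and `1 ≤ C₁ * min 1 𝔼(x|R)`. The cap at one is needed later, when this term is
  -- paired with a velocity and its square must still be bounded by `𝔼(x|R)`.
  rcases le_or_gt (rlo / 2) (max x y) with hmax | hmax
  · have key : ∀ E : ℝ, c * (x - y) ^ 2 / (1 + x + y) ≤ E → L * |y - x| ≤ 1 / h * E
        + (L ^ 2 / (4 * c) + L * rlo * C₁)
          * (h * (1 + x + y) + min 1 (relPotential a γ x R)) := by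
      intro E hE
      have h1 := mul_le_sq_add_sq (c / (h * (1 + x + y))) |y - x| L (by positivity)
      rw [sq_abs] at h1
      have h2 : 1 / h * (c * (x - y) ^ 2 / (1 + x + y)) ≤ 1 / h * E := by gcongr
      have h3 : L ^ 2 / (4 * (c / (h * (1 + x + y)))) = L ^ 2 / (4 * c) * (h * (1 + x + y)) := by
        field_simp
      have h4 : c / (h * (1 + x + y)) * (y - x) ^ 2 = 1 / h * (c * (x - y) ^ 2 / (1 + x + y)) := by
        field_simp; ring
      rw [h3, h4] at h1
      have h5 : 0 ≤ L * rlo * C₁ * (h * (1 + x + y)) := by positivity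
      have h6 := mul_nonneg hLL hm
      have h7 := mul_nonneg hLc hm
      linarith
    refine ⟨key _ (hcoer x y hx hy hmax), key _ ?_⟩
    have := hcoer y x hy hx (by rwa [max_comm])
    rwa [show (x - y) ^ 2 = (y - x) ^ 2 by ring, show 1 + x + y = 1 + y + x by ring]
  · obtain ⟨hx', hy'⟩ := max_lt_iff.1 hmax
    have h1 := hsmall x R hx hx' hR hR'
    have h2 : |y - x| ≤ rlo := by rw [abs_le]; constructor <;> linarith
    have h3 : L * |y - x| ≤ L * rlo * C₁ * min 1 (relPotential a γ x R) := by
      calc L * |y - x| ≤ L * rlo * 1 := by rw [mul_one]; gcongr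
        _ ≤ L * rlo * (C₁ * min 1 (relPotential a γ x R)) := by gcongr
        _ = _ := by ring
    have h4 : 0 ≤ (L ^ 2 / (4 * c) + L * rlo * C₁) * (h * (1 + x + y)) := by positivity
    have h7 := mul_nonneg hLc hm
    have e1 : 0 ≤ 1 / h * relPotential a γ x y :=
      mul_nonneg (by positivity) (relPotential_nonneg ha hγ hx hy)
    have e2 : 0 ≤ 1 / h * relPotential a γ y x :=
      mul_nonneg (by positivity) (relPotential_nonneg ha hγ hy hx)
    constructor <;> linarith

/-- The product is the symmetric sum `𝔼(x|y) + 𝔼(y|x)`. -/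
lemma potentialDeriv_mono_mul (ha : 0 < a) (hγ : 1 < γ) {x y : ℝ} (hx : 0 < x) (hy : 0 < y) :
    0 ≤ (y - x) * (potentialDeriv a γ y - potentialDeriv a γ x) := by
  have h1 := relPotential_nonneg ha hγ hx hy
  have h2 := relPotential_nonneg ha hγ hy hx
  rw [relPotential_eq hγ hx hy] at h1
  rw [relPotential_eq hγ hy hx] at h2
  linarith

/-- The artificial diffusion flux is controlled by its dissipation away from the vacuum and by
the relative energy near the vacuum. -/
lemma diffusion_face_le (ha : 0 < a) (hγ : 1 < γ) (hlo : 0 < rlo) (rhi : ℝ) :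
    ∃ C : ℝ, 0 ≤ C ∧ ∀ h κ x y R X : ℝ, 0 < h → 0 ≤ κ → κ ≤ h → 0 < x → 0 < y →
      rlo ≤ R → R ≤ rhi →
      κ * ((y - x) / h * X)
        ≤ κ * ((y - x) / h * ((potentialDeriv a γ y - potentialDeriv a γ x) / h))
          + C * (h * (1 + x + y) * X ^ 2 + min 1 (relPotential a γ x R) * |X|) := by
  obtain ⟨c, hc, hmono⟩ := potentialDeriv_strong_mono ha hγ (half_pos hlo)
  obtain ⟨C₁, hC₁, hsmall⟩ := one_le_relPotential_of_lt ha hγ hlo rhi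
  refine ⟨1 / (4 * c) + rlo * C₁, by positivity, fun h κ x y R X hh hκ hκh hx hy hR hR' => ?_⟩
  have hm : 0 ≤ min 1 (relPotential a γ x R) :=
    le_min zero_le_one (relPotential_nonneg ha hγ hx (by linarith))
  have hs : 0 < 1 + x + y := by linarith
  have hmX : 0 ≤ min 1 (relPotential a γ x R) * |X| := by positivity
  -- The same alternative as for the upwind jump: away from the vacuum the dissipation dominates the
  -- squared density difference, and near the vacuum `κ ≤ h` makes the flux itself bounded.
  rcases le_or_gt (rlo / 2) (max x y) with hmax | hmax
  · have h1 : c * (y - x) ^ 2 / (1 + x + y)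
        ≤ (y - x) * (potentialDeriv a γ y - potentialDeriv a γ x) := by
      rcases le_total x y with hxy | hxy
      · rw [max_eq_right hxy] at hmax
        have := mul_le_mul_of_nonneg_right
          (hmono x y (x + y) hx hxy hmax (by linarith)) (by linarith : 0 ≤ y - x)
        calc _ = c * (y - x) / (1 + (x + y)) * (y - x) := by ring_nf
          _ ≤ _ := by linarith
      · rw [max_eq_left hxy] at hmax
        have := mul_le_mul_of_nonneg_right
          (hmono y x (x + y) hy hxy hmax (by linarith)) (by linarith : 0 ≤ x - y)
        calc _ = c * (x - y) / (1 + (x + y)) * (x - y) := by ring_nf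
          _ ≤ _ := by linarith
    have h2 := mul_le_sq_add_sq (c / (1 + x + y)) ((y - x) / h) X (by positivity)
    have h3 : (y - x) / h * X ≤ (y - x) / h * ((potentialDeriv a γ y - potentialDeriv a γ x) / h)
        + 1 / (4 * c) * ((1 + x + y) * X ^ 2) := by
      refine h2.trans (add_le_add ?_ (le_of_eq (by field_simp)))
      have : 1 / h ^ 2 * (c * (y - x) ^ 2 / (1 + x + y)) ≤ 1 / h ^ 2 *
        ((y - x) * (potentialDeriv a γ y - potentialDeriv a γ x)) := by gcongr
      calc _ = 1 / h ^ 2 * (c * (y - x) ^ 2 / (1 + x + y)) := by ring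
        _ ≤ _ := this
        _ = _ := by ring
    have h4 := mul_le_mul_of_nonneg_left h3 hκ
    have h5 : κ * (1 / (4 * c) * ((1 + x + y) * X ^ 2))
        ≤ 1 / (4 * c) * (h * (1 + x + y) * X ^ 2) := by
      calc _ ≤ h * (1 / (4 * c) * ((1 + x + y) * X ^ 2)) := by gcongr
        _ = _ := by ring
    have h6 : 0 ≤ rlo * C₁ * (h * (1 + x + y) * X ^ 2) := by positivity
    have h7 : 0 ≤ (1 / (4 * c) + rlo * C₁) * (min 1 (relPotential a γ x R) * |X|) := by
      positivity
    linarith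
  · obtain ⟨hx', hy'⟩ := max_lt_iff.1 hmax
    have h1 := hsmall x R hx hx' hR hR'
    have h2 : |y - x| ≤ rlo := by rw [abs_le]; constructor <;> linarith
    have h3 : κ * ((y - x) / h * X) ≤ rlo * C₁ * (min 1 (relPotential a γ x R) * |X|) := by
      have hκ1 : κ / h ≤ 1 := by rw [div_le_one hh]; exact hκh
      have hκ0 : 0 ≤ κ / h := by positivity
      calc κ * ((y - x) / h * X) = κ / h * ((y - x) * X) := by ring
        _ ≤ κ / h * (|y - x| * |X|) :=
            mul_le_mul_of_nonneg_left ((le_abs_self _).trans (abs_mul _ _).le) hκ0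
        _ ≤ 1 * (rlo * |X|) := by gcongr
        _ = rlo * 1 * |X| := by ring
        _ ≤ rlo * (C₁ * min 1 (relPotential a γ x R)) * |X| := by gcongr
        _ = _ := by ring
    have h4 : 0 ≤ κ * ((y - x) / h * ((potentialDeriv a γ y - potentialDeriv a γ x) / h)) := by
      have := potentialDeriv_mono_mul ha hγ hx hy
      calc 0 ≤ κ * (1 / h ^ 2 * ((y - x) * (potentialDeriv a γ y - potentialDeriv a γ x))) := by
            positivity
        _ = _ := by ring
    have h5 : 0 ≤ (1 / (4 * c) + rlo * C₁) * (h * (1 + x + y) * X ^ 2) := by positivity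
    have h6 : 0 ≤ 1 / (4 * c) * (min 1 (relPotential a γ x R) * |X|) := by positivity
    linarith

/-- Writing the positive and negative parts through absolute values reduces the left side to `||x| -
|y|| / 2`. For the two faces of a cell this is the price of replacing the upwind combination by the
mean velocity. -/
lemma abs_max_add_min_sub (x y : ℝ) :
    |max 0 x + min 0 y - (x + y) / 2| ≤ |x - y| / 2 := by
  have h1 : max 0 x = (x + |x|) / 2 := by
    rcases le_total 0 x with h | h
    · rw [max_eq_right h, abs_of_nonneg h]; ring
    · rw [max_eq_left h, abs_of_nonpos h]; ring
  have h2 : min 0 y = (y - |y|) / 2 := by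
    rcases le_total 0 y with h | h
    · rw [min_eq_left h, abs_of_nonneg h]; ring
    · rw [min_eq_right h, abs_of_nonpos h]; ring
  rw [h1, h2, show (x + |x|) / 2 + (y - |y|) / 2 - (x + y) / 2 = (|x| - |y|) / 2 by ring, abs_div,
    abs_two]
  exact div_le_div_of_nonneg_right (abs_abs_sub_abs_le_abs_sub x y) zero_le_two

/-- The two face velocities of a cell in terms of the cell velocity. -/
lemma abs_face_velocity_le {L h up um W z dV dv : ℝ} (hh : 0 < h) (hh1 : h ≤ 1)
    (hdiff : up - um = h * (dV + dv)) (hmean : (up + um) / 2 = W + z) (hW : |W| ≤ L)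
    (hdV : |dV| ≤ L) :
    |up| ≤ 2 * L + |z| + h * |dv| ∧ |um| ≤ 2 * L + |z| + h * |dv| ∧
      |up - um| ≤ h * (L + |dv|) := by
  have hL : 0 ≤ L := (abs_nonneg _).trans hW
  have h1 : |up - um| ≤ h * (L + |dv|) := by
    rw [hdiff, abs_mul, abs_of_pos hh]
    gcongr
    exact (abs_add_le _ _).trans (by linarith)
  have h2 : h * (L + |dv|) ≤ L + h * |dv| := by nlinarith
  have h3 : |W + z| ≤ L + |z| := (abs_add_le _ _).trans (by linarith)
  have h4 : 0 ≤ h * |dv| := by positivity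
  rw [← hmean] at h3
  have h5 := abs_le.1 h1
  have h6 := abs_le.1 h3
  refine ⟨abs_le.2 ⟨?_, ?_⟩, abs_le.2 ⟨?_, ?_⟩, h1⟩ <;> linarith

/-- Young's inequality for every monomial. The divergence error `E` occurs on the right only as `h *
E`, so that after multiplication with a density the inverse estimate for `h² ρ` applies. -/
lemma convection_poly_le {L h A B E : ℝ} (hL : 1 ≤ L) (hh : 0 ≤ h) (hh1 : h ≤ 1) (hA : 0 ≤ A)
    (hB : 0 ≤ B) (hE : 0 ≤ E) :
    A * (B * L) + A * (L * (h * (L + E)) + (2 * L + B + h * E) * (L * h))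
      + h / 2 * (2 * ((2 * L + B + h * E) * L ^ 2))
    ≤ 10 * L ^ 3 * (A ^ 2 + B ^ 2 + h + h ^ 2 * E ^ 2) := by
  have hhh : h ^ 2 ≤ h := by nlinarith
  have p1 := two_mul_le_add_sq A B
  have p2 := two_mul_le_add_sq A h
  have p3 := two_mul_le_add_sq A (h * E)
  have p4 := two_mul_le_add_sq h B
  have p5 := two_mul_le_add_sq h (h * E)
  rw [mul_pow] at p3 p5
  have p6 : A * B * h ≤ A * B * 1 := by gcongr
  have p7 : A * (h * E) * h ≤ A * (h * E) * 1 := by gcongr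
  have i1 : 0 ≤ h ^ 2 * E ^ 2 := by positivity
  have i2 : 0 ≤ B ^ 2 := by positivity
  have i3 : 0 ≤ A ^ 2 := by positivity
  set F := A ^ 2 + B ^ 2 + h + h ^ 2 * E ^ 2 with hF
  have hF0 : 0 ≤ F := by positivity
  have e1 : A * (B * L) + A * (L * (h * (L + E)) + (2 * L + B + h * E) * (L * h))
    + h / 2 * (2 * ((2 * L + B + h * E) * L ^ 2))
    = L * (A * B + A * (h * E) + A * B * h + A * (h * E) * h)
      + L ^ 2 * (3 * (A * h) + h * B + h * (h * E)) + L ^ 3 * (2 * h) := by ring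
  have e2 : A * B + A * (h * E) + A * B * h + A * (h * E) * h ≤ 2 * F := by linarith
  have e3 : 3 * (A * h) + h * B + h * (h * E) ≤ 3 * F := by linarith
  have e4 : 2 * h ≤ 2 * F := by linarith
  have l1 : L ≤ L ^ 3 := le_self_pow₀ hL (by norm_num)
  have l2 : L ^ 2 ≤ L ^ 3 := pow_le_pow_right₀ hL (by norm_num)
  have l3 : 0 ≤ L ^ 3 := by positivity
  rw [e1]
  calc _ ≤ L * (2 * F) + L ^ 2 * (3 * F) + L ^ 3 * (2 * F) := by gcongr
    _ ≤ L ^ 3 * (2 * F) + L ^ 3 * (3 * F) + L ^ 3 * (2 * F) := by gcongr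
    _ ≤ 10 * L ^ 3 * F := by linarith [mul_nonneg l3 hF0]

/-- The convective term of one cell. -/
lemma convection_cell_le {L h ε ρ zi up um W zj dV dv Dk Dm : ℝ} (hL : 1 ≤ L) (hh : 0 < h)
    (hh1 : h ≤ 1) (hε : h ≤ ε) (hρ : 0 < ρ) (hinv : h ^ 2 * ρ ≤ L * ε)
    (hdiff : up - um = h * (dV + dv)) (hmean : (up + um) / 2 = W + zj) (hW : |W| ≤ L)
    (hdV : |dV| ≤ L) (hDk : |Dk| ≤ L) (hDm : |Dm| ≤ L) (hD : |Dk - Dm| ≤ L * h) :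
    -(ρ * zi * (max 0 up * Dk + min 0 um * Dm))
      + h / 2 * (ρ * (max 0 up * Dk ^ 2 - min 0 um * Dm ^ 2))
    ≤ -(ρ * zi * W * Dk) + 10 * L ^ 4 * (ρ * (zi ^ 2 + zj ^ 2) + ε * (ρ + dv ^ 2)) := by
  obtain ⟨hup, hum, hdif⟩ := abs_face_velocity_le hh hh1 hdiff hmean hW hdV
  set A := |zi| with hA
  set B := |zj| with hB
  set E := |dv| with hE
  have hA0 : 0 ≤ A := abs_nonneg _
  have hB0 : 0 ≤ B := abs_nonneg _
  have hE0 : 0 ≤ E := abs_nonneg _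
  have hA2 : zi ^ 2 = A ^ 2 := (sq_abs _).symm
  have hB2 : zj ^ 2 = B ^ 2 := (sq_abs _).symm
  have hE2 : dv ^ 2 = E ^ 2 := (sq_abs _).symm
  -- The upwind combination differs from the transport by the mean velocity through the difference
  -- of the two face velocities and through the oscillation of the gradient, both of order `h`.
  have h1 : |max 0 up * Dk + min 0 um * Dm - (W + zj) * Dk|
      ≤ L * (h * (L + E)) + (2 * L + B + h * E) * (L * h) := by
    have e1 : max 0 up * Dk + min 0 um * Dm - (W + zj) * Dk
        = (max 0 up + min 0 um - (up + um) / 2) * Dk - min 0 um * (Dk - Dm) := by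
      rw [hmean]; ring
    rw [e1]
    refine (abs_sub _ _).trans ?_
    rw [abs_mul, abs_mul]
    have e2 := abs_max_add_min_sub up um
    have e3 : |max 0 up + min 0 um - (up + um) / 2| ≤ h * (L + E) := by
      have := abs_nonneg (up - um)
      linarith
    have e4 : |min 0 um| ≤ 2 * L + B + h * E := by
      refine le_trans ?_ hum
      rcases le_total 0 um with h | h
      · rw [min_eq_left h]; simp
      · rw [min_eq_right h]
    have e5 : |max 0 up + min 0 um - (up + um) / 2| * |Dk| ≤ h * (L + E) * L := by gcongr
    have e6 : |min 0 um| * |Dk - Dm| ≤ (2 * L + B + h * E) * (L * h) := by gcongr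
    linarith
  have h2 : -(ρ * zi * (max 0 up * Dk + min 0 um * Dm)) ≤ -(ρ * zi * W * Dk)
      + ρ * (A * (B * L))
      + ρ * (A * (L * (h * (L + E)) + (2 * L + B + h * E) * (L * h))) := by
    have e1 : -(ρ * zi * (max 0 up * Dk + min 0 um * Dm)) = -(ρ * zi * W * Dk)
      + ρ * (-(zi * (zj * Dk)))
      + ρ * (-(zi * (max 0 up * Dk + min 0 um * Dm - (W + zj) * Dk))) := by ring
    rw [e1]
    have e2 : -(zi * (zj * Dk)) ≤ A * (B * L) := by
      refine (neg_le_abs _).trans ?_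
      rw [abs_mul, abs_mul]
      gcongr
    have e3 : -(zi * (max 0 up * Dk + min 0 um * Dm - (W + zj) * Dk))
        ≤ A * (L * (h * (L + E)) + (2 * L + B + h * E) * (L * h)) := by
      refine (neg_le_abs _).trans ?_
      rw [abs_mul]
      gcongr
    gcongr
  have h3 : max 0 up * Dk ^ 2 - min 0 um * Dm ^ 2 ≤ 2 * ((2 * L + B + h * E) * L ^ 2) := by
    have e1 : max 0 up ≤ 2 * L + B + h * E := by
      refine max_le (by positivity) ((le_abs_self _).trans hup)
    have e2 : -min 0 um ≤ 2 * L + B + h * E := by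
      have : -(2 * L + B + h * E) ≤ min 0 um :=
        le_min (by have : 0 ≤ 2 * L + B + h * E := by positivity
                   linarith) (by linarith [(abs_le.1 hum).1])
      linarith
    have e3 : Dk ^ 2 ≤ L ^ 2 := by rw [← sq_abs]; gcongr
    have e4 : Dm ^ 2 ≤ L ^ 2 := by rw [← sq_abs]; gcongr
    have e5 : max 0 up * Dk ^ 2 ≤ (2 * L + B + h * E) * L ^ 2 := by gcongr
    have e6 : -min 0 um * Dm ^ 2 ≤ (2 * L + B + h * E) * L ^ 2 := by gcongr
    linarith
  have h4 : h / 2 * (ρ * (max 0 up * Dk ^ 2 - min 0 um * Dm ^ 2))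
      ≤ h / 2 * (ρ * (2 * ((2 * L + B + h * E) * L ^ 2))) := by gcongr
  set F := A ^ 2 + B ^ 2 + h + h ^ 2 * E ^ 2 with hF
  have q := convection_poly_le hL hh.le hh1 hA0 hB0 hE0
  rw [← hF] at q
  -- The inverse estimate enters here: `ρ h² E²` becomes `L ε E²`, without a density weight.
  have q2 : ρ * F ≤ L * (ρ * (zi ^ 2 + zj ^ 2) + ε * (ρ + dv ^ 2)) := by
    rw [hA2, hB2, hE2]
    have e1 : ρ * (h ^ 2 * E ^ 2) ≤ L * ε * E ^ 2 := by
      calc _ = h ^ 2 * ρ * E ^ 2 := by ring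
        _ ≤ _ := by gcongr
    have e2 : ρ * h ≤ ρ * ε := by gcongr
    have e3 : 0 ≤ (L - 1) * (ρ * (A ^ 2 + B ^ 2) + ε * ρ) := by
      have : 0 ≤ L - 1 := by linarith
      have : 0 ≤ ε := by linarith
      positivity
    rw [hF]
    linarith
  have q3 := mul_le_mul_of_nonneg_left q hρ.le
  have q4 := mul_le_mul_of_nonneg_left q2 (by positivity : 0 ≤ 10 * L ^ 3)
  linarith

/-- The face flux of the density weighted with the mesh size. -/
lemma mesh_flux_le {L h ε ρ u z dv : ℝ} (hL : 1 ≤ L) (hh : 0 < h)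
    (hh1 : h ≤ 1) (hε : h ≤ ε) (hρ : 0 < ρ) (hinv : h ^ 2 * ρ ≤ L * ε)
    (hu : |u| ≤ 2 * L + |z| + h * |dv|) :
    h * ρ * |u| ≤ 3 * L * (ρ * z ^ 2 + ε * (ρ + dv ^ 2)) := by
  have h1 : h * ρ * |u| ≤ h * ρ * (2 * L + |z| + h * |dv|) := by gcongr
  rw [← sq_abs z, ← sq_abs dv]
  set B := |z|
  set E := |dv|
  have hB0 : 0 ≤ B := abs_nonneg _
  have hE0 : 0 ≤ E := abs_nonneg _
  have hhh : h ^ 2 ≤ h := by nlinarith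
  have p4 : h * B ≤ (B ^ 2 + h) / 2 := by linarith [two_mul_le_add_sq h B]
  have p5 : h * (h * E) ≤ (h + h ^ 2 * E ^ 2) / 2 := by
    linarith [two_mul_le_add_sq h (h * E), mul_pow h E 2]
  have e1 : ρ * (h ^ 2 * E ^ 2) ≤ L * ε * E ^ 2 := by
    calc _ = h ^ 2 * ρ * E ^ 2 := by ring
      _ ≤ _ := by gcongr
  have e2 : ρ * h ≤ ρ * ε := by gcongr
  have e3 := mul_le_mul_of_nonneg_left p4 hρ.le
  have e4 := mul_le_mul_of_nonneg_left p5 hρ.le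
  have e5 : 0 ≤ (L - 1) * (ρ * ε) := by
    have : 0 ≤ L - 1 := by linarith
    have : 0 ≤ ε := by linarith
    positivity
  have e6 : 0 ≤ (L - 1) * (ρ * B ^ 2) := by
    have : 0 ≤ L - 1 := by linarith
    positivity
  have e7 : 0 ≤ ρ * B ^ 2 := by positivity
  have e8 : 0 ≤ L * ε * E ^ 2 := by
    have : 0 ≤ ε := by linarith
    positivity
  have e9 : h * ρ * (2 * L) ≤ 2 * L * (ρ * ε) := by
    calc _ = 2 * L * (ρ * h) := by ring
      _ ≤ _ := by gcongr
  linarith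

end ScalarEstimates

/-! ### Upwind flux and artificial diffusion on one face. -/

section FaceEstimates

variable {a γ rlo rhi : ℝ}

lemma abs_le_one_add_sq (x : ℝ) : |x| ≤ 1 + x ^ 2 := by
  rw [← sq_abs]; nlinarith [sq_nonneg (|x| - 1), abs_nonneg x]

/-- The upwind jump terms on one face. -/
lemma flux_face_le (ha : 0 < a) (hγ : 1 < γ) (hlo : 0 < rlo) (rhi : ℝ) {L δ : ℝ} (hL : 1 ≤ L)
    (hδ : 0 < δ) :
    ∃ C : ℝ, 0 ≤ C ∧ ∀ h ε x y R u v zK zL dK dL : ℝ, 0 < h → h ≤ 1 → h ≤ ε → 0 < x → 0 < y →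
      rlo ≤ R → R ≤ rhi → h ^ 2 * x ≤ L * ε → h ^ 2 * y ≤ L * ε →
      |u| ≤ 2 * L + |zK| + h * |dK| → |u| ≤ 2 * L + |zL| + h * |dL| → |u| ≤ L + |v| →
      L * (|y - x| * |u|)
        ≤ 1 / h * (max 0 u * relPotential a γ x y - min 0 u * relPotential a γ y x)
          + δ * v ^ 2 + C * (relPotential a γ x R + x * zK ^ 2 + y * zL ^ 2
            + ε * (1 + x + y + v ^ 2 + dK ^ 2 + dL ^ 2)) := by
  obtain ⟨C₂, hC₂, hjump⟩ := jump_le_upwind ha hγ hlo rhi L (by linarith)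
  refine ⟨C₂ * (L + 1) + 3 * L * C₂ + C₂ * L + C₂ ^ 2 / (4 * δ), by positivity, ?_⟩
  intro h ε x y R u v zK zL dK dL hh hh1 hε hx hy hR hR' hix hiy huK huL huv
  obtain ⟨j1, j2⟩ := hjump h x y R hh hx hy hR hR'
  have hP := relPotential_nonneg ha hγ hx (by linarith : 0 < R)
  set P := relPotential a γ x R
  set m := min 1 P
  have hm0 : 0 ≤ m := le_min zero_le_one hP
  have hm1 : m ≤ 1 := min_le_left _ _
  have hmP : m ≤ P := min_le_right _ _
  have hup : 0 ≤ max 0 u := le_max_left _ _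
  have hum : 0 ≤ - min 0 u := by have := min_le_left 0 u; linarith
  have hau : |u| = max 0 u - min 0 u := by
    rcases le_total 0 u with h | h
    · rw [abs_of_nonneg h, max_eq_right h, min_eq_left h]; ring
    · rw [abs_of_nonpos h, max_eq_left h, min_eq_right h]; ring
  have k1 := mul_le_mul_of_nonneg_right j1 hup
  have k2 := mul_le_mul_of_nonneg_right j2 hum
  have hε0 : 0 ≤ ε := by linarith
  have hL0 : 0 ≤ L := by linarith
  have s1 : L * (|y - x| * |u|)
      ≤ 1 / h * (max 0 u * relPotential a γ x y - min 0 u * relPotential a γ y x)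
        + C₂ * (h * (1 + x + y) + m) * |u| := by
    rw [hau]; linarith
  -- The bound `|u| ≤ L + |v|` serves for terms without a density factor. Terms with the factor `x`
  -- or `y` must use the cell velocity of the same cell instead, since the relative energy controls
  -- the density times the squared cell average but not the density times `v²`.
  have s2 : h * |u| ≤ (L + 1) * (ε * (1 + v ^ 2)) := by
    have e1 := abs_le_one_add_sq v
    have e2 : 0 ≤ L * v ^ 2 := by positivity
    calc h * |u| ≤ ε * (L + |v|) := by gcongr
      _ ≤ ε * (L * (1 + v ^ 2) + (1 + v ^ 2)) := by
          gcongr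
          linarith
      _ = _ := by ring
  have s3 := mesh_flux_le hL hh hh1 hε hx hix huK
  have s4 := mesh_flux_le hL hh hh1 hε hy hiy huL
  -- Since `0 ≤ m ≤ 1`, Young's inequality produces `m² ≤ m ≤ P`; without the cap the square of the
  -- relative potential would appear.
  have s5 : C₂ * m * |u| ≤ C₂ * L * P + δ * v ^ 2 + C₂ ^ 2 / (4 * δ) * P := by
    have e1 := mul_le_sq_add_sq δ |v| (C₂ * m) hδ
    rw [sq_abs] at e1
    have e2 : (C₂ * m) ^ 2 / (4 * δ) ≤ C₂ ^ 2 / (4 * δ) * P := by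
      have : m ^ 2 ≤ P := (pow_le_of_le_one hm0 hm1 two_ne_zero).trans hmP
      calc (C₂ * m) ^ 2 / (4 * δ) = C₂ ^ 2 / (4 * δ) * m ^ 2 := by ring
        _ ≤ _ := by gcongr
    calc C₂ * m * |u| ≤ C₂ * m * (L + |v|) := by gcongr
      _ = C₂ * L * m + |v| * (C₂ * m) := by ring
      _ ≤ C₂ * L * P + (δ * v ^ 2 + C₂ ^ 2 / (4 * δ) * P) := by
          have : C₂ * L * m ≤ C₂ * L * P := by gcongr
          linarith
      _ = _ := by ring
  set Z := relPotential a γ x R + x * zK ^ 2 + y * zL ^ 2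
            + ε * (1 + x + y + v ^ 2 + dK ^ 2 + dL ^ 2) with hZ
  have z1 : ε * (1 + v ^ 2) ≤ Z := by
    have : 0 ≤ x * zK ^ 2 + y * zL ^ 2 + ε * (x + y + dK ^ 2 + dL ^ 2) := by positivity
    rw [hZ]; linarith
  have z2 : x * zK ^ 2 + ε * (x + dK ^ 2) + (y * zL ^ 2 + ε * (y + dL ^ 2)) ≤ Z := by
    have : 0 ≤ ε * (1 + v ^ 2) := by positivity
    rw [hZ]; linarith
  have z3 : P ≤ Z := by
    have : 0 ≤ x * zK ^ 2 + y * zL ^ 2 + ε * (1 + x + y + v ^ 2 + dK ^ 2 + dL ^ 2) := by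
      positivity
    rw [hZ]; linarith
  have t1 : C₂ * (h * |u|) ≤ C₂ * (L + 1) * Z := by
    calc C₂ * (h * |u|) ≤ C₂ * ((L + 1) * (ε * (1 + v ^ 2))) := by gcongr
      _ = C₂ * (L + 1) * (ε * (1 + v ^ 2)) := by ring
      _ ≤ _ := by gcongr
  have t2 : C₂ * (h * x * |u| + h * y * |u|) ≤ 3 * L * C₂ * Z := by
    calc C₂ * (h * x * |u| + h * y * |u|) ≤ C₂ * (3 * L * (x * zK ^ 2 + ε * (x + dK ^ 2))
          + 3 * L * (y * zL ^ 2 + ε * (y + dL ^ 2))) := by gcongr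
      _ = 3 * L * C₂ * (x * zK ^ 2 + ε * (x + dK ^ 2) + (y * zL ^ 2 + ε * (y + dL ^ 2))) := by
          ring
      _ ≤ _ := by gcongr
  have t3 : C₂ * L * P ≤ C₂ * L * Z := by gcongr
  have t4 : C₂ ^ 2 / (4 * δ) * P ≤ C₂ ^ 2 / (4 * δ) * Z := by gcongr
  linarith

/-- The artificial diffusion terms on one face. -/
lemma diffusion_budget_le (ha : 0 < a) (hγ : 1 < γ) (hlo : 0 < rlo) (rhi : ℝ) {L δ C₀ : ℝ}
    (hL : 1 ≤ L) (hδ : 0 < δ) (hC₀ : 1 ≤ C₀) :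
    ∃ C : ℝ, 0 ≤ C ∧ ∀ h ε κ x y R X SK SL T : ℝ, 0 < h → h ≤ 1 → h ≤ ε → 0 ≤ κ → κ ≤ h →
      0 < x → 0 < y → rlo ≤ R → R ≤ rhi → h ^ 2 * x ≤ L * ε → h ^ 2 * y ≤ L * ε →
      0 ≤ SK → 0 ≤ SL → 0 ≤ T → X ^ 2 ≤ C₀ * (1 + SK + SL) → SL ≤ 2 * SK + 2 * (h ^ 2 * T) →
      SK ≤ 2 * SL + 2 * (h ^ 2 * T) →
      κ * ((y - x) / h * X)
        ≤ κ * ((y - x) / h * ((potentialDeriv a γ y - potentialDeriv a γ x) / h))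
          + δ * (SK + SL) + C * (relPotential a γ x R + x * SK + y * SL
            + ε * (1 + x + y + SK + SL + T)) := by
  obtain ⟨C₁, hC₁, hdiff⟩ := diffusion_face_le ha hγ hlo rhi
  refine ⟨C₁ * C₀ * (3 + 4 * L) + C₁ * C₀ + (C₁ * C₀) ^ 2 / (4 * δ), by positivity, ?_⟩
  intro h ε κ x y R X SK SL T hh hh1 hε hκ hκh hx hy hR hR' hix hiy hSK hSL hT hX hSLK hSKL
  have hd := hdiff h κ x y R X hh hκ hκh hx hy hR hR'
  have hP := relPotential_nonneg ha hγ hx (by linarith : 0 < R)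
  set P := relPotential a γ x R
  set m := min 1 P
  have hm0 : 0 ≤ m := le_min zero_le_one hP
  have hm1 : m ≤ 1 := min_le_left _ _
  have hmP : m ≤ P := min_le_right _ _
  have hε0 : 0 ≤ ε := by linarith
  have hL0 : 0 ≤ L := by linarith
  set s := Real.sqrt (SK + SL) with hs
  have hs0 : 0 ≤ s := Real.sqrt_nonneg _
  have hs2 : s ^ 2 = SK + SL := Real.sq_sqrt (by linarith)
  have hXa : |X| ≤ C₀ * (1 + s) := by
    refine abs_le_of_sq_le_sq ?_ (by positivity)
    have : C₀ * (1 + SK + SL) ≤ C₀ ^ 2 * (1 + s) ^ 2 := by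
      have e1 : C₀ ≤ C₀ ^ 2 := le_self_pow₀ hC₀ (by norm_num)
      have e2 : 1 + SK + SL ≤ (1 + s) ^ 2 := by linarith [add_sq 1 s]
      gcongr
    calc X ^ 2 ≤ _ := hX
      _ ≤ _ := this
      _ = _ := by ring
  have a1 : C₁ * (m * |X|) ≤ C₁ * C₀ * P + δ * (SK + SL) + (C₁ * C₀) ^ 2 / (4 * δ) * P := by
    have e1 := mul_le_sq_add_sq δ s (C₁ * C₀ * m) hδ
    have e2 : (C₁ * C₀ * m) ^ 2 / (4 * δ) ≤ (C₁ * C₀) ^ 2 / (4 * δ) * P := by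
      have : m ^ 2 ≤ P := (pow_le_of_le_one hm0 hm1 two_ne_zero).trans hmP
      calc (C₁ * C₀ * m) ^ 2 / (4 * δ) = (C₁ * C₀) ^ 2 / (4 * δ) * m ^ 2 := by ring
        _ ≤ _ := by gcongr
    have e3 : C₁ * C₀ * m ≤ C₁ * C₀ * P := by gcongr
    calc C₁ * (m * |X|) ≤ C₁ * (m * (C₀ * (1 + s))) := by gcongr
      _ = C₁ * C₀ * m + s * (C₁ * C₀ * m) := by ring
      _ ≤ C₁ * C₀ * P + (δ * s ^ 2 + (C₁ * C₀) ^ 2 / (4 * δ) * P) := by linarith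
      _ = _ := by rw [hs2]; ring
  -- The density of one cell meets the velocity of its neighbour. The velocity is carried over to
  -- the first cell at the cost of `h² T`, and `h² x` is then bounded by the inverse estimate.
  have c1 : h * (x * SL) ≤ 2 * (x * SK) + 2 * (L * ε * T) := by
    have e1 : h * (x * SL) ≤ 1 * (x * SL) := by gcongr
    have e2 : x * SL ≤ x * (2 * SK + 2 * (h ^ 2 * T)) := by gcongr
    have e3 : h ^ 2 * x * T ≤ L * ε * T := by gcongr
    linarith
  have c2 : h * (y * SK) ≤ 2 * (y * SL) + 2 * (L * ε * T) := by
    have e1 : h * (y * SK) ≤ 1 * (y * SK) := by gcongr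
    have e2 : y * SK ≤ y * (2 * SL + 2 * (h ^ 2 * T)) := by gcongr
    have e3 : h ^ 2 * y * T ≤ L * ε * T := by gcongr
    linarith
  have c3 : h * (x * SK) ≤ 1 * (x * SK) := by gcongr
  have c4 : h * (y * SL) ≤ 1 * (y * SL) := by gcongr
  have c5 : h * (1 + x + y + SK + SL) ≤ ε * (1 + x + y + SK + SL) := by gcongr
  set Z := P + x * SK + y * SL + ε * (1 + x + y + SK + SL + T) with hZ
  have n1 : 0 ≤ x * SK := by positivity
  have n2 : 0 ≤ y * SL := by positivity
  have n3 : 0 ≤ ε * (1 + x + y + SK + SL) := by positivity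
  have n4 : 0 ≤ ε * T := by positivity
  have a2 : h * (1 + x + y) * (1 + SK + SL) ≤ (3 + 4 * L) * Z := by
    have e1 : h * (1 + x + y) * (1 + SK + SL) ≤ 3 * (x * SK) + 3 * (y * SL)
        + ε * (1 + x + y + SK + SL) + 4 * L * (ε * T) := by linarith
    have e2 : 4 * L * (ε * T) ≤ 4 * L * Z := by
      have : ε * T ≤ Z := by rw [hZ]; linarith
      gcongr
    have e3 : 3 * (x * SK) + 3 * (y * SL) + ε * (1 + x + y + SK + SL) ≤ 3 * Z := by
      rw [hZ]; linarith
    linarith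
  have a3 : C₁ * (h * (1 + x + y) * X ^ 2) ≤ C₁ * C₀ * (3 + 4 * L) * Z := by
    calc C₁ * (h * (1 + x + y) * X ^ 2) ≤ C₁ * (h * (1 + x + y) * (C₀ * (1 + SK + SL))) := by
          gcongr
      _ = C₁ * C₀ * (h * (1 + x + y) * (1 + SK + SL)) := by ring
      _ ≤ C₁ * C₀ * ((3 + 4 * L) * Z) := by gcongr
      _ = _ := by ring
  have a4 : P ≤ Z := by rw [hZ]; linarith
  have a5 : C₁ * C₀ * P ≤ C₁ * C₀ * Z := by gcongr
  have a6 : (C₁ * C₀) ^ 2 / (4 * δ) * P ≤ (C₁ * C₀) ^ 2 / (4 * δ) * Z := by gcongr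
  linarith

/-- The density flux against the gradient of the discrete test potential in one cell. -/
lemma flux_cell_le {L h ε δ ρ up um W z dV dv Q qp qm : ℝ} (hL : 1 ≤ L) (hδ : 0 < δ) (hh : 0 < h)
    (hh1 : h ≤ 1) (hε : h ≤ ε) (hρ : 0 < ρ) (hinv : h ^ 2 * ρ ≤ L * ε)
    (hdiff : up - um = h * (dV + dv)) (hmean : (up + um) / 2 = W + z) (hW : |W| ≤ L)
    (hdV : |dV| ≤ L) (hqp : |qp - Q| ≤ L * h) (hqm : |Q - qm| ≤ L * h) :
    -(ρ * (um * (Q - qm) + up * (qp - Q)) / h)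
      ≤ -(ρ * ((W + z) * ((qp - qm) / h))) + δ * dv ^ 2
        + (L ^ 2 + L ^ 3 / (4 * δ)) * (ε * ρ) := by
  obtain ⟨-, -, hdif⟩ := abs_face_velocity_le hh hh1 hdiff hmean hW hdV
  -- Both face velocities are expanded about their mean. The mean meets the full difference `qp -
  -- qm`; the half difference of the velocities is of order `h` and meets bounded quotients.
  have e1 : -(ρ * (um * (Q - qm) + up * (qp - Q)) / h)
      = -(ρ * ((W + z) * ((qp - qm) / h)))
        + ρ * (-((up - um) * ((qp - Q) / h) / 2) + (up - um) * ((Q - qm) / h) / 2) := by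
    rw [← hmean]; field_simp; ring
  have b1 : |(qp - Q) / h| ≤ L := by
    rw [abs_div, abs_of_pos hh, div_le_iff₀ hh]; exact hqp
  have b2 : |(Q - qm) / h| ≤ L := by
    rw [abs_div, abs_of_pos hh, div_le_iff₀ hh]; exact hqm
  have e2 : -((up - um) * ((qp - Q) / h) / 2) + (up - um) * ((Q - qm) / h) / 2
      ≤ h * (L + |dv|) * L := by
    have f1 : |(up - um) * ((qp - Q) / h)| ≤ h * (L + |dv|) * L := by
      rw [abs_mul]; gcongr
    have f2 : |(up - um) * ((Q - qm) / h)| ≤ h * (L + |dv|) * L := by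
      rw [abs_mul]; gcongr
    have := (abs_le.1 f1).1
    have := (abs_le.1 f2).2
    linarith
  have e3 := mul_le_mul_of_nonneg_left e2 hρ.le
  have e4 := mul_le_sq_add_sq δ |dv| (L * ρ * h) hδ
  rw [sq_abs] at e4
  have e5 : (L * ρ * h) ^ 2 / (4 * δ) ≤ L ^ 3 / (4 * δ) * (ε * ρ) := by
    calc (L * ρ * h) ^ 2 / (4 * δ) = L ^ 2 * ρ / (4 * δ) * (h ^ 2 * ρ) := by ring
      _ ≤ L ^ 2 * ρ / (4 * δ) * (L * ε) := by gcongr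
      _ = _ := by ring
  have e6 : L ^ 2 * (h * ρ) ≤ L ^ 2 * (ε * ρ) := by gcongr
  rw [e1]
  linarith

end FaceEstimates

/-! ### Admissible error terms, and the consistency requirements on the projections. -/

section Budget

variable {d N : ℕ} [NeZero N]

/-- Square of the cell-averaged velocity. -/
noncomputable def kinSq (v : Fin d → Grid d N → ℝ) (k : Grid d N) : ℝ :=
  ∑ i, (avgCell v i k) ^ 2

/-- Sum of the squares of all velocity quantities attached to a cell. -/
noncomputable def stateSq (v : Fin d → Grid d N → ℝ) (k : Grid d N) : ℝ :=
  ∑ i, ∑ j, (diffFace j (v i) k) ^ 2 + ∑ i, ∑ j, (diffFace j (avgCell v i) k) ^ 2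
    + ∑ j, (diffCell j (v j) k) ^ 2 + kinSq v k + ∑ i, (v i k) ^ 2

/-- The terms of a cell that are admissible in the relative energy estimate. -/
noncomputable def budget (a γ δ C ε : ℝ) (ρ R : Grid d N → ℝ) (v : Fin d → Grid d N → ℝ)
    (k : Grid d N) : ℝ :=
  δ * stateSq v k
    + C * (relPotential a γ (ρ k) (R k) + ρ k * kinSq v k + ε * (1 + ρ k + stateSq v k))

lemma sq_le_sum_sq {ι : Type*} [Fintype ι] (f : ι → ℝ) (i : ι) : f i ^ 2 ≤ ∑ i, f i ^ 2 :=
  Finset.single_le_sum (f := fun i => f i ^ 2) (fun _ _ => sq_nonneg _) (Finset.mem_univ i)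

lemma kinSq_nonneg (v : Fin d → Grid d N → ℝ) (k : Grid d N) : 0 ≤ kinSq v k :=
  Finset.sum_nonneg fun _ _ => sq_nonneg _

lemma avgCell_sq_le_kinSq (v : Fin d → Grid d N → ℝ) (i : Fin d) (k : Grid d N) :
    avgCell v i k ^ 2 ≤ kinSq v k := sq_le_sum_sq (fun i => avgCell v i k) i

lemma stateSq_bounds (v : Fin d → Grid d N → ℝ) (k : Grid d N) :
    ∑ i, ∑ j, (diffFace j (v i) k) ^ 2 ≤ stateSq v k
    ∧ ∑ i, ∑ j, (diffFace j (avgCell v i) k) ^ 2 ≤ stateSq v k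
    ∧ ∑ j, (diffCell j (v j) k) ^ 2 ≤ stateSq v k
    ∧ kinSq v k ≤ stateSq v k ∧ ∑ i, (v i k) ^ 2 ≤ stateSq v k := by
  have h1 : 0 ≤ ∑ i, ∑ j, (diffFace j (v i) k) ^ 2 :=
    Finset.sum_nonneg fun _ _ => Finset.sum_nonneg fun _ _ => sq_nonneg _
  have h2 : 0 ≤ ∑ i, ∑ j, (diffFace j (avgCell v i) k) ^ 2 :=
    Finset.sum_nonneg fun _ _ => Finset.sum_nonneg fun _ _ => sq_nonneg _
  have h3 : 0 ≤ ∑ j, (diffCell j (v j) k) ^ 2 := Finset.sum_nonneg fun _ _ => sq_nonneg _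
  have h4 := kinSq_nonneg v k
  have h5 : 0 ≤ ∑ i, (v i k) ^ 2 := Finset.sum_nonneg fun _ _ => sq_nonneg _
  unfold stateSq
  refine ⟨?_, ?_, ?_, ?_, ?_⟩ <;> linarith

lemma stateSq_nonneg (v : Fin d → Grid d N → ℝ) (k : Grid d N) : 0 ≤ stateSq v k :=
  (kinSq_nonneg v k).trans (stateSq_bounds v k).2.2.2.1

lemma diffCell_sq_le_stateSq (v : Fin d → Grid d N → ℝ) (j : Fin d) (k : Grid d N) :
    diffCell j (v j) k ^ 2 ≤ stateSq v k :=
  (sq_le_sum_sq (fun j => diffCell j (v j) k) j).trans (stateSq_bounds v k).2.2.1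

lemma sq_le_stateSq (v : Fin d → Grid d N → ℝ) (j : Fin d) (k : Grid d N) :
    v j k ^ 2 ≤ stateSq v k :=
  (sq_le_sum_sq (fun j => v j k) j).trans (stateSq_bounds v k).2.2.2.2

lemma gridInt_budget (a γ δ C ε : ℝ) (ρ R : Grid d N → ℝ) (v : Fin d → Grid d N → ℝ) :
    gridInt (budget a γ δ C ε ρ R v) = δ * gridInt (stateSq v)
      + C * (gridInt (fun k => relPotential a γ (ρ k) (R k)) + gridInt (fun k => ρ k * kinSq v k)
        + ε * (1 + gridInt ρ + gridInt (stateSq v))) := by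
  have : budget a γ δ C ε ρ R v = fun k => δ * stateSq v k
    + C * (relPotential a γ (ρ k) (R k) + ρ k * kinSq v k + ε * (1 + ρ k + stateSq v k)) := rfl
  rw [this]
  simp only [gridInt_add, gridInt_mul_left, gridInt_const]

lemma diffCell_eq_diffFace (j : Fin d) (f : Grid d N → ℝ) (k : Grid d N) :
    diffCell j f k = diffFace j f (k - e j) := by
  simp [diffCell, diffFace]

lemma diffFace_avgCell (i j : Fin d) (v : Fin d → Grid d N → ℝ) (k : Grid d N) :
    diffFace j (avgCell v i) k = (diffFace j (v i) k + diffFace j (v i) (k - e i)) / 2 := by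
  simp only [diffFace, avgCell]
  rw [show k + e j - e i = k - e i + e j by abel]
  ring

/-- The integral of all velocity quantities is controlled by the gradient and the kinetic
energy. -/
lemma stateSq_le (d : ℕ) {γ M : ℝ} (hγ : 1 < γ) (hM : 0 < M) (CE : ℝ) :
    ∃ C : ℝ, 0 < C ∧ ∀ (N : ℕ) [NeZero N] (ρ : Grid d N → ℝ) (v : Fin d → Grid d N → ℝ),
      (∀ k, 0 < ρ k) → gridInt ρ = M → gridInt (fun k => ρ k ^ γ) ≤ CE →
      gridInt (stateSq v) ≤ C * (gradSq v + gridInt (fun k => ρ k * kinSq v k)) := by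
  obtain ⟨C, hC, hP⟩ := density_poincare hγ hM CE
  refine ⟨4 + 3 * (C * 2 ^ d), by positivity, fun N _ ρ v hρ hmass hE => ?_⟩
  have hm := mesh_pos N
  have hm1 := mesh_le_one N
  have e1 : gridInt (fun k => ∑ i, ∑ j, (diffFace j (v i) k) ^ 2) = gradSq v := rfl
  have e2 : gridInt (fun k => ∑ i, ∑ j, (diffFace j (avgCell v i) k) ^ 2) ≤ gradSq v := by
    rw [← e1, gridInt_sum, gridInt_sum]
    refine Finset.sum_le_sum fun i _ => ?_
    have h1 : ∀ k, ∑ j, (diffFace j (avgCell v i) k) ^ 2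
        ≤ 1 / 2 * ∑ j, (diffFace j (v i) k) ^ 2 + 1 / 2 * ∑ j, (diffFace j (v i) (k - e i)) ^ 2 := by
      intro k
      rw [Finset.mul_sum, Finset.mul_sum, ← Finset.sum_add_distrib]
      refine Finset.sum_le_sum fun j _ => ?_
      rw [diffFace_avgCell]
      nlinarith [sq_nonneg (diffFace j (v i) k - diffFace j (v i) (k - e i))]
    refine (gridInt_mono h1).trans (le_of_eq ?_)
    rw [gridInt_add, gridInt_mul_left, gridInt_mul_left,
      gridInt_shift_sub (e i) (fun k => ∑ j, (diffFace j (v i) k) ^ 2)]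
    ring
  have e3 : gridInt (fun k => ∑ j, (diffCell j (v j) k) ^ 2) ≤ gradSq v := by
    rw [← e1, gridInt_sum, gridInt_sum]
    refine Finset.sum_le_sum fun j _ => ?_
    have h1 : (fun k => (diffCell j (v j) k) ^ 2)
        = fun k => (fun k => (diffFace j (v j) k) ^ 2) (k - e j) := by
      funext k; rw [diffCell_eq_diffFace]
    rw [h1, gridInt_shift_sub (e j) (fun k => (diffFace j (v j) k) ^ 2)]
    exact gridInt_mono fun k => sq_le_sum_sq (fun l => diffFace l (v j) k) j
  -- Only this summand needs the Poincaré inequality: away from the gradient, the relative energy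
  -- controls the velocity only with the weight `ρ`.
  have e4 : gridInt (kinSq v)
      ≤ C * 2 ^ d * (gradSq v + gridInt (fun k => ρ k * kinSq v k)) := by
    have h1 : gridInt (kinSq v) = ∑ i, gridInt (fun k => (avgCell v i k) ^ 2) := by
      rw [← gridInt_sum]; rfl
    have h2 : gridInt (fun k => ρ k * kinSq v k)
        = ∑ i, gridInt (fun k => ρ k * (avgCell v i k) ^ 2) := by
      rw [← gridInt_sum]
      congr 1; funext k; rw [kinSq, Finset.mul_sum]
    rw [gridInt_sum] at e2
    rw [h1, h2]
    calc _ ≤ ∑ i, C * 2 ^ d * (gridInt (fun k => ∑ j, (diffFace j (avgCell v i) k) ^ 2)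
          + gridInt (fun k => ρ k * (avgCell v i k) ^ 2)) :=
          Finset.sum_le_sum fun i _ => hP d N ρ (avgCell v i) hρ hmass hE
      _ = C * 2 ^ d * (∑ i, gridInt (fun k => ∑ j, (diffFace j (avgCell v i) k) ^ 2)
          + ∑ i, gridInt (fun k => ρ k * (avgCell v i k) ^ 2)) := by
          rw [← Finset.mul_sum, Finset.sum_add_distrib]
      _ ≤ _ := by gcongr
  -- A face value is the cell average plus half the mesh size times the normal difference quotient.
  have e5 : gridInt (fun k => ∑ i, (v i k) ^ 2) ≤ 2 * gridInt (kinSq v) + gradSq v := by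
    have h1 : ∀ k, ∑ i, (v i k) ^ 2 ≤ 2 * kinSq v k + ∑ j, (diffCell j (v j) k) ^ 2 := by
      intro k
      rw [kinSq, Finset.mul_sum, ← Finset.sum_add_distrib]
      refine Finset.sum_le_sum fun i _ => ?_
      have h2 : v i k = avgCell v i k + mesh N / 2 * diffCell i (v i) k := by
        simp only [avgCell, diffCell]; field_simp; ring
      have h3 : (mesh N / 2 * diffCell i (v i) k) ^ 2 ≤ 1 / 4 * (diffCell i (v i) k) ^ 2 := by
        rw [mul_pow]
        gcongr
        nlinarith
      rw [h2]
      nlinarith [sq_nonneg (avgCell v i k - mesh N / 2 * diffCell i (v i) k),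
        sq_nonneg (diffCell i (v i) k)]
    have := gridInt_mono h1
    rw [gridInt_add, gridInt_mul_left] at this
    have h4 : gridInt (kinSq v) = gridInt (fun k => kinSq v k) := rfl
    rw [h4]
    linarith
  have e6 : gridInt (stateSq v) = gradSq v
      + gridInt (fun k => ∑ i, ∑ j, (diffFace j (avgCell v i) k) ^ 2)
      + gridInt (fun k => ∑ j, (diffCell j (v j) k) ^ 2) + gridInt (kinSq v)
      + gridInt (fun k => ∑ i, (v i k) ^ 2) := by
    rw [← e1]
    simp only [← gridInt_add]
    rfl
  have h7 : 0 ≤ gridInt (fun k => ρ k * kinSq v k) :=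
    gridInt_nonneg fun k => mul_nonneg (hρ k).le (kinSq_nonneg v k)
  rw [e6]
  linarith

/-- Consistency properties of the discrete projections of a strong solution at two consecutive
time levels. -/
structure StepData (a γ μ lam L rlo rhi dt : ℝ) (R Rm : Grid d N → ℝ)
    (V Wm q : Fin d → Grid d N → ℝ) : Prop where
  density : ∀ k, rlo ≤ R k ∧ R k ≤ rhi
  density_prev : ∀ k, rlo ≤ Rm k ∧ Rm k ≤ rhi
  vel : ∀ i k, |V i k| ≤ L
  grad : ∀ i j k, |diffFace j (V i) k| ≤ L
  grad_osc : ∀ i j k,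
    |diffFace j (avgCell V i) k - diffFace j (avgCell V i) (k - e j)| ≤ L * mesh N
  time : ∀ i k, |(avgCell V i k - Wm i k) / dt| ≤ L
  -- `q` carries values of the potential on faces. Difference quotients of the cell values `H'(Rm)`
  -- would be consistent to first order only with second space derivatives of the density, whereas
  -- differences of `q` across a cell are exact averages of a derivative. This field and the next
  -- one bound the cost of passing between both representations.
  face_left : ∀ j k, |q j k - potentialDeriv a γ (Rm k)| ≤ L * mesh N
  face_right : ∀ j k, |potentialDeriv a γ (Rm (k + e j)) - q j k| ≤ L * mesh N
  continuity : ∀ k, |(potentialDeriv a γ (R k) - potentialDeriv a γ (Rm k)) / dt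
      + ∑ j, avgCell V j k * diffCell j (q j) k + a * γ * R k ^ (γ - 1) * divh V k|
    ≤ L * (mesh N + dt)
  press : ∀ v : Fin d → Grid d N → ℝ,
    |gridInt (fun k => ∑ i, R k * diffCell i (q i) k * avgCell v i k)
        + gridInt (fun k => pressure a γ (R k) * divh v k)|
      ≤ L * (mesh N + dt) * gridInt (fun k => ∑ i, ∑ j, |diffFace j (v i) k|
        + ∑ i, |avgCell v i k|)
  -- The residual is required to be small only after testing. The viscous terms are compared in weak
  -- form, so that two space derivatives of the velocity are enough.
  momentum : ∀ v : Fin d → Grid d N → ℝ,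
    |gridInt (fun k => ∑ i, (Rm k * ((avgCell V i k - Wm i k) / dt)
          + R k * ∑ j, avgCell V j k * diffFace j (avgCell V i) k
          + R k * diffCell i (q i) k) * avgCell v i k)
        + μ * gridInt (fun k => ∑ i, ∑ j, diffFace j (V i) k * diffFace j (v i) k)
        + (μ + lam) * gridInt (fun k => divh V k * divh v k)|
      ≤ L * (mesh N + dt) * gridInt (fun k => ∑ i, ∑ j, |diffFace j (v i) k|
        + ∑ i, |avgCell v i k|)

section StepDataBounds

variable {a γ μ lam L rlo rhi dt : ℝ} {R Rm : Grid d N → ℝ} {V Wm q : Fin d → Grid d N → ℝ}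

lemma StepData.velCell (h : StepData a γ μ lam L rlo rhi dt R Rm V Wm q) (i : Fin d)
    (k : Grid d N) : |avgCell V i k| ≤ L := by
  have h1 := abs_le.1 (h.vel i k)
  have h2 := abs_le.1 (h.vel i (k - e i))
  unfold avgCell
  exact abs_le.2 ⟨by linarith, by linarith⟩

lemma StepData.gradCell (h : StepData a γ μ lam L rlo rhi dt R Rm V Wm q) (i j : Fin d)
    (k : Grid d N) : |diffFace j (avgCell V i) k| ≤ L := by
  rw [diffFace_avgCell]
  have h1 := abs_le.1 (h.grad i j k)
  have h2 := abs_le.1 (h.grad i j (k - e i))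
  exact abs_le.2 ⟨by linarith, by linarith⟩

lemma StepData.diffCell_le (h : StepData a γ μ lam L rlo rhi dt R Rm V Wm q) (j : Fin d)
    (k : Grid d N) : |diffCell j (V j) k| ≤ L := by
  rw [diffCell_eq_diffFace]; exact h.grad j j _

lemma StepData.divh_le (h : StepData a γ μ lam L rlo rhi dt R Rm V Wm q)
    (k : Grid d N) : |divh V k| ≤ d * L := by
  unfold divh
  refine (Finset.abs_sum_le_sum_abs _ _).trans ?_
  refine (Finset.sum_le_sum fun j _ => h.diffCell_le j k).trans (le_of_eq ?_)
  simp

lemma StepData.gradPot_le (h : StepData a γ μ lam L rlo rhi dt R Rm V Wm q) (j : Fin d)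
    (k : Grid d N) : |diffFace j (fun l => potentialDeriv a γ (Rm l)) k| ≤ 2 * L := by
  have hm := mesh_pos N
  have h1 := abs_le.1 (h.face_left j k)
  have h2 := abs_le.1 (h.face_right j k)
  unfold diffFace
  rw [abs_div, abs_of_pos hm, div_le_iff₀ hm]
  exact abs_le.2 ⟨by linarith, by linarith⟩

lemma StepData.face_right' (h : StepData a γ μ lam L rlo rhi dt R Rm V Wm q) (j : Fin d)
    (k : Grid d N) : |potentialDeriv a γ (Rm k) - q j (k - e j)| ≤ L * mesh N := by
  have := h.face_right j (k - e j)
  rwa [sub_add_cancel] at this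

lemma StepData.gradFace_le (h : StepData a γ μ lam L rlo rhi dt R Rm V Wm q) (j : Fin d)
    (k : Grid d N) : |diffCell j (q j) k| ≤ 2 * L := by
  have hm := mesh_pos N
  have h1 := abs_le.1 (h.face_left j k)
  have h2 := abs_le.1 (h.face_right' j k)
  unfold diffCell
  rw [abs_div, abs_of_pos hm, div_le_iff₀ hm]
  exact abs_le.2 ⟨by linarith, by linarith⟩

end StepDataBounds

end Budget

/-! ### Summation of the face estimates over the grid. -/

section StepTerms

variable {a γ μ lam rlo rhi : ℝ}

/-- Difference and mean of the two face velocities of a cell, each split into a smooth part and an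
error; this is the form in which the scalar cell estimates take the velocity. -/
lemma velocity_split {d N : ℕ} [NeZero N] (u V : Fin d → Grid d N → ℝ) (j : Fin d)
    (k : Grid d N) :
    u j k - u j (k - e j) = mesh N * (diffCell j (V j) k + diffCell j ((u - V) j) k) ∧
      (u j k + u j (k - e j)) / 2 = avgCell V j k + avgCell (u - V) j k := by
  have hm := (mesh_pos N).ne'
  constructor
  · simp only [diffCell, Pi.sub_apply]; field_simp; ring
  · simp only [avgCell, Pi.sub_apply]; ring

/-- The convective terms of the relative energy inequality. -/
lemma convection_sum_le (d : ℕ) (ha : 0 < a) (hγ : 1 < γ) (hlo : 0 < rlo) {L : ℝ}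
    (hL : 1 ≤ L) :
    ∃ C : ℝ, 0 ≤ C ∧ ∀ (N : ℕ) [NeZero N] (ε dt : ℝ) (ρ R Rm : Grid d N → ℝ)
      (u V Wm q : Fin d → Grid d N → ℝ), (∀ k, 0 < ρ k) → mesh N ≤ ε →
      (∀ k, mesh N ^ 2 * ρ k ≤ L * ε) → StepData a γ μ lam L rlo rhi dt R Rm V Wm q →
      gridInt (fun k => ∑ i, ∑ j,
          (-((ρ k * max 0 (u j k) * avgCell (u - V) i k
              + ρ (k + e j) * min 0 (u j k) * avgCell (u - V) i (k + e j))
                * diffFace j (avgCell V i) k)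
            + mesh N / 2 * ((ρ k * max 0 (u j k) - ρ (k + e j) * min 0 (u j k))
                * (diffFace j (avgCell V i) k) ^ 2)))
      ≤ gridInt (fun k => ∑ i, ∑ j,
          -(ρ k * avgCell (u - V) i k * avgCell V j k * diffFace j (avgCell V i) k))
        + gridInt (budget a γ 0 C ε ρ R (u - V)) := by
  refine ⟨d * (d * (20 * L ^ 4)), by positivity, ?_⟩
  intro N _ ε dt ρ R Rm u V Wm q hρ hε hinv hdata
  have hm := mesh_pos N
  have hm1 := mesh_le_one N
  -- Rearranging the face sum by cells collects, for every cell, the contributions of its two faces,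
  -- so that density and velocity error always belong to the same cell.
  have h1 : ∀ i j : Fin d, gridInt (fun k =>
          (-((ρ k * max 0 (u j k) * avgCell (u - V) i k
              + ρ (k + e j) * min 0 (u j k) * avgCell (u - V) i (k + e j))
                * diffFace j (avgCell V i) k)
            + mesh N / 2 * ((ρ k * max 0 (u j k) - ρ (k + e j) * min 0 (u j k))
                * (diffFace j (avgCell V i) k) ^ 2)))
      = gridInt (fun k => -(ρ k * avgCell (u - V) i k
            * (max 0 (u j k) * diffFace j (avgCell V i) k
              + min 0 (u j (k - e j)) * diffFace j (avgCell V i) (k - e j)))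
          + mesh N / 2 * (ρ k * (max 0 (u j k) * diffFace j (avgCell V i) k ^ 2
            - min 0 (u j (k - e j)) * diffFace j (avgCell V i) (k - e j) ^ 2))) := by
    intro i j
    refine gridInt_eq_of_telescope j (fun k =>
      -(ρ k * avgCell (u - V) i k
            * (min 0 (u j (k - e j)) * diffFace j (avgCell V i) (k - e j)))
          + mesh N / 2 * (ρ k * (
            - min 0 (u j (k - e j)) * diffFace j (avgCell V i) (k - e j) ^ 2))) fun k => ?_
    simp only [add_sub_cancel_right]
    ring
  have h2 : ∀ (i j : Fin d) (k : Grid d N), -(ρ k * avgCell (u - V) i k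
            * (max 0 (u j k) * diffFace j (avgCell V i) k
              + min 0 (u j (k - e j)) * diffFace j (avgCell V i) (k - e j)))
          + mesh N / 2 * (ρ k * (max 0 (u j k) * diffFace j (avgCell V i) k ^ 2
            - min 0 (u j (k - e j)) * diffFace j (avgCell V i) (k - e j) ^ 2))
      ≤ -(ρ k * avgCell (u - V) i k * avgCell V j k * diffFace j (avgCell V i) k)
        + 20 * L ^ 4 * (relPotential a γ (ρ k) (R k) + ρ k * kinSq (u - V) k
          + ε * (1 + ρ k + stateSq (u - V) k)) := by
    intro i j k
    obtain ⟨hd1, hd2⟩ := velocity_split u V j k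
    have h3 := convection_cell_le (zi := avgCell (u - V) i k) hL hm hm1 hε (hρ k) (hinv k)
      hd1 hd2 (hdata.velCell j k) (hdata.diffCell_le j k) (hdata.gradCell i j k)
      (hdata.gradCell i j (k - e j)) (hdata.grad_osc i j k)
    refine h3.trans ?_
    have e1 := avgCell_sq_le_kinSq (u - V) i k
    have e2 := avgCell_sq_le_kinSq (u - V) j k
    have e3 := diffCell_sq_le_stateSq (u - V) j k
    have e4 := relPotential_nonneg ha hγ (hρ k) (hlo.trans_le (hdata.density k).1)
    have hε0 : 0 ≤ ε := hm.le.trans hε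
    have hL4 : 0 ≤ L ^ 4 := by positivity
    have e5 : ρ k * (avgCell (u - V) i k ^ 2 + avgCell (u - V) j k ^ 2)
        ≤ 2 * (ρ k * kinSq (u - V) k) := by
      have := mul_le_mul_of_nonneg_left (add_le_add e1 e2) (hρ k).le
      linarith
    have e6 : ε * (ρ k + diffCell j ((u - V) j) k ^ 2)
        ≤ 2 * (ε * (1 + ρ k + stateSq (u - V) k)) := by
      have : 0 ≤ ε * (1 + ρ k + stateSq (u - V) k) := by
        have := (hρ k).le
        have := stateSq_nonneg (u - V) k
        positivity
      have h5 : ε * (ρ k + diffCell j ((u - V) j) k ^ 2) ≤ ε * (1 + ρ k + stateSq (u - V) k) := by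
        gcongr; linarith
      linarith
    have e7 : ρ k * (avgCell (u - V) i k ^ 2 + avgCell (u - V) j k ^ 2)
        + ε * (ρ k + diffCell j ((u - V) j) k ^ 2)
        ≤ 2 * (relPotential a γ (ρ k) (R k) + ρ k * kinSq (u - V) k
          + ε * (1 + ρ k + stateSq (u - V) k)) := by linarith
    have e8 := mul_le_mul_of_nonneg_left e7 (by positivity : 0 ≤ 10 * L ^ 4)
    linarith
  rw [gridInt_sum, gridInt_sum]
  simp only [gridInt_sum] at h1 ⊢
  have h4 : gridInt (budget a γ 0 (d * (d * (20 * L ^ 4))) ε ρ R (u - V))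
      = ∑ _i : Fin d, ∑ _j : Fin d, gridInt (fun k => 20 * L ^ 4 *
        (relPotential a γ (ρ k) (R k) + ρ k * kinSq (u - V) k
          + ε * (1 + ρ k + stateSq (u - V) k))) := by
    simp only [Finset.sum_const, Finset.card_univ, Fintype.card_fin, nsmul_eq_mul,
      ← gridInt_mul_left]
    congr 1; funext k
    simp only [budget]; ring
  rw [h4, ← Finset.sum_add_distrib]
  refine Finset.sum_le_sum fun i _ => ?_
  rw [← Finset.sum_add_distrib]
  refine Finset.sum_le_sum fun j _ => ?_
  rw [h1, ← gridInt_add]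
  exact gridInt_mono (h2 i j)

/-- The density flux terms of the relative energy inequality. -/
lemma density_flux_sum_le (d : ℕ) (ha : 0 < a) (hγ : 1 < γ) (hlo : 0 < rlo) (rhi : ℝ) {L δ : ℝ}
    (hL : 1 ≤ L) (hδ : 0 < δ) :
    ∃ C : ℝ, 0 ≤ C ∧ ∀ (N : ℕ) [NeZero N] (ε dt : ℝ) (ρ R Rm : Grid d N → ℝ)
      (u V Wm q : Fin d → Grid d N → ℝ), (∀ k, 0 < ρ k) → mesh N ≤ ε →
      (∀ k, mesh N ^ 2 * ρ k ≤ L * ε) → StepData a γ μ lam L rlo rhi dt R Rm V Wm q →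
      -gridInt (fun k => ∑ j,
          upFlux ρ u j k * diffFace j (fun l => potentialDeriv a γ (Rm l)) k)
      ≤ gridInt (fun k => ∑ j, 1 / mesh N * (max 0 (u j k)
            * relPotential a γ (ρ k) (ρ (k + e j))
          - min 0 (u j k) * relPotential a γ (ρ (k + e j)) (ρ k)))
        + gridInt (fun k => ∑ j,
          -(ρ k * ((avgCell V j k + avgCell (u - V) j k) * diffCell j (q j) k)))
        + gridInt (budget a γ δ C ε ρ R (u - V)) := by
  -- The allowance `δ` is shared by `d` directions, each using it once in the face estimate and once
  -- in the cell estimate; hence `2 * d * δ' ≤ δ`.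
  set δ' := δ / (2 * (d + 1)) with hδ'
  have hδ'0 : 0 < δ' := by positivity
  obtain ⟨C₁, hC₁, hface⟩ := flux_face_le ha hγ hlo rhi hL hδ'0
  set C₂ := L ^ 2 + L ^ 3 / (4 * δ') with hC₂
  have hC₂0 : 0 ≤ C₂ := by positivity
  refine ⟨d * (4 * C₁ + C₂), by positivity, ?_⟩
  intro N _ ε dt ρ R Rm u V Wm q hρ hε hinv hdata
  have hm := mesh_pos N
  have hm1 := mesh_le_one N
  have hε0 : 0 ≤ ε := hm.le.trans hε
  set v := u - V with hv
  set D : Fin d → Grid d N → ℝ := fun j k => 1 / mesh N * (max 0 (u j k)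
            * relPotential a γ (ρ k) (ρ (k + e j))
          - min 0 (u j k) * relPotential a γ (ρ (k + e j)) (ρ k)) with hD
  set Q : Grid d N → ℝ := fun l => potentialDeriv a γ (Rm l) with hQ
  have hP : ∀ k, 0 ≤ relPotential a γ (ρ k) (R k) := fun k =>
    relPotential_nonneg ha hγ (hρ k) (hlo.trans_le (hdata.density k).1)
  set b : Grid d N → ℝ := fun k => relPotential a γ (ρ k) (R k) + ρ k * kinSq v k
          + ε * (1 + ρ k + stateSq v k) with hb
  have hb1 : ∀ k, 0 ≤ b k := fun k => by
    have := (hρ k).le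
    have := stateSq_nonneg v k
    have := kinSq_nonneg v k
    have := hP k
    positivity
  have hvel : ∀ j k, |u j k| ≤ 2 * L + |avgCell v j k| + mesh N * |diffCell j (v j) k| ∧
      |u j (k - e j)| ≤ 2 * L + |avgCell v j k| + mesh N * |diffCell j (v j) k| := by
    intro j k
    obtain ⟨hd1, hd2⟩ := velocity_split u V j k
    have := abs_face_velocity_le hm hm1 hd1 hd2 (hdata.velCell j k) (hdata.diffCell_le j k)
    exact ⟨this.1, this.2.1⟩
  -- one face
  have h1 : ∀ j k, -(upFlux ρ u j k * diffFace j Q k)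
      ≤ (D j k + (δ' * stateSq v k + 2 * C₁ * b k + 2 * C₁ * b (k + e j)))
        + -((ρ (k + e j) * u j k * (Q (k + e j) - q j k) + ρ k * u j k * (q j k - Q k))
          / mesh N) := by
    intro j k
    have hvel2 := (hvel j (k + e j)).2
    rw [add_sub_cancel_right] at hvel2
    have hu3 : |u j k| ≤ L + |v j k| := by
      have : u j k = V j k + v j k := by rw [hv]; simp
      rw [this]
      exact (abs_add_le _ _).trans (by linarith [hdata.vel j k])
    have hf := hface (mesh N) ε (ρ k) (ρ (k + e j)) (R k) (u j k) (v j k) (avgCell v j k)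
      (avgCell v j (k + e j)) (diffCell j (v j) k) (diffCell j (v j) (k + e j)) hm hm1 hε (hρ _)
      (hρ _) (hdata.density k).1 (hdata.density k).2 (hinv _) (hinv _) (hvel j k).1 hvel2 hu3
    have e1 := avgCell_sq_le_kinSq v j k
    have e2 := avgCell_sq_le_kinSq v j (k + e j)
    have e3 := diffCell_sq_le_stateSq v j k
    have e4 := diffCell_sq_le_stateSq v j (k + e j)
    have e5 := sq_le_stateSq v j k
    have e6 : ρ k * avgCell v j k ^ 2 ≤ ρ k * kinSq v k :=
      mul_le_mul_of_nonneg_left e1 (hρ k).le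
    have e7 : ρ (k + e j) * avgCell v j (k + e j) ^ 2 ≤ ρ (k + e j) * kinSq v (k + e j) :=
      mul_le_mul_of_nonneg_left e2 (hρ _).le
    have e8 : ε * (1 + ρ k + ρ (k + e j) + v j k ^ 2 + diffCell j (v j) k ^ 2
        + diffCell j (v j) (k + e j) ^ 2)
        ≤ 2 * (ε * (1 + ρ k + stateSq v k)) + 2 * (ε * (1 + ρ (k + e j) + stateSq v (k + e j))) := by
      have : 1 + ρ k + ρ (k + e j) + v j k ^ 2 + diffCell j (v j) k ^ 2
        + diffCell j (v j) (k + e j) ^ 2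
        ≤ 2 * (1 + ρ k + stateSq v k) + 2 * (1 + ρ (k + e j) + stateSq v (k + e j)) := by
        have := hρ k
        have := hρ (k + e j)
        have := stateSq_nonneg v (k + e j)
        linarith
      have := mul_le_mul_of_nonneg_left this hε0
      linarith
    have e9 : relPotential a γ (ρ k) (R k) + ρ k * avgCell v j k ^ 2
        + ρ (k + e j) * avgCell v j (k + e j) ^ 2
        + ε * (1 + ρ k + ρ (k + e j) + v j k ^ 2 + diffCell j (v j) k ^ 2
        + diffCell j (v j) (k + e j) ^ 2) ≤ 2 * b k + 2 * b (k + e j) := by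
      have n1 := hP k
      have n2 := hP (k + e j)
      have n3 := mul_nonneg (hρ k).le (kinSq_nonneg v k)
      have n4 := mul_nonneg (hρ (k + e j)).le (kinSq_nonneg v (k + e j))
      simp only [hb]
      linarith
    have e10 := mul_le_mul_of_nonneg_left e9 hC₁
    have e11 := mul_le_mul_of_nonneg_left e5 hδ'0.le
    -- The jump of `Q` is split at the face value `q`. On each half the upwind density is exchanged
    -- for the density of the adjacent cell, which costs the density jump times `|u|`; this is what
    -- the upwind dissipation pays for. The remaining term can be regrouped by cells.
    have key : -(upFlux ρ u j k * diffFace j Q k)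
        ≤ L * (|ρ (k + e j) - ρ k| * |u j k|)
          + -((ρ (k + e j) * u j k * (Q (k + e j) - q j k) + ρ k * u j k * (q j k - Q k))
          / mesh N) := by
      have f1 : upFlux ρ u j k = ρ (k + e j) * u j k - (ρ (k + e j) - ρ k) * max 0 (u j k) := by
        have : max 0 (u j k) + min 0 (u j k) = u j k := by rw [max_add_min, zero_add]
        rw [upFlux]; linear_combination (ρ (k + e j)) * this
      have f2 : upFlux ρ u j k = ρ k * u j k + (ρ (k + e j) - ρ k) * min 0 (u j k) := by
        have : max 0 (u j k) + min 0 (u j k) = u j k := by rw [max_add_min, zero_add]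
        rw [upFlux]; linear_combination (ρ k) * this
      have f3 : -(upFlux ρ u j k * diffFace j Q k)
          = (ρ (k + e j) - ρ k) * (max 0 (u j k) * ((Q (k + e j) - q j k) / mesh N)
              - min 0 (u j k) * ((q j k - Q k) / mesh N))
            + -((ρ (k + e j) * u j k * (Q (k + e j) - q j k) + ρ k * u j k * (q j k - Q k))
          / mesh N) := by
        have : upFlux ρ u j k * diffFace j Q k
            = upFlux ρ u j k * ((Q (k + e j) - q j k) / mesh N)
              + upFlux ρ u j k * ((q j k - Q k) / mesh N) := by
          rw [diffFace]; ring
        rw [this]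
        nth_rewrite 1 [f1]
        rw [f2]
        ring
      rw [f3]
      have b1 : |(Q (k + e j) - q j k) / mesh N| ≤ L := by
        rw [abs_div, abs_of_pos hm, div_le_iff₀ hm]; exact hdata.face_right j k
      have b2 : |(q j k - Q k) / mesh N| ≤ L := by
        rw [abs_div, abs_of_pos hm, div_le_iff₀ hm]; exact hdata.face_left j k
      have b3 : |max 0 (u j k) * ((Q (k + e j) - q j k) / mesh N)
              - min 0 (u j k) * ((q j k - Q k) / mesh N)| ≤ |u j k| * L := by
        rcases le_total 0 (u j k) with h | h
        · rw [max_eq_right h, min_eq_left h, zero_mul, sub_zero, abs_mul]; gcongr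
        · rw [max_eq_left h, min_eq_right h, zero_mul, zero_sub, abs_neg, abs_mul]; gcongr
      have b4 : (ρ (k + e j) - ρ k) * (max 0 (u j k) * ((Q (k + e j) - q j k) / mesh N)
              - min 0 (u j k) * ((q j k - Q k) / mesh N))
          ≤ L * (|ρ (k + e j) - ρ k| * |u j k|) := by
        refine (le_abs_self _).trans ?_
        rw [abs_mul]
        calc _ ≤ |ρ (k + e j) - ρ k| * (|u j k| * L) := by gcongr
          _ = _ := by ring
      linarith
    simp only [hD]
    linarith
  -- one cell
  have h2 : ∀ j, gridInt (fun k => -((ρ (k + e j) * u j k * (Q (k + e j) - q j k)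
        + ρ k * u j k * (q j k - Q k)) / mesh N))
      ≤ gridInt (fun k => -(ρ k * ((avgCell V j k + avgCell v j k) * diffCell j (q j) k))
        + (δ' * stateSq v k + C₂ * b k)) := by
    intro j
    have h3 : gridInt (fun k => -((ρ (k + e j) * u j k * (Q (k + e j) - q j k)
        + ρ k * u j k * (q j k - Q k)) / mesh N))
        = gridInt (fun k => -(ρ k * (u j (k - e j) * (Q k - q j (k - e j))
          + u j k * (q j k - Q k)) / mesh N)) := by
      refine gridInt_eq_of_telescope j (fun k =>
        -(ρ k * (u j (k - e j) * (Q k - q j (k - e j))) / mesh N)) fun k => ?_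
      simp only [add_sub_cancel_right]
      ring
    rw [h3]
    refine gridInt_mono fun k => ?_
    obtain ⟨hd1, hd2⟩ := velocity_split u V j k
    have h4 := flux_cell_le hL hδ'0 hm hm1 hε (hρ k) (hinv k) hd1 hd2 (hdata.velCell j k)
      (hdata.diffCell_le j k) (hdata.face_left j k) (hdata.face_right' j k)
    refine h4.trans ?_
    have e3 := mul_le_mul_of_nonneg_left (diffCell_sq_le_stateSq v j k) hδ'0.le
    have e4 : ε * ρ k ≤ b k := by
      have n1 := hP k
      have n3 := mul_nonneg (hρ k).le (kinSq_nonneg v k)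
      have n4 := mul_nonneg hε0 (stateSq_nonneg v k)
      simp only [hb]
      linarith
    have e5 := mul_le_mul_of_nonneg_left e4 hC₂0
    have e6 : diffCell j (q j) k = (q j k - q j (k - e j)) / mesh N := rfl
    rw [e6]
    linarith
  have h3 : ∀ j, gridInt (fun k => -(upFlux ρ u j k * diffFace j Q k))
      ≤ gridInt (D j) + gridInt (fun k =>
          -(ρ k * ((avgCell V j k + avgCell v j k) * diffCell j (q j) k)))
        + gridInt (fun k => 2 * δ' * stateSq v k + (4 * C₁ + C₂) * b k) := by
    intro j
    have h4 := gridInt_mono (h1 j)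
    have h5 := h2 j
    have h6 := gridInt_shift (e j) b
    simp only [gridInt_add, gridInt_mul_left] at h4 h5 ⊢
    rw [h6] at h4
    have : gridInt (D j) = gridInt (fun k => D j k) := rfl
    linarith
  have h4 := Finset.sum_le_sum fun j (_ : j ∈ (Finset.univ : Finset (Fin d))) => h3 j
  rw [Finset.sum_add_distrib, Finset.sum_add_distrib, ← gridInt_sum, ← gridInt_sum,
    ← gridInt_sum] at h4
  have h5 : gridInt (fun k => ∑ j, -(upFlux ρ u j k * diffFace j Q k))
      = -gridInt (fun k => ∑ j, upFlux ρ u j k * diffFace j Q k) := by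
    rw [← gridInt_neg]; congr 1; funext k; rw [Finset.sum_neg_distrib]
  rw [h5] at h4
  refine h4.trans ?_
  gcongr
  rw [Finset.sum_const, Finset.card_univ, Fintype.card_fin, nsmul_eq_mul, ← gridInt_mul_left]
  refine gridInt_mono fun k => ?_
  simp only [budget]
  have e1 : d * (2 * δ') ≤ δ := by
    rw [hδ']
    have : d * (2 * (δ / (2 * (d + 1)))) = δ * (d / (d + 1 : ℝ)) := by field_simp
    rw [this]
    have : (d / (d + 1 : ℝ)) ≤ 1 := by rw [div_le_one (by positivity)]; linarith
    nlinarith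
  have e2 := mul_le_mul_of_nonneg_right e1 (stateSq_nonneg v k)
  simp only [hb]
  linarith

/-- The artificial diffusion terms of the relative energy inequality. -/
lemma diffusion_sum_le (d : ℕ) (ha : 0 < a) (hγ : 1 < γ) (hlo : 0 < rlo) (rhi : ℝ) {L δ : ℝ}
    (hL : 1 ≤ L) (hδ : 0 < δ) :
    ∃ C : ℝ, 0 ≤ C ∧ ∀ (N : ℕ) [NeZero N] (ε dt κ : ℝ) (ρ R Rm : Grid d N → ℝ)
      (u V Wm q : Fin d → Grid d N → ℝ), (∀ k, 0 < ρ k) → mesh N ≤ ε → 0 ≤ κ → κ ≤ mesh N →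
      (∀ k, mesh N ^ 2 * ρ k ≤ L * ε) → StepData a γ μ lam L rlo rhi dt R Rm V Wm q →
      κ * gridInt (fun k => ∑ j, diffFace j ρ k *
          (∑ i, avgFace j (avgCell (u - V) i) k * diffFace j (avgCell V i) k
            + diffFace j (fun l => potentialDeriv a γ (Rm l)) k))
      ≤ κ * gridInt (fun k => ∑ j,
          diffFace j ρ k * diffFace j (fun l => potentialDeriv a γ (ρ l)) k)
        + gridInt (budget a γ δ C ε ρ R (u - V)) := by
  set δ' := δ / (2 * (d + 1)) with hδ'
  have hδ'0 : 0 < δ' := by positivity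
  -- From `(A + B)² ≤ 2A² + 2B²`: the first summand is Cauchy-Schwarz against the `d` velocity
  -- gradients, the second is twice the squared bound `2 * L` for the difference of the potential.
  set C₀ := (d : ℝ) * L ^ 2 + 8 * L ^ 2 with hC₀
  have hC₀1 : 1 ≤ C₀ := by
    have : (1 : ℝ) ≤ L ^ 2 := one_le_pow₀ hL
    have : 0 ≤ (d : ℝ) * L ^ 2 := by positivity
    linarith
  obtain ⟨C₁, hC₁, hface⟩ := diffusion_budget_le ha hγ hlo rhi hL hδ'0 hC₀1
  refine ⟨d * (4 * C₁), by positivity, ?_⟩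
  intro N _ ε dt κ ρ R Rm u V Wm q hρ hε hκ hκh hinv hdata
  have hm := mesh_pos N
  have hm1 := mesh_le_one N
  have hε0 : 0 ≤ ε := hm.le.trans hε
  set v := u - V with hv
  set Q : Grid d N → ℝ := fun l => potentialDeriv a γ (Rm l) with hQ
  have hP : ∀ k, 0 ≤ relPotential a γ (ρ k) (R k) := fun k =>
    relPotential_nonneg ha hγ (hρ k) (hlo.trans_le (hdata.density k).1)
  set b : Grid d N → ℝ := fun k => relPotential a γ (ρ k) (R k) + ρ k * kinSq v k
          + ε * (1 + ρ k + stateSq v k) with hb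
  have h1 : ∀ j k, κ * (diffFace j ρ k *
          (∑ i, avgFace j (avgCell v i) k * diffFace j (avgCell V i) k + diffFace j Q k))
      ≤ κ * (diffFace j ρ k * diffFace j (fun l => potentialDeriv a γ (ρ l)) k)
        + (δ' * stateSq v k + 2 * C₁ * b k + (δ' * stateSq v (k + e j) + 2 * C₁ * b (k + e j)))
      := by
    intro j k
    set T : ℝ := ∑ i, (diffFace j (avgCell v i) k) ^ 2 with hT
    have hT0 : 0 ≤ T := Finset.sum_nonneg fun _ _ => sq_nonneg _
    have hTs : T ≤ stateSq v k := by
      refine le_trans ?_ (stateSq_bounds v k).2.1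
      exact Finset.sum_le_sum fun i _ => sq_le_sum_sq (fun j => diffFace j (avgCell v i) k) j
    have hz : ∀ i, avgCell v i (k + e j)
        = avgCell v i k + mesh N * diffFace j (avgCell v i) k := fun i => by
      simp only [diffFace]; field_simp; ring
    have hS1 : kinSq v (k + e j) ≤ 2 * kinSq v k + 2 * (mesh N ^ 2 * T) := by
      simp only [kinSq, hT, Finset.mul_sum, ← Finset.sum_add_distrib]
      refine Finset.sum_le_sum fun i _ => ?_
      rw [hz i]
      nlinarith [sq_nonneg (avgCell v i k - mesh N * diffFace j (avgCell v i) k)]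
    have hS2 : kinSq v k ≤ 2 * kinSq v (k + e j) + 2 * (mesh N ^ 2 * T) := by
      simp only [kinSq, hT, Finset.mul_sum, ← Finset.sum_add_distrib]
      refine Finset.sum_le_sum fun i _ => ?_
      rw [hz i]
      nlinarith [sq_nonneg (avgCell v i k + 2 * (mesh N * diffFace j (avgCell v i) k))]
    have hX : (∑ i, avgFace j (avgCell v i) k * diffFace j (avgCell V i) k + diffFace j Q k) ^ 2
        ≤ C₀ * (1 + kinSq v k + kinSq v (k + e j)) := by
      have f1 : (∑ i, avgFace j (avgCell v i) k * diffFace j (avgCell V i) k) ^ 2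
          ≤ (kinSq v k + kinSq v (k + e j)) / 2 * (d * L ^ 2) := by
        refine (Finset.sum_mul_sq_le_sq_mul_sq _ _ _).trans ?_
        have g1 : ∑ i, avgFace j (avgCell v i) k ^ 2
            ≤ (kinSq v k + kinSq v (k + e j)) / 2 := by
          simp only [kinSq, ← Finset.sum_add_distrib, Finset.sum_div]
          refine Finset.sum_le_sum fun i _ => ?_
          simp only [avgFace]
          nlinarith [sq_nonneg (avgCell v i k - avgCell v i (k + e j))]
        have g2 : ∑ i, diffFace j (avgCell V i) k ^ 2 ≤ d * L ^ 2 := by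
          calc _ ≤ ∑ _i : Fin d, L ^ 2 := Finset.sum_le_sum fun i _ => by
                have := hdata.gradCell i j k
                rw [← sq_abs]; gcongr
            _ = _ := by simp
        have g3 := kinSq_nonneg v k
        have g4 := kinSq_nonneg v (k + e j)
        gcongr
      have f2 : diffFace j Q k ^ 2 ≤ (2 * L) ^ 2 := by
        have := hdata.gradPot_le j k
        rw [← sq_abs]; gcongr
      have g3 := kinSq_nonneg v k
      have g4 := kinSq_nonneg v (k + e j)
      have f3 : 0 ≤ 8 * L ^ 2 * (kinSq v k + kinSq v (k + e j)) := by positivity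
      have f4 : 0 ≤ d * L ^ 2 := by positivity
      have f5 := add_sq_le (a := ∑ i, avgFace j (avgCell v i) k * diffFace j (avgCell V i) k)
        (b := diffFace j Q k)
      rw [hC₀]
      linarith
    have hf := hface (mesh N) ε κ (ρ k) (ρ (k + e j)) (R k)
      (∑ i, avgFace j (avgCell v i) k * diffFace j (avgCell V i) k + diffFace j Q k)
      (kinSq v k) (kinSq v (k + e j)) T hm hm1 hε hκ hκh (hρ _) (hρ _) (hdata.density k).1
      (hdata.density k).2 (hinv _) (hinv _) (kinSq_nonneg v k) (kinSq_nonneg v _) hT0 hX hS1 hS2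
    have e1 := (stateSq_bounds v k).2.2.2.1
    have e2 := (stateSq_bounds v (k + e j)).2.2.2.1
    have e9 : relPotential a γ (ρ k) (R k) + ρ k * kinSq v k + ρ (k + e j) * kinSq v (k + e j)
            + ε * (1 + ρ k + ρ (k + e j) + kinSq v k + kinSq v (k + e j) + T)
        ≤ 2 * b k + 2 * b (k + e j) := by
      have f1 : ε * (1 + ρ k + ρ (k + e j) + kinSq v k + kinSq v (k + e j) + T)
          ≤ ε * (2 * (1 + ρ k + stateSq v k) + 2 * (1 + ρ (k + e j) + stateSq v (k + e j))) := by
        have := hρ k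
        have := hρ (k + e j)
        have := stateSq_nonneg v (k + e j)
        exact mul_le_mul_of_nonneg_left (by linarith) hε0
      have n1 := hP k
      have n2 := hP (k + e j)
      have n3 := mul_nonneg (hρ k).le (kinSq_nonneg v k)
      have n4 := mul_nonneg (hρ (k + e j)).le (kinSq_nonneg v (k + e j))
      simp only [hb]
      linarith
    have e10 := mul_le_mul_of_nonneg_left e9 hC₁
    have e11 := mul_le_mul_of_nonneg_left e1 hδ'0.le
    have e12 := mul_le_mul_of_nonneg_left e2 hδ'0.le
    refine hf.trans ?_
    have e13 : diffFace j ρ k * diffFace j (fun l => potentialDeriv a γ (ρ l)) k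
      = (ρ (k + e j) - ρ k) / mesh N *
        ((potentialDeriv a γ (ρ (k + e j)) - potentialDeriv a γ (ρ k)) / mesh N) := rfl
    rw [e13]
    linarith
  have h3 : ∀ j, gridInt (fun k => κ * (diffFace j ρ k *
          (∑ i, avgFace j (avgCell v i) k * diffFace j (avgCell V i) k + diffFace j Q k)))
      ≤ gridInt (fun k => κ * (diffFace j ρ k
          * diffFace j (fun l => potentialDeriv a γ (ρ l)) k))
        + gridInt (fun k => 2 * δ' * stateSq v k + 4 * C₁ * b k) := by
    intro j
    have h4 := gridInt_mono (h1 j)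
    have h5 := gridInt_shift (e j) (stateSq v)
    have h6 := gridInt_shift (e j) b
    simp only [gridInt_add, gridInt_mul_left] at h4 ⊢
    rw [h5, h6] at h4
    have : gridInt (stateSq v) = gridInt (fun k => stateSq v k) := rfl
    linarith
  have h4 := Finset.sum_le_sum fun j (_ : j ∈ (Finset.univ : Finset (Fin d))) => h3 j
  rw [Finset.sum_add_distrib, ← gridInt_sum, ← gridInt_sum] at h4
  simp only [← Finset.mul_sum, gridInt_mul_left] at h4
  refine h4.trans ?_
  gcongr
  rw [Finset.sum_const, Finset.card_univ, Fintype.card_fin, nsmul_eq_mul, ← gridInt_mul_left]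
  refine gridInt_mono fun k => ?_
  simp only [budget]
  have e1 : d * (2 * δ') ≤ δ := by
    rw [hδ']
    have : d * (2 * (δ / (2 * (d + 1)))) = δ * (d / (d + 1 : ℝ)) := by field_simp
    rw [this]
    have : (d / (d + 1 : ℝ)) ≤ 1 := by rw [div_le_one (by positivity)]; linarith
    nlinarith
  have e2 := mul_le_mul_of_nonneg_right e1 (stateSq_nonneg v k)
  simp only [hb]
  linarith

end StepTerms

/-! ### The relative energy estimate for one time step. -/

section StepEstimate

variable {a γ μ lam rlo rhi : ℝ}

/-- The remaining terms of the relative energy inequality in one cell. -/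
lemma remainder_cell_le (d : ℕ) (ha : 0 < a) (hγ : 1 < γ) (hlo : 0 < rlo) (rhi : ℝ) {L δ T : ℝ}
    (hL : 1 ≤ L) (hδ : 0 < δ) (hT : 0 < T) :
    ∃ C : ℝ, 0 ≤ C ∧ ∀ (ε dt ρ ρm R Rm dV dQ : ℝ) (z zm W g Dt : Fin d → ℝ)
      (D : Fin d → Fin d → ℝ), 0 < dt → dt ≤ T → 0 ≤ ε → 0 < ρ → 0 < ρm → rlo ≤ R → R ≤ rhi →
      rlo ≤ Rm → Rm ≤ rhi → (∀ i, |W i| ≤ L) → (∀ i, |g i| ≤ 2 * L) → (∀ i j, |D i j| ≤ L) →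
      (∀ i, |Dt i| ≤ L) → |dV| ≤ d * L →
      |dQ + ∑ j, W j * g j + a * γ * R ^ (γ - 1) * dV| ≤ 2 * L * ε →
      ∑ i, ∑ j, -(ρ * z i * W j * D i j) - ρm * ∑ i, Dt i * z i - pressure a γ ρ * dV
        + ∑ j, -(ρ * ((W j + z j) * g j)) - (ρ - R) * dQ
        + ∑ i, (Rm * Dt i + R * ∑ j, W j * D i j + R * g i) * z i
      ≤ -(∑ j, R * g j * W j + pressure a γ R * dV)
        + (δ * ∑ i, z i ^ 2 + C * (relPotential a γ ρ R + ρ * ∑ i, z i ^ 2 + ε * (1 + ρ)))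
        + (C * (relPotential a γ ρm Rm + ρm * ∑ i, zm i ^ 2)
          + 1 / (2 * dt) * (ρm * ∑ i, (z i - zm i) ^ 2)) := by
  set δ₁ := δ / 4 with hδ₁
  have hδ₁0 : 0 < δ₁ := by positivity
  -- As `dt ≤ T`, the second entry gives `2 * δ₂ ≤ 1 / (2 * dt)`, the coefficient of the dissipation
  -- of the implicit time step.
  set δ₂ := min (δ / 4) (1 / (4 * T)) with hδ₂
  have hδ₂0 : 0 < δ₂ := by positivity
  have hδ₂δ : δ₂ ≤ δ / 4 := min_le_left _ _
  have hδ₂T : δ₂ ≤ 1 / (4 * T) := min_le_right _ _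
  obtain ⟨C₁, hC₁, h₁⟩ := abs_sub_mul_le ha hγ hlo rhi (d * L ^ 2 + 2 * L) δ₁ hδ₁0
  obtain ⟨C₂, hC₂, h₂⟩ := abs_sub_mul_le ha hγ hlo rhi L δ₂ hδ₂0
  set C₃ := 2 * L * (1 + |rhi|) with hC₃
  have hC₃0 : 0 ≤ C₃ := by positivity
  refine ⟨d * C₁ + d * C₂ + δ₁ + 2 * δ₂ + C₃ + (γ - 1) * (d * L),
    by have : 0 ≤ γ - 1 := by linarith
       positivity, ?_⟩
  intro ε dt ρ ρm R Rm dV dQ z zm W g Dt D hdt hdtT hε hρ hρm hR hR' hRm hRm' hW hg hD hDt hdV hcont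
  have hR0 : 0 < R := by linarith
  have hP := relPotential_nonneg ha hγ hρ hR0
  have hPm := relPotential_nonneg ha hγ hρm (by linarith : 0 < Rm)
  have hL0 : 0 ≤ L := by linarith
  -- Adding the tested residual of the discrete momentum equation for the projections replaces the
  -- densities `ρ` and `ρm` in front of the error by `ρ - R` and `ρm - Rm`. The density equation of
  -- the projections appears with the factor `ρ - R`, and the pressure is left with its quadratic
  -- remainder `(γ - 1) 𝔼(ρ|R)`.
  have hid : ∑ i, ∑ j, -(ρ * z i * W j * D i j) - ρm * ∑ i, Dt i * z i - pressure a γ ρ * dV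
        + ∑ j, -(ρ * ((W j + z j) * g j)) - (ρ - R) * dQ
        + ∑ i, (Rm * Dt i + R * ∑ j, W j * D i j + R * g i) * z i
      = -(∑ j, R * g j * W j + pressure a γ R * dV)
        + ∑ i, -((ρ - R) * z i * (∑ j, W j * D i j + g i))
        + ∑ i, -((ρm - Rm) * z i * Dt i)
        + -((ρ - R) * (dQ + ∑ j, W j * g j + a * γ * R ^ (γ - 1) * dV))
        + -((γ - 1) * relPotential a γ ρ R * dV) := by
    rw [← pressure_rel_eq hγ hρ hR0]
    have e1 : ∑ i, ∑ j, -(ρ * z i * W j * D i j) = ∑ i, -(ρ * z i * ∑ j, W j * D i j) :=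
      Finset.sum_congr rfl fun i _ => by
        rw [Finset.sum_neg_distrib, Finset.mul_sum]
        congr 1
        exact Finset.sum_congr rfl fun j _ => by ring
    have e2 : ρm * ∑ i, Dt i * z i = ∑ i, ρm * (Dt i * z i) := Finset.mul_sum _ _ _
    have e3 : (ρ - R) * (dQ + ∑ j, W j * g j + a * γ * R ^ (γ - 1) * dV)
        = (ρ - R) * dQ + ∑ j, (ρ - R) * (W j * g j) + (ρ - R) * (a * γ * R ^ (γ - 1) * dV) := by
      rw [mul_add, mul_add, Finset.mul_sum]
    rw [e1, e2, e3]
    have e4 : ∑ i, -(ρ * z i * ∑ j, W j * D i j) - ∑ i, ρm * (Dt i * z i)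
        + ∑ j, -(ρ * ((W j + z j) * g j))
        + ∑ i, (Rm * Dt i + R * ∑ j, W j * D i j + R * g i) * z i
        = -(∑ j, R * g j * W j) + ∑ i, -((ρ - R) * z i * (∑ j, W j * D i j + g i))
        + ∑ i, -((ρm - Rm) * z i * Dt i) - ∑ j, (ρ - R) * (W j * g j) := by
      rw [← Finset.sum_neg_distrib]
      simp only [← Finset.sum_add_distrib, ← Finset.sum_sub_distrib]
      exact Finset.sum_congr rfl fun i _ => by ring
    linear_combination e4
  rw [hid]
  -- convective and potential gradients
  have b1 : ∑ i, -((ρ - R) * z i * (∑ j, W j * D i j + g i))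
      ≤ d * C₁ * relPotential a γ ρ R + δ₁ * ((1 + ρ) * ∑ i, z i ^ 2) := by
    have : ∀ i, -((ρ - R) * z i * (∑ j, W j * D i j + g i))
        ≤ C₁ * relPotential a γ ρ R + δ₁ * ((1 + ρ) * z i ^ 2) := by
      intro i
      refine le_trans ?_ (h₁ ρ R (z i) hρ hR hR')
      refine (neg_le_abs _).trans ?_
      rw [abs_mul, abs_mul, mul_comm]
      gcongr
      refine (abs_add_le _ _).trans (add_le_add ?_ (hg i))
      refine (Finset.abs_sum_le_sum_abs _ _).trans ?_
      calc ∑ j, |W j * D i j| ≤ ∑ _j : Fin d, L ^ 2 := Finset.sum_le_sum fun j _ => by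
            rw [abs_mul, sq]
            exact mul_le_mul (hW j) (hD i j) (abs_nonneg _) hL0
        _ = d * L ^ 2 := by simp
    refine (Finset.sum_le_sum fun i _ => this i).trans (le_of_eq ?_)
    rw [Finset.sum_add_distrib, Finset.sum_const, Finset.card_univ, Fintype.card_fin,
      nsmul_eq_mul, ← Finset.mul_sum, ← Finset.mul_sum]
    ring
  -- time derivative
  have b2 : ∑ i, -((ρm - Rm) * z i * Dt i)
      ≤ d * C₂ * relPotential a γ ρm Rm + (δ₂ * ∑ i, z i ^ 2
        + 2 * δ₂ * (ρm * ∑ i, zm i ^ 2) + 1 / (2 * dt) * (ρm * ∑ i, (z i - zm i) ^ 2)) := by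
    have : ∀ i, -((ρm - Rm) * z i * Dt i)
        ≤ C₂ * relPotential a γ ρm Rm + (δ₂ * z i ^ 2 + 2 * δ₂ * (ρm * zm i ^ 2)
          + 1 / (2 * dt) * (ρm * (z i - zm i) ^ 2)) := by
      intro i
      have e1 : -((ρm - Rm) * z i * Dt i) ≤ L * (|ρm - Rm| * |z i|) := by
        refine (neg_le_abs _).trans ?_
        rw [abs_mul, abs_mul, mul_comm]
        gcongr
        exact hDt i
      refine e1.trans ((h₂ ρm Rm (z i) hρm hRm hRm').trans ?_)
      -- The weight is the old density `ρm` while the velocity error is new. Passing to the old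
      -- error gives old kinetic energy, plus an increment absorbed by the dissipation of the time
      -- step.
      have e2 : z i ^ 2 ≤ 2 * (z i - zm i) ^ 2 + 2 * zm i ^ 2 := by
        nlinarith [sq_nonneg (z i - 2 * zm i)]
      have e3 : δ₂ * (ρm * z i ^ 2)
          ≤ 2 * δ₂ * (ρm * (z i - zm i) ^ 2) + 2 * δ₂ * (ρm * zm i ^ 2) := by
        calc δ₂ * (ρm * z i ^ 2) ≤ δ₂ * (ρm * (2 * (z i - zm i) ^ 2 + 2 * zm i ^ 2)) := by
              gcongr
          _ = _ := by ring
      have e4 : 2 * δ₂ ≤ 1 / (2 * dt) := by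
        have : 1 / (4 * T) ≤ 1 / (4 * dt) := by gcongr
        have e5 : 1 / (4 * dt) = 1 / (2 * dt) / 2 := by field_simp; norm_num
        linarith
      have e6 : 2 * δ₂ * (ρm * (z i - zm i) ^ 2) ≤ 1 / (2 * dt) * (ρm * (z i - zm i) ^ 2) := by
        gcongr
      linarith
    refine (Finset.sum_le_sum fun i _ => this i).trans (le_of_eq ?_)
    simp only [Finset.sum_add_distrib, Finset.sum_const, Finset.card_univ, Fintype.card_fin,
      nsmul_eq_mul, Finset.mul_sum]
    ring
  have b3 : -((ρ - R) * (dQ + ∑ j, W j * g j + a * γ * R ^ (γ - 1) * dV))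
      ≤ C₃ * (ε * (1 + ρ)) := by
    refine (neg_le_abs _).trans ?_
    rw [abs_mul]
    have e1 : |ρ - R| ≤ (1 + |rhi|) * (1 + ρ) := by
      have f1 : |ρ - R| ≤ ρ + R := by rw [abs_le]; constructor <;> linarith
      have f2 := le_abs_self rhi
      have f3 : 0 ≤ |rhi| * ρ := by positivity
      linarith
    calc _ ≤ (1 + |rhi|) * (1 + ρ) * (2 * L * ε) := by gcongr
      _ = _ := by rw [hC₃]; ring
  have b4 : -((γ - 1) * relPotential a γ ρ R * dV)
      ≤ (γ - 1) * (d * L) * relPotential a γ ρ R := by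
    refine (neg_le_abs _).trans ?_
    have hγ1 : 0 ≤ γ - 1 := by linarith
    rw [abs_mul, abs_of_nonneg (mul_nonneg hγ1 hP)]
    calc _ ≤ (γ - 1) * relPotential a γ ρ R * (d * L) := by gcongr
      _ = _ := by ring
  have hS : 0 ≤ ∑ i, z i ^ 2 := Finset.sum_nonneg fun _ _ => sq_nonneg _
  have hSm : 0 ≤ ∑ i, zm i ^ 2 := Finset.sum_nonneg fun _ _ => sq_nonneg _
  set S := ∑ i, z i ^ 2
  set Sm := ∑ i, zm i ^ 2
  set P := relPotential a γ ρ R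
  set Pm := relPotential a γ ρm Rm
  have hγ1 : 0 ≤ (γ - 1) * (d * L) := by
    have : 0 ≤ γ - 1 := by linarith
    positivity
  have n1 : 0 ≤ ρ * S := by positivity
  have n2 : 0 ≤ ρm * Sm := by positivity
  have n3 : 0 ≤ ε * (1 + ρ) := by positivity
  have n4 : 0 ≤ (d : ℝ) * C₁ := by positivity
  have n5 : 0 ≤ (d : ℝ) * C₂ := by positivity
  set E := d * C₁ + d * C₂ + δ₁ + 2 * δ₂ + C₃ + (γ - 1) * (d * L) with hE
  have m1 : d * C₁ * P + (γ - 1) * (d * L) * P ≤ E * P := by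
    rw [← add_mul]
    exact mul_le_mul_of_nonneg_right (by linarith) hP
  have m2 : δ₁ * (ρ * S) ≤ E * (ρ * S) := mul_le_mul_of_nonneg_right (by linarith) n1
  have m3 : C₃ * (ε * (1 + ρ)) ≤ E * (ε * (1 + ρ)) :=
    mul_le_mul_of_nonneg_right (by linarith) n3
  have m4 : d * C₂ * Pm ≤ E * Pm := mul_le_mul_of_nonneg_right (by linarith) hPm
  have m5 : 2 * δ₂ * (ρm * Sm) ≤ E * (ρm * Sm) := mul_le_mul_of_nonneg_right (by linarith) n2
  have m6 : δ₁ * S + δ₂ * S ≤ δ * S := by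
    rw [← add_mul]
    exact mul_le_mul_of_nonneg_right (by linarith) hS
  linarith

lemma gridRelEnergy_eq {d N : ℕ} [NeZero N] (ρ R : Grid d N → ℝ) (w W : Fin d → Grid d N → ℝ) :
    gridRelEnergy a γ ρ w R W
      = 1 / 2 * gridInt (fun k => ρ k * ∑ i, (w i k - W i k) ^ 2)
        + gridInt (fun k => relPotential a γ (ρ k) (R k)) := by
  rw [gridRelEnergy, gridInt_add, ← gridInt_mul_left]
  congr 2; funext k; ring

/-- The absolute values in the consistency errors are controlled by the state. -/
lemma gridInt_abs_le {d N : ℕ} [NeZero N] (v : Fin d → Grid d N → ℝ) :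
    gridInt (fun k => ∑ i, ∑ j, |diffFace j (v i) k| + ∑ i, |avgCell v i k|)
      ≤ d * d + d + 2 * gridInt (stateSq v) := by
  have h1 : ∀ k, ∑ i, ∑ j, |diffFace j (v i) k| + ∑ i, |avgCell v i k|
      ≤ (d * d + d) + 2 * stateSq v k := by
    intro k
    have e1 : ∑ i, ∑ j, |diffFace j (v i) k| ≤ ∑ i, ∑ j, (1 + (diffFace j (v i) k) ^ 2) :=
      Finset.sum_le_sum fun i _ => Finset.sum_le_sum fun j _ => abs_le_one_add_sq _
    have e2 : ∑ i, |avgCell v i k| ≤ ∑ i, (1 + (avgCell v i k) ^ 2) :=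
      Finset.sum_le_sum fun i _ => abs_le_one_add_sq _
    simp only [Finset.sum_add_distrib, Finset.sum_const, Finset.card_univ, Fintype.card_fin,
      nsmul_eq_mul, mul_one] at e1 e2
    have e3 := (stateSq_bounds v k).1
    have e4 : ∑ i, avgCell v i k ^ 2 ≤ stateSq v k := (stateSq_bounds v k).2.2.2.1
    linarith
  refine (gridInt_mono h1).trans (le_of_eq ?_)
  rw [gridInt_add, gridInt_const, gridInt_mul_left]

/-- Collecting the terms of the relative energy inequality. -/
lemma energy_balance_arith (d : ℕ) {X Xm IP IK IPm IKm Y G Dv ε dt B C₄ E₀ CY μ lam L M : ℝ}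
    (hdt : 0 < dt) (hε0 : 0 ≤ ε) (hεE : ε ≤ E₀) (hμ : 0 < μ) (hB0 : 0 ≤ B) (hC₄ : 0 ≤ C₄)
    (hCY : 0 < CY) (hL : 0 ≤ L) (hM : 0 ≤ M) (hIP0 : 0 ≤ IP) (hIK0 : 0 ≤ IK) (hIPm0 : 0 ≤ IPm)
    (hIKm0 : 0 ≤ IKm) (hG0 : 0 ≤ G) (hXeq : X = 1 / 2 * IK + IP)
    (hXmeq : Xm = 1 / 2 * IKm + IPm) (hYY : Y ≤ CY * (G + IK))
    (main : (X - Xm) / dt + μ * G + (μ + lam) * Dv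
      ≤ 3 * (μ / (6 * CY)) * Y + B * (IP + IK + ε * (1 + M + Y)) + C₄ * (IPm + IKm)
        + 2 * L * ε * (d * d + d + 2 * Y) + 2 * L * ε * (d * (d * L) + d * L)) :
    X - Xm + dt * (μ / 2 * G + (μ + lam) * Dv)
      ≤ dt * (((2 * B + μ + 2 * E₀ * (B * CY + 4 * L * CY)) + 2 * C₄
          + (B * (1 + M) + 2 * L * (d * d + d) + 2 * L * (d * (d * L) + d * L))
          + (B * CY + 4 * L * CY)) * (X + Xm + ε * (1 + G))) := by
  have hE₀ : 0 ≤ E₀ := hε0.trans hεE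
  set δ := μ / (6 * CY) with hδdef
  have hδ : 0 < δ := by positivity
  set A := B * (1 + M) + 2 * L * (d * d + d) + 2 * L * (d * (d * L) + d * L) with hA
  have hA0 : 0 ≤ A := by positivity
  set F := B * CY + 4 * L * CY with hF
  have hF0 : 0 ≤ F := by positivity
  -- The value `δ = μ / (6 * CY)` is chosen for this: three uses of `δ * Y` consume half of the
  -- viscous dissipation, and the other half remains on the left of the estimate.
  have hδY : 3 * δ * Y ≤ μ / 2 * G + μ * X := by
    have e1 : 3 * δ * Y ≤ 3 * δ * (CY * (G + IK)) := by gcongr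
    have e2 : 3 * δ * (CY * (G + IK)) = μ / 2 * (G + IK) := by
      rw [hδdef]; field_simp; ring
    have e3 : μ / 2 * IK ≤ μ * X := by
      have : IK ≤ 2 * X := by linarith
      have := mul_le_mul_of_nonneg_left this hμ.le
      linarith
    linarith
  have hX0 : 0 ≤ X := by linarith
  have hXm0 : 0 ≤ Xm := by linarith
  have hYX : Y ≤ CY * (G + 2 * X) := by
    refine hYY.trans ?_
    have : IK ≤ 2 * X := by linarith
    gcongr
  -- In `ε * Y ≤ ε * CY * (G + 2 * X)` the part with `X` uses only `ε ≤ E₀`. The part `ε * G` cannot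
  -- be absorbed, because `ε` need not be small compared with `μ`, and is kept on the right.
  have m1 : B * (IP + IK + ε * (1 + M + Y))
      ≤ 2 * B * X + ε * (B * (1 + M)) + ε * (B * CY * G) + 2 * E₀ * (B * CY) * X := by
    have e1 : IP + IK ≤ 2 * X := by linarith
    have e2 : ε * Y ≤ ε * (CY * G) + 2 * E₀ * CY * X := by
      have f1 : ε * Y ≤ ε * (CY * (G + 2 * X)) := by gcongr
      have f2 : ε * (CY * (2 * X)) ≤ E₀ * (CY * (2 * X)) := by gcongr
      linarith
    have e3 : IP + IK + ε * (1 + M + Y)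
        ≤ 2 * X + ε * (1 + M) + (ε * (CY * G) + 2 * E₀ * CY * X) := by linarith
    have := mul_le_mul_of_nonneg_left e3 hB0
    linarith
  have m2 : 2 * L * ε * (d * d + d + 2 * Y) ≤ ε * (2 * L * (d * d + d)) + ε * (4 * L * CY * G)
      + 2 * E₀ * (4 * L * CY) * X := by
    have f1 : ε * Y ≤ ε * (CY * (G + 2 * X)) := by gcongr
    have f2 : ε * (CY * (2 * X)) ≤ E₀ * (CY * (2 * X)) := by gcongr
    have f3 : ε * Y ≤ ε * (CY * G) + 2 * E₀ * CY * X := by linarith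
    have := mul_le_mul_of_nonneg_left f3 (by positivity : 0 ≤ 4 * L)
    linarith
  have m3 : C₄ * (IPm
          + IKm) ≤ 2 * C₄ * Xm := by
    have : IPm
          + IKm ≤ 2 * Xm := by
      linarith
    have := mul_le_mul_of_nonneg_left this hC₄
    linarith
  have fin : (X - Xm) / dt + (μ / 2 * G + (μ + lam) * Dv)
      ≤ (2 * B + μ + 2 * E₀ * F) * X + 2 * C₄ * Xm + ε * A + ε * (F * G) := by
    rw [hA, hF]
    linarith
  have fin2 : (2 * B + μ + 2 * E₀ * F) * X + 2 * C₄ * Xm + ε * A + ε * (F * G)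
      ≤ ((2 * B + μ + 2 * E₀ * F) + 2 * C₄ + A + F) * (X + Xm + ε * (1 + G)) := by
    have c1 : 0 ≤ 2 * B + μ + 2 * E₀ * F := by positivity
    have c2 : 0 ≤ ε * G := by positivity
    have t1 : 0 ≤ (2 * B + μ + 2 * E₀ * F) * (Xm + ε * (1 + G)) := by positivity
    have t2 : 0 ≤ 2 * C₄ * (X + ε * (1 + G)) := by positivity
    have t3 : 0 ≤ A * (X + Xm + ε * G) := by positivity
    have t4 : 0 ≤ F * (X + Xm + ε) := by positivity
    linarith
  have := mul_le_mul_of_nonneg_left (fin.trans fin2) hdt.le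
  have e1 : dt * ((X - Xm) / dt + (μ / 2 * G + (μ + lam) * Dv))
      = X - Xm + dt * (μ / 2 * G + (μ + lam) * Dv) := by field_simp
  rw [e1] at this
  exact this

/-- The relative energy estimate for one time step. -/
theorem step_estimate (d : ℕ) (ha : 0 < a) (hγ : 1 < γ) (hμ : 0 < μ)
    (hlo : 0 < rlo) (rhi : ℝ) {L T M : ℝ} (hL : 1 ≤ L) (hT : 0 < T) (hM : 0 < M) (CE : ℝ) {E₀ : ℝ}
    (hE₀ : 0 ≤ E₀) :
    ∃ C : ℝ, 0 ≤ C ∧ ∀ (N : ℕ) [NeZero N] (ε dt κ : ℝ) (ρ ρm R Rm : Grid d N → ℝ)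
      (u V wm Wm q : Fin d → Grid d N → ℝ), (∀ k, 0 < ρ k) → (∀ k, 0 < ρm k) →
      0 < dt → dt ≤ T → dt ≤ ε → ε ≤ E₀ → mesh N ≤ ε → 0 ≤ κ → κ ≤ mesh N →
      (∀ k, mesh N ^ 2 * ρ k ≤ L * ε) → gridInt ρ = M → gridInt (fun k => ρ k ^ γ) ≤ CE →
      StepData a γ μ lam L rlo rhi dt R Rm V Wm q →
      (∀ k, (ρ k - ρm k) / dt + divUp ρ u k - κ * lapCell ρ k = 0) →
      (∀ (i : Fin d) (k : Grid d N),
        avgFace i (fun l => (ρ l * avgCell u i l - ρm l * wm i l) / dt) k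
          + avgFace i (divUp (fun l => ρ l * avgCell u i l) u) k
          + diffFace i (fun l => pressure a γ (ρ l)) k
          - μ * lapFace (u i) k
          - (μ + lam) * diffFace i (divh u) k
        = κ * ∑ j, avgFace i
            (diffCell j (fun l => avgFace j (avgCell u i) l * diffFace j ρ l)) k) →
      gridRelEnergy a γ ρ (avgCell u) R (avgCell V) - gridRelEnergy a γ ρm wm Rm Wm
        + dt * (μ / 2 * gradSq (u - V) + (μ + lam) * divSq (u - V))
      ≤ dt * (C * (gridRelEnergy a γ ρ (avgCell u) R (avgCell V) + gridRelEnergy a γ ρm wm Rm Wm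
        + ε * (1 + gradSq (u - V)))) := by
  obtain ⟨CY, hCY, hY⟩ := stateSq_le d hγ hM CE
  -- The allowance `δ * stateSq` is used three times: for the density flux, for the artificial
  -- diffusion and for the remaining cell terms.
  set δ := μ / (6 * CY) with hδdef
  have hδ : 0 < δ := by positivity
  obtain ⟨C₁, hC₁, h₁⟩ := convection_sum_le (μ := μ) (lam := lam) (rhi := rhi) d ha hγ hlo hL
  obtain ⟨C₂, hC₂, h₂⟩ := density_flux_sum_le (μ := μ) (lam := lam) d ha hγ hlo rhi hL hδ
  obtain ⟨C₃, hC₃, h₃⟩ := diffusion_sum_le (μ := μ) (lam := lam) d ha hγ hlo rhi hL hδ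
  obtain ⟨C₄, hC₄, h₄⟩ := remainder_cell_le d ha hγ hlo rhi hL hδ hT
  set B := C₁ + C₂ + C₃ + C₄ with hB
  have hB0 : 0 ≤ B := by positivity
  set A := B * (1 + M) + 2 * L * (d * d + d) + 2 * L * (d * (d * L) + d * L) with hA
  have hA0 : 0 ≤ A := by positivity
  set F := B * CY + 4 * L * CY with hF
  have hF0 : 0 ≤ F := by positivity
  refine ⟨(2 * B + μ + 2 * E₀ * F) + 2 * C₄ + A + F, by positivity, ?_⟩
  intro N _ ε dt κ ρ ρm R Rm u V wm Wm q hρ hρm hdt hdtT hdtε hεE hε hκ hκh hinv hmass hE hdata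
    hden hmom
  have hm := mesh_pos N
  have hε0 : 0 ≤ ε := hm.le.trans hε
  set v := u - V with hv
  have hREI := relative_energy_inequality (R := R) (Rm := Rm) (V := V) (Wm := Wm) ha hγ hdt hρ hρm
    (fun k => hlo.trans_le (hdata.density k).1) (fun k => hlo.trans_le (hdata.density_prev k).1)
    hden hmom
  rw [← hv] at hREI
  have g1 := h₁ N ε dt ρ R Rm u V Wm q hρ hε hinv hdata
  have g2 := h₂ N ε dt ρ R Rm u V Wm q hρ hε hinv hdata
  have g3 := h₃ N ε dt κ ρ R Rm u V Wm q hρ hε hκ hκh hinv hdata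
  rw [← hv] at g1 g2 g3
  -- consistency of the momentum equation and of the pressure
  have hmesh2 : L * (mesh N + dt) ≤ 2 * L * ε := by
    have : L * (mesh N + dt) ≤ L * (ε + ε) := by gcongr
    linarith
  -- The momentum residual is tested with the error `v`, the pressure residual with `V` itself;
  -- these are the two brackets left open by the cell estimate `h₄`.
  have g4 := (abs_le.1 (hdata.momentum v)).1
  have g5 := (abs_le.1 (hdata.press V)).1
  have g6 := gridInt_abs_le v
  have g6' : 0 ≤ gridInt (fun k => ∑ i, ∑ j, |diffFace j (v i) k| + ∑ i, |avgCell v i k|) :=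
    gridInt_nonneg fun k => add_nonneg
      (Finset.sum_nonneg fun _ _ => Finset.sum_nonneg fun _ _ => abs_nonneg _)
      (Finset.sum_nonneg fun _ _ => abs_nonneg _)
  have g7' : 0 ≤ gridInt (fun k => ∑ i, ∑ j, |diffFace j (V i) k| + ∑ i, |avgCell V i k|) :=
    gridInt_nonneg fun k => add_nonneg
      (Finset.sum_nonneg fun _ _ => Finset.sum_nonneg fun _ _ => abs_nonneg _)
      (Finset.sum_nonneg fun _ _ => abs_nonneg _)
  have g7 : gridInt (fun k => ∑ i, ∑ j, |diffFace j (V i) k| + ∑ i, |avgCell V i k|)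
      ≤ d * (d * L) + d * L := by
    have : ∀ k, ∑ i, ∑ j, |diffFace j (V i) k| + ∑ i, |avgCell V i k|
        ≤ d * (d * L) + d * L := by
      intro k
      have e1 : ∑ i, ∑ j, |diffFace j (V i) k| ≤ ∑ _i : Fin d, ∑ _j : Fin d, L :=
        Finset.sum_le_sum fun i _ => Finset.sum_le_sum fun j _ => hdata.grad i j k
      have e2 : ∑ i, |avgCell V i k| ≤ ∑ _i : Fin d, L :=
        Finset.sum_le_sum fun i _ => hdata.velCell i k
      simp only [Finset.sum_const, Finset.card_univ, Fintype.card_fin, nsmul_eq_mul] at e1 e2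
      linarith
    have := gridInt_mono this
    rwa [gridInt_const] at this
  have g4' : L * (mesh N + dt)
        * gridInt (fun k => ∑ i, ∑ j, |diffFace j (v i) k| + ∑ i, |avgCell v i k|)
      ≤ 2 * L * ε * (d * d + d + 2 * gridInt (stateSq v)) := by gcongr
  have g5' : L * (mesh N + dt)
        * gridInt (fun k => ∑ i, ∑ j, |diffFace j (V i) k| + ∑ i, |avgCell V i k|)
      ≤ 2 * L * ε * (d * (d * L) + d * L) := by gcongr
  -- remaining cell terms
  have g8 : ∀ k, _ := fun k => h₄ ε dt (ρ k) (ρm k) (R k) (Rm k) (divh V k)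
    ((potentialDeriv a γ (R k) - potentialDeriv a γ (Rm k)) / dt)
    (fun i => avgCell v i k) (fun i => wm i k - Wm i k) (fun i => avgCell V i k)
    (fun i => diffCell i (q i) k) (fun i => (avgCell V i k - Wm i k) / dt)
    (fun i j => diffFace j (avgCell V i) k) hdt hdtT hε0 (hρ k) (hρm k) (hdata.density k).1
    (hdata.density k).2 (hdata.density_prev k).1 (hdata.density_prev k).2
    (fun i => hdata.velCell i k) (fun i => hdata.gradFace_le i k)
    (fun i j => hdata.gradCell i j k) (fun i => hdata.time i k) (hdata.divh_le k)
    ((hdata.continuity k).trans hmesh2)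
  have g9 := gridInt_mono g8
  simp only [gridInt_add, gridInt_sub, gridInt_neg, gridInt_mul_left] at g9
  -- collecting
  set X := gridRelEnergy a γ ρ (avgCell u) R (avgCell V) with hX
  set Xm := gridRelEnergy a γ ρm wm Rm Wm with hXm
  set IP := gridInt (fun k => relPotential a γ (ρ k) (R k)) with hIP
  set IK := gridInt (fun k => ρ k * kinSq v k) with hIK
  have hXeq : X = 1 / 2 * IK + IP := by
    rw [hX, gridRelEnergy_eq]
    have : ∀ k, ∑ i, (avgCell u i k - avgCell V i k) ^ 2 = kinSq v k := fun k => by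
      simp only [kinSq, hv, avgCell_sub]
    simp only [this]
    rfl
  have hXmeq := gridRelEnergy_eq (a := a) (γ := γ) ρm Rm wm Wm
  rw [← hXm] at hXmeq
  have hIP0 : 0 ≤ IP := gridInt_nonneg fun k =>
    relPotential_nonneg ha hγ (hρ k) (hlo.trans_le (hdata.density k).1)
  have hIK0 : 0 ≤ IK := gridInt_nonneg fun k => mul_nonneg (hρ k).le (kinSq_nonneg v k)
  have hIPm0 : 0 ≤ gridInt (fun k => relPotential a γ (ρm k) (Rm k)) := gridInt_nonneg fun k =>
    relPotential_nonneg ha hγ (hρm k) (hlo.trans_le (hdata.density_prev k).1)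
  have hIKm0 : 0 ≤ gridInt (fun k => ρm k * ∑ i, (wm i k - Wm i k) ^ 2) :=
    gridInt_nonneg fun k => mul_nonneg (hρm k).le (Finset.sum_nonneg fun _ _ => sq_nonneg _)
  have hYY := hY N ρ v hρ hmass hE
  rw [← hIK] at hYY
  have hS : gridInt (kinSq v) ≤ gridInt (stateSq v) :=
    gridInt_mono fun k => (stateSq_bounds v k).2.2.2.1
  have hS0 : 0 ≤ gridInt (stateSq v) := gridInt_nonneg fun k => stateSq_nonneg v k
  rw [gridInt_budget, ← hIP, ← hIK, hmass] at g1 g2 g3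
  have hk1 : gridInt (fun k => ∑ i, avgCell v i k ^ 2) = gridInt (kinSq v) := rfl
  have hk2 : gridInt (fun k => ρ k * ∑ i, avgCell v i k ^ 2) = IK := rfl
  have hk3 : gridInt (fun k => 1 + ρ k) = 1 + M := by rw [gridInt_add, gridInt_const, hmass]
  rw [hk1, hk2, gridInt_const, hmass] at g9
  set Y := gridInt (stateSq v) with hYdef
  set G := gradSq v with hG
  have hG0 : 0 ≤ G := gridInt_nonneg fun k =>
    Finset.sum_nonneg fun _ _ => Finset.sum_nonneg fun _ _ => sq_nonneg _
  set Dv := divSq v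
  have main : (X - Xm) / dt + μ * G + (μ + lam) * Dv
      ≤ 3 * δ * Y + B * (IP + IK + ε * (1 + M + Y))
        + C₄ * (gridInt (fun k => relPotential a γ (ρm k) (Rm k))
          + gridInt (fun k => ρm k * ∑ i, (wm i k - Wm i k) ^ 2))
        + 2 * L * ε * (d * d + d + 2 * Y) + 2 * L * ε * (d * (d * L) + d * L) := by
    have e1 : δ * gridInt (kinSq v) ≤ δ * Y := by gcongr
    have e2 : 0 ≤ C₄ * (ε * Y) := by positivity
    rw [hB]
    linarith
  exact energy_balance_arith d hdt hε0 hεE hμ hB0 hC₄ hCY (by linarith) hM.le hIP0 hIK0 hIPm0 hIKm0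
    hG0 hXeq hXmeq hYY main

end StepEstimate

/-! ### Cell and face averages of periodic functions. -/

section Averages

variable {d N : ℕ} [NeZero N]

/-- The corner of a cell with the smallest coordinates. -/
noncomputable def corner (k : Grid d N) : Fin d → ℝ := fun i => ((k i).val : ℝ) * mesh N

/-- `1`-periodicity in every coordinate. -/
def IsPeriodic (f : (Fin d → ℝ) → ℝ) : Prop := ∀ x i, f (x + Pi.single i 1) = f x

/-- Lipschitz bound with respect to the maximum norm. -/
def LipBound (B : ℝ) (f : (Fin d → ℝ) → ℝ) : Prop := ∀ x y, |f x - f y| ≤ B * ‖x - y‖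

lemma LipBound.continuous {B : ℝ} {f : (Fin d → ℝ) → ℝ} (h : LipBound B f) : Continuous f := by
  have : LipschitzWith (Real.toNNReal B) f := LipschitzWith.of_dist_le_mul fun x y => by
    rw [Real.dist_eq, dist_eq_norm]
    refine (h x y).trans ?_
    gcongr
    exact Real.le_coe_toNNReal B
  exact this.continuous

lemma volume_real_cube : (volume : Measure (Fin d → ℝ)).real (cube d) = 1 := by
  rw [cube, measureReal_def, Real.volume_Icc_pi]
  simp

lemma measurableSet_cube : MeasurableSet (cube d) := measurableSet_Icc

lemma isCompact_cube : IsCompact (cube d) := isCompact_Icc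

lemma integrableOn_cube {g : (Fin d → ℝ) → ℝ} (hg : Continuous g) : IntegrableOn g (cube d) :=
  hg.continuousOn.integrableOn_compact isCompact_cube

lemma norm_le_one_of_mem_cube {θ : Fin d → ℝ} (h : θ ∈ cube d) : ‖θ‖ ≤ 1 := by
  rw [pi_norm_le_iff_of_nonneg zero_le_one]
  intro i
  rw [Real.norm_eq_abs, abs_of_nonneg (h.1 i)]
  exact h.2 i

lemma update_mem_cube {θ : Fin d → ℝ} (h : θ ∈ cube d) (i : Fin d) {s : ℝ} (h0 : 0 ≤ s)
    (h1 : s ≤ 1) : Function.update θ i s ∈ cube d := by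
  constructor
  · intro j
    rcases eq_or_ne j i with rfl | hj
    · simpa using h0
    · simpa [hj] using h.1 j
  · intro j
    rcases eq_or_ne j i with rfl | hj
    · simpa using h1
    · simpa [hj] using h.2 j

lemma integral_cube_const (c : ℝ) : ∫ _ in cube d, c = c := by
  rw [setIntegral_const, volume_real_cube, one_smul]

lemma integral_cube_mono {f g : (Fin d → ℝ) → ℝ} (hf : Continuous f) (hg : Continuous g)
    (h : ∀ θ ∈ cube d, f θ ≤ g θ) : ∫ θ in cube d, f θ ≤ ∫ θ in cube d, g θ :=
  setIntegral_mono_on (integrableOn_cube hf) (integrableOn_cube hg) measurableSet_cube h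

lemma abs_integral_cube_le {g : (Fin d → ℝ) → ℝ} (hg : Continuous g) {ε : ℝ}
    (h : ∀ θ ∈ cube d, |g θ| ≤ ε) : |∫ θ in cube d, g θ| ≤ ε := by
  rw [abs_le]
  constructor
  · rw [← integral_cube_const (d := d) (-ε)]
    exact integral_cube_mono continuous_const hg fun θ hθ => (abs_le.1 (h θ hθ)).1
  · rw [← integral_cube_const (d := d) ε]
    exact integral_cube_mono hg continuous_const fun θ hθ => (abs_le.1 (h θ hθ)).2

lemma mem_cell_iff (k : Grid d N) (θ : Fin d → ℝ) :
    corner k + mesh N • θ ∈ cell k ↔ θ ∈ cube d := by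
  have hm := mesh_pos N
  simp only [cell, cube, mem_Icc, Pi.le_def, Pi.add_apply, Pi.smul_apply, smul_eq_mul, corner,
    Pi.zero_apply, Pi.one_apply]
  refine and_congr (forall_congr' fun i => ?_) (forall_congr' fun i => ?_)
  · rw [le_add_iff_nonneg_right, mul_nonneg_iff_of_pos_left hm]
  · rw [add_mul, one_mul, add_le_add_iff_left, mul_le_iff_le_one_right hm]

/-- Translation and scaling to the unit cube. With a common domain of integration, averages over
different cells and faces can be compared pointwise. -/
lemma integral_cell (f : (Fin d → ℝ) → ℝ) (k : Grid d N) :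
    ∫ x in cell k, f x = mesh N ^ d * ∫ θ in cube d, f (corner k + mesh N • θ) := by
  have hm := mesh_pos N
  have hmeas : MeasurableSet (cell k) := measurableSet_Icc
  have h1 : ∀ θ, (cube d).indicator (fun θ => f (corner k + mesh N • θ)) θ
      = (fun y => (cell k).indicator f (corner k + y)) (mesh N • θ) := by
    intro θ
    by_cases hθ : θ ∈ cube d
    · rw [indicator_of_mem hθ]
      simp only
      rw [indicator_of_mem ((mem_cell_iff k θ).2 hθ)]
    · rw [indicator_of_notMem hθ]
      simp only
      rw [indicator_of_notMem (fun h => hθ ((mem_cell_iff k θ).1 h))]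
  rw [← integral_indicator hmeas, ← integral_indicator measurableSet_cube]
  simp only [h1]
  rw [Measure.integral_comp_smul_of_nonneg volume (fun y => (cell k).indicator f (corner k + y))
    (mesh N) (hR := hm.le), integral_add_left_eq_self]
  simp only [Module.finrank_fintype_fun_eq_card, Fintype.card_fin, smul_eq_mul]
  rw [← mul_assoc, mul_inv_cancel₀ (by positivity), one_mul]

lemma volume_real_cell (k : Grid d N) :
    (volume : Measure (Fin d → ℝ)).real (cell k) = mesh N ^ d := by
  have h := integral_cell (fun _ => (1 : ℝ)) k
  rwa [setIntegral_const, integral_cube_const, smul_eq_mul, mul_one, mul_one] at h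

lemma cellProj_eq (f : (Fin d → ℝ) → ℝ) (k : Grid d N) :
    cellProj N f k = ∫ θ in cube d, f (corner k + mesh N • θ) := by
  have hm := mesh_pos N
  rw [cellProj, setAverage_eq, volume_real_cell, integral_cell, smul_eq_mul, ← mul_assoc,
    inv_mul_cancel₀ (by positivity), one_mul]

lemma faceProj_eq (i : Fin d) (f : (Fin d → ℝ) → ℝ) (k : Grid d N) :
    faceProj N i f k = ∫ θ in cube d, f (corner k + mesh N • Function.update θ i 1) := by
  have h := cellProj_eq (fun x => f (Function.update x i ((((k i).val : ℝ) + 1) * mesh N))) k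
  rw [cellProj] at h
  rw [faceProj, h]
  congr 1; funext θ; congr 1; funext j
  rcases eq_or_ne j i with rfl | hj
  · simp [corner]; ring
  · simp [hj]

lemma continuous_cell_comp {f : (Fin d → ℝ) → ℝ} (hf : Continuous f) (x : Fin d → ℝ) (s : ℝ) :
    Continuous fun θ : Fin d → ℝ => f (x + s • θ) := by fun_prop

lemma continuous_face_comp {f : (Fin d → ℝ) → ℝ} (hf : Continuous f) (x : Fin d → ℝ) (s : ℝ)
    (i : Fin d) (c : ℝ) :
    Continuous fun θ : Fin d → ℝ => f (x + s • Function.update θ i c) :=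
  hf.comp (continuous_const.add
    ((continuous_id.update i continuous_const).const_smul s))

lemma cellProj_sub {f g : (Fin d → ℝ) → ℝ} (hf : Continuous f) (hg : Continuous g)
    (k : Grid d N) : cellProj N (fun x => f x - g x) k = cellProj N f k - cellProj N g k := by
  simp only [cellProj_eq]
  exact integral_sub (integrableOn_cube (continuous_cell_comp hf _ _))
    (integrableOn_cube (continuous_cell_comp hg _ _))

lemma cellProj_add {f g : (Fin d → ℝ) → ℝ} (hf : Continuous f) (hg : Continuous g)
    (k : Grid d N) : cellProj N (fun x => f x + g x) k = cellProj N f k + cellProj N g k := by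
  simp only [cellProj_eq]
  exact integral_add (integrableOn_cube (continuous_cell_comp hf _ _))
    (integrableOn_cube (continuous_cell_comp hg _ _))

lemma cellProj_mul_left (c : ℝ) (f : (Fin d → ℝ) → ℝ) (k : Grid d N) :
    cellProj N (fun x => c * f x) k = c * cellProj N f k := by
  simp only [cellProj_eq]
  exact integral_const_mul _ _

lemma cellProj_sum {ι : Type*} (s : Finset ι) {f : ι → (Fin d → ℝ) → ℝ}
    (hf : ∀ i ∈ s, Continuous (f i)) (k : Grid d N) :
    cellProj N (fun x => ∑ i ∈ s, f i x) k = ∑ i ∈ s, cellProj N (f i) k := by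
  simp only [cellProj_eq]
  exact integral_finsetSum _ fun i hi => integrableOn_cube (continuous_cell_comp (hf i hi) _ _)

lemma cellProj_const (c : ℝ) (k : Grid d N) : cellProj N (fun _ => c) k = c := by
  rw [cellProj_eq, integral_cube_const]

lemma faceProj_sub {f g : (Fin d → ℝ) → ℝ} (hf : Continuous f) (hg : Continuous g) (i : Fin d)
    (k : Grid d N) : faceProj N i (fun x => f x - g x) k = faceProj N i f k - faceProj N i g k := by
  simp only [faceProj_eq]
  exact integral_sub (integrableOn_cube (continuous_face_comp hf _ _ _ _))
    (integrableOn_cube (continuous_face_comp hg _ _ _ _))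

/-- A cell average is close to `c` if the function is. -/
lemma abs_cellProj_sub_le {f : (Fin d → ℝ) → ℝ} (hf : Continuous f) {c ε : ℝ} {k : Grid d N}
    (h : ∀ x, ‖x - corner k‖ ≤ mesh N → |f x - c| ≤ ε) : |cellProj N f k - c| ≤ ε := by
  have hm := mesh_pos N
  have h1 : cellProj N f k - c = cellProj N (fun x => f x - c) k := by
    rw [cellProj_sub hf continuous_const, cellProj_const]
  rw [h1, cellProj_eq]
  refine abs_integral_cube_le (continuous_cell_comp (hf.sub continuous_const) _ _) fun θ hθ => ?_
  refine h _ ?_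
  rw [add_sub_cancel_left, norm_smul, Real.norm_eq_abs, abs_of_pos hm]
  exact mul_le_of_le_one_right hm.le (norm_le_one_of_mem_cube hθ)

/-- A face average is close to `c` if the function is. -/
lemma abs_faceProj_sub_le {f : (Fin d → ℝ) → ℝ} (hf : Continuous f) {c ε : ℝ} {i : Fin d}
    {k : Grid d N} (h : ∀ x, ‖x - corner k‖ ≤ mesh N → |f x - c| ≤ ε) :
    |faceProj N i f k - c| ≤ ε := by
  have hm := mesh_pos N
  have h1 : faceProj N i f k - c = faceProj N i (fun x => f x - c) k := by
    rw [faceProj_sub hf continuous_const, faceProj_eq i (fun _ => c), integral_cube_const]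
  rw [h1, faceProj_eq]
  refine abs_integral_cube_le (continuous_face_comp (hf.sub continuous_const) _ _ _ _)
    fun θ hθ => ?_
  refine h _ ?_
  rw [add_sub_cancel_left, norm_smul, Real.norm_eq_abs, abs_of_pos hm]
  exact mul_le_of_le_one_right hm.le
    (norm_le_one_of_mem_cube (update_mem_cube hθ i zero_le_one le_rfl))

lemma LipBound.cellProj_le {B : ℝ} {f : (Fin d → ℝ) → ℝ} (h : LipBound B f) (hB : 0 ≤ B)
    (k : Grid d N) : |cellProj N f k - f (corner k)| ≤ B * mesh N :=
  abs_cellProj_sub_le h.continuous fun x hx => (h x _).trans (by gcongr)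

lemma LipBound.faceProj_le {B : ℝ} {f : (Fin d → ℝ) → ℝ} (h : LipBound B f) (hB : 0 ≤ B)
    (i : Fin d) (k : Grid d N) : |faceProj N i f k - f (corner k)| ≤ B * mesh N :=
  abs_faceProj_sub_le h.continuous fun x hx => (h x _).trans (by gcongr)

lemma IsPeriodic.zsmul {f : (Fin d → ℝ) → ℝ} (hf : IsPeriodic f) (x : Fin d → ℝ) (j : Fin d)
    (m : ℤ) : f (x + (m : ℝ) • Pi.single j (1 : ℝ)) = f x := by
  have : Function.Periodic f (Pi.single j (1 : ℝ)) := fun x => hf x j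
  rw [Int.cast_smul_eq_zsmul]
  exact this.zsmul m x

/-- Indices live in `ℤ/N`, so a step may wrap around. The corner then changes by an additional
integer multiple of the unit vector, which periodic functions do not see. -/
lemma corner_add (k : Grid d N) (j : Fin d) :
    ∃ m : ℤ, corner (k + e j) = corner k + mesh N • Pi.single j (1 : ℝ)
      + (m : ℝ) • Pi.single j (1 : ℝ) := by
  have h1 : (((k j + 1 : ZMod N).val : ℤ) : ZMod N) = (((k j).val + 1 : ℤ) : ZMod N) := by
    push_cast
    simp
  rw [ZMod.intCast_eq_intCast_iff_dvd_sub] at h1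
  obtain ⟨m, hm⟩ := h1
  refine ⟨-m, ?_⟩
  have h2 : ((k j + 1 : ZMod N).val : ℝ) = (k j).val + 1 - N * m := by
    have : ((k j + 1 : ZMod N).val : ℤ) = (k j).val + 1 - N * m := by linarith
    exact_mod_cast this
  funext i
  rcases eq_or_ne i j with rfl | hi
  · simp only [corner, Pi.add_apply, e, Pi.single_eq_same, Pi.smul_apply, smul_eq_mul,
      Int.cast_neg, mul_one]
    rw [h2]
    have := natCast_mul_mesh N
    linear_combination (-(m : ℝ)) * this
  · simp [corner, e, hi]

lemma IsPeriodic.corner_add {f : (Fin d → ℝ) → ℝ} (hf : IsPeriodic f) (k : Grid d N) (j : Fin d)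
    (y : Fin d → ℝ) :
    f (corner (k + e j) + y) = f (corner k + mesh N • Pi.single j (1 : ℝ) + y) := by
  obtain ⟨m, hm⟩ := MACNS.corner_add k j
  rw [hm, ← hf.zsmul (corner k + mesh N • (Pi.single j (1 : ℝ) : Fin d → ℝ) + y) j m]
  congr 1
  abel

lemma norm_mesh_single (j : Fin d) : ‖mesh N • (Pi.single j (1 : ℝ) : Fin d → ℝ)‖ = mesh N := by
  rw [norm_smul, Pi.norm_single, norm_one, mul_one, Real.norm_eq_abs, abs_of_pos (mesh_pos N)]

lemma LipBound.corner_add {B : ℝ} {f : (Fin d → ℝ) → ℝ} (h : LipBound B f) (hf : IsPeriodic f)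
    (k : Grid d N) (j : Fin d) : |f (corner (k + e j)) - f (corner k)| ≤ B * mesh N := by
  have h1 := hf.corner_add k j 0
  rw [add_zero, add_zero] at h1
  rw [h1]
  refine (h _ _).trans (le_of_eq ?_)
  rw [add_sub_cancel_left, norm_mesh_single]

lemma LipBound.corner_sub {B : ℝ} {f : (Fin d → ℝ) → ℝ} (h : LipBound B f) (hf : IsPeriodic f)
    (k : Grid d N) (j : Fin d) : |f (corner (k - e j)) - f (corner k)| ≤ B * mesh N := by
  have := h.corner_add hf (k - e j) j
  rwa [sub_add_cancel, abs_sub_comm] at this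

lemma faceProj_add_e {f : (Fin d → ℝ) → ℝ} (hf : IsPeriodic f) (i j : Fin d) (k : Grid d N) :
    faceProj N i f (k + e j) = faceProj N i (fun x => f (x + mesh N • Pi.single j (1 : ℝ))) k := by
  simp only [faceProj_eq]
  congr 1; funext θ
  rw [hf.corner_add]
  congr 1
  abel

lemma diffFace_faceProj {f : (Fin d → ℝ) → ℝ} (hf : IsPeriodic f) (hc : Continuous f)
    (i j : Fin d) (k : Grid d N) :
    diffFace j (faceProj N i f) k
      = faceProj N i (fun x => (f (x + mesh N • Pi.single j (1 : ℝ)) - f x) / mesh N) k := by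
  rw [diffFace, faceProj_add_e hf, ← faceProj_sub (by fun_prop) hc]
  simp only [faceProj_eq]
  rw [← integral_div]

lemma LipBound.diffFace_le {B : ℝ} {f : (Fin d → ℝ) → ℝ} (h : LipBound B f) (hf : IsPeriodic f)
    (i j : Fin d) (k : Grid d N) : |diffFace j (faceProj N i f) k| ≤ B := by
  have hm := mesh_pos N
  have hc := h.continuous
  rw [diffFace_faceProj hf hc, ← sub_zero (faceProj N i _ k)]
  refine abs_faceProj_sub_le (by fun_prop) fun x _ => ?_
  rw [sub_zero, abs_div, abs_of_pos hm, div_le_iff₀ hm]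
  refine (h _ _).trans (le_of_eq ?_)
  rw [add_sub_cancel_left, norm_mesh_single]

lemma hasDerivAt_line {f : (Fin d → ℝ) → ℝ} (hf : Differentiable ℝ f) (x : Fin d → ℝ) (j : Fin d)
    (s : ℝ) : HasDerivAt (fun s : ℝ => f (x + s • Pi.single j (1 : ℝ)))
      (pd j f (x + s • Pi.single j (1 : ℝ))) s := by
  have h1 := (hf (x + s • Pi.single j (1 : ℝ))).hasFDerivAt
  have h2 : HasDerivAt (fun s : ℝ => x + s • (Pi.single j (1 : ℝ) : Fin d → ℝ))
      (Pi.single j (1 : ℝ)) s := by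
    simpa using ((hasDerivAt_id s).smul_const (Pi.single j (1 : ℝ) : Fin d → ℝ)).const_add x
  exact h1.comp_hasDerivAt s h2

/-- With respect to the maximum norm the operator norm of the gradient is at most the sum of the `d`
partial derivatives; hence the factor `d`. -/
lemma lipBound_of_pd {f : (Fin d → ℝ) → ℝ} (hf : Differentiable ℝ f) {K : ℝ}
    (hK : ∀ x i, |pd i f x| ≤ K) : LipBound (d * K) f := by
  intro x y
  rcases Nat.eq_zero_or_pos d with rfl | hd
  · rw [Subsingleton.elim x y]; simp
  have h1 : ∀ z, ‖fderiv ℝ f z‖ ≤ d * K := by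
    intro z
    have hK0 : 0 ≤ K := (abs_nonneg _).trans (hK z ⟨0, hd⟩)
    refine ContinuousLinearMap.opNorm_le_bound _ (by positivity) fun w => ?_
    have h2 : w = ∑ i, w i • (Pi.single i (1 : ℝ) : Fin d → ℝ) := by
      conv_lhs => rw [pi_eq_sum_univ' w]
    conv_lhs => rw [h2]
    rw [map_sum]
    refine (norm_sum_le _ _).trans ?_
    calc ∑ i, ‖fderiv ℝ f z (w i • (Pi.single i (1 : ℝ) : Fin d → ℝ))‖
        ≤ ∑ _i : Fin d, ‖w‖ * K := by
          refine Finset.sum_le_sum fun i _ => ?_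
          rw [map_smul, norm_smul]
          exact mul_le_mul (norm_le_pi_norm w i) (hK z i) (norm_nonneg _) (norm_nonneg _)
      _ = _ := by
          rw [Finset.sum_const, Finset.card_univ, Fintype.card_fin, nsmul_eq_mul]; ring
  have := Convex.norm_image_sub_le_of_norm_fderiv_le (𝕜 := ℝ) (fun z _ => hf z)
    (fun z _ => h1 z) convex_univ (mem_univ y) (mem_univ x)
  rwa [Real.norm_eq_abs] at this

/-- The difference quotients of the face averages are consistent with the partial derivatives. -/
lemma diffFace_faceProj_le {B C : ℝ} {f : (Fin d → ℝ) → ℝ} (hf : IsPeriodic f)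
    (hC : LipBound C f) (hd : Differentiable ℝ f) (i j : Fin d) (h : LipBound B (pd j f))
    (hB : 0 ≤ B) (k : Grid d N) :
    |diffFace j (faceProj N i f) k - pd j f (corner k)| ≤ 2 * B * mesh N := by
  have hm := mesh_pos N
  have hc := hC.continuous
  rw [diffFace_faceProj hf hc]
  refine abs_faceProj_sub_le (by fun_prop) fun x hx => ?_
  obtain ⟨s, hs, hs'⟩ := exists_hasDerivAt_eq_slope
    (fun s : ℝ => f (x + s • Pi.single j (1 : ℝ)))
    (fun s => pd j f (x + s • Pi.single j (1 : ℝ))) hm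
    (fun s _ => (hasDerivAt_line hd x j s).continuousAt.continuousWithinAt)
    (fun s _ => hasDerivAt_line hd x j s)
  simp only [zero_smul, add_zero, sub_zero] at hs'
  rw [← hs']
  refine (h _ _).trans ?_
  have h2 : ‖x + s • (Pi.single j (1 : ℝ) : Fin d → ℝ) - corner k‖ ≤ 2 * mesh N := by
    rw [add_sub_right_comm]
    refine (norm_add_le _ _).trans ?_
    have : ‖s • (Pi.single j (1 : ℝ) : Fin d → ℝ)‖ ≤ mesh N := by
      rw [norm_smul, Pi.norm_single, norm_one, mul_one, Real.norm_eq_abs, abs_of_pos hs.1]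
      exact hs.2.le
    linarith
  calc B * ‖x + s • (Pi.single j (1 : ℝ) : Fin d → ℝ) - corner k‖ ≤ B * (2 * mesh N) := by gcongr
    _ = _ := by ring

/-- Fubini's theorem with the `j`-th coordinate as inner variable, prepared for the one-dimensional
fundamental theorem of calculus. -/
lemma integral_cube_insertNth {n : ℕ} (j : Fin (n + 1)) {G : (Fin (n + 1) → ℝ) → ℝ}
    (hG : Continuous G) :
    ∫ θ in cube (n + 1), G θ
      = ∫ y in cube n, ∫ s in Icc (0 : ℝ) 1, G (j.insertNth s y) := by
  have hmp := (volume_preserving_piFinSuccAbove (fun _ : Fin (n + 1) => ℝ) j).symm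
  rw [← hmp.map_eq, (MeasurableEquiv.piFinSuccAbove (fun _ => ℝ) j).symm.restrict_map,
    (MeasurableEquiv.piFinSuccAbove (fun _ => ℝ) j).symm.measurableEmbedding.integral_map]
  have hpre : (MeasurableEquiv.piFinSuccAbove (fun _ : Fin (n + 1) => ℝ) j).symm ⁻¹' cube (n + 1)
      = Icc (0 : ℝ) 1 ×ˢ cube n := by
    ext ⟨s, y⟩
    simp only [mem_preimage, MeasurableEquiv.piFinSuccAbove_symm_apply, cube, mem_prod, mem_Icc,
      Fin.insertNthEquiv_apply, Pi.le_def, Pi.zero_apply, Pi.one_apply, Fin.forall_iff_succAbove j,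
      Fin.insertNth_apply_same, Fin.insertNth_apply_succAbove]
    tauto
  rw [hpre]
  have hcont : Continuous fun p : ℝ × (Fin n → ℝ) => G (j.insertNth p.1 p.2) := by
    refine hG.comp (continuous_pi fun i => ?_)
    refine Fin.succAboveCases j ?_ (fun i => ?_) i
    · simp only [Fin.insertNth_apply_same]; fun_prop
    · simp only [Fin.insertNth_apply_succAbove]; fun_prop
  have hint : IntegrableOn (fun p : ℝ × (Fin n → ℝ) => G (j.insertNth p.1 p.2))
      (Icc (0 : ℝ) 1 ×ˢ cube n) (volume.prod volume) :=
    hcont.continuousOn.integrableOn_compact (isCompact_Icc.prod isCompact_cube)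
  have h1 : ∫ p in Icc (0 : ℝ) 1 ×ˢ cube n, G (j.insertNth p.1 p.2) ∂(volume.prod volume)
      = ∫ y in cube n, ∫ s in Icc (0 : ℝ) 1, G (j.insertNth s y) := by
    rw [IntegrableOn, ← Measure.prod_restrict] at hint
    rw [← Measure.prod_restrict]
    exact integral_prod_symm _ hint
  exact h1

/-- The fundamental theorem of calculus in direction `j` on the unit cube. -/
lemma integral_cube_pd (j : Fin d) {F : (Fin d → ℝ) → ℝ} (hF : ContDiff ℝ 1 F) :
    ∫ θ in cube d, pd j F θ
      = ∫ θ in cube d, (F (Function.update θ j 1) - F (Function.update θ j 0)) := by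
  obtain ⟨n, rfl⟩ : ∃ n, d = n + 1 := ⟨d - 1, by have := j.pos; omega⟩
  have hdiff : Differentiable ℝ F := hF.differentiable one_ne_zero
  have hpd : Continuous (pd j F) := by
    have := hF.continuous_fderiv one_ne_zero
    unfold pd
    fun_prop
  have hup : ∀ c : ℝ, Continuous fun θ : Fin (n + 1) → ℝ => F (Function.update θ j c) := fun c =>
    hF.continuous.comp (continuous_id.update j continuous_const)
  rw [integral_cube_insertNth j hpd, integral_cube_insertNth j
    (G := fun θ => F (Function.update θ j 1) - F (Function.update θ j 0)) ((hup 1).sub (hup 0))]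
  congr 1; funext y
  have hins : ∀ s : ℝ, (j.insertNth s y : Fin (n + 1) → ℝ)
      = j.insertNth 0 y + s • Pi.single j (1 : ℝ) := by
    intro s
    funext i
    refine Fin.succAboveCases j ?_ (fun i => ?_) i
    · simp
    · simp
  have hder : ∀ s : ℝ, HasDerivAt (fun s : ℝ => F (j.insertNth s y))
      (pd j F (j.insertNth s y)) s := by
    intro s
    have := hasDerivAt_line hdiff (j.insertNth 0 y) j s
    simp only [← hins] at this
    exact this
  have hcs : Continuous fun s : ℝ => pd j F (j.insertNth s y) := by
    refine hpd.comp ?_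
    rw [funext hins]
    fun_prop
  rw [integral_Icc_eq_integral_Ioc, ← intervalIntegral.integral_of_le zero_le_one,
    intervalIntegral.integral_eq_sub_of_hasDerivAt (fun s _ => hder s)
      (hcs.intervalIntegrable 0 1)]
  have hupd : ∀ s c : ℝ, Function.update (j.insertNth s y : Fin (n + 1) → ℝ) j c
      = j.insertNth c y := fun s c => Fin.update_insertNth _ _ _ _
  rw [show (fun s : ℝ => F (Function.update (j.insertNth s y : Fin (n + 1) → ℝ) j 1)
      - F (Function.update (j.insertNth s y : Fin (n + 1) → ℝ) j 0))
      = fun _ => F (j.insertNth 1 y) - F (j.insertNth 0 y) from by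
        funext s; rw [hupd, hupd],
    setIntegral_const, Real.volume_real_Icc_of_le zero_le_one, sub_zero, one_smul]

/-- The cell average of a partial derivative is the difference quotient of the face averages. -/
lemma diffCell_faceProj {f : (Fin d → ℝ) → ℝ} (hf : IsPeriodic f) (hs : ContDiff ℝ 1 f)
    (j : Fin d) (k : Grid d N) : diffCell j (faceProj N j f) k = cellProj N (pd j f) k := by
  have hm := mesh_pos N
  have hc := hs.continuous
  -- The face with index `k - e j` is the side `θ j = 0` of the cell `k`, up to an integer
  -- translation when the index wraps around.
  have h1 : faceProj N j f (k - e j)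
      = ∫ θ in cube d, f (corner k + mesh N • Function.update θ j 0) := by
    rw [faceProj_eq]
    congr 1; funext θ
    have h2 := hf.corner_add (k - e j) j (mesh N • Function.update θ j 0)
    rw [sub_add_cancel] at h2
    rw [h2, add_assoc, ← smul_add]
    congr 3
    funext i
    rcases eq_or_ne i j with rfl | hi
    · simp
    · simp [hi]
  have h3 : ∀ θ, pd j (fun θ => f (corner k + mesh N • θ)) θ
      = mesh N * pd j f (corner k + mesh N • θ) := by
    intro θ
    have e1 := (hs.differentiable one_ne_zero (corner k + mesh N • θ)).hasFDerivAt
    have e2 : HasFDerivAt (fun θ : Fin d → ℝ => corner k + mesh N • θ)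
        (mesh N • ContinuousLinearMap.id ℝ (Fin d → ℝ)) θ :=
      ((hasFDerivAt_id θ).const_smul (mesh N)).const_add (corner k)
    have e3 : HasFDerivAt (fun θ : Fin d → ℝ => f (corner k + mesh N • θ)) _ θ := e1.comp θ e2
    rw [pd, e3.fderiv]
    simp [pd]
  have h4 := integral_cube_pd j (F := fun θ => f (corner k + mesh N • θ)) (by fun_prop)
  simp only [h3] at h4
  rw [integral_const_mul, integral_sub
    (integrableOn_cube (continuous_face_comp hc _ _ _ _))
    (integrableOn_cube (continuous_face_comp hc _ _ _ _))] at h4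
  rw [diffCell, h1, faceProj_eq, cellProj_eq, ← h4]
  field_simp

end Averages

/-! ### Calculus on the space-time cylinder. -/

section SpaceTime

variable {d : ℕ} {T : ℝ} {f : ℝ → (Fin d → ℝ) → ℝ}

/-- Scalar functions of class `C²` on the space-time cylinder. -/
def IsSmooth (T : ℝ) (f : ℝ → (Fin d → ℝ) → ℝ) : Prop :=
  ContDiffOn ℝ 2 (fun q : ℝ × (Fin d → ℝ) => f q.1 q.2) (Icc 0 T ×ˢ univ)

lemma IsSmooth.space (hf : IsSmooth T f) {t : ℝ} (ht : t ∈ Icc 0 T) : ContDiff ℝ 2 (f t) := by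
  rw [← contDiffOn_univ]
  exact ContDiffOn.comp hf (f := fun x : Fin d → ℝ => (t, x)) (by fun_prop)
    fun x _ => ⟨ht, mem_univ x⟩

lemma IsSmooth.time (hf : IsSmooth T f) (x : Fin d → ℝ) :
    ContDiffOn ℝ 2 (fun s => f s x) (Icc 0 T) :=
  ContDiffOn.comp hf (f := fun s : ℝ => (s, x)) (by fun_prop) fun _ hs => ⟨hs, mem_univ x⟩

lemma IsSmooth.differentiableOn_time (hf : IsSmooth T f) (x : Fin d → ℝ) :
    DifferentiableOn ℝ (fun s => f s x) (Icc 0 T) :=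
  (hf.time x).differentiableOn two_ne_zero

lemma IsSmooth.differentiable (hf : IsSmooth T f) {t : ℝ} (ht : t ∈ Icc 0 T) :
    Differentiable ℝ (f t) := (hf.space ht).differentiable two_ne_zero

lemma contDiff_pd {n m : ℕ} {g : (Fin d → ℝ) → ℝ} (hg : ContDiff ℝ n g) (h : m + 1 ≤ n)
    (j : Fin d) : ContDiff ℝ m (pd j g) :=
  (hg.fderiv_right (m := m) (by exact_mod_cast h)).clm_apply contDiff_const

lemma IsSmooth.contDiff_pd (hf : IsSmooth T f) {t : ℝ} (ht : t ∈ Icc 0 T) (j : Fin d) :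
    ContDiff ℝ 1 (pd j (f t)) :=
  MACNS.contDiff_pd (n := 2) (m := 1) (hf.space ht) le_rfl j

lemma IsSmooth.differentiable_pd (hf : IsSmooth T f) {t : ℝ} (ht : t ∈ Icc 0 T) (j : Fin d) :
    Differentiable ℝ (pd j (f t)) := (hf.contDiff_pd ht j).differentiable one_ne_zero

/-- The space derivative is the derivative within the closed cylinder applied to `(0, e_j)`, which
is of class `C¹` up to the end points of the time interval. This legitimises the one-sided
derivatives there. -/
lemma IsSmooth.differentiableOn_pd (hT : 0 < T) (hf : IsSmooth T f) (j : Fin d)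
    (x : Fin d → ℝ) : DifferentiableOn ℝ (fun s => pd j (f s) x) (Icc 0 T) := by
  set S : Set (ℝ × (Fin d → ℝ)) := Icc 0 T ×ˢ univ
  set F : ℝ × (Fin d → ℝ) → ℝ := fun q => f q.1 q.2 with hF
  have hS : UniqueDiffOn ℝ S := (uniqueDiffOn_Icc hT).prod uniqueDiffOn_univ
  have h1 : ContDiffOn ℝ 1 (fderivWithin ℝ F S) S :=
    ContDiffOn.fderivWithin (n := 2) hf hS (by norm_num)
  have h2 : ContDiffOn ℝ 1 (fun q => fderivWithin ℝ F S q (0, Pi.single j 1)) S :=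
    h1.clm_apply contDiffOn_const
  have h3 : ContDiffOn ℝ 1 (fun s : ℝ => fderivWithin ℝ F S (s, x) (0, Pi.single j 1))
      (Icc 0 T) :=
    h2.comp (f := fun s : ℝ => (s, x)) (by fun_prop) fun _ hs => ⟨hs, mem_univ x⟩
  refine (h3.differentiableOn one_ne_zero).congr fun s hs => ?_
  have e1 : HasFDerivWithinAt F (fderivWithin ℝ F S (s, x)) S (s, x) :=
    ((ContDiffOn.differentiableOn hf two_ne_zero) (s, x) ⟨hs, mem_univ x⟩).hasFDerivWithinAt
  have e2 : HasFDerivAt (fun y : Fin d → ℝ => (s, y))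
      (ContinuousLinearMap.inr ℝ ℝ (Fin d → ℝ)) x := hasFDerivAt_prodMk_right s x
  have e3 := e1.comp_hasFDerivAt x e2 (Filter.Eventually.of_forall fun y => ⟨hs, mem_univ y⟩)
  have e4 : HasFDerivAt (f s) _ x := e3
  rw [pd, e4.fderiv]
  simp

lemma abs_sub_le_of_td {g : ℝ → ℝ} (hg : DifferentiableOn ℝ g (Icc 0 T)) {K : ℝ}
    (hK : ∀ s ∈ Icc 0 T, |td T g s| ≤ K) {s t : ℝ} (hs : s ∈ Icc 0 T) (ht : t ∈ Icc 0 T) :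
    |g t - g s| ≤ K * |t - s| :=
  Convex.norm_image_sub_le_of_norm_derivWithin_le hg hK (convex_Icc 0 T) hs ht

/-- The quotient equals the derivative at an intermediate time, and the derivative is Lipschitz by
the bound on the second time derivative. -/
lemma abs_sub_sub_le_of_td {g : ℝ → ℝ} (hT : 0 < T) (hg : ContDiffOn ℝ 2 g (Icc 0 T)) {K : ℝ}
    (hK : ∀ s ∈ Icc 0 T, |td T (td T g) s| ≤ K) {s t : ℝ} (hs : s ∈ Icc 0 T) (ht : t ∈ Icc 0 T)
    (hst : s < t) : |(g t - g s) / (t - s) - td T g s| ≤ K * (t - s) := by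
  have h0 : 0 < t - s := sub_pos.2 hst
  have hd : DifferentiableOn ℝ g (Icc 0 T) := hg.differentiableOn two_ne_zero
  have hd2 : DifferentiableOn ℝ (td T g) (Icc 0 T) :=
    (hg.derivWithin (m := 1) (uniqueDiffOn_Icc hT) (by norm_num)).differentiableOn one_ne_zero
  obtain ⟨c, hc, hc'⟩ := exists_hasDerivAt_eq_slope g (td T g) hst
    (hd.continuousOn.mono (Icc_subset_Icc hs.1 ht.2)) (fun x hx => by
      have hx' : x ∈ Ioo 0 T := ⟨hs.1.trans_lt hx.1, hx.2.trans_le ht.2⟩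
      exact ((hd x (Ioo_subset_Icc_self hx')).hasDerivWithinAt).hasDerivAt
        (Icc_mem_nhds hx'.1 hx'.2))
  rw [← hc']
  have hcI : c ∈ Icc 0 T := ⟨hs.1.trans hc.1.le, hc.2.le.trans ht.2⟩
  refine (abs_sub_le_of_td hd2 hK hs hcI).trans ?_
  have hK0 : 0 ≤ K := (abs_nonneg _).trans (hK s hs)
  rw [abs_of_pos (sub_pos.2 hc.1)]
  gcongr
  exact hc.2.le

/-- A function that is Lipschitz in time has a bounded time derivative. -/
lemma abs_td_le {g : ℝ → ℝ} (hT : 0 < T) (hg : DifferentiableOn ℝ g (Icc 0 T)) {B t : ℝ}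
    (ht : t ∈ Icc 0 T) (hB : ∀ s ∈ Icc 0 T, |g s - g t| ≤ B * |s - t|) : |td T g t| ≤ B := by
  have h1 := hasDerivWithinAt_iff_tendsto_slope.1 (hg t ht).hasDerivWithinAt
  have h2 : (nhdsWithin t (Icc 0 T \ {t})).NeBot :=
    accPt_principal_iff_nhdsWithin.1 ((uniqueDiffOn_Icc hT) t ht).accPt
  refine le_of_tendsto h1.abs ?_
  filter_upwards [self_mem_nhdsWithin] with s hs
  have h3 : 0 < |s - t| := abs_pos.2 (sub_ne_zero.2 hs.2)
  rw [slope_def_field, abs_div, div_le_iff₀ h3]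
  exact hB s hs.1

lemma td_sub {g₁ g₂ : ℝ → ℝ} {t : ℝ} (ht : t ∈ Icc 0 T)
    (h₁ : DifferentiableOn ℝ g₁ (Icc 0 T)) (h₂ : DifferentiableOn ℝ g₂ (Icc 0 T)) :
    td T (fun s => g₁ s - g₂ s) t = td T g₁ t - td T g₂ t :=
  derivWithin_fun_sub (h₁ t ht) (h₂ t ht)

lemma td_mul {g₁ g₂ : ℝ → ℝ} {t : ℝ} (ht : t ∈ Icc 0 T)
    (h₁ : DifferentiableOn ℝ g₁ (Icc 0 T)) (h₂ : DifferentiableOn ℝ g₂ (Icc 0 T)) :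
    td T (fun s => g₁ s * g₂ s) t = td T g₁ t * g₂ t + g₁ t * td T g₂ t :=
  derivWithin_fun_mul (h₁ t ht) (h₂ t ht)

lemma pd_add {g₁ g₂ : (Fin d → ℝ) → ℝ} (h₁ : Differentiable ℝ g₁) (h₂ : Differentiable ℝ g₂)
    (j : Fin d) (x : Fin d → ℝ) : pd j (fun y => g₁ y + g₂ y) x = pd j g₁ x + pd j g₂ x := by
  simp only [pd]
  rw [fderiv_fun_add (h₁ x) (h₂ x)]
  simp

lemma pd_sub {g₁ g₂ : (Fin d → ℝ) → ℝ} (h₁ : Differentiable ℝ g₁) (h₂ : Differentiable ℝ g₂)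
    (j : Fin d) (x : Fin d → ℝ) : pd j (fun y => g₁ y - g₂ y) x = pd j g₁ x - pd j g₂ x := by
  simp only [pd]
  rw [fderiv_fun_sub (h₁ x) (h₂ x)]
  simp

lemma pd_mul {g₁ g₂ : (Fin d → ℝ) → ℝ} (h₁ : Differentiable ℝ g₁) (h₂ : Differentiable ℝ g₂)
    (j : Fin d) (x : Fin d → ℝ) :
    pd j (fun y => g₁ y * g₂ y) x = pd j g₁ x * g₂ x + g₁ x * pd j g₂ x := by
  simp only [pd]
  rw [fderiv_fun_mul (h₁ x) (h₂ x)]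
  simp
  ring

lemma pd_const_mul {g : (Fin d → ℝ) → ℝ} (h : Differentiable ℝ g) (c : ℝ)
    (j : Fin d) (x : Fin d → ℝ) : pd j (fun y => c * g y) x = c * pd j g x := by
  simp only [pd]
  rw [fderiv_const_mul (h x)]
  simp

lemma pd_sum {ι : Type*} (s : Finset ι) {g : ι → (Fin d → ℝ) → ℝ}
    (h : ∀ i ∈ s, Differentiable ℝ (g i)) (j : Fin d) (x : Fin d → ℝ) :
    pd j (fun y => ∑ i ∈ s, g i y) x = ∑ i ∈ s, pd j (g i) x := by
  simp only [pd]
  rw [fderiv_fun_sum fun i hi => h i hi x]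
  simp

lemma pd_comp {φ : ℝ → ℝ} {φ' : ℝ} {g : (Fin d → ℝ) → ℝ} (h : Differentiable ℝ g)
    {x : Fin d → ℝ} (hφ : HasDerivAt φ φ' (g x)) (j : Fin d) :
    pd j (fun y => φ (g y)) x = φ' * pd j g x := by
  have h1 : HasFDerivAt (fun y => φ (g y)) _ x := hφ.comp_hasFDerivAt x (h x).hasFDerivAt
  rw [pd, h1.fderiv]
  simp [pd]

/-- Symmetry of the second derivatives. -/
lemma pd_comm {g : (Fin d → ℝ) → ℝ} (h : ContDiff ℝ 2 g) (i j : Fin d) (x : Fin d → ℝ) :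
    pd i (pd j g) x = pd j (pd i g) x := by
  have hd : DifferentiableAt ℝ (fderiv ℝ g) x :=
    ((h.fderiv_right (m := 1) (by norm_num)).differentiable one_ne_zero) x
  have h1 : ∀ i j, pd i (pd j g) x
      = fderiv ℝ (fderiv ℝ g) x (Pi.single i 1) (Pi.single j 1) := by
    intro i j
    have e1 : HasFDerivAt (fun y => fderiv ℝ g y (Pi.single j (1 : ℝ)))
        ((ContinuousLinearMap.apply ℝ ℝ (Pi.single j (1 : ℝ) : Fin d → ℝ)).comp
          (fderiv ℝ (fderiv ℝ g) x)) x :=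
      (ContinuousLinearMap.apply ℝ ℝ (Pi.single j (1 : ℝ) : Fin d → ℝ)).hasFDerivAt.comp x
        hd.hasFDerivAt
    change fderiv ℝ (fun y => fderiv ℝ g y (Pi.single j (1 : ℝ))) x (Pi.single i 1) = _
    rw [e1.fderiv]
    rfl
  rw [h1, h1]
  exact (h.contDiffAt.isSymmSndFDerivAt (by simp)).eq _ _

lemma IsPeriodic.pd {g : (Fin d → ℝ) → ℝ} (h : IsPeriodic g) (j : Fin d) :
    IsPeriodic (pd j g) := by
  intro x i
  have h1 : (fun y => g (y + Pi.single i 1)) = g := funext fun y => h y i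
  rw [MACNS.pd, ← fderiv_comp_add_right, h1]
  rfl

lemma IsSmooth.lipBound (hf : IsSmooth T f) {K t : ℝ} (ht : t ∈ Icc 0 T)
    (hK : ∀ x i, |pd i (f t) x| ≤ K) : LipBound (d * K) (f t) :=
  lipBound_of_pd (hf.differentiable ht) hK

/-- Lipschitz continuity in space of time increments. -/
lemma IsSmooth.lipBound_sub (hT : 0 < T) (hf : IsSmooth T f) {K s t : ℝ}
    (hK : ∀ t ∈ Icc 0 T, ∀ x i, |td T (fun s => pd i (f s) x) t| ≤ K) (hs : s ∈ Icc 0 T)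
    (ht : t ∈ Icc 0 T) : LipBound (d * (K * |t - s|)) (fun x => f t x - f s x) := by
  have h1 := hf.differentiable ht
  have h2 := hf.differentiable hs
  refine lipBound_of_pd (h1.fun_sub h2) fun x i => ?_
  rw [pd_sub h1 h2]
  exact abs_sub_le_of_td (hf.differentiableOn_pd hT i x) (fun s hs => hK s hs x i) hs ht

/-- Lipschitz continuity in space of the time derivative. -/
lemma IsSmooth.lipBound_td (hT : 0 < T) (hf : IsSmooth T f) {K t : ℝ}
    (hK : ∀ t ∈ Icc 0 T, ∀ x i, |td T (fun s => pd i (f s) x) t| ≤ K)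
    (ht : t ∈ Icc 0 T) : LipBound (d * K) (fun x => td T (fun s => f s x) t) := by
  intro x y
  have h1 := hf.differentiableOn_time x
  have h2 := hf.differentiableOn_time y
  rw [← td_sub ht h1 h2]
  -- The hypothesis bounds the time derivative of the gradient. Instead of interchanging
  -- derivatives, the time increment is shown to be Lipschitz in space with a constant proportional
  -- to its length, and the limit of the quotient is taken.
  refine abs_td_le hT (h1.fun_sub h2) ht fun s hs => ?_
  have h3 := hf.lipBound_sub hT hK ht hs x y
  rw [show f s x - f s y - (f t x - f t y) = f s x - f t x - (f s y - f t y) by ring]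
  refine h3.trans (le_of_eq ?_)
  ring

end SpaceTime

/-! ### Non-conservative form of the equations. -/

section StrongSolution

variable {d : ℕ} {T a γ μ lam : ℝ} {r : ℝ → (Fin d → ℝ) → ℝ} {U : ℝ → (Fin d → ℝ) → Fin d → ℝ}

lemma IsStrongSolution.density (h : IsStrongSolution T a γ μ lam r U) : IsSmooth T r :=
  h.smooth_density

lemma IsStrongSolution.velocity (h : IsStrongSolution T a γ μ lam r U) (i : Fin d) :
    IsSmooth T (fun t x => U t x i) :=
  (contDiffOn_pi.1 h.smooth_velocity) i

lemma IsStrongSolution.isPeriodic_density (h : IsStrongSolution T a γ μ lam r U) {t : ℝ}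
    (ht : t ∈ Icc 0 T) : IsPeriodic (r t) := h.periodic_density t ht

lemma IsStrongSolution.isPeriodic_velocity (h : IsStrongSolution T a γ μ lam r U) {t : ℝ}
    (ht : t ∈ Icc 0 T) (i : Fin d) : IsPeriodic (fun x => U t x i) := fun x j => by
  change U t (x + Pi.single j 1) i = U t x i
  rw [h.periodic_velocity t ht x j]

/-- The continuity equation in non-conservative form. -/
lemma IsStrongSolution.continuity (h : IsStrongSolution T a γ μ lam r U) {t : ℝ}
    (ht : t ∈ Icc 0 T) (x : Fin d → ℝ) :
    td T (fun s => r s x) t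
      + ∑ j, (pd j (r t) x * U t x j + r t x * pd j (fun y => U t y j) x) = 0 := by
  rw [← h.continuity_eq t ht x]
  congr 1
  exact Finset.sum_congr rfl fun j _ =>
    (pd_mul (h.density.differentiable ht) ((h.velocity j).differentiable ht) j x).symm

/-- The momentum equation in non-conservative form. -/
lemma IsStrongSolution.momentum (h : IsStrongSolution T a γ μ lam r U) {t : ℝ}
    (ht : t ∈ Icc 0 T) (x : Fin d → ℝ) (i : Fin d) :
    r t x * td T (fun s => U s x i) t + ∑ j, r t x * U t x j * pd j (fun y => U t y i) x
        + pd i (fun y => pressure a γ (r t y)) x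
      = μ * ∑ j, pd j (pd j (fun y => U t y i)) x
        + (μ + lam) * pd i (fun y => ∑ k, pd k (fun y => U t y k) y) x := by
  have hr := h.density.differentiable ht
  have hU := fun i => (h.velocity i).differentiable ht
  have hpU := fun i j => (h.velocity i).differentiable_pd ht j
  have h1 := h.momentum_eq t ht x i
  have h2 := h.continuity ht x
  rw [td_mul ht (h.density.differentiableOn_time x) ((h.velocity i).differentiableOn_time x)] at h1
  have h3 : ∀ j, pd j (fun y => r t y * U t y i * U t y j) x
      = (pd j (r t) x * U t x j + r t x * pd j (fun y => U t y j) x) * U t x i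
        + r t x * U t x j * pd j (fun y => U t y i) x := by
    intro j
    rw [pd_mul (g₁ := fun y => r t y * U t y i) (hr.mul (hU i)) (hU j), pd_mul hr (hU i)]
    ring
  -- Symmetry of second derivatives turns the divergence of the transposed gradient into the
  -- gradient of the divergence, so that `μ` joins `lam` there.
  have h4 : ∀ j, pd j (stress μ lam (U t) i j) x
      = μ * (pd j (pd j (fun y => U t y i)) x + pd i (pd j (fun y => U t y j)) x)
        + if i = j then lam * pd i (fun y => ∑ k, pd k (fun y => U t y k) y) x else 0 := by
    intro j
    have hs : Differentiable ℝ fun y => ∑ k, pd k (fun y => U t y k) y :=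
      Differentiable.fun_sum fun k _ => hpU k k
    have e1 : pd j (fun y => μ * (pd j (fun y => U t y i) y + pd i (fun y => U t y j) y)) x
        = μ * (pd j (pd j (fun y => U t y i)) x + pd i (pd j (fun y => U t y j)) x) := by
      rw [pd_const_mul ((hpU i j).fun_add (hpU j i)), pd_add (hpU i j) (hpU j i),
        pd_comm ((h.velocity j).space ht) j i]
    rw [← e1]
    by_cases hij : i = j
    · subst hij
      rw [if_pos rfl, ← pd_const_mul hs]
      rw [← pd_add (((hpU i i).fun_add (hpU i i)).const_mul μ) (hs.const_mul lam)]
      congr 1; funext y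
      simp [stress]
    · rw [if_neg hij, add_zero]
      congr 1; funext y
      simp [stress, hij]
  simp only [h3, h4] at h1
  rw [pd_sum _ fun k _ => hpU k k]
  have h5 : ∑ j, ((pd j (r t) x * U t x j + r t x * pd j (fun y => U t y j) x) * U t x i
        + r t x * U t x j * pd j (fun y => U t y i) x)
      = (∑ j, (pd j (r t) x * U t x j + r t x * pd j (fun y => U t y j) x)) * U t x i
        + ∑ j, r t x * U t x j * pd j (fun y => U t y i) x := by
    rw [Finset.sum_add_distrib, Finset.sum_mul]
  have h6 : ∑ j, (μ * (pd j (pd j fun y => U t y i) x + pd i (pd j fun y => U t y j) x)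
        + if i = j then lam * pd i (fun y => ∑ k, pd k (fun y => U t y k) y) x else 0)
      = μ * (∑ j, pd j (pd j fun y => U t y i) x + ∑ j, pd i (pd j fun y => U t y j) x)
        + lam * ∑ j, pd i (pd j fun y => U t y j) x := by
    rw [Finset.sum_add_distrib, Finset.sum_ite_eq, if_pos (Finset.mem_univ i), ← Finset.mul_sum,
      Finset.sum_add_distrib, pd_sum _ fun k _ => hpU k k]
  rw [h5, h6] at h1
  -- Subtracting `U_i` times the continuity equation removes the conservative form.
  linear_combination h1 - U t x i * h2

end StrongSolution

/-! ### The pressure law and its potential on a compact range of densities. -/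

section Coefficients

variable {a γ : ℝ}

/-- Second derivative of the pressure potential. -/
noncomputable def potentialDeriv₂ (a γ x : ℝ) : ℝ := a * γ * x ^ (γ - 2)

lemma hasDerivAt_potentialDeriv (hγ : 1 < γ) {x : ℝ} (hx : 0 < x) :
    HasDerivAt (potentialDeriv a γ) (potentialDeriv₂ a γ x) x := by
  have hγ1 : γ - 1 ≠ 0 := by linarith
  have h := (((Real.hasDerivAt_rpow_const (p := γ - 1) (Or.inl hx.ne')).const_mul γ).sub_const
    1).const_mul (a / (γ - 1))
  refine h.congr_deriv ?_
  rw [potentialDeriv₂, show γ - 1 - 1 = γ - 2 by ring]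
  field_simp

lemma mul_potentialDeriv₂ {x : ℝ} (hx : 0 < x) :
    x * potentialDeriv₂ a γ x = a * γ * x ^ (γ - 1) := by
  rw [potentialDeriv₂, show γ - 1 = γ - 2 + 1 by ring, Real.rpow_add_one hx.ne']
  ring

lemma hasDerivAt_pressure {x : ℝ} (hx : 0 < x) :
    HasDerivAt (pressure a γ) (x * potentialDeriv₂ a γ x) x := by
  rw [mul_potentialDeriv₂ hx, mul_assoc]
  exact (Real.hasDerivAt_rpow_const (Or.inl hx.ne')).const_mul a

/-- Bounds for the coefficients on a compact range of densities. -/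
structure CoeffBound (a γ rlo rhi C : ℝ) : Prop where
  nonneg : 0 ≤ C
  deriv_lip : ∀ x ∈ Icc rlo rhi, ∀ y ∈ Icc rlo rhi,
    |potentialDeriv a γ x - potentialDeriv a γ y| ≤ C * |x - y|
  pressure_lip : ∀ x ∈ Icc rlo rhi, ∀ y ∈ Icc rlo rhi,
    |pressure a γ x - pressure a γ y| ≤ C * |x - y|
  deriv₂_lip : ∀ x ∈ Icc rlo rhi, ∀ y ∈ Icc rlo rhi,
    |potentialDeriv₂ a γ x - potentialDeriv₂ a γ y| ≤ C * |x - y|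
  deriv₂_le : ∀ x ∈ Icc rlo rhi, |potentialDeriv₂ a γ x| ≤ C
  sound_lip : ∀ x ∈ Icc rlo rhi, ∀ y ∈ Icc rlo rhi,
    |a * γ * x ^ (γ - 1) - y * potentialDeriv₂ a γ y| ≤ C * |x - y|
  val_le : ∀ x ∈ Icc rlo rhi, |x| ≤ C

lemma exists_coeffBound (a γ : ℝ) {rlo : ℝ} (rhi : ℝ) (hlo : 0 < rlo) :
    ∃ C, CoeffBound a γ rlo rhi C := by
  obtain ⟨B₁, hB₁, -, h₁⟩ := rpow_bounded_lipschitz (γ - 1) rhi hlo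
  obtain ⟨B₂, hB₂, -, h₂⟩ := rpow_bounded_lipschitz γ rhi hlo
  obtain ⟨B₃, hB₃, h₃', h₃⟩ := rpow_bounded_lipschitz (γ - 2) rhi hlo
  have n1 : 0 ≤ |a / (γ - 1) * γ| * B₁ := by positivity
  have n2 : 0 ≤ |a| * B₂ := by positivity
  have n3 : 0 ≤ |a * γ| * B₃ := by positivity
  have n4 : 0 ≤ |a * γ| * B₁ := by positivity
  set C := |a / (γ - 1) * γ| * B₁ + |a| * B₂ + |a * γ| * B₃ + |a * γ| * B₁ + |rhi| with hC
  have hr := abs_nonneg rhi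
  refine ⟨C, ⟨by positivity, ?_, ?_, ?_, ?_, ?_, ?_⟩⟩
  · intro x hx y hy
    rw [show potentialDeriv a γ x - potentialDeriv a γ y
      = a / (γ - 1) * γ * (x ^ (γ - 1) - y ^ (γ - 1)) by rw [potentialDeriv, potentialDeriv]; ring,
      abs_mul]
    calc _ ≤ |a / (γ - 1) * γ| * (B₁ * |x - y|) := by gcongr; exact h₁ x hx y hy
      _ = |a / (γ - 1) * γ| * B₁ * |x - y| := by ring
      _ ≤ C * |x - y| := mul_le_mul_of_nonneg_right (by linarith) (abs_nonneg _)
  · intro x hx y hy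
    rw [show pressure a γ x - pressure a γ y = a * (x ^ γ - y ^ γ) by
      rw [pressure, pressure]; ring, abs_mul]
    calc _ ≤ |a| * (B₂ * |x - y|) := by gcongr; exact h₂ x hx y hy
      _ = |a| * B₂ * |x - y| := by ring
      _ ≤ C * |x - y| := mul_le_mul_of_nonneg_right (by linarith) (abs_nonneg _)
  · intro x hx y hy
    rw [show potentialDeriv₂ a γ x - potentialDeriv₂ a γ y
      = a * γ * (x ^ (γ - 2) - y ^ (γ - 2)) by rw [potentialDeriv₂, potentialDeriv₂]; ring, abs_mul]
    calc _ ≤ |a * γ| * (B₃ * |x - y|) := by gcongr; exact h₃ x hx y hy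
      _ = |a * γ| * B₃ * |x - y| := by ring
      _ ≤ C * |x - y| := mul_le_mul_of_nonneg_right (by linarith) (abs_nonneg _)
  · intro x hx
    rw [potentialDeriv₂, abs_mul]
    calc _ ≤ |a * γ| * B₃ := by gcongr; exact h₃' x hx
      _ ≤ C := by linarith
  · intro x hx y hy
    rw [mul_potentialDeriv₂ (hlo.trans_le hy.1), ← mul_sub, abs_mul]
    calc _ ≤ |a * γ| * (B₁ * |x - y|) := by gcongr; exact h₁ x hx y hy
      _ = |a * γ| * B₁ * |x - y| := by ring
      _ ≤ C * |x - y| := mul_le_mul_of_nonneg_right (by linarith) (abs_nonneg _)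
  · intro x hx
    have := le_abs_self rhi
    rw [abs_of_pos (hlo.trans_le hx.1)]
    linarith [hx.2]

/-- The mean value theorem makes the increment of `H'` linear in the increment of the density. The
latter commutes with cell averages, which `H'` itself does not. -/
lemma exists_potentialDeriv_sub (hγ : 1 < γ) {rlo rhi x y : ℝ} (hlo : 0 < rlo)
    (hx : x ∈ Icc rlo rhi) (hy : y ∈ Icc rlo rhi) :
    ∃ ξ ∈ Icc rlo rhi, |ξ - y| ≤ |x - y|
      ∧ potentialDeriv a γ x - potentialDeriv a γ y = potentialDeriv₂ a γ ξ * (x - y) := by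
  have key : ∀ u ∈ Icc rlo rhi, ∀ v ∈ Icc rlo rhi, u < v → ∃ ξ ∈ Ioo u v,
      potentialDeriv a γ v - potentialDeriv a γ u = potentialDeriv₂ a γ ξ * (v - u) := by
    intro u hu v hv huv
    have hpos : ∀ s, u ≤ s → 0 < s := fun s hs => hlo.trans_le (hu.1.trans hs)
    obtain ⟨ξ, hξ, h⟩ := exists_hasDerivAt_eq_slope (potentialDeriv a γ) (potentialDeriv₂ a γ) huv
      (fun s hs => (hasDerivAt_potentialDeriv hγ (hpos s hs.1)).continuousAt.continuousWithinAt)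
      (fun s hs => hasDerivAt_potentialDeriv hγ (hpos s hs.1.le))
    refine ⟨ξ, hξ, ?_⟩
    rw [h]
    field_simp [(sub_pos.2 huv).ne']
  rcases lt_trichotomy x y with hxy | hxy | hxy
  · obtain ⟨ξ, hξ, h⟩ := key x hx y hy hxy
    refine ⟨ξ, ⟨hx.1.trans hξ.1.le, hξ.2.le.trans hy.2⟩, ?_, by linarith⟩
    rw [abs_of_neg (sub_neg.2 hξ.2), abs_of_neg (sub_neg.2 hxy)]
    linarith [hξ.1]
  · subst hxy
    exact ⟨x, hx, le_rfl, by ring⟩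
  · obtain ⟨ξ, hξ, h⟩ := key y hy x hx hxy
    refine ⟨ξ, ⟨hy.1.trans hξ.1.le, hξ.2.le.trans hx.2⟩, ?_, h⟩
    rw [abs_of_pos (sub_pos.2 hξ.1), abs_of_pos (sub_pos.2 hxy)]
    linarith [hξ.2]

end Coefficients

/-! ### Consistency of averages and difference quotients at the cell corners. -/

section Nodal

variable {d N : ℕ} [NeZero N]

/-- Consistency of the cell averages of face averages. -/
lemma avgCell_faceProj_le {B : ℝ} {f : (Fin d → ℝ) → ℝ} (hf : IsPeriodic f) (h : LipBound B f)
    (hB : 0 ≤ B) {V : Fin d → Grid d N → ℝ} {i : Fin d} (hV : V i = faceProj N i f)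
    (k : Grid d N) : |avgCell V i k - f (corner k)| ≤ 2 * B * mesh N := by
  have h1 := abs_le.1 (h.faceProj_le hB i k)
  have h2 := abs_le.1 (h.faceProj_le hB i (k - e i))
  have h3 := abs_le.1 (h.corner_sub hf k i)
  rw [avgCell, hV, abs_le]
  have hm := mul_nonneg hB (mesh_pos N).le
  constructor <;> linarith [h1.1, h1.2, h2.1, h2.2, h3.1, h3.2]

lemma diffFace_avgCell_faceProj_le {B C : ℝ} {f : (Fin d → ℝ) → ℝ} (hf : IsPeriodic f)
    (hC : LipBound C f) (hd : Differentiable ℝ f) {j : Fin d} (h : LipBound B (pd j f))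
    (hB : 0 ≤ B) {V : Fin d → Grid d N → ℝ} {i : Fin d} (hV : V i = faceProj N i f)
    (k : Grid d N) : |diffFace j (avgCell V i) k - pd j f (corner k)| ≤ 3 * B * mesh N := by
  have h1 := abs_le.1 (diffFace_faceProj_le hf hC hd i j h hB k)
  have h2 := abs_le.1 (diffFace_faceProj_le hf hC hd i j h hB (k - e i))
  have h3 := abs_le.1 (h.corner_sub (hf.pd j) k i)
  rw [diffFace_avgCell, hV, abs_le]
  have hm := mul_nonneg hB (mesh_pos N).le
  constructor <;> linarith [h1.1, h1.2, h2.1, h2.2, h3.1, h3.2]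

lemma diffCell_faceProj_le {B C : ℝ} {f : (Fin d → ℝ) → ℝ} (hf : IsPeriodic f)
    (hC : LipBound C f) (hd : Differentiable ℝ f) {i : Fin d} (h : LipBound B (pd i f))
    (hB : 0 ≤ B) (k : Grid d N) :
    |diffCell i (faceProj N i f) k - pd i f (corner k)| ≤ 3 * B * mesh N := by
  have h2 := abs_le.1 (diffFace_faceProj_le hf hC hd i i h hB (k - e i))
  have h3 := abs_le.1 (h.corner_sub (hf.pd i) k i)
  rw [diffCell_eq_diffFace, abs_le]
  constructor <;> linarith [h2.1, h2.2, h3.1, h3.2]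

lemma abs_cellProj_le {f : (Fin d → ℝ) → ℝ} (hf : Continuous f) {ε : ℝ} {k : Grid d N}
    (h : ∀ x, ‖x - corner k‖ ≤ mesh N → |f x| ≤ ε) : |cellProj N f k| ≤ ε := by
  have := abs_cellProj_sub_le (c := 0) (ε := ε) hf (k := k) (by simpa using h)
  simpa using this

lemma cellProj_mem_Icc {f : (Fin d → ℝ) → ℝ} (hf : Continuous f) {lo hi : ℝ}
    (h : ∀ x, lo ≤ f x ∧ f x ≤ hi) (k : Grid d N) :
    lo ≤ cellProj N f k ∧ cellProj N f k ≤ hi := by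
  have := abs_le.1 (abs_cellProj_sub_le (c := (lo + hi) / 2) (ε := (hi - lo) / 2) hf (k := k)
    fun x _ => by rw [abs_le]; constructor <;> linarith [(h x).1, (h x).2])
  constructor <;> linarith [this.1, this.2]

/-- Replacing a face quantity, tested with the differences of cell averages, by a nearby one,
tested with the differences of the face values. -/
lemma avg_parts_le {A G : Grid d N → ℝ} {ε : ℝ} (i j : Fin d) (v : Fin d → Grid d N → ℝ)
    (h1 : ∀ k, |A k - G k| ≤ ε) (h2 : ∀ k, |A (k + e i) - G k| ≤ ε) :
    |gridInt (fun k => A k * diffFace j (avgCell v i) k)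
      - gridInt (fun k => G k * diffFace j (v i) k)|
    ≤ ε * gridInt (fun k => |diffFace j (v i) k|) := by
  -- The averaging in direction `i` is moved from the test field to `A`, so both integrals contain
  -- the same differences of face values.
  have e1 : gridInt (fun k => A k * diffFace j (avgCell v i) k)
      = gridInt (fun k => (A k + A (k + e i)) / 2 * diffFace j (v i) k) := by
    have s1 : gridInt (fun k => A k * diffFace j (v i) (k - e i))
        = gridInt (fun k => A (k + e i) * diffFace j (v i) k) := by
      rw [← gridInt_shift (e i) (fun k => A k * diffFace j (v i) (k - e i))]
      simp only [add_sub_cancel_right]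
    have s2 : (fun k => A k * diffFace j (avgCell v i) k)
        = fun k => 1 / 2 * (A k * diffFace j (v i) k)
          + 1 / 2 * (A k * diffFace j (v i) (k - e i)) := by
      funext k; rw [diffFace_avgCell]; ring
    have s3 : (fun k => (A k + A (k + e i)) / 2 * diffFace j (v i) k)
        = fun k => 1 / 2 * (A k * diffFace j (v i) k)
          + 1 / 2 * (A (k + e i) * diffFace j (v i) k) := by
      funext k; ring
    rw [s2, s3]
    simp only [gridInt_add, gridInt_mul_left]
    rw [s1]
  rw [e1, ← gridInt_sub, ← gridInt_mul_left]
  refine (abs_gridInt_le _).trans (gridInt_mono fun k => ?_)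
  rw [← sub_mul, abs_mul]
  gcongr
  have f1 := abs_le.1 (h1 k)
  have f2 := abs_le.1 (h2 k)
  rw [abs_le]
  constructor <;> linarith [f1.1, f1.2, f2.1, f2.2]

end Nodal

/-- A strong solution together with the bounds on which the constants may depend. -/
structure BoundedSolution {d : ℕ} (T a γ μ lam rlo rhi K : ℝ) (r : ℝ → (Fin d → ℝ) → ℝ)
    (U : ℝ → (Fin d → ℝ) → Fin d → ℝ) : Prop where
  sol : IsStrongSolution T a γ μ lam r U
  range : ∀ t ∈ Icc 0 T, ∀ x, r t x ∈ Icc rlo rhi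
  bound : DerivBound T K r U
  time_pos : 0 < T
  lo_pos : 0 < rlo

/-! ### Distance between the projections and the strong solution. -/

namespace BoundedSolution

variable {d : ℕ} {T a γ μ lam rlo rhi K : ℝ} {r : ℝ → (Fin d → ℝ) → ℝ}
  {U : ℝ → (Fin d → ℝ) → Fin d → ℝ} {s t : ℝ}

lemma nonneg (h : BoundedSolution T a γ μ lam rlo rhi K r U) : 0 ≤ K :=
  (abs_nonneg _).trans (h.bound.dt_r 0 ⟨le_rfl, h.time_pos.le⟩ 0)

lemma density_lip (h : BoundedSolution T a γ μ lam rlo rhi K r U) (ht : t ∈ Icc 0 T) :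
    LipBound (d * K) (r t) := h.sol.density.lipBound ht (h.bound.grad_r t ht)

lemma vel_lip (h : BoundedSolution T a γ μ lam rlo rhi K r U) (ht : t ∈ Icc 0 T) (i : Fin d) :
    LipBound (d * K) (fun x => U t x i) :=
  (h.sol.velocity i).lipBound ht fun x j => h.bound.grad_vel t ht x i j

lemma grad_lip (h : BoundedSolution T a γ μ lam rlo rhi K r U) (ht : t ∈ Icc 0 T) (i j : Fin d) :
    LipBound (d * K) (pd j fun x => U t x i) :=
  lipBound_of_pd ((h.sol.velocity i).differentiable_pd ht j)
    fun x l => h.bound.grad_grad_vel t ht x i j l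

lemma density_time (h : BoundedSolution T a γ μ lam rlo rhi K r U) (hs : s ∈ Icc 0 T)
    (ht : t ∈ Icc 0 T) (x : Fin d → ℝ) : |r t x - r s x| ≤ K * |t - s| :=
  abs_sub_le_of_td (h.sol.density.differentiableOn_time x) (fun s hs => h.bound.dt_r s hs x) hs ht

lemma grad_density_time (h : BoundedSolution T a γ μ lam rlo rhi K r U) (hs : s ∈ Icc 0 T)
    (ht : t ∈ Icc 0 T) (x : Fin d → ℝ) (i : Fin d) :
    |pd i (r t) x - pd i (r s) x| ≤ K * |t - s| :=
  abs_sub_le_of_td (h.sol.density.differentiableOn_pd h.time_pos i x)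
    (fun s hs => h.bound.dt_grad_r s hs x i) hs ht

lemma vel_time (h : BoundedSolution T a γ μ lam rlo rhi K r U) (hs : s ∈ Icc 0 T)
    (ht : t ∈ Icc 0 T) (x : Fin d → ℝ) (i : Fin d) : |U t x i - U s x i| ≤ K * |t - s| :=
  abs_sub_le_of_td ((h.sol.velocity i).differentiableOn_time x)
    (fun s hs => h.bound.dt_vel s hs x i) hs ht

lemma grad_vel_time (h : BoundedSolution T a γ μ lam rlo rhi K r U) (hs : s ∈ Icc 0 T)
    (ht : t ∈ Icc 0 T) (x : Fin d → ℝ) (i j : Fin d) :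
    |pd j (fun y => U t y i) x - pd j (fun y => U s y i) x| ≤ K * |t - s| :=
  abs_sub_le_of_td ((h.sol.velocity i).differentiableOn_pd h.time_pos j x)
    (fun s hs => h.bound.dt_grad_vel s hs x i j) hs ht

lemma dt_vel_lip (h : BoundedSolution T a γ μ lam rlo rhi K r U) (ht : t ∈ Icc 0 T) (i : Fin d) :
    LipBound (d * K) (fun x => td T (fun s => U s x i) t) :=
  (h.sol.velocity i).lipBound_td h.time_pos (fun t ht x j => h.bound.dt_grad_vel t ht x i j) ht

lemma vel_incr_lip (h : BoundedSolution T a γ μ lam rlo rhi K r U) (hs : s ∈ Icc 0 T)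
    (ht : t ∈ Icc 0 T) (i : Fin d) :
    LipBound (d * (K * |t - s|)) (fun x => U t x i - U s x i) :=
  (h.sol.velocity i).lipBound_sub h.time_pos (fun t ht x j => h.bound.dt_grad_vel t ht x i j) hs ht

variable (N : ℕ) [NeZero N]

/-- The error consists of the averaging, the distance of `x` from the corner, and the time shift
from `t` to `s`. Arbitrary `x` and `s` are allowed, because the differential equations are later
used pointwise in a cell at a time other than `t`. The estimates up to `density_le` follow the same
pattern. -/
lemma avgCell_vel_le (h : BoundedSolution T a γ μ lam rlo rhi K r U) (hs : s ∈ Icc 0 T)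
    (ht : t ∈ Icc 0 T) {τ : ℝ} (hτ : |t - s| ≤ τ) (i : Fin d) (k : Grid d N) (x : Fin d → ℝ)
    (hx : ‖x - corner k‖ ≤ mesh N) :
    |avgCell (fun i => faceProj N i fun x => U t x i) i k - U s x i|
      ≤ (3 * (d * K) + K) * (mesh N + τ) := by
  have hK := h.nonneg
  have hm := mesh_pos N
  have hB : 0 ≤ d * K := by positivity
  have h1 := abs_le.1 (avgCell_faceProj_le (V := fun i => faceProj N i fun x => U t x i)
    (h.sol.isPeriodic_velocity ht i) (h.vel_lip ht i) hB (i := i) rfl k)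
  have h2 := abs_le.1 ((h.vel_lip ht i x (corner k)).trans
    (mul_le_mul_of_nonneg_left hx hB))
  have h3 := abs_le.1 ((h.vel_time hs ht x i).trans (mul_le_mul_of_nonneg_left hτ hK))
  have hτ0 := (abs_nonneg _).trans hτ
  have n1 : 0 ≤ d * K * τ := by positivity
  have n2 : 0 ≤ K * mesh N := by positivity
  rw [abs_le]
  constructor <;> linarith [h1.1, h1.2, h2.1, h2.2, h3.1, h3.2]

lemma diffFace_vel_le (h : BoundedSolution T a γ μ lam rlo rhi K r U) (hs : s ∈ Icc 0 T)
    (ht : t ∈ Icc 0 T) {τ : ℝ} (hτ : |t - s| ≤ τ) (i j : Fin d) (k : Grid d N) (x : Fin d → ℝ)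
    (hx : ‖x - corner k‖ ≤ mesh N) :
    |diffFace j (faceProj N i fun x => U t x i) k - pd j (fun y => U s y i) x|
      ≤ (3 * (d * K) + K) * (mesh N + τ) := by
  have hK := h.nonneg
  have hm := mesh_pos N
  have hB : 0 ≤ d * K := by positivity
  have h1 := abs_le.1 (diffFace_faceProj_le
    (h.sol.isPeriodic_velocity ht i) (h.vel_lip ht i) ((h.sol.velocity i).differentiable ht) i j
    (h.grad_lip ht i j) hB k)
  have h2 := abs_le.1 ((h.grad_lip ht i j x (corner k)).trans
    (mul_le_mul_of_nonneg_left hx hB))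
  have h3 := abs_le.1 ((h.grad_vel_time hs ht x i j).trans (mul_le_mul_of_nonneg_left hτ hK))
  have hτ0 := (abs_nonneg _).trans hτ
  have n1 : 0 ≤ d * K * τ := by positivity
  have n2 : 0 ≤ K * mesh N := by positivity
  rw [abs_le]
  constructor <;> linarith [h1.1, h1.2, h2.1, h2.2, h3.1, h3.2]

lemma diffFace_avgCell_vel_le (h : BoundedSolution T a γ μ lam rlo rhi K r U) (hs : s ∈ Icc 0 T)
    (ht : t ∈ Icc 0 T) {τ : ℝ} (hτ : |t - s| ≤ τ) (i j : Fin d) (k : Grid d N) (x : Fin d → ℝ)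
    (hx : ‖x - corner k‖ ≤ mesh N) :
    |diffFace j (avgCell (fun i => faceProj N i fun x => U t x i) i) k
        - pd j (fun y => U s y i) x| ≤ (4 * (d * K) + K) * (mesh N + τ) := by
  have hK := h.nonneg
  have hm := mesh_pos N
  have hB : 0 ≤ d * K := by positivity
  have h1 := abs_le.1 (diffFace_avgCell_faceProj_le
    (V := fun i => faceProj N i fun x => U t x i)
    (h.sol.isPeriodic_velocity ht i) (h.vel_lip ht i) ((h.sol.velocity i).differentiable ht)
    (h.grad_lip ht i j) hB (i := i) rfl k)
  have h2 := abs_le.1 ((h.grad_lip ht i j x (corner k)).trans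
    (mul_le_mul_of_nonneg_left hx hB))
  have h3 := abs_le.1 ((h.grad_vel_time hs ht x i j).trans (mul_le_mul_of_nonneg_left hτ hK))
  have hτ0 := (abs_nonneg _).trans hτ
  have n1 : 0 ≤ d * K * τ := by positivity
  have n2 : 0 ≤ K * mesh N := by positivity
  rw [abs_le]
  constructor <;> linarith [h1.1, h1.2, h2.1, h2.2, h3.1, h3.2]

lemma divh_vel_le (h : BoundedSolution T a γ μ lam rlo rhi K r U) (hs : s ∈ Icc 0 T)
    (ht : t ∈ Icc 0 T) {τ : ℝ} (hτ : |t - s| ≤ τ) (k : Grid d N) (x : Fin d → ℝ)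
    (hx : ‖x - corner k‖ ≤ mesh N) :
    |divh (fun i => faceProj N i fun x => U t x i) k - ∑ i, pd i (fun y => U s y i) x|
      ≤ d * ((4 * (d * K) + K) * (mesh N + τ)) := by
  have hK := h.nonneg
  have hm := mesh_pos N
  have hB : 0 ≤ d * K := by positivity
  rw [divh, ← Finset.sum_sub_distrib]
  refine (Finset.abs_sum_le_sum_abs _ _).trans ?_
  refine (Finset.sum_le_sum (g := fun _ => (4 * (d * K) + K) * (mesh N + τ)) fun i _ => ?_).trans
    (by simp)
  have h1 := abs_le.1 (diffCell_faceProj_le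
    (h.sol.isPeriodic_velocity ht i) (h.vel_lip ht i) ((h.sol.velocity i).differentiable ht)
    (h.grad_lip ht i i) hB k)
  have h2 := abs_le.1 ((h.grad_lip ht i i x (corner k)).trans
    (mul_le_mul_of_nonneg_left hx hB))
  have h3 := abs_le.1 ((h.grad_vel_time hs ht x i i).trans (mul_le_mul_of_nonneg_left hτ hK))
  have hτ0 := (abs_nonneg _).trans hτ
  have n1 : 0 ≤ d * K * τ := by positivity
  have n2 : 0 ≤ K * mesh N := by positivity
  rw [abs_le]
  constructor <;> linarith [h1.1, h1.2, h2.1, h2.2, h3.1, h3.2]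

lemma density_le (h : BoundedSolution T a γ μ lam rlo rhi K r U) (hs : s ∈ Icc 0 T)
    (ht : t ∈ Icc 0 T) {τ : ℝ} (hτ : |t - s| ≤ τ) (k : Grid d N) (x : Fin d → ℝ)
    (hx : ‖x - corner k‖ ≤ mesh N) :
    |cellProj N (r t) k - r s x| ≤ (2 * (d * K) + K) * (mesh N + τ) := by
  have hK := h.nonneg
  have hm := mesh_pos N
  have hB : 0 ≤ d * K := by positivity
  have h1 := abs_le.1 ((h.density_lip ht).cellProj_le hB k)
  have h2 := abs_le.1 ((h.density_lip ht x (corner k)).trans (mul_le_mul_of_nonneg_left hx hB))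
  have h3 := abs_le.1 ((h.density_time hs ht x).trans (mul_le_mul_of_nonneg_left hτ hK))
  have hτ0 := (abs_nonneg _).trans hτ
  have n1 : 0 ≤ d * K * τ := by positivity
  have n2 : 0 ≤ K * mesh N := by positivity
  rw [abs_le]
  constructor <;> linarith [h1.1, h1.2, h2.1, h2.2, h3.1, h3.2]

lemma density_mem (h : BoundedSolution T a γ μ lam rlo rhi K r U)
    (ht : t ∈ Icc 0 T) (k : Grid d N) : cellProj N (r t) k ∈ Icc rlo rhi :=
  cellProj_mem_Icc (h.density_lip ht).continuous (h.range t ht) k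

end BoundedSolution

/-! ### Approximate integration by parts for the projections. -/

section WeakForms

variable {d N : ℕ} [NeZero N]

/-- Discrete integration by parts for one difference quotient of face averages. -/
lemma diffCell_parts_le {g : (Fin d → ℝ) → ℝ} {G : Grid d N → ℝ} {B ε : ℝ} (hg : IsPeriodic g)
    (hB : LipBound B g) (hB0 : 0 ≤ B) (hG : ∀ k, |G k - g (corner k)| ≤ ε) (i j : Fin d)
    (v : Fin d → Grid d N → ℝ) :
    |gridInt (fun k => diffCell j (faceProj N j g) k * avgCell v i k)
        + gridInt (fun k => G k * diffFace j (v i) k)|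
      ≤ (ε + 2 * B * mesh N) * gridInt (fun k => |diffFace j (v i) k|) := by
  have hn := mul_nonneg hB0 (mesh_pos N).le
  rw [gridInt_diffCell_mul, gridInt_neg, neg_add_eq_sub, abs_sub_comm]
  refine avg_parts_le i j v (fun k => ?_) (fun k => ?_)
  · have h1 := abs_le.1 (hB.faceProj_le hB0 j k)
    have h2 := abs_le.1 (hG k)
    rw [abs_le]
    constructor <;> linarith [h1.1, h1.2, h2.1, h2.2]
  · have h1 := abs_le.1 (hB.faceProj_le hB0 j (k + e i))
    have h2 := abs_le.1 (hG k)
    have h3 := abs_le.1 (hB.corner_add hg k i)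
    rw [abs_le]
    constructor <;> linarith [h1.1, h1.2, h2.1, h2.2, h3.1, h3.2]

lemma gridInt_sum_abs_diag_le (v : Fin d → Grid d N → ℝ) :
    ∑ i, gridInt (fun k => |diffFace i (v i) k|)
      ≤ gridInt (fun k => ∑ i, ∑ j, |diffFace j (v i) k|) := by
  rw [gridInt_sum]
  refine Finset.sum_le_sum fun i _ => gridInt_mono fun k => ?_
  exact Finset.single_le_sum (f := fun j => |diffFace j (v i) k|) (fun _ _ => abs_nonneg _)
    (Finset.mem_univ i)

/-- Discrete integration by parts for a gradient. -/
lemma grad_parts_le {g : (Fin d → ℝ) → ℝ} {G : Grid d N → ℝ} {B ε : ℝ} (hg : IsPeriodic g)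
    (hB : LipBound B g) (hB0 : 0 ≤ B) (hG : ∀ k, |G k - g (corner k)| ≤ ε)
    (v : Fin d → Grid d N → ℝ) :
    |gridInt (fun k => ∑ i, diffCell i (faceProj N i g) k * avgCell v i k)
        + gridInt (fun k => G k * divh v k)|
      ≤ (ε + 3 * B * mesh N) * gridInt (fun k => ∑ i, ∑ j, |diffFace j (v i) k|) := by
  have hn := mul_nonneg hB0 (mesh_pos N).le
  have hε : 0 ≤ ε := (abs_nonneg _).trans (hG 0)
  -- Differences across a cell are differences of face values at the shifted index; the shift is
  -- transferred to `G` and costs one Lipschitz step.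
  have h1 : gridInt (fun k => G k * divh v k)
      = ∑ i, gridInt (fun k => G (k + e i) * diffFace i (v i) k) := by
    rw [← gridInt_sum]
    simp only [divh, Finset.mul_sum]
    rw [gridInt_sum, gridInt_sum]
    refine Finset.sum_congr rfl fun i _ => ?_
    rw [← gridInt_shift (e i) (fun k => G k * diffCell i (v i) k)]
    simp only [diffCell_eq_diffFace, add_sub_cancel_right]
  rw [h1, gridInt_sum, ← Finset.sum_add_distrib]
  refine (Finset.abs_sum_le_sum_abs _ _).trans ?_
  refine le_trans (b := ∑ i, (ε + 3 * B * mesh N) * gridInt (fun k => |diffFace i (v i) k|))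
    (Finset.sum_le_sum fun i _ => ?_) ?_
  · have h2 : ∀ k, |G (k + e i) - g (corner k)| ≤ ε + B * mesh N := by
      intro k
      have e1 := abs_le.1 (hG (k + e i))
      have e2 := abs_le.1 (hB.corner_add hg k i)
      rw [abs_le]
      constructor <;> linarith [e1.1, e1.2, e2.1, e2.2]
    have := diffCell_parts_le (G := fun k => G (k + e i)) hg hB hB0 h2 i i v
    refine this.trans (le_of_eq ?_)
    ring
  · rw [← Finset.mul_sum]
    exact mul_le_mul_of_nonneg_left (gridInt_sum_abs_diag_le v) (by linarith)

end WeakForms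

/-! ### Consistency of the density equation and of the pressure gradient. -/

namespace BoundedSolution

variable {d : ℕ} {T a γ μ lam rlo rhi K C : ℝ} {r : ℝ → (Fin d → ℝ) → ℝ}
  {U : ℝ → (Fin d → ℝ) → Fin d → ℝ} {s t : ℝ}

lemma density_pos (h : BoundedSolution T a γ μ lam rlo rhi K r U) (ht : t ∈ Icc 0 T)
    (x : Fin d → ℝ) : 0 < r t x := h.lo_pos.trans_le (h.range t ht x).1

lemma potential_periodic (h : BoundedSolution T a γ μ lam rlo rhi K r U) (ht : t ∈ Icc 0 T) :
    IsPeriodic (fun x => potentialDeriv a γ (r t x)) := fun x i => by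
  change potentialDeriv a γ (r t (x + Pi.single i 1)) = _
  rw [h.sol.isPeriodic_density ht x i]

lemma pressure_periodic (h : BoundedSolution T a γ μ lam rlo rhi K r U) (ht : t ∈ Icc 0 T) :
    IsPeriodic (fun x => pressure a γ (r t x)) := fun x i => by
  change pressure a γ (r t (x + Pi.single i 1)) = _
  rw [h.sol.isPeriodic_density ht x i]

lemma potential_contDiff (h : BoundedSolution T a γ μ lam rlo rhi K r U) (ht : t ∈ Icc 0 T) :
    ContDiff ℝ 1 (fun x => potentialDeriv a γ (r t x)) := by
  have h1 : ContDiff ℝ 1 fun x => r t x ^ (γ - 1) :=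
    ((h.sol.density.space ht).of_le one_le_two).rpow_const_of_ne
      fun x => (h.density_pos ht x).ne'
  simp only [potentialDeriv]
  fun_prop

lemma pressure_contDiff (h : BoundedSolution T a γ μ lam rlo rhi K r U) (ht : t ∈ Icc 0 T) :
    ContDiff ℝ 1 (fun x => pressure a γ (r t x)) := by
  have h1 : ContDiff ℝ 1 fun x => r t x ^ γ :=
    ((h.sol.density.space ht).of_le one_le_two).rpow_const_of_ne
      fun x => (h.density_pos ht x).ne'
  simp only [pressure]
  fun_prop

lemma potential_lip (h : BoundedSolution T a γ μ lam rlo rhi K r U)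
    (hC : CoeffBound a γ rlo rhi C) (ht : t ∈ Icc 0 T) :
    LipBound (C * (d * K)) (fun x => potentialDeriv a γ (r t x)) := fun x y => by
  refine (hC.deriv_lip _ (h.range t ht x) _ (h.range t ht y)).trans ?_
  rw [mul_assoc]
  exact mul_le_mul_of_nonneg_left (h.density_lip ht x y) hC.nonneg

lemma pressure_lip (h : BoundedSolution T a γ μ lam rlo rhi K r U)
    (hC : CoeffBound a γ rlo rhi C) (ht : t ∈ Icc 0 T) :
    LipBound (C * (d * K)) (fun x => pressure a γ (r t x)) := fun x y => by
  refine (hC.pressure_lip _ (h.range t ht x) _ (h.range t ht y)).trans ?_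
  rw [mul_assoc]
  exact mul_le_mul_of_nonneg_left (h.density_lip ht x y) hC.nonneg

lemma pd_potential (h : BoundedSolution T a γ μ lam rlo rhi K r U) (hγ : 1 < γ)
    (ht : t ∈ Icc 0 T) (j : Fin d) (x : Fin d → ℝ) :
    pd j (fun x => potentialDeriv a γ (r t x)) x = potentialDeriv₂ a γ (r t x) * pd j (r t) x :=
  pd_comp (h.sol.density.differentiable ht)
    (hasDerivAt_potentialDeriv hγ (h.density_pos ht x)) j

lemma pd_pressure (h : BoundedSolution T a γ μ lam rlo rhi K r U)
    (ht : t ∈ Icc 0 T) (j : Fin d) (x : Fin d → ℝ) :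
    pd j (fun x => pressure a γ (r t x)) x
      = r t x * potentialDeriv₂ a γ (r t x) * pd j (r t) x :=
  pd_comp (h.sol.density.differentiable ht) (hasDerivAt_pressure (h.density_pos ht x)) j

variable (N : ℕ) [NeZero N]

lemma face_left (h : BoundedSolution T a γ μ lam rlo rhi K r U)
    (hC : CoeffBound a γ rlo rhi C) (ht : t ∈ Icc 0 T) (j : Fin d) (k : Grid d N) :
    |faceProj N j (fun x => potentialDeriv a γ (r t x)) k
      - potentialDeriv a γ (cellProj N (r t) k)| ≤ 2 * (C * (d * K)) * mesh N := by
  have hK := h.nonneg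
  have hC0 := hC.nonneg
  have hB : 0 ≤ d * K := by positivity
  have h1 := abs_le.1 ((h.potential_lip hC ht).faceProj_le (by positivity) j k)
  have h2 := abs_le.1 ((hC.deriv_lip _ (h.density_mem N ht k) _ (h.range t ht (corner k))).trans
    (mul_le_mul_of_nonneg_left ((h.density_lip ht).cellProj_le hB k) hC0))
  rw [abs_le]
  constructor <;> linarith [h1.1, h1.2, h2.1, h2.2]

lemma face_right (h : BoundedSolution T a γ μ lam rlo rhi K r U)
    (hC : CoeffBound a γ rlo rhi C) (ht : t ∈ Icc 0 T) (j : Fin d) (k : Grid d N) :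
    |potentialDeriv a γ (cellProj N (r t) (k + e j))
      - faceProj N j (fun x => potentialDeriv a γ (r t x)) k| ≤ 3 * (C * (d * K)) * mesh N := by
  have hK := h.nonneg
  have hC0 := hC.nonneg
  have hB : 0 ≤ d * K := by positivity
  have h1 := abs_le.1 ((h.potential_lip hC ht).faceProj_le (by positivity) j k)
  have h2 := abs_le.1 ((hC.deriv_lip _ (h.density_mem N ht (k + e j)) _
    (h.range t ht (corner (k + e j)))).trans
    (mul_le_mul_of_nonneg_left ((h.density_lip ht).cellProj_le hB (k + e j)) hC0))
  have h3 := abs_le.1 ((h.potential_lip hC ht).corner_add (h.potential_periodic ht) k j)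
  rw [abs_le]
  constructor <;> linarith [h1.1, h1.2, h2.1, h2.2, h3.1, h3.2]

lemma faceProj_vel_le (h : BoundedSolution T a γ μ lam rlo rhi K r U) (ht : t ∈ Icc 0 T)
    (i : Fin d) (k : Grid d N) : |faceProj N i (fun x => U t x i) k| ≤ K := by
  rw [← sub_zero (faceProj N i _ k)]
  exact abs_faceProj_sub_le (h.vel_lip ht i).continuous fun x _ => by
    rw [sub_zero]; exact h.bound.vel t ht x i

lemma avgCell_vel_bound (h : BoundedSolution T a γ μ lam rlo rhi K r U) (ht : t ∈ Icc 0 T)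
    (i : Fin d) (k : Grid d N) :
    |avgCell (fun i => faceProj N i fun x => U t x i) i k| ≤ K := by
  have h1 := abs_le.1 (h.faceProj_vel_le N ht i k)
  have h2 := abs_le.1 (h.faceProj_vel_le N ht i (k - e i))
  rw [avgCell, abs_le]
  constructor <;> linarith [h1.1, h1.2, h2.1, h2.2]

lemma divh_vel_bound (h : BoundedSolution T a γ μ lam rlo rhi K r U) (ht : t ∈ Icc 0 T)
    (k : Grid d N) : |divh (fun i => faceProj N i fun x => U t x i) k| ≤ d * (d * K) := by
  rw [divh]
  refine (Finset.abs_sum_le_sum_abs _ _).trans ?_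
  refine (Finset.sum_le_sum (g := fun _ => d * K) fun i _ => ?_).trans (by simp)
  rw [diffCell_eq_diffFace]
  exact (h.vel_lip ht i).diffFace_le (h.sol.isPeriodic_velocity ht i) i i _

lemma grad_osc (h : BoundedSolution T a γ μ lam rlo rhi K r U) (ht : t ∈ Icc 0 T)
    (i j : Fin d) (k : Grid d N) :
    |diffFace j (avgCell (fun i => faceProj N i fun x => U t x i) i) k
      - diffFace j (avgCell (fun i => faceProj N i fun x => U t x i) i) (k - e j)|
      ≤ 7 * (d * K) * mesh N := by
  have hK := h.nonneg
  have hB : 0 ≤ d * K := by positivity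
  have h0 := fun k : Grid d N => abs_le.1 (diffFace_avgCell_faceProj_le
    (V := fun i => faceProj N i fun x => U t x i)
    (h.sol.isPeriodic_velocity ht i) (h.vel_lip ht i) ((h.sol.velocity i).differentiable ht)
    (h.grad_lip ht i j) hB (i := i) rfl k)
  have h3 := abs_le.1 ((h.grad_lip ht i j).corner_sub
    ((h.sol.isPeriodic_velocity ht i).pd j) k j)
  rw [abs_le]
  constructor <;> linarith [(h0 k).1, (h0 k).2, (h0 (k - e j)).1, (h0 (k - e j)).2, h3.1, h3.2]

lemma time_le (h : BoundedSolution T a γ μ lam rlo rhi K r U) (hs : s ∈ Icc 0 T)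
    (ht : t ∈ Icc 0 T) (hst : s < t) (i : Fin d) (k : Grid d N) :
    |(avgCell (fun i => faceProj N i fun x => U t x i) i k
      - avgCell (fun i => faceProj N i fun x => U s x i) i k) / (t - s)| ≤ K := by
  have h0 : 0 < t - s := sub_pos.2 hst
  have h1 : ∀ k : Grid d N,
      |faceProj N i (fun x => U t x i) k - faceProj N i (fun x => U s x i) k| ≤ K * (t - s) := by
    intro k
    rw [← faceProj_sub (h.vel_lip ht i).continuous (h.vel_lip hs i).continuous,
      ← sub_zero (faceProj N i _ k)]
    refine abs_faceProj_sub_le ((h.vel_lip ht i).continuous.sub (h.vel_lip hs i).continuous)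
      fun x _ => ?_
    rw [sub_zero, ← abs_of_pos h0]
    exact h.vel_time hs ht x i
  have h2 := abs_le.1 (h1 k)
  have h3 := abs_le.1 (h1 (k - e i))
  rw [abs_div, abs_of_pos h0, div_le_iff₀ h0, avgCell, avgCell, abs_le]
  constructor <;> linarith [h2.1, h2.2, h3.1, h3.2]

/-- Discrete continuity equation for the projections of a strong solution. -/
lemma continuity_le (h : BoundedSolution T a γ μ lam rlo rhi K r U) (hγ : 1 < γ)
    (hC : CoeffBound a γ rlo rhi C) {c : ℝ} (hc : c = 4 * (d * K) + K) (hs : s ∈ Icc 0 T)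
    (ht : t ∈ Icc 0 T) (hst : s < t) (k : Grid d N) :
    |(potentialDeriv a γ (cellProj N (r t) k) - potentialDeriv a γ (cellProj N (r s) k)) / (t - s)
      + ∑ j, avgCell (fun i => faceProj N i fun x => U t x i) j k
        * diffCell j (faceProj N j fun x => potentialDeriv a γ (r s x)) k
      + a * γ * cellProj N (r t) k ^ (γ - 1) * divh (fun i => faceProj N i fun x => U t x i) k|
      ≤ (3 * C * c * K + C * K + d * (c * (C * K)) + C * c * (d * (d * K)) + C * C * (d * c))
        * (mesh N + (t - s)) := by
  have hK := h.nonneg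
  have hC0 := hC.nonneg
  have hm := mesh_pos N
  have hB : 0 ≤ d * K := by positivity
  have h0 : 0 < t - s := sub_pos.2 hst
  have hτ : |t - s| ≤ t - s := (abs_of_pos h0).le
  have hτ' : |s - s| ≤ t - s := by rw [sub_self, abs_zero]; exact h0.le
  have hc0 : 0 ≤ c := by rw [hc]; positivity
  set η := mesh N + (t - s) with hη
  have hη0 : 0 ≤ η := by positivity
  set R := cellProj N (r t) k with hR
  set Rm := cellProj N (r s) k with hRm
  have hRI : R ∈ Icc rlo rhi := h.density_mem N ht k
  have hRmI : Rm ∈ Icc rlo rhi := h.density_mem N hs k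
  obtain ⟨ξ, hξI, hξ, hξeq⟩ := exists_potentialDeriv_sub (a := a) hγ h.lo_pos hRI hRmI
  set W := fun j => avgCell (fun i => faceProj N i fun x => U t x i) j k with hW
  set D := divh (fun i => faceProj N i fun x => U t x i) k with hD
  have hrc := (h.density_lip ht).continuous
  have hrc' := (h.density_lip hs).continuous
  have hqc : ∀ j, Continuous (pd j fun x => potentialDeriv a γ (r s x)) := fun j =>
    (contDiff_pd (n := 1) (m := 0) (h.potential_contDiff hs) le_rfl j).continuous
  -- Everything is one cell average: the increment of `H'` is linear in the density increment
  -- through `ξ`, and the differences of face averages are exact averages of derivatives. It remains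
  -- to bound the integrand at each point `y` of the cell.
  have hrep : (potentialDeriv a γ R - potentialDeriv a γ Rm) / (t - s)
      + ∑ j, W j * diffCell j (faceProj N j fun x => potentialDeriv a γ (r s x)) k
      + a * γ * R ^ (γ - 1) * D
      = cellProj N (fun y => potentialDeriv₂ a γ ξ / (t - s) * (r t y - r s y)
        + ∑ j, W j * pd j (fun x => potentialDeriv a γ (r s x)) y + a * γ * R ^ (γ - 1) * D) k := by
    rw [cellProj_add (by fun_prop) continuous_const, cellProj_const,
      cellProj_add (by fun_prop) (by fun_prop), cellProj_mul_left, cellProj_sub hrc hrc',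
      cellProj_sum _ (fun j _ => by fun_prop), hξeq]
    congr 2
    · ring
    · refine Finset.sum_congr rfl fun j _ => ?_
      rw [cellProj_mul_left, diffCell_faceProj (h.potential_periodic hs) (h.potential_contDiff hs)]
  change |(potentialDeriv a γ R - potentialDeriv a γ Rm) / (t - s)
      + ∑ j, W j * diffCell j (faceProj N j fun x => potentialDeriv a γ (r s x)) k
      + a * γ * R ^ (γ - 1) * D| ≤ _
  rw [hrep]
  refine abs_cellProj_le (by fun_prop) fun y hy => ?_
  simp only [h.pd_potential hγ hs]
  set Qy := potentialDeriv₂ a γ (r s y) with hQy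
  set ρy := r s y with hρy
  have hρyI : ρy ∈ Icc rlo rhi := h.range s hs y
  have hpde := h.sol.continuity hs y
  set δr := (r t y - r s y) / (t - s) with hδr
  set dr := td T (fun s => r s y) s with hdr
  have b1 : |(potentialDeriv₂ a γ ξ - Qy) * δr| ≤ 3 * C * c * K * η := by
    have e1 : |R - ρy| ≤ c * η := (h.density_le N hs ht hτ k y hy).trans
      (mul_le_mul_of_nonneg_right (by rw [hc]; linarith) hη0)
    have e2 : |Rm - ρy| ≤ c * η := (h.density_le N hs hs hτ' k y hy).trans
      (mul_le_mul_of_nonneg_right (by rw [hc]; linarith) hη0)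
    have e3 : |ξ - ρy| ≤ 3 * (c * η) := by
      calc |ξ - ρy| ≤ |ξ - Rm| + |Rm - ρy| := abs_sub_le _ _ _
        _ ≤ |R - Rm| + |Rm - ρy| := by gcongr
        _ ≤ (|R - ρy| + |ρy - Rm|) + |Rm - ρy| := by gcongr; exact abs_sub_le _ _ _
        _ ≤ _ := by rw [abs_sub_comm ρy Rm]; linarith
    have e4 : |δr| ≤ K := by
      rw [hδr, abs_div, abs_of_pos h0, div_le_iff₀ h0]
      exact (h.density_time hs ht y).trans (le_of_eq (by rw [abs_of_pos h0]))
    rw [abs_mul]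
    calc _ ≤ C * (3 * (c * η)) * K := by
          gcongr
          exact (hC.deriv₂_lip _ hξI _ hρyI).trans (by gcongr)
      _ = _ := by ring
  have hQyC : |Qy| ≤ C := hC.deriv₂_le _ hρyI
  have b2 : |Qy * (δr - dr)| ≤ C * K * η := by
    rw [abs_mul]
    have e1 : |δr - dr| ≤ K * (t - s) := abs_sub_sub_le_of_td h.time_pos (h.sol.density.time y)
      (fun s hs => h.bound.dt_dt_r s hs y) hs ht hst
    calc _ ≤ C * (K * (t - s)) := by gcongr
      _ ≤ C * (K * η) := by gcongr; rw [hη]; linarith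
      _ = _ := by ring
  have b3 : |∑ j, (W j - U s y j) * (Qy * pd j (r s) y)| ≤ d * (c * (C * K)) * η := by
    refine (Finset.abs_sum_le_sum_abs _ _).trans ?_
    refine (Finset.sum_le_sum (g := fun _ => c * η * (C * K)) fun j _ => ?_).trans
      (le_of_eq (by simp; ring))
    rw [abs_mul, abs_mul]
    have e1 : |W j - U s y j| ≤ c * η := (h.avgCell_vel_le N hs ht hτ j k y hy).trans
      (mul_le_mul_of_nonneg_right (by rw [hc]; linarith) hη0)
    have e2 := h.bound.grad_r s hs y j
    gcongr
  have b4 : |(a * γ * R ^ (γ - 1) - ρy * Qy) * D| ≤ C * c * (d * (d * K)) * η := by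
    rw [abs_mul]
    have e1 : |R - ρy| ≤ c * η := (h.density_le N hs ht hτ k y hy).trans
      (mul_le_mul_of_nonneg_right (by rw [hc]; linarith) hη0)
    calc _ ≤ C * (c * η) * (d * (d * K)) := by
          gcongr
          · exact (hC.sound_lip _ hRI _ hρyI).trans (by gcongr)
          · exact h.divh_vel_bound N ht k
      _ = _ := by ring
  have b5 : |ρy * Qy * (D - ∑ i, pd i (fun y => U s y i) y)| ≤ C * C * (d * c) * η := by
    rw [abs_mul, abs_mul]
    calc _ ≤ C * C * (d * (c * η)) := by
          gcongr
          · exact hC.val_le _ hρyI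
          · rw [hc]
            exact h.divh_vel_le N hs ht hτ k y hy
      _ = _ := by ring
  -- The integrand is reduced by `H''(r)` times the continuity equation at `(s, y)`; the five
  -- remaining summands are differences estimated in `b1` to `b5`.
  have hsum : potentialDeriv₂ a γ ξ / (t - s) * (r t y - ρy)
        + ∑ j, W j * (Qy * pd j (r s) y) + a * γ * R ^ (γ - 1) * D
      = (potentialDeriv₂ a γ ξ - Qy) * δr + Qy * (δr - dr)
        + ∑ j, (W j - U s y j) * (Qy * pd j (r s) y) + (a * γ * R ^ (γ - 1) - ρy * Qy) * D
        + ρy * Qy * (D - ∑ i, pd i (fun y => U s y i) y) := by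
    have e1 : ∑ j, (W j - U s y j) * (Qy * pd j (r s) y)
        = ∑ j, W j * (Qy * pd j (r s) y) - Qy * ∑ j, pd j (r s) y * U s y j := by
      rw [Finset.mul_sum, ← Finset.sum_sub_distrib]
      exact Finset.sum_congr rfl fun j _ => by ring
    rw [Finset.sum_add_distrib, ← Finset.mul_sum] at hpde
    have e2 : potentialDeriv₂ a γ ξ / (t - s) * (r t y - ρy) = potentialDeriv₂ a γ ξ * δr := by
      rw [hδr]; ring
    rw [e1, e2]
    linear_combination Qy * hpde
  rw [hsum]
  have t1 := abs_add_le ((potentialDeriv₂ a γ ξ - Qy) * δr + Qy * (δr - dr)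
        + ∑ j, (W j - U s y j) * (Qy * pd j (r s) y) + (a * γ * R ^ (γ - 1) - ρy * Qy) * D)
        (ρy * Qy * (D - ∑ i, pd i (fun y => U s y i) y))
  have t2 := abs_add_le ((potentialDeriv₂ a γ ξ - Qy) * δr + Qy * (δr - dr)
        + ∑ j, (W j - U s y j) * (Qy * pd j (r s) y)) ((a * γ * R ^ (γ - 1) - ρy * Qy) * D)
  have t3 := abs_add_le ((potentialDeriv₂ a γ ξ - Qy) * δr + Qy * (δr - dr))
        (∑ j, (W j - U s y j) * (Qy * pd j (r s) y))
  have t4 := abs_add_le ((potentialDeriv₂ a γ ξ - Qy) * δr) (Qy * (δr - dr))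
  linarith

/-- The discrete pressure gradient is consistent with the pressure. -/
lemma press_le (h : BoundedSolution T a γ μ lam rlo rhi K r U) (hγ : 1 < γ)
    (hC : CoeffBound a γ rlo rhi C) {c : ℝ} (hc : c = 4 * (d * K) + K) (hs : s ∈ Icc 0 T)
    (ht : t ∈ Icc 0 T) (hst : s < t) (v : Fin d → Grid d N → ℝ) :
    |gridInt (fun k => ∑ i, cellProj N (r t) k
          * diffCell i (faceProj N i fun x => potentialDeriv a γ (r s x)) k * avgCell v i k)
        + gridInt (fun k => pressure a γ (cellProj N (r t) k) * divh v k)|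
      ≤ (c * (C * K) + C * c + 3 * (C * (d * K))) * (mesh N + (t - s))
        * gridInt (fun k => ∑ i, ∑ j, |diffFace j (v i) k| + ∑ i, |avgCell v i k|) := by
  have hK := h.nonneg
  have hC0 := hC.nonneg
  have hm := mesh_pos N
  have hB : 0 ≤ d * K := by positivity
  have h0 : 0 < t - s := sub_pos.2 hst
  have hτ : |t - s| ≤ t - s := (abs_of_pos h0).le
  have hc0 : 0 ≤ c := by rw [hc]; positivity
  set η := mesh N + (t - s) with hη
  have hη0 : 0 ≤ η := by positivity
  have hden : ∀ (k : Grid d N) y, ‖y - corner k‖ ≤ mesh N → |cellProj N (r t) k - r s y| ≤ c * η :=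
    fun k y hy => (h.density_le N hs ht hτ k y hy).trans
      (mul_le_mul_of_nonneg_right (by rw [hc]; linarith) hη0)
  have hqc : ∀ j, Continuous (pd j fun x => potentialDeriv a γ (r s x)) := fun j =>
    (contDiff_pd (n := 1) (m := 0) (h.potential_contDiff hs) le_rfl j).continuous
  have hpc : ∀ j, Continuous (pd j fun x => pressure a γ (r s x)) := fun j =>
    (contDiff_pd (n := 1) (m := 0) (h.pressure_contDiff hs) le_rfl j).continuous
  have h1 : ∀ i (k : Grid d N), |cellProj N (r t) k
        * diffCell i (faceProj N i fun x => potentialDeriv a γ (r s x)) k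
        - diffCell i (faceProj N i fun x => pressure a γ (r s x)) k| ≤ c * (C * K) * η := by
    intro i k
    rw [diffCell_faceProj (h.potential_periodic hs) (h.potential_contDiff hs),
      diffCell_faceProj (h.pressure_periodic hs) (h.pressure_contDiff hs), ← cellProj_mul_left,
      ← cellProj_sub (by fun_prop) (by fun_prop)]
    refine abs_cellProj_le (by fun_prop) fun y hy => ?_
    -- As `∇p(r) = r ∇H'(r)`, both terms have the same derivative factor at the same point, and only
    -- the density averaged over the cell is compared with its point value.
    rw [h.pd_potential hγ hs, h.pd_pressure hs, ← sub_eq_zero.1 (by ring :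
      (cellProj N (r t) k - r s y) * (potentialDeriv₂ a γ (r s y) * pd i (r s) y)
      - (cellProj N (r t) k * (potentialDeriv₂ a γ (r s y) * pd i (r s) y)
      - r s y * potentialDeriv₂ a γ (r s y) * pd i (r s) y) = 0), abs_mul, abs_mul]
    calc _ ≤ c * η * (C * K) := by
          gcongr
          · exact hden k y hy
          · exact hC.deriv₂_le _ (h.range s hs y)
          · exact h.bound.grad_r s hs y i
      _ = _ := by ring
  have h2 : ∀ k : Grid d N, |pressure a γ (cellProj N (r t) k) - pressure a γ (r s (corner k))|
      ≤ C * c * η := fun k => by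
    refine (hC.pressure_lip _ (h.density_mem N ht k) _ (h.range s hs _)).trans ?_
    rw [mul_assoc]
    gcongr
    exact hden k _ (by rw [sub_self, norm_zero]; exact hm.le)
  have h3 := grad_parts_le (h.pressure_periodic hs) (h.pressure_lip hC hs) (by positivity) h2 v
  set I₁ := gridInt (fun k : Grid d N => ∑ i, ∑ j, |diffFace j (v i) k|) with hI₁
  set I₂ := gridInt (fun k : Grid d N => ∑ i, |avgCell v i k|) with hI₂
  have hI₁0 : 0 ≤ I₁ := gridInt_nonneg fun k =>
    Finset.sum_nonneg fun _ _ => Finset.sum_nonneg fun _ _ => abs_nonneg _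
  have hI₂0 : 0 ≤ I₂ := gridInt_nonneg fun k => Finset.sum_nonneg fun _ _ => abs_nonneg _
  have h4 : |gridInt (fun k => ∑ i, cellProj N (r t) k
          * diffCell i (faceProj N i fun x => potentialDeriv a γ (r s x)) k * avgCell v i k)
        - gridInt (fun k => ∑ i, diffCell i (faceProj N i fun x => pressure a γ (r s x)) k
          * avgCell v i k)| ≤ c * (C * K) * η * I₂ := by
    rw [← gridInt_sub, hI₂, ← gridInt_mul_left]
    refine (abs_gridInt_le _).trans (gridInt_mono fun k => ?_)
    rw [← Finset.sum_sub_distrib, Finset.mul_sum]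
    refine (Finset.abs_sum_le_sum_abs _ _).trans (Finset.sum_le_sum fun i _ => ?_)
    rw [← sub_mul, abs_mul]
    gcongr
    exact h1 i k
  rw [gridInt_add, ← hI₁, ← hI₂]
  have h5 : (C * c * η + 3 * (C * (d * K)) * mesh N) * I₁
      ≤ (C * c + 3 * (C * (d * K))) * η * I₁ := by
    have : 3 * (C * (d * K)) * mesh N ≤ 3 * (C * (d * K)) * η := by gcongr; rw [hη]; linarith
    refine mul_le_mul_of_nonneg_right ?_ hI₁0
    linarith
  have n1 : 0 ≤ c * (C * K) * η * I₁ := by positivity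
  have n2 : 0 ≤ (C * c + 3 * (C * (d * K))) * η * I₂ := by positivity
  have a1 := abs_le.1 h3
  have a2 := abs_le.1 h4
  rw [abs_le]
  constructor <;> linarith [a1.1, a1.2, a2.1, a2.2]

end BoundedSolution

/-! ### Consistency of the momentum equation. -/

namespace BoundedSolution

variable {d : ℕ} {T a γ μ lam rlo rhi K C : ℝ} {r : ℝ → (Fin d → ℝ) → ℝ}
  {U : ℝ → (Fin d → ℝ) → Fin d → ℝ} {s t t' : ℝ}

variable (N : ℕ) [NeZero N]

/-- Discrete momentum equation in one cell for the projections of a strong solution. -/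
lemma momentum_cell_le (h : BoundedSolution T a γ μ lam rlo rhi K r U) (hγ : 1 < γ)
    (hC : CoeffBound a γ rlo rhi C) {c : ℝ} (hc : c = 4 * (d * K) + K) (ht' : t' ∈ Icc 0 T)
    (ht : t ∈ Icc 0 T) (hs' : t' ≤ s) (hs : s ≤ t) (i : Fin d) (k : Grid d N) :
    |(cellProj N (r t') k * td T (fun s => U s (corner k) i) s
      + cellProj N (r t) k * ∑ j, avgCell (fun i => faceProj N i fun x => U t x i) j k
        * diffFace j (avgCell (fun i => faceProj N i fun x => U t x i) i) k
      + cellProj N (r t) k * diffCell i (faceProj N i fun x => potentialDeriv a γ (r t' x)) k)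
      - (μ * ∑ j, diffCell j (faceProj N j (pd j fun x => U s x i)) k
        + (μ + lam) * diffCell i (faceProj N i fun x => ∑ j, pd j (fun x => U s x j) x) k)|
      ≤ (c * K + C * (d * K) + d * (c * K * K + 2 * (C * c * K)) + c * C * K + 2 * (C * C * K)
        + C * K * (C * K)) * (mesh N + (t - t')) := by
  have hK := h.nonneg
  have hC0 := hC.nonneg
  have hm := mesh_pos N
  have hB : 0 ≤ d * K := by positivity
  have h0 : 0 ≤ t - t' := by linarith
  have hsI : s ∈ Icc 0 T := ⟨ht'.1.trans hs', hs.trans ht.2⟩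
  have hτ : |t - s| ≤ t - t' := by rw [abs_of_nonneg (by linarith)]; linarith
  have hτ' : |t' - s| ≤ t - t' := by rw [abs_sub_comm, abs_of_nonneg (by linarith)]; linarith
  have hc0 : 0 ≤ c := by rw [hc]; positivity
  set η := mesh N + (t - t') with hη
  have hη0 : 0 ≤ η := by positivity
  set R := cellProj N (r t) k with hR
  set Rm := cellProj N (r t') k with hRm
  have hRI : R ∈ Icc rlo rhi := h.density_mem N ht k
  set W := fun j => avgCell (fun i => faceProj N i fun x => U t x i) j k with hW
  set D := fun j => diffFace j (avgCell (fun i => faceProj N i fun x => U t x i) i) k with hD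
  set A := td T (fun s => U s (corner k) i) s with hA
  have hqc : Continuous (pd i fun x => potentialDeriv a γ (r t' x)) :=
    (contDiff_pd (n := 1) (m := 0) (h.potential_contDiff ht') le_rfl i).continuous
  have hvc : ∀ j, Continuous (pd j (pd j fun x => U s x i)) := fun j =>
    (MACNS.contDiff_pd (n := 1) (m := 0) ((h.sol.velocity i).contDiff_pd hsI j) le_rfl
      j).continuous
  have hdC : ContDiff ℝ 1 fun x => ∑ j, pd j (fun x => U s x j) x :=
    ContDiff.sum fun j _ => (h.sol.velocity j).contDiff_pd hsI j
  have hdc : Continuous (pd i fun x => ∑ j, pd j (fun x => U s x j) x) :=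
    (contDiff_pd (n := 1) (m := 0) hdC le_rfl i).continuous
  have hdP : IsPeriodic fun x => ∑ j, pd j (fun x => U s x j) x := fun x l =>
    Finset.sum_congr rfl fun j _ => ((h.sol.isPeriodic_velocity hsI j).pd j) x l
  -- As for the density equation, the residual is a single cell average. In particular the viscous
  -- terms are exact averages of second derivatives, so the momentum equation can be inserted at
  -- every point at time `s`.
  have hrep : Rm * A + R * ∑ j, W j * D j
        + R * diffCell i (faceProj N i fun x => potentialDeriv a γ (r t' x)) k
      - (μ * ∑ j, diffCell j (faceProj N j (pd j fun x => U s x i)) k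
        + (μ + lam) * diffCell i (faceProj N i fun x => ∑ j, pd j (fun x => U s x j) x) k)
      = cellProj N (fun y => (Rm * A + R * ∑ j, W j * D j
          + R * pd i (fun x => potentialDeriv a γ (r t' x)) y)
        - (μ * ∑ j, pd j (pd j fun x => U s x i) y
          + (μ + lam) * pd i (fun x => ∑ j, pd j (fun x => U s x j) x) y)) k := by
    rw [cellProj_sub (by fun_prop) (by fun_prop), cellProj_add continuous_const (by fun_prop),
      cellProj_const, cellProj_add (by fun_prop) (by fun_prop), cellProj_mul_left,
      cellProj_mul_left, cellProj_mul_left, cellProj_sum _ (fun j _ => hvc j),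
      diffCell_faceProj (h.potential_periodic ht') (h.potential_contDiff ht'),
      diffCell_faceProj hdP hdC]
    congr 3
    congr 1
    funext j
    exact diffCell_faceProj
      ((h.sol.isPeriodic_velocity hsI i).pd j) ((h.sol.velocity i).contDiff_pd hsI j) j k
  change |Rm * A + R * ∑ j, W j * D j
        + R * diffCell i (faceProj N i fun x => potentialDeriv a γ (r t' x)) k
      - (μ * ∑ j, diffCell j (faceProj N j (pd j fun x => U s x i)) k
        + (μ + lam) * diffCell i (faceProj N i fun x => ∑ j, pd j (fun x => U s x j) x) k)| ≤ _
  rw [hrep]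
  refine abs_cellProj_le (by fun_prop) fun y hy => ?_
  have hpde := h.sol.momentum hsI y i
  rw [h.pd_pressure hsI] at hpde
  rw [← hpde, h.pd_potential hγ ht']
  have hρI : r s y ∈ Icc rlo rhi := h.range s hsI y
  have hρI' : r t' y ∈ Icc rlo rhi := h.range t' ht' y
  have eR : |R - r s y| ≤ c * η := (h.density_le N hsI ht hτ k y hy).trans
    (mul_le_mul_of_nonneg_right (by rw [hc]; linarith) hη0)
  have eRm : |Rm - r s y| ≤ c * η := by
    refine (h.density_le N hsI ht' hτ' k y hy).trans ?_
    exact mul_le_mul_of_nonneg_right (by rw [hc]; linarith) hη0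
  have eρ : |r s y| ≤ C := hC.val_le _ hρI
  have b1 : |Rm * A - r s y * td T (fun s => U s y i) s| ≤ (c * K + C * (d * K)) * η := by
    have e1 : |A| ≤ K := h.bound.dt_vel s hsI (corner k) i
    have e2 : |A - td T (fun s => U s y i) s| ≤ d * K * η := by
      refine (h.dt_vel_lip hsI i (corner k) y).trans ?_
      rw [norm_sub_rev]
      gcongr
      rw [hη]
      linarith
    rw [show Rm * A - r s y * td T (fun s => U s y i) s
      = (Rm - r s y) * A + r s y * (A - td T (fun s => U s y i) s) by ring]
    refine (abs_add_le _ _).trans ?_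
    rw [abs_mul, abs_mul]
    calc _ ≤ c * η * K + C * (d * K * η) := by gcongr
      _ = _ := by ring
  have b2 : |R * ∑ j, W j * D j - ∑ j, r s y * U s y j * pd j (fun y => U s y i) y|
      ≤ d * (c * K * K + 2 * (C * c * K)) * η := by
    rw [Finset.mul_sum, ← Finset.sum_sub_distrib]
    refine (Finset.abs_sum_le_sum_abs _ _).trans ?_
    refine (Finset.sum_le_sum (g := fun _ => (c * K * K + 2 * (C * c * K)) * η)
      fun j _ => ?_).trans (le_of_eq (by simp; ring))
    have e1 : |W j - U s y j| ≤ c * η := (h.avgCell_vel_le N hsI ht hτ j k y hy).trans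
      (mul_le_mul_of_nonneg_right (by rw [hc]; linarith) hη0)
    have e2 : |D j - pd j (fun y => U s y i) y| ≤ c * η := by
      rw [hc]
      exact h.diffFace_avgCell_vel_le N hsI ht hτ i j k y hy
    have e3 : |W j| ≤ K := h.avgCell_vel_bound N ht j k
    have e4 := h.bound.vel s hsI y j
    have e5 := h.bound.grad_vel s hsI y i j
    have e6 := hC.val_le _ hRI
    rw [show R * (W j * D j) - r s y * U s y j * pd j (fun y => U s y i) y
      = (R - r s y) * (U s y j) * pd j (fun y => U s y i) y
        + R * (W j - U s y j) * pd j (fun y => U s y i) y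
        + R * W j * (D j - pd j (fun y => U s y i) y) by ring]
    refine (abs_add_le _ _).trans ?_
    refine (add_le_add_left (abs_add_le _ _) _).trans ?_
    simp only [abs_mul]
    calc _ ≤ c * η * K * K + C * (c * η) * K + C * K * (c * η) := by gcongr
      _ = _ := by ring
  have b3 : |R * (potentialDeriv₂ a γ (r t' y) * pd i (r t') y)
      - r s y * potentialDeriv₂ a γ (r s y) * pd i (r s) y|
      ≤ (c * C * K + 2 * (C * C * K) + C * K * (C * K)) * η := by
    have e1 := hC.deriv₂_le _ hρI'
    have e2 := hC.deriv₂_le _ hρI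
    have e3 : |r t' y - r s y| ≤ K * η := (h.density_time hsI ht' y).trans (by
      gcongr; rw [hη]; linarith)
    have e4 : |potentialDeriv₂ a γ (r t' y) - potentialDeriv₂ a γ (r s y)| ≤ C * (K * η) :=
      (hC.deriv₂_lip _ hρI' _ hρI).trans (by gcongr)
    have e5 : |pd i (r t') y - pd i (r s) y| ≤ K * η := (h.grad_density_time hsI ht' y i).trans (by
      gcongr; rw [hη]; linarith)
    have e6 := h.bound.grad_r t' ht' y i
    rw [show R * (potentialDeriv₂ a γ (r t' y) * pd i (r t') y)
      - r s y * potentialDeriv₂ a γ (r s y) * pd i (r s) y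
      = (R - r s y) * potentialDeriv₂ a γ (r t' y) * pd i (r t') y
        + r s y * (potentialDeriv₂ a γ (r t' y) - potentialDeriv₂ a γ (r s y)) * pd i (r t') y
        + r s y * potentialDeriv₂ a γ (r s y) * (pd i (r t') y - pd i (r s) y) by ring]
    refine (abs_add_le _ _).trans ?_
    refine (add_le_add_left (abs_add_le _ _) _).trans ?_
    simp only [abs_mul]
    calc _ ≤ c * η * C * K + C * (C * (K * η)) * K + C * C * (K * η) := by gcongr
      _ ≤ _ := by
        have : 0 ≤ C * C * K * η := by positivity
        nlinarith
  rw [show Rm * A + R * ∑ j, W j * D j + R * (potentialDeriv₂ a γ (r t' y) * pd i (r t') y)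
      - (r s y * td T (fun s => U s y i) s
        + ∑ j, r s y * U s y j * pd j (fun y => U s y i) y
        + r s y * potentialDeriv₂ a γ (r s y) * pd i (r s) y)
      = (Rm * A - r s y * td T (fun s => U s y i) s)
        + (R * ∑ j, W j * D j - ∑ j, r s y * U s y j * pd j (fun y => U s y i) y)
        + (R * (potentialDeriv₂ a γ (r t' y) * pd i (r t') y)
      - r s y * potentialDeriv₂ a γ (r s y) * pd i (r s) y) by ring]
  refine (abs_add_le _ _).trans ?_
  refine (add_le_add_left (abs_add_le _ _) _).trans ?_
  linarith

/-- Mean value theorem for the discrete time derivative of the nodal velocities. -/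
lemma exists_time_slope (h : BoundedSolution T a γ μ lam rlo rhi K r U) (ht' : t' ∈ Icc 0 T)
    (ht : t ∈ Icc 0 T) (htt : t' < t) (w : Fin d → Grid d N → ℝ) :
    ∃ s ∈ Ioo t' t,
      gridInt (fun k => ∑ i, (U t (corner k) i - U t' (corner k) i) / (t - t') * w i k)
        = gridInt (fun k => ∑ i, td T (fun s => U s (corner k) i) s * w i k) := by
  have h0 : 0 < t - t' := sub_pos.2 htt
  have hsub : ∀ s ∈ Ioo t' t, s ∈ Ioo 0 T := fun s hs =>
    ⟨ht'.1.trans_lt hs.1, hs.2.trans_le ht.2⟩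
  -- The mean value theorem is applied to the whole weighted sum, a scalar function of time, so that
  -- one intermediate time serves all cells and components. No bound on the second time derivative
  -- of the velocity is needed.
  obtain ⟨s, hs, hs'⟩ := exists_hasDerivAt_eq_slope
    (fun s => mesh N ^ d * ∑ k : Grid d N, ∑ i, U s (corner k) i * w i k)
    (fun s => mesh N ^ d * ∑ k : Grid d N, ∑ i, td T (fun s => U s (corner k) i) s * w i k) htt
    (by
      refine continuousOn_const.mul (continuousOn_finsetSum _ fun k _ =>
        continuousOn_finsetSum _ fun i _ => ContinuousOn.mul ?_ continuousOn_const)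
      exact ((h.sol.velocity i).differentiableOn_time (corner k)).continuousOn.mono
        (Icc_subset_Icc ht'.1 ht.2))
    (fun s hs => by
      refine HasDerivAt.const_mul _ (HasDerivAt.fun_sum fun k _ => HasDerivAt.fun_sum fun i _ =>
        HasDerivAt.mul_const ?_ _)
      have hs1 := hsub s hs
      exact ((h.sol.velocity i).differentiableOn_time (corner k) s
        (Ioo_subset_Icc_self hs1)).hasDerivWithinAt.hasDerivAt (Icc_mem_nhds hs1.1 hs1.2))
  refine ⟨s, hs, ?_⟩
  rw [gridInt, gridInt, hs', ← mul_sub, ← Finset.sum_sub_distrib, mul_div_assoc, Finset.sum_div]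
  congr 1
  refine Finset.sum_congr rfl fun k _ => ?_
  rw [← Finset.sum_sub_distrib, Finset.sum_div]
  exact Finset.sum_congr rfl fun i _ => by ring

/-- The velocity increment is Lipschitz in space with a constant proportional to `t - t'`. Hence
replacing averages by corner values still costs only order `h` after division by `t - t'`. -/
lemma velIncr_le (h : BoundedSolution T a γ μ lam rlo rhi K r U) (ht' : t' ∈ Icc 0 T)
    (ht : t ∈ Icc 0 T) (htt : t' < t) (i : Fin d) (k : Grid d N) :
    |(avgCell (fun i => faceProj N i fun x => U t x i) i k
      - avgCell (fun i => faceProj N i fun x => U t' x i) i k) / (t - t')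
      - (U t (corner k) i - U t' (corner k) i) / (t - t')| ≤ 2 * (d * K) * mesh N := by
  have hK := h.nonneg
  have h0 : 0 < t - t' := sub_pos.2 htt
  have hper : IsPeriodic fun x => U t x i - U t' x i := fun x l => by
    change U t (x + Pi.single l 1) i - U t' (x + Pi.single l 1) i = _
    rw [h.sol.periodic_velocity t ht, h.sol.periodic_velocity t' ht']
  have h1 := avgCell_faceProj_le (N := N) (V := fun i => faceProj N i fun x => U t x i - U t' x i)
    hper (h.vel_incr_lip ht' ht i) (by positivity) (i := i) rfl k
  have h2 : avgCell (fun i => faceProj N i fun x => U t x i - U t' x i) i k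
      = avgCell (fun i => faceProj N i fun x => U t x i) i k
      - avgCell (fun i => faceProj N i fun x => U t' x i) i k := by
    simp only [avgCell]
    rw [faceProj_sub (h.vel_lip ht i).continuous (h.vel_lip ht' i).continuous,
      faceProj_sub (h.vel_lip ht i).continuous (h.vel_lip ht' i).continuous]
    ring
  rw [h2, abs_of_pos h0] at h1
  rw [← sub_div, abs_div, abs_of_pos h0, div_le_iff₀ h0]
  refine h1.trans (le_of_eq ?_)
  ring

/-- Discrete momentum equation for the projections of a strong solution. -/
lemma momentum_le (h : BoundedSolution T a γ μ lam rlo rhi K r U) (hγ : 1 < γ)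
    (hC : CoeffBound a γ rlo rhi C) {c : ℝ} (hc : c = 4 * (d * K) + K) (ht' : t' ∈ Icc 0 T)
    (ht : t ∈ Icc 0 T) (htt : t' < t) (v : Fin d → Grid d N → ℝ) :
    |gridInt (fun k => ∑ i, (cellProj N (r t') k
          * ((avgCell (fun i => faceProj N i fun x => U t x i) i k
            - avgCell (fun i => faceProj N i fun x => U t' x i) i k) / (t - t'))
        + cellProj N (r t) k * ∑ j, avgCell (fun i => faceProj N i fun x => U t x i) j k
          * diffFace j (avgCell (fun i => faceProj N i fun x => U t x i) i) k
        + cellProj N (r t) k * diffCell i (faceProj N i fun x => potentialDeriv a γ (r t' x)) k)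
        * avgCell v i k)
      + μ * gridInt (fun k => ∑ i, ∑ j, diffFace j (faceProj N i fun x => U t x i) k
        * diffFace j (v i) k)
      + (μ + lam) * gridInt (fun k => divh (fun i => faceProj N i fun x => U t x i) k * divh v k)|
      ≤ ((c * K + C * (d * K) + d * (c * K * K + 2 * (C * c * K)) + c * C * K + 2 * (C * C * K)
          + C * K * (C * K)) + C * (2 * (d * K)) + |μ| * (c + 2 * (d * K))
          + |μ + lam| * (d * c + 3 * (d * (d * K)))) * (mesh N + (t - t'))
        * gridInt (fun k => ∑ i, ∑ j, |diffFace j (v i) k| + ∑ i, |avgCell v i k|) := by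
  have hK := h.nonneg
  have hC0 := hC.nonneg
  have hm := mesh_pos N
  have hB : 0 ≤ d * K := by positivity
  have h0 : 0 < t - t' := sub_pos.2 htt
  have hc0 : 0 ≤ c := by rw [hc]; positivity
  -- The weights are those that multiply the time quotient in the tested equation. So `s` depends on
  -- the test field, while all bounds are uniform in `s`.
  obtain ⟨s, hsI, hslope⟩ := h.exists_time_slope N ht' ht htt
    (fun i k => cellProj N (r t') k * avgCell v i k)
  have hs : s ∈ Icc 0 T := ⟨ht'.1.trans hsI.1.le, hsI.2.le.trans ht.2⟩
  have hτ : |t - s| ≤ t - t' := by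
    rw [abs_of_pos (by linarith [hsI.2])]
    linarith [hsI.1]
  set η := mesh N + (t - t') with hη
  have hη0 : 0 ≤ η := by positivity
  have hmη : mesh N ≤ η := by rw [hη]; linarith
  set c₁ := c * K + C * (d * K) + d * (c * K * K + 2 * (C * c * K)) + c * C * K + 2 * (C * C * K)
          + C * K * (C * K) with hc₁
  have hc₁0 : 0 ≤ c₁ := by positivity
  set I₁ := gridInt (fun k : Grid d N => ∑ i, ∑ j, |diffFace j (v i) k|) with hI₁
  set I₂ := gridInt (fun k : Grid d N => ∑ i, |avgCell v i k|) with hI₂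
  have hI₁0 : 0 ≤ I₁ := gridInt_nonneg fun k =>
    Finset.sum_nonneg fun _ _ => Finset.sum_nonneg fun _ _ => abs_nonneg _
  have hI₂0 : 0 ≤ I₂ := gridInt_nonneg fun k => Finset.sum_nonneg fun _ _ => abs_nonneg _
  set V : Fin d → Grid d N → ℝ := fun i => faceProj N i fun x => U t x i with hV
  set V' : Fin d → Grid d N → ℝ := fun i => faceProj N i fun x => U t' x i with hV'
  set R := cellProj N (r t) with hR
  set Rm := cellProj N (r t') with hRm
  set g : Fin d → Grid d N → ℝ :=
    fun i => diffCell i (faceProj N i fun x => potentialDeriv a γ (r t' x)) with hg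
  set A : Fin d → Grid d N → ℝ := fun i k =>
    μ * ∑ j, diffCell j (faceProj N j (pd j fun x => U s x i)) k
      + (μ + lam) * diffCell i (faceProj N i fun x => ∑ j, pd j (fun x => U s x j) x) k with hA
  -- the time derivative and the equation
  have p1 : |gridInt (fun k => ∑ i, (Rm k * ((avgCell V i k - avgCell V' i k) / (t - t'))
        + R k * ∑ j, avgCell V j k * diffFace j (avgCell V i) k + R k * g i k) * avgCell v i k)
      - gridInt (fun k => ∑ i, A i k * avgCell v i k)| ≤ (c₁ + C * (2 * (d * K))) * η * I₂ := by
    have e1 : gridInt (fun k => ∑ i, (Rm k * ((avgCell V i k - avgCell V' i k) / (t - t'))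
        + R k * ∑ j, avgCell V j k * diffFace j (avgCell V i) k + R k * g i k) * avgCell v i k)
        - gridInt (fun k => ∑ i, A i k * avgCell v i k)
        = gridInt (fun k => ∑ i, (Rm k * ((avgCell V i k - avgCell V' i k) / (t - t')
            - (U t (corner k) i - U t' (corner k) i) / (t - t'))
          + ((Rm k * td T (fun s => U s (corner k) i) s
            + R k * ∑ j, avgCell V j k * diffFace j (avgCell V i) k + R k * g i k) - A i k))
          * avgCell v i k) := by
      have e2 : gridInt (fun k => ∑ i, (Rm k * ((avgCell V i k - avgCell V' i k) / (t - t')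
            - (U t (corner k) i - U t' (corner k) i) / (t - t'))
          + ((Rm k * td T (fun s => U s (corner k) i) s
            + R k * ∑ j, avgCell V j k * diffFace j (avgCell V i) k + R k * g i k) - A i k))
          * avgCell v i k)
          = gridInt (fun k => ∑ i, (Rm k * ((avgCell V i k - avgCell V' i k) / (t - t'))
            + R k * ∑ j, avgCell V j k * diffFace j (avgCell V i) k + R k * g i k) * avgCell v i k)
          - gridInt (fun k => ∑ i, A i k * avgCell v i k)
          - (gridInt (fun k => ∑ i, (U t (corner k) i - U t' (corner k) i) / (t - t')
              * (Rm k * avgCell v i k))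
            - gridInt (fun k => ∑ i, td T (fun s => U s (corner k) i) s
              * (Rm k * avgCell v i k))) := by
        simp only [← gridInt_sub, ← Finset.sum_sub_distrib]
        congr 1; funext k
        exact Finset.sum_congr rfl fun i _ => by ring
      rw [e2, hslope, sub_self, sub_zero]
    rw [e1, hI₂, ← gridInt_mul_left]
    refine (abs_gridInt_le _).trans (gridInt_mono fun k => ?_)
    rw [Finset.mul_sum]
    refine (Finset.abs_sum_le_sum_abs _ _).trans (Finset.sum_le_sum fun i _ => ?_)
    rw [abs_mul]
    gcongr
    refine (abs_add_le _ _).trans ?_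
    rw [abs_mul]
    have f1 := h.velIncr_le N ht' ht htt i k
    have f2 := h.momentum_cell_le N hγ hC hc ht' ht hsI.1.le hsI.2.le i k
    calc _ ≤ C * (2 * (d * K) * η) + c₁ * η := by
          gcongr
          · exact hC.val_le _ (h.density_mem N ht' k)
          · exact f1.trans (by gcongr)
      _ = _ := by ring
  -- viscous terms
  have p2 : |gridInt (fun k => ∑ i, (∑ j, diffCell j (faceProj N j (pd j fun x => U s x i)) k)
        * avgCell v i k) + gridInt (fun k => ∑ i, ∑ j, diffFace j (V i) k * diffFace j (v i) k)|
      -- Compared are the gradient of the projection at time `t` and the derivative of the strong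
      -- solution at time `s`; the bound on the time derivative of the velocity gradient covers the
      -- shift.
      ≤ (c + 2 * (d * K)) * η * I₁ := by
    have e1 : gridInt (fun k => ∑ i, (∑ j, diffCell j (faceProj N j (pd j fun x => U s x i)) k)
        * avgCell v i k) + gridInt (fun k => ∑ i, ∑ j, diffFace j (V i) k * diffFace j (v i) k)
        = ∑ i, ∑ j, (gridInt (fun k => diffCell j (faceProj N j (pd j fun x => U s x i)) k
          * avgCell v i k) + gridInt (fun k => diffFace j (V i) k * diffFace j (v i) k)) := by
      simp only [Finset.sum_mul, gridInt_sum, Finset.sum_add_distrib]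
    have e2 : I₁ = ∑ i, ∑ j, gridInt (fun k => |diffFace j (v i) k|) := by
      rw [hI₁]; simp only [gridInt_sum]
    rw [e1, e2, Finset.mul_sum]
    refine (Finset.abs_sum_le_sum_abs _ _).trans (Finset.sum_le_sum fun i _ => ?_)
    rw [Finset.mul_sum]
    refine (Finset.abs_sum_le_sum_abs _ _).trans (Finset.sum_le_sum fun j _ => ?_)
    have e3 : ∀ k : Grid d N, |diffFace j (V i) k - pd j (fun x => U s x i) (corner k)| ≤ c * η :=
      fun k => (h.diffFace_vel_le N hs ht hτ i j k (corner k)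
        (by rw [sub_self, norm_zero]; exact hm.le)).trans
        (mul_le_mul_of_nonneg_right (by rw [hc]; linarith) hη0)
    refine (diffCell_parts_le ((h.sol.isPeriodic_velocity hs i).pd j) (h.grad_lip hs i j) hB
      e3 i j v).trans ?_
    refine mul_le_mul_of_nonneg_right ?_ (gridInt_nonneg fun k => abs_nonneg _)
    have : 2 * (d * K) * mesh N ≤ 2 * (d * K) * η := by gcongr
    linarith
  have p3 : |gridInt (fun k => ∑ i, diffCell i
        (faceProj N i fun x => ∑ j, pd j (fun x => U s x j) x) k * avgCell v i k)
        + gridInt (fun k => divh V k * divh v k)|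
      ≤ (d * c + 3 * (d * (d * K))) * η * I₁ := by
    have hdP : IsPeriodic fun x => ∑ j, pd j (fun x => U s x j) x := fun x l =>
      Finset.sum_congr rfl fun j _ => ((h.sol.isPeriodic_velocity hs j).pd j) x l
    have hdL : LipBound (d * (d * K)) fun x => ∑ j, pd j (fun x => U s x j) x := fun x y => by
      simp only
      rw [← Finset.sum_sub_distrib]
      refine (Finset.abs_sum_le_sum_abs _ _).trans ?_
      refine (Finset.sum_le_sum fun j _ => h.grad_lip hs j j x y).trans (le_of_eq ?_)
      simp
      ring
    have e3 : ∀ k : Grid d N, |divh V k - ∑ j, pd j (fun x => U s x j) (corner k)| ≤ d * c * η :=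
      fun k => (h.divh_vel_le N hs ht hτ k (corner k)
        (by rw [sub_self, norm_zero]; exact hm.le)).trans (le_of_eq (by rw [hc]; ring))
    refine (grad_parts_le hdP hdL (by positivity) e3 v).trans ?_
    refine mul_le_mul_of_nonneg_right ?_ hI₁0
    have : 3 * (d * (d * K)) * mesh N ≤ 3 * (d * (d * K)) * η := by gcongr
    linarith
  have p4 : gridInt (fun k => ∑ i, A i k * avgCell v i k)
      = μ * gridInt (fun k => ∑ i, (∑ j, diffCell j (faceProj N j (pd j fun x => U s x i)) k)
        * avgCell v i k)
      + (μ + lam) * gridInt (fun k => ∑ i, diffCell i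
        (faceProj N i fun x => ∑ j, pd j (fun x => U s x j) x) k * avgCell v i k) := by
    rw [← gridInt_mul_left, ← gridInt_mul_left, ← gridInt_add]
    congr 1; funext k
    rw [Finset.mul_sum, Finset.mul_sum, ← Finset.sum_add_distrib]
    exact Finset.sum_congr rfl fun i _ => by rw [hA]; ring
  set J₀ := gridInt (fun k => ∑ i, (Rm k * ((avgCell V i k - avgCell V' i k) / (t - t'))
        + R k * ∑ j, avgCell V j k * diffFace j (avgCell V i) k + R k * g i k) * avgCell v i k)
  set J₁ := gridInt (fun k => ∑ i, (∑ j, diffCell j (faceProj N j (pd j fun x => U s x i)) k)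
        * avgCell v i k)
  set J₂ := gridInt (fun k => ∑ i, diffCell i
        (faceProj N i fun x => ∑ j, pd j (fun x => U s x j) x) k * avgCell v i k)
  set J₃ := gridInt (fun k => ∑ i, ∑ j, diffFace j (V i) k * diffFace j (v i) k)
  set J₄ := gridInt (fun k => divh V k * divh v k)
  change |J₀ + μ * J₃ + (μ + lam) * J₄| ≤ _
  rw [p4] at p1
  rw [show J₀ + μ * J₃ + (μ + lam) * J₄ = (J₀ - (μ * J₁ + (μ + lam) * J₂)) + μ * (J₁ + J₃)
    + (μ + lam) * (J₂ + J₄) by ring, gridInt_add, ← hI₁, ← hI₂]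
  refine (abs_add_le _ _).trans ?_
  refine (add_le_add_left (abs_add_le _ _) _).trans ?_
  rw [abs_mul, abs_mul]
  have q2 := mul_le_mul_of_nonneg_left p2 (abs_nonneg μ)
  have q3 := mul_le_mul_of_nonneg_left p3 (abs_nonneg (μ + lam))
  have n1 : 0 ≤ (c₁ + C * (2 * (d * K))) * η * I₁ := by positivity
  have n2 : 0 ≤ (|μ| * (c + 2 * (d * K))) * η * I₂ := by positivity
  have n3 : 0 ≤ (|μ + lam| * (d * c + 3 * (d * (d * K)))) * η * I₂ := by positivity
  linarith

end BoundedSolution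

/-- The projections of a strong solution satisfy the consistency properties with a constant that
depends only on the bounds for the solution. -/
theorem exists_stepData (d : ℕ) {γ : ℝ} (hγ : 1 < γ) (a μ lam T : ℝ) {rlo : ℝ} (rhi K : ℝ)
    (hlo : 0 < rlo) :
    ∃ L₀ : ℝ, ∀ (r : ℝ → (Fin d → ℝ) → ℝ) (U : ℝ → (Fin d → ℝ) → Fin d → ℝ),
      BoundedSolution T a γ μ lam rlo rhi K r U → ∀ L, L₀ ≤ L → ∀ (N : ℕ) [NeZero N] (s t : ℝ),
      s ∈ Icc 0 T → t ∈ Icc 0 T → s < t →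
      StepData (N := N) a γ μ lam L rlo rhi (t - s) (cellProj N (r t)) (cellProj N (r s))
        (fun i => faceProj N i fun x => U t x i)
        (avgCell fun i => faceProj N i fun x => U s x i)
        (fun j => faceProj N j fun x => potentialDeriv a γ (r s x)) := by
  obtain ⟨C, hC⟩ := exists_coeffBound a γ rhi hlo
  set c := 4 * (d * K) + K with hc
  set L₁ := 3 * C * c * K + C * K + d * (c * (C * K)) + C * c * (d * (d * K)) + C * C * (d * c)
  set L₂ := c * (C * K) + C * c + 3 * (C * (d * K))
  set L₃ := (c * K + C * (d * K) + d * (c * K * K + 2 * (C * c * K)) + c * C * K + 2 * (C * C * K)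
          + C * K * (C * K)) + C * (2 * (d * K)) + |μ| * (c + 2 * (d * K))
          + |μ + lam| * (d * c + 3 * (d * (d * K)))
  refine ⟨max (K + 7 * (d * K) + 3 * (C * (d * K))) (max L₁ (max L₂ L₃)), ?_⟩
  intro r U h L hL N _ s t hs ht hst
  have hK := h.nonneg
  have hC0 := hC.nonneg
  have hm := mesh_pos N
  have hη : 0 < mesh N + (t - s) := by linarith
  have n1 : 0 ≤ (d : ℝ) * K := by positivity
  have n2 : 0 ≤ C * (d * K) := by positivity
  have l0 := (le_max_left _ _).trans hL
  have l1 : L₁ ≤ L := ((le_max_left _ _).trans (le_max_right _ _)).trans hL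
  have l2 : L₂ ≤ L :=
    (((le_max_left _ _).trans (le_max_right _ _)).trans (le_max_right _ _)).trans hL
  have l3 : L₃ ≤ L :=
    (((le_max_right _ _).trans (le_max_right _ _)).trans (le_max_right _ _)).trans hL
  have hI : ∀ v : Fin d → Grid d N → ℝ,
      0 ≤ gridInt (fun k => ∑ i, ∑ j, |diffFace j (v i) k| + ∑ i, |avgCell v i k|) := fun v =>
    gridInt_nonneg fun k => add_nonneg
      (Finset.sum_nonneg fun _ _ => Finset.sum_nonneg fun _ _ => abs_nonneg _)
      (Finset.sum_nonneg fun _ _ => abs_nonneg _)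
  exact
    { density := fun k => h.density_mem N ht k
      density_prev := fun k => h.density_mem N hs k
      vel := fun i k => (h.faceProj_vel_le N ht i k).trans (by linarith)
      grad := fun i j k => ((h.vel_lip ht i).diffFace_le
        (h.sol.isPeriodic_velocity ht i) i j k).trans (by linarith)
      grad_osc := fun i j k => (h.grad_osc N ht i j k).trans
        (mul_le_mul_of_nonneg_right (by linarith) hm.le)
      time := fun i k => (h.time_le N hs ht hst i k).trans (by linarith)
      face_left := fun j k => (h.face_left N hC hs j k).trans
        (mul_le_mul_of_nonneg_right (by linarith) hm.le)
      face_right := fun j k => (h.face_right N hC hs j k).trans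
        (mul_le_mul_of_nonneg_right (by linarith) hm.le)
      continuity := fun k => (h.continuity_le N hγ hC hc hs ht hst k).trans
        (mul_le_mul_of_nonneg_right l1 hη.le)
      press := fun v => (h.press_le N hγ hC hc hs ht hst v).trans
        (mul_le_mul_of_nonneg_right (mul_le_mul_of_nonneg_right l2 hη.le) (hI v))
      momentum := fun v => (h.momentum_le N hγ hC hc hs ht hst v).trans
        (mul_le_mul_of_nonneg_right (mul_le_mul_of_nonneg_right l3 hη.le) (hI v)) }

/-! ### Integrals over the torus as sums over cells. -/

section TorusIntegral

variable {d N : ℕ} [NeZero N]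

/-- The half-open cell. -/
def openCell (k : Grid d N) : Set (Fin d → ℝ) :=
  univ.pi fun i => Ico (((k i).val : ℝ) * mesh N) ((((k i).val : ℝ) + 1) * mesh N)

lemma openCell_ae_eq (k : Grid d N) : openCell k =ᵐ[volume] cell k := Measure.univ_pi_Ico_ae_eq_Icc

lemma cellIndex_eq_of_mem {k : Grid d N} {x : Fin d → ℝ} (hx : x ∈ openCell k) :
    cellIndex N x = k := by
  have hm := mesh_pos N
  have hN := natCast_mul_mesh N
  have hN0 : (0 : ℝ) < N := by exact_mod_cast Nat.pos_of_ne_zero (NeZero.ne N)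
  funext i
  have h1 := hx i (mem_univ i)
  have h2 : ⌊x i * N⌋ = ((k i).val : ℤ) := by
    rw [Int.floor_eq_iff]
    constructor
    · calc (((k i).val : ℤ) : ℝ) = ((k i).val : ℝ) * mesh N * N := by
            rw [mul_assoc, mul_comm (mesh N), hN, mul_one]; simp
        _ ≤ _ := by gcongr; exact h1.1
    · calc x i * N < (((k i).val : ℝ) + 1) * mesh N * N := by gcongr; exact h1.2
        _ = _ := by rw [mul_assoc, mul_comm (mesh N), hN, mul_one]; simp
  rw [cellIndex, h2]
  simp

/-- The half-open cells tile the torus exactly and differ from the closed cells by null sets. This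
reconciles `cellIndex`, defined by rounding down, with averages over closed cells. -/
lemma iUnion_openCell : ⋃ k : Grid d N, openCell k = univ.pi fun _ : Fin d => Ico (0 : ℝ) 1 := by
  have hm := mesh_pos N
  have hN := natCast_mul_mesh N
  have hN0 : (0 : ℝ) < N := by exact_mod_cast Nat.pos_of_ne_zero (NeZero.ne N)
  ext x
  simp only [mem_iUnion, openCell, mem_pi, mem_univ, true_implies, mem_Ico]
  constructor
  · rintro ⟨k, hk⟩ i
    refine ⟨le_trans (by positivity) (hk i).1, (hk i).2.trans_le ?_⟩
    refine le_of_le_of_eq ?_ hN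
    gcongr
    exact_mod_cast (k i).val_lt
  · intro hx
    refine ⟨fun i => ((⌊x i * N⌋₊ : ℕ) : ZMod N), fun i => ?_⟩
    have h0 : 0 ≤ x i * N := mul_nonneg (hx i).1 hN0.le
    have h1 : ⌊x i * N⌋₊ < N := by
      rw [Nat.floor_lt h0]
      have := (hx i).2
      nlinarith
    rw [ZMod.val_natCast_of_lt h1]
    have hx' : x i = x i * N * mesh N := by rw [mul_assoc, hN, mul_one]
    constructor
    · conv_rhs => rw [hx']
      gcongr
      exact Nat.floor_le h0
    · conv_lhs => rw [hx']
      gcongr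
      exact Nat.lt_floor_add_one _

/-- Integrals over the torus as sums over the cells. -/
lemma integral_cube_cellIndex {G : Grid d N → (Fin d → ℝ) → ℝ} (hG : ∀ k, Continuous (G k)) :
    ∫ x in cube d, G (cellIndex N x) x = gridInt (fun k => cellProj N (G k) k) := by
  have hmeas : ∀ k : Grid d N, MeasurableSet (openCell k) := fun k =>
    MeasurableSet.univ_pi fun i => measurableSet_Ico
  have hcong : ∀ k : Grid d N, ∀ x ∈ openCell k, G (cellIndex N x) x = G k x := fun k x hx => by
    rw [cellIndex_eq_of_mem hx]
  have hint : ∀ k : Grid d N, IntegrableOn (G k) (openCell k) := fun k =>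
    ((hG k).continuousOn.integrableOn_compact (isCompact_Icc (a := fun i => ((k i).val : ℝ) * mesh N)
      (b := fun i => (((k i).val : ℝ) + 1) * mesh N))).congr_set_ae (openCell_ae_eq k)
  have h1 : (univ.pi fun _ : Fin d => Ico (0 : ℝ) 1) =ᵐ[volume] cube d :=
    Measure.univ_pi_Ico_ae_eq_Icc
  rw [← setIntegral_congr_set h1, ← iUnion_openCell (N := N), integral_iUnion_fintype hmeas, gridInt,
    Finset.mul_sum]
  · refine Finset.sum_congr rfl fun k _ => ?_
    rw [setIntegral_congr_fun (hmeas k) (hcong k), setIntegral_congr_set (openCell_ae_eq k),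
      integral_cell, cellProj_eq]
  · intro k l hkl
    refine disjoint_left.2 fun x hx hx' => hkl ?_
    rw [← cellIndex_eq_of_mem hx, ← cellIndex_eq_of_mem hx']
  · exact fun k => (hint k).congr_fun (fun x hx => (hcong k x hx).symm) (hmeas k)

lemma discreteRelEnergy_eq (a γ : ℝ) (ρ r : Grid d N → ℝ) (w W : Fin d → Grid d N → ℝ) :
    discreteRelEnergy a γ ρ w r W = gridRelEnergy a γ ρ w r W := by
  have h := integral_cube_cellIndex (d := d) (N := N)
    (G := fun k _ => 1 / 2 * ρ k * ∑ i, (w i k - W i k) ^ 2 + relPotential a γ (ρ k) (r k))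
    (fun k => continuous_const)
  simp only [cellProj_const] at h
  exact h

lemma le_cellProj {f : (Fin d → ℝ) → ℝ} (hf : Continuous f) {c : ℝ} {k : Grid d N}
    (h : ∀ x, ‖x - corner k‖ ≤ mesh N → c ≤ f x) : c ≤ cellProj N f k := by
  have hm := mesh_pos N
  rw [cellProj_eq, ← integral_cube_const (d := d) c]
  refine integral_cube_mono continuous_const (continuous_cell_comp hf _ _) fun θ hθ => h _ ?_
  rw [add_sub_cancel_left, norm_smul, Real.norm_eq_abs, abs_of_pos hm]
  exact mul_le_of_le_one_right hm.le (norm_le_one_of_mem_cube hθ)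

lemma cell_subset_cube (k : Grid d N) : cell k ⊆ cube d := by
  have hm := mesh_pos N
  intro x hx
  refine ⟨fun i => le_trans ?_ (hx.1 i), fun i => (hx.2 i).trans ?_⟩
  · simp only [Pi.zero_apply]
    positivity
  · simp only [Pi.one_apply]
    refine le_of_le_of_eq ?_ (natCast_mul_mesh N)
    gcongr
    exact_mod_cast (k i).val_lt

/-- Cell averages of positive functions are positive. -/
lemma cellProj_pos {f : (Fin d → ℝ) → ℝ} (hf : IntegrableOn f (cube d))
    (hpos : ∀ᵐ x ∂(volume.restrict (cube d)), 0 < f x) (k : Grid d N) : 0 < cellProj N f k := by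
  have hm := mesh_pos N
  have hv := volume_real_cell k
  have hint := hf.mono_set (cell_subset_cube k)
  have hae : ∀ᵐ x ∂(volume.restrict (cell k)), 0 < f x :=
    ae_mono (Measure.restrict_mono_set volume (cell_subset_cube k)) hpos
  rw [cellProj, setAverage_eq, hv, smul_eq_mul]
  refine mul_pos (by positivity) ?_
  have h0 : 0 ≤ ∫ x in cell k, f x := integral_nonneg_of_ae (hae.mono fun x hx => hx.le)
  -- A vanishing integral would force `f = 0` almost everywhere on the cell, which contradicts
  -- positivity because the cell has positive volume.
  refine h0.lt_of_ne fun h => ?_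
  have h1 := (integral_eq_zero_iff_of_nonneg_ae (hae.mono fun x hx => hx.le) hint).1 h.symm
  have h2 : ∀ᵐ x ∂(volume.restrict (cell k)), False := by
    filter_upwards [hae, h1] with x hx hx'
    rw [hx'] at hx
    exact lt_irrefl _ hx
  rw [ae_iff] at h2
  simp only [not_false_eq_true, ofPred_true, Measure.restrict_apply_univ] at h2
  rw [measureReal_def, h2] at hv
  have : 0 < mesh N ^ d := by positivity
  simp only [ENNReal.toReal_zero] at hv
  linarith

end TorusIntegral

/-! ### Initial relative energy: from the strong solution to its projections. -/

section InitialEnergy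

variable {a γ : ℝ}

/-- Because `y H'(y) - H(y) = p(y)`, one has `𝔼(x|y) = H(x) - x H'(y) + p(y)`. The term `H(x)`
cancels from the difference, so the dependence on the second argument is Lipschitz with a constant
linear in `x`. -/
lemma relPotential_sub_eq (hγ : 1 < γ) {x y z : ℝ} (hx : 0 < x) (hy : 0 < y) (hz : 0 < z) :
    relPotential a γ x y - relPotential a γ x z
      = -(x * (potentialDeriv a γ y - potentialDeriv a γ z))
        + (pressure a γ y - pressure a γ z) := by
  rw [relPotential_eq hγ hx hy, relPotential_eq hγ hx hz, pressure_eq hγ hy, pressure_eq hγ hz]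
  ring

lemma relPotential_le_add {rlo rhi C : ℝ} (hγ : 1 < γ) (hC : CoeffBound a γ rlo rhi C)
    (hlo : 0 < rlo) {x y z : ℝ} (hx : 0 < x) (hy : y ∈ Icc rlo rhi) (hz : z ∈ Icc rlo rhi) :
    relPotential a γ x y ≤ relPotential a γ x z + C * |y - z| * (1 + x) := by
  have h1 := relPotential_sub_eq (a := a) hγ hx (hlo.trans_le hy.1) (hlo.trans_le hz.1)
  have h2 := abs_le.1 (hC.deriv_lip y hy z hz)
  have h3 := abs_le.1 (hC.pressure_lip y hy z hz)
  have h4 := mul_le_mul_of_nonneg_left h2.1 hx.le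
  linarith [h3.2]

variable {d : ℕ} {T μ lam rlo rhi K C : ℝ} {r : ℝ → (Fin d → ℝ) → ℝ}
  {U : ℝ → (Fin d → ℝ) → Fin d → ℝ}

lemma BoundedSolution.continuous_relPotential
    (h : BoundedSolution T a γ μ lam rlo rhi K r U) (hγ : 1 < γ) {t : ℝ} (ht : t ∈ Icc 0 T)
    {x : ℝ} (hx : 0 < x) : Continuous fun y => relPotential a γ x (r t y) := by
  have h1 := (h.density_lip ht).continuous
  have h2 : Continuous fun y => potentialDeriv a γ (r t y) := (h.potential_contDiff ht).continuous
  have h3 : Continuous fun y => pressure a γ (r t y) := (h.pressure_contDiff ht).continuous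
  have h4 : (fun y => relPotential a γ x (r t y)) = fun y =>
      potentialFn a γ x - x * potentialDeriv a γ (r t y) + pressure a γ (r t y) := by
    funext y
    rw [relPotential_eq hγ hx (h.density_pos ht y), pressure_eq hγ (h.density_pos ht y)]
    ring
  rw [h4]
  fun_prop

/-- The initial relative energy with respect to the projections of the strong solution. -/
lemma BoundedSolution.initial_le (h : BoundedSolution T a γ μ lam rlo rhi K r U) (ha : 0 < a)
    (hγ : 1 < γ) (hC : CoeffBound a γ rlo rhi C) {c : ℝ} (hc : c = 3 * (d * K) + K) {N : ℕ}
    [NeZero N] (ρ : Grid d N → ℝ) (hρ : ∀ k, 0 < ρ k) (w : Fin d → Grid d N → ℝ) :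
    0 ≤ relEnergy a γ (pc ρ) (pcVec w) (r 0) (U 0) ∧
    gridRelEnergy a γ ρ w (cellProj N (r 0)) (avgCell fun i => faceProj N i fun x => U 0 x i)
      ≤ 2 * relEnergy a γ (pc ρ) (pcVec w) (r 0) (U 0)
        + (d * c ^ 2 + C * c) * (1 + gridInt ρ) * mesh N := by
  have h0 : (0 : ℝ) ∈ Icc 0 T := ⟨le_rfl, h.time_pos.le⟩
  have hK := h.nonneg
  have hC0 := hC.nonneg
  have hm := mesh_pos N
  have hc0 : 0 ≤ c := by rw [hc]; positivity
  set W := avgCell (N := N) fun i => faceProj N i fun x => U 0 x i with hW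
  set G : Grid d N → (Fin d → ℝ) → ℝ := fun k y =>
    1 / 2 * ρ k * ∑ i, (w i k - U 0 y i) ^ 2 + relPotential a γ (ρ k) (r 0 y) with hG
  have hGc : ∀ k, Continuous (G k) := by
    intro k
    have h1 := h.continuous_relPotential hγ h0 (hρ k)
    have h2 : ∀ i, Continuous fun y => U 0 y i := fun i => (h.vel_lip h0 i).continuous
    fun_prop
  have hE : relEnergy a γ (pc ρ) (pcVec w) (r 0) (U 0) = gridInt (fun k => cellProj N (G k) k) :=
    integral_cube_cellIndex hGc
  rw [hE]
  constructor
  · refine gridInt_nonneg fun k => le_cellProj (hGc k) fun y _ => ?_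
    refine add_nonneg (mul_nonneg (mul_nonneg (by norm_num) (hρ k).le)
      (Finset.sum_nonneg fun _ _ => sq_nonneg _))
      (relPotential_nonneg ha hγ (hρ k) (h.density_pos h0 y))
  · have hfin : 2 * gridInt (fun k => cellProj N (G k) k)
        + (d * c ^ 2 + C * c) * (1 + gridInt ρ) * mesh N
        = gridInt (fun k => cellProj N
          (fun y => 2 * G k y + (d * c ^ 2 + C * c) * mesh N * (1 + ρ k)) k) := by
      have e1 : ∀ k, cellProj N (fun y => 2 * G k y + (d * c ^ 2 + C * c) * mesh N * (1 + ρ k)) k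
          = 2 * cellProj N (G k) k + (d * c ^ 2 + C * c) * mesh N * (1 + ρ k) := by
        intro k
        have := hGc k
        rw [cellProj_add (by fun_prop) continuous_const, cellProj_mul_left, cellProj_const]
      simp only [e1, gridInt_add, gridInt_mul_left, gridInt_const]
      ring
    rw [hfin, gridRelEnergy]
    refine gridInt_mono fun k => le_cellProj (by have := hGc k; fun_prop) fun y hy => ?_
    have e1 : ∀ i, |W i k - U 0 y i| ≤ c * mesh N := fun i => by
      have := h.avgCell_vel_le N h0 h0 (τ := 0) (by simp) i k y hy
      rwa [add_zero, ← hc] at this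
    have e2 : |cellProj N (r 0) k - r 0 y| ≤ c * mesh N := by
      have := h.density_le N h0 h0 (τ := 0) (by simp) k y hy
      rw [add_zero] at this
      refine this.trans (mul_le_mul_of_nonneg_right ?_ hm.le)
      have : 0 ≤ d * K := by positivity
      rw [hc]; linarith
    have e3 := relPotential_le_add hγ hC h.lo_pos (hρ k) (h.density_mem N h0 k) (h.range 0 h0 y)
    have e4 : C * |cellProj N (r 0) k - r 0 y| * (1 + ρ k) ≤ C * (c * mesh N) * (1 + ρ k) := by
      have := (hρ k).le
      gcongr
    have e5 : ∑ i, (w i k - W i k) ^ 2 ≤ 2 * ∑ i, (w i k - U 0 y i) ^ 2 + 2 * (d * c ^ 2 * mesh N) := by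
      have f1 : ∀ i, (w i k - W i k) ^ 2 ≤ 2 * (w i k - U 0 y i) ^ 2 + 2 * (c ^ 2 * mesh N) := by
        intro i
        have g1 : (W i k - U 0 y i) ^ 2 ≤ (c * mesh N) ^ 2 := sq_le_sq' (abs_le.1 (e1 i)).1 (abs_le.1 (e1 i)).2
        have g2 : (c * mesh N) ^ 2 ≤ c ^ 2 * mesh N := by
          rw [mul_pow]
          gcongr
          nlinarith [mesh_le_one N]
        nlinarith [sq_nonneg ((w i k - U 0 y i) + (W i k - U 0 y i))]
      refine (Finset.sum_le_sum fun i _ => f1 i).trans (le_of_eq ?_)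
      rw [Finset.sum_add_distrib, ← Finset.mul_sum]
      simp
      ring
    have e6 : 1 / 2 * ρ k * ∑ i, (w i k - W i k) ^ 2
        ≤ 1 / 2 * ρ k * (2 * ∑ i, (w i k - U 0 y i) ^ 2 + 2 * (d * c ^ 2 * mesh N)) := by
      have := (hρ k).le
      gcongr
    have e7 : 0 ≤ d * c ^ 2 * mesh N := by positivity
    have e8 := relPotential_nonneg ha hγ (hρ k) (h.density_pos h0 y)
    simp only [hG]
    linarith

end InitialEnergy

/-! ### Discrete Gronwall argument. -/

section Gronwall

/-- A discrete Gronwall inequality. -/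
lemma discrete_gronwall {S b : ℕ → ℝ} {q : ℝ} {n : ℕ} (hq0 : 0 ≤ q) (hq : q ≤ 1 / 2)
    (hS : ∀ m ≤ n, 0 ≤ S m) (hb : ∀ m, 0 ≤ b m)
    (h : ∀ m < n, S (m + 1) - S m ≤ q * (S (m + 1) + S m) + b m) :
    S n ≤ Real.exp (4 * q * n) * (S 0 + 2 * ∑ m ∈ Finset.range n, b m) := by
  induction n with
  | zero => simp
  | succ n ih =>
    have ih' := ih (fun m hm => hS m (by omega)) fun m hm => h m (by omega)
    have h1 := h n (by omega)
    have h2 : S (n + 1) ≤ (1 + 4 * q) * S n + 2 * b n := by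
      have e1 : (1 - q) * S (n + 1) ≤ (1 + q) * S n + b n := by linarith
      -- Here `q ≤ 1 / 2` is used: `(1 - q) * (1 + 4 * q) - (1 + q) = 2 * q * (1 - 2 * q)`.
      have e2 : (1 + q) * S n ≤ (1 - q) * (1 + 4 * q) * S n :=
        mul_le_mul_of_nonneg_right (by nlinarith) (hS n (by omega))
      have e3 : b n ≤ (1 - q) * (2 * b n) := by nlinarith [hb n]
      have e4 : (1 - q) * S (n + 1) ≤ (1 - q) * ((1 + 4 * q) * S n + 2 * b n) := by linarith
      exact le_of_mul_le_mul_left e4 (by linarith)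
    have h3 : 1 + 4 * q ≤ Real.exp (4 * q) := by
      have := Real.add_one_le_exp (4 * q)
      linarith
    have h4 : Real.exp (4 * q * (n + 1 : ℕ)) = Real.exp (4 * q) * Real.exp (4 * q * n) := by
      rw [← Real.exp_add]
      push_cast
      ring_nf
    have h5 : 1 ≤ Real.exp (4 * q * (n + 1 : ℕ)) := Real.one_le_exp (by positivity)
    rw [Finset.sum_range_succ]
    calc S (n + 1) ≤ (1 + 4 * q) * S n + 2 * b n := h2
      _ ≤ Real.exp (4 * q) * (Real.exp (4 * q * n) * (S 0 + 2 * ∑ m ∈ Finset.range n, b m))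
          + Real.exp (4 * q * (n + 1 : ℕ)) * (2 * b n) := by
          have := hS n (by omega)
          have := hb n
          refine add_le_add (mul_le_mul h3 ih' (hS n (by omega)) (Real.exp_pos _).le) ?_
          exact le_mul_of_one_le_left (by positivity) h5
      _ = _ := by rw [h4]; ring

/-- Gronwall is applied to the relative energy plus the accumulated dissipation. The terms `ε * g m`
are treated as a source, whose sum is controlled by the a priori bound `G₀`. -/
lemma gronwall_of_step {X g y : ℕ → ℝ} {dt T C ε μ' ν G₀ : ℝ} {Nt : ℕ} (hdt : 0 < dt)
    (hT : Nt * dt = T) (hC : 0 ≤ C) (hε : 0 ≤ ε) (hμ : 0 ≤ μ') (hν : 0 ≤ ν)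
    (hX : ∀ n ≤ Nt, 0 ≤ X n) (hg : ∀ n, 0 ≤ g n) (hy : ∀ n, 0 ≤ y n) (hCdt : C * dt ≤ 1 / 2)
    (hG : dt * ∑ m ∈ Finset.range Nt, g m ≤ G₀)
    (h : ∀ m < Nt, X (m + 1) - X m + dt * (μ' * g m + ν * y m)
      ≤ dt * (C * (X (m + 1) + X m + ε * (1 + g m)))) {n : ℕ} (hn : n ≤ Nt) :
    X n + dt * ∑ m ∈ Finset.range n, (μ' * g m + ν * y m)
      ≤ Real.exp (4 * C * T) * (X 0 + 2 * (C * ε * (T + G₀))) := by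
  set S : ℕ → ℝ := fun n => X n + dt * ∑ m ∈ Finset.range n, (μ' * g m + ν * y m) with hSdef
  have hD : ∀ n, 0 ≤ dt * ∑ m ∈ Finset.range n, (μ' * g m + ν * y m) := fun n =>
    mul_nonneg hdt.le (Finset.sum_nonneg fun m _ =>
      add_nonneg (mul_nonneg hμ (hg m)) (mul_nonneg hν (hy m)))
  have hXS : ∀ n, X n ≤ S n := fun n => by
    have := hD n
    simp only [hSdef]
    linarith
  have hb : ∀ m, 0 ≤ dt * (C * (ε * (1 + g m))) := fun m => by
    have := hg m
    positivity
  have h1 := discrete_gronwall (S := S) (b := fun m => dt * (C * (ε * (1 + g m)))) (q := C * dt)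
    (n := n) (by positivity) hCdt (fun m hm => (hX m (hm.trans hn)).trans (hXS m)) hb (fun m hm => by
      have e1 := h m (by omega)
      have e2 : S (m + 1) - S m = X (m + 1) - X m + dt * (μ' * g m + ν * y m) := by
        simp only [hSdef, Finset.sum_range_succ]
        ring
      have e3 : C * dt * (X (m + 1) + X m) ≤ C * dt * (S (m + 1) + S m) := by
        gcongr
        · exact hXS _
        · exact hXS _
      rw [e2]
      linarith)
  have h2 : ∑ m ∈ Finset.range n, dt * (C * (ε * (1 + g m))) ≤ C * ε * (T + G₀) := by
    have e1 : ∑ m ∈ Finset.range n, dt * (C * (ε * (1 + g m)))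
        ≤ ∑ m ∈ Finset.range Nt, dt * (C * (ε * (1 + g m))) :=
      Finset.sum_le_sum_of_subset_of_nonneg (Finset.range_mono hn) fun m _ _ => hb m
    have e2 : ∑ m ∈ Finset.range Nt, dt * (C * (ε * (1 + g m)))
        = C * ε * (Nt * dt + dt * ∑ m ∈ Finset.range Nt, g m) := by
      have : ∀ m, dt * (C * (ε * (1 + g m))) = C * ε * dt + C * ε * dt * g m := fun m => by ring
      simp only [this, Finset.sum_add_distrib, ← Finset.mul_sum, Finset.sum_const,
        Finset.card_range, nsmul_eq_mul]
      ring
    rw [e2, hT] at e1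
    refine e1.trans ?_
    gcongr
  have h3 : Real.exp (4 * (C * dt) * n) ≤ Real.exp (4 * C * T) := by
    rw [Real.exp_le_exp, ← hT]
    have : (n : ℝ) ≤ Nt := by exact_mod_cast hn
    calc 4 * (C * dt) * n ≤ 4 * (C * dt) * Nt := by gcongr
      _ = _ := by ring
  have h4 : S 0 = X 0 := by simp [hSdef]
  have h5 : 0 ≤ ∑ m ∈ Finset.range n, dt * (C * (ε * (1 + g m))) :=
    Finset.sum_nonneg fun m _ => hb m
  calc S n ≤ _ := h1
    _ ≤ Real.exp (4 * C * T) * (S 0 + 2 * (C * ε * (T + G₀))) := by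
        refine mul_le_mul h3 (by linarith) ?_ (Real.exp_pos _).le
        have := hX 0 (Nat.zero_le _)
        rw [h4]
        positivity
    _ = _ := by rw [h4]

end Gronwall

/-! ### A priori energy bounds. -/

section EnergyEstimate

variable {d N : ℕ} [NeZero N] {a γ μ lam κ dt : ℝ}

lemma mul_potentialDeriv_diff_nonneg (ha : 0 < a) (hγ : 1 < γ) {x y : ℝ} (hx : 0 < x)
    (hy : 0 < y) : 0 ≤ (y - x) * (potentialDeriv a γ y - potentialDeriv a γ x) := by
  have h1 := relPotential_nonneg ha hγ hx hy
  have h2 := relPotential_nonneg ha hγ hy hx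
  rw [relPotential_eq hγ hx hy] at h1
  rw [relPotential_eq hγ hy hx] at h2
  linarith

/-- The discrete energy inequality. -/
lemma energy_step (ha : 0 < a) (hγ : 1 < γ) (hdt : 0 < dt) (hκ : 0 ≤ κ)
    {ρ ρm : Grid d N → ℝ} {u wm : Fin d → Grid d N → ℝ}
    (hρ : ∀ k, 0 < ρ k) (hρm : ∀ k, 0 < ρm k)
    (hden : ∀ k, (ρ k - ρm k) / dt + divUp ρ u k - κ * lapCell ρ k = 0)
    (hmom : ∀ (i : Fin d) (k : Grid d N),
      avgFace i (fun l => (ρ l * avgCell u i l - ρm l * wm i l) / dt) k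
        + avgFace i (divUp (fun l => ρ l * avgCell u i l) u) k
        + diffFace i (fun l => pressure a γ (ρ l)) k
        - μ * lapFace (u i) k
        - (μ + lam) * diffFace i (divh u) k
      = κ * ∑ j, avgFace i
          (diffCell j (fun l => avgFace j (avgCell u i) l * diffFace j ρ l)) k) :
    gridRelEnergy a γ ρ (avgCell u) 1 0 + dt * (μ * gradSq u + (μ + lam) * divSq u)
      ≤ gridRelEnergy a γ ρm wm 1 0 := by
  have hm := mesh_pos N
  -- For the constant state of density one at rest every remainder vanishes, and the relative energy
  -- inequality becomes the energy inequality.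
  have h := relative_energy_inequality (R := fun _ => 1) (Rm := fun _ => 1)
    (V := (0 : Fin d → Grid d N → ℝ)) (Wm := 0) ha hγ hdt hρ hρm (fun _ => one_pos)
    (fun _ => one_pos) hden hmom
  have z1 : avgCell (0 : Fin d → Grid d N → ℝ) = 0 := by
    funext i k; simp [avgCell]
  have z2 : ∀ k, divh (0 : Fin d → Grid d N → ℝ) k = 0 := by
    intro k; simp [divh, diffCell]
  have z3 : ∀ (j : Fin d) (k : Grid d N), diffFace j (0 : Grid d N → ℝ) k = 0 := by
    intro j k; simp [diffFace]
  have z4 : ∀ (c : ℝ) (j : Fin d) (k : Grid d N), diffFace j (fun _ => c) k = 0 := by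
    intro c j k; simp [diffFace]
  have z5 : gridInt (fun _ : Grid d N => (0 : ℝ)) = 0 := gridInt_const 0
  simp only [z1, z2, z3, z4, z5, sub_zero, Pi.zero_apply, sub_self, zero_div, mul_zero, zero_mul,
    Finset.sum_const_zero, add_zero, neg_zero, ne_eq, OfNat.ofNat_ne_zero, not_false_eq_true,
    zero_pow] at h
  have p1 : 0 ≤ 1 / (2 * dt) * gridInt (fun k => ρm k * ∑ i, (avgCell u i k - wm i k) ^ 2) :=
    mul_nonneg (by positivity) (gridInt_nonneg fun k => mul_nonneg (hρm k).le
      (Finset.sum_nonneg fun _ _ => sq_nonneg _))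
  have p2 : 0 ≤ gridInt (fun k => ∑ j, 1 / mesh N
        * (max 0 (u j k) * relPotential a γ (ρ k) (ρ (k + e j))
          - min 0 (u j k) * relPotential a γ (ρ (k + e j)) (ρ k))) := by
    refine gridInt_nonneg fun k => Finset.sum_nonneg fun j _ => mul_nonneg (by positivity) ?_
    have e1 := mul_nonneg (le_max_left 0 (u j k))
      (relPotential_nonneg ha hγ (hρ k) (hρ (k + e j)))
    have e2 := mul_nonneg (neg_nonneg.2 (min_le_left 0 (u j k)))
      (relPotential_nonneg ha hγ (hρ (k + e j)) (hρ k))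
    linarith
  have p3 : 0 ≤ κ * gridInt (fun k => ∑ j,
          diffFace j ρ k * diffFace j (fun l => potentialDeriv a γ (ρ l)) k) := by
    refine mul_nonneg hκ (gridInt_nonneg fun k => Finset.sum_nonneg fun j _ => ?_)
    rw [diffFace, diffFace, div_mul_div_comm]
    exact div_nonneg (mul_potentialDeriv_diff_nonneg ha hγ (hρ k) (hρ (k + e j)))
      (mul_self_nonneg _)
  have h2 : (gridRelEnergy a γ ρ (avgCell u) 1 0 - gridRelEnergy a γ ρm wm 1 0) / dt
      + μ * gradSq u + (μ + lam) * divSq u ≤ 0 := by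
    have e1 : (fun _ : Grid d N => (1 : ℝ)) = 1 := rfl
    rw [e1] at h
    linarith
  have h3 := mul_le_mul_of_nonneg_left h2 hdt.le
  rw [mul_zero, mul_add, mul_add, mul_div_cancel₀ _ hdt.ne'] at h3
  linarith

lemma gradSq_nonneg (v : Fin d → Grid d N → ℝ) : 0 ≤ gradSq v := gridInt_nonneg fun _ =>
  Finset.sum_nonneg fun _ _ => Finset.sum_nonneg fun _ _ => sq_nonneg _

lemma divSq_nonneg (v : Fin d → Grid d N → ℝ) : 0 ≤ divSq v := gridInt_nonneg fun _ => sq_nonneg _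

lemma gradSq_sub_le {L : ℝ} (u V : Fin d → Grid d N → ℝ)
    (hV : ∀ i j k, |diffFace j (V i) k| ≤ L) :
    gradSq (u - V) ≤ 2 * gradSq u + 2 * (d * (d * L ^ 2)) := by
  have h : ∀ k : Grid d N, ∑ i, ∑ j, (bidualDiff j ((u - V) i) k) ^ 2
      ≤ 2 * ∑ i, ∑ j, (bidualDiff j (u i) k) ^ 2 + 2 * (d * (d * L ^ 2)) := by
    intro k
    have e1 : ∑ i, ∑ j, (bidualDiff j ((u - V) i) k) ^ 2
        ≤ ∑ i : Fin d, ∑ j : Fin d, (2 * (bidualDiff j (u i) k) ^ 2 + 2 * L ^ 2) := by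
      refine Finset.sum_le_sum fun i _ => Finset.sum_le_sum fun j _ => ?_
      have f1 : (diffFace j (V i) k) ^ 2 ≤ L ^ 2 :=
        sq_le_sq' (abs_le.1 (hV i j k)).1 (abs_le.1 (hV i j k)).2
      rw [bidualDiff_eq_diffFace, diffFace_sub]
      nlinarith [sq_nonneg (diffFace j (u i) k + diffFace j (V i) k)]
    refine e1.trans (le_of_eq ?_)
    simp only [Finset.sum_add_distrib, ← Finset.mul_sum, Finset.sum_const, Finset.card_univ,
      Fintype.card_fin, nsmul_eq_mul]
  refine (gridInt_mono h).trans (le_of_eq ?_)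
  rw [gridInt_add, gridInt_mul_left, gridInt_const]
  rfl

lemma divSq_sub_le {L : ℝ} (u V : Fin d → Grid d N → ℝ) (hV : ∀ k, |divh V k| ≤ L) :
    divSq (u - V) ≤ 2 * divSq u + 2 * L ^ 2 := by
  have h : ∀ k : Grid d N, (divh (u - V) k) ^ 2 ≤ 2 * (divh u k) ^ 2 + 2 * L ^ 2 := by
    intro k
    have f1 : (divh V k) ^ 2 ≤ L ^ 2 := sq_le_sq' (abs_le.1 (hV k)).1 (abs_le.1 (hV k)).2
    rw [divh_sub]
    nlinarith [sq_nonneg (divh u k + divh V k)]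
  refine (gridInt_mono h).trans (le_of_eq ?_)
  rw [gridInt_add, gridInt_mul_left, gridInt_const]
  rfl

lemma gridRelEnergy_nonneg (ha : 0 < a) (hγ : 1 < γ) {ρ R : Grid d N → ℝ}
    {w W : Fin d → Grid d N → ℝ} (hρ : ∀ k, 0 < ρ k) (hR : ∀ k, 0 < R k) :
    0 ≤ gridRelEnergy a γ ρ w R W := gridInt_nonneg fun k =>
  add_nonneg (mul_nonneg (mul_nonneg (by norm_num) (hρ k).le)
    (Finset.sum_nonneg fun _ _ => sq_nonneg _)) (relPotential_nonneg ha hγ (hρ k) (hR k))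

/-- The relative energy is controlled by the energy. -/
lemma gridRelEnergy_le {rlo rhi C L : ℝ} (ha : 0 < a) (hγ : 1 < γ)
    (hC : CoeffBound a γ (min rlo 1) (max rhi 1) C) (hlo : 0 < rlo) {ρ R : Grid d N → ℝ}
    {w W : Fin d → Grid d N → ℝ} (hρ : ∀ k, 0 < ρ k) (hR : ∀ k, R k ∈ Icc rlo rhi)
    (hW : ∀ i k, |W i k| ≤ L) :
    gridRelEnergy a γ ρ w R W
      ≤ 2 * gridRelEnergy a γ ρ w 1 0 + d * L ^ 2 * gridInt ρ
        + C * (2 * C) * (1 + gridInt ρ) := by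
  -- The range of densities is enlarged to contain the reference density one.
  have h1 : (1 : ℝ) ∈ Icc (min rlo 1) (max rhi 1) := ⟨min_le_right _ _, le_max_right _ _⟩
  have hC0 := hC.nonneg
  have hp : ∀ k, 1 / 2 * ρ k * ∑ i, (w i k - W i k) ^ 2 + relPotential a γ (ρ k) (R k)
      ≤ 2 * (1 / 2 * ρ k * ∑ i, (w i k - (0 : Fin d → Grid d N → ℝ) i k) ^ 2
          + relPotential a γ (ρ k) ((1 : Grid d N → ℝ) k)) + d * L ^ 2 * ρ k
        + C * (2 * C) * (1 + ρ k) := by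
    intro k
    have hRk : R k ∈ Icc (min rlo 1) (max rhi 1) :=
      ⟨(min_le_left _ _).trans (hR k).1, (hR k).2.trans (le_max_left _ _)⟩
    have e1 := relPotential_le_add hγ hC (lt_min hlo one_pos) (hρ k) hRk h1
    have e2 : |R k - 1| ≤ 2 * C := by
      have := abs_sub (R k) 1
      have g1 := hC.val_le _ hRk
      have g2 := hC.val_le _ h1
      linarith
    have e3 : C * |R k - 1| * (1 + ρ k) ≤ C * (2 * C) * (1 + ρ k) := by
      have := (hρ k).le
      gcongr
    have e4 : ∑ i, (w i k - W i k) ^ 2 ≤ 2 * ∑ i, (w i k) ^ 2 + 2 * (d * L ^ 2) := by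
      have f1 : ∀ i, (w i k - W i k) ^ 2 ≤ 2 * (w i k) ^ 2 + 2 * L ^ 2 := by
        intro i
        have g1 : (W i k) ^ 2 ≤ L ^ 2 := sq_le_sq' (abs_le.1 (hW i k)).1 (abs_le.1 (hW i k)).2
        nlinarith [sq_nonneg (w i k + W i k)]
      refine (Finset.sum_le_sum fun i _ => f1 i).trans (le_of_eq ?_)
      rw [Finset.sum_add_distrib, ← Finset.mul_sum]
      simp
      ring
    have e5 := relPotential_nonneg ha hγ (hρ k) one_pos
    have e6 : 1 / 2 * ρ k * ∑ i, (w i k - W i k) ^ 2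
        ≤ 1 / 2 * ρ k * (2 * ∑ i, (w i k) ^ 2 + 2 * (d * L ^ 2)) := by
      have := (hρ k).le
      gcongr
    simp only [Pi.zero_apply, sub_zero, Pi.one_apply]
    linarith
  refine (gridInt_mono hp).trans (le_of_eq ?_)
  simp only [gridRelEnergy, gridInt_add, gridInt_mul_left, gridInt_const]

/-- `H(1) = 0` and `H'(1) = a`, so the two energies differ by a function of the mass only. The
relative form has the advantage of being nonnegative. -/
lemma gridRelEnergy_one_zero (hγ : 1 < γ) {ρ : Grid d N → ℝ}
    {w : Fin d → Grid d N → ℝ} :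
    gridRelEnergy a γ ρ w 1 0 = initEnergy a γ ρ w - a * (gridInt ρ - 1) := by
  have h1 : potential a γ 1 = 0 := by simp [potential]
  have h2 : deriv (potential a γ) 1 = a := by
    have : γ - 1 ≠ 0 := by linarith
    rw [deriv_potential hγ one_pos, potentialDeriv, Real.one_rpow]
    field_simp
  have h3 : ∀ k, 1 / 2 * ρ k * ∑ i, (w i k - (0 : Fin d → Grid d N → ℝ) i k) ^ 2
      + relPotential a γ (ρ k) ((1 : Grid d N → ℝ) k)
      = (1 / 2 * ρ k * ∑ i, (w i k) ^ 2 + potential a γ (ρ k)) - a * (ρ k - 1) := by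
    intro k
    simp only [relPotential, Pi.one_apply, Pi.zero_apply, sub_zero, h1, h2]
    ring
  rw [gridRelEnergy]
  simp only [h3]
  rw [gridInt_sub, gridInt_mul_left, gridInt_sub, gridInt_const]
  rfl

/-- Provides the `L^γ` bound at each time level that enters both the weighted Poincaré inequality
and the inverse estimate. -/
lemma gridInt_rpow_le {C : ℝ} (hC : ∀ x y : ℝ, 0 < x → 0 < y → y ≤ 1 →
      x ^ γ ≤ C * (1 + relPotential a γ x y)) (hC0 : 0 ≤ C) {ρ : Grid d N → ℝ}
    {w : Fin d → Grid d N → ℝ} (hρ : ∀ k, 0 < ρ k) :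
    gridInt (fun k => ρ k ^ γ) ≤ C * (1 + gridRelEnergy a γ ρ w 1 0) := by
  have h1 : ∀ k, ρ k ^ γ ≤ C * (1 + (1 / 2 * ρ k
      * ∑ i, (w i k - (0 : Fin d → Grid d N → ℝ) i k) ^ 2
      + relPotential a γ (ρ k) ((1 : Grid d N → ℝ) k))) := by
    intro k
    refine (hC (ρ k) 1 (hρ k) one_pos le_rfl).trans ?_
    have : 0 ≤ 1 / 2 * ρ k * ∑ i, (w i k - (0 : Fin d → Grid d N → ℝ) i k) ^ 2 :=
      mul_nonneg (mul_nonneg (by norm_num) (hρ k).le) (Finset.sum_nonneg fun _ _ => sq_nonneg _)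
    refine mul_le_mul_of_nonneg_left ?_ hC0
    simp only [Pi.one_apply]
    linarith
  refine (gridInt_mono h1).trans (le_of_eq ?_)
  rw [gridInt_mul_left, gridInt_add, gridInt_const]
  rfl

end EnergyEstimate

/-! ### Positivity, mass and energy along the time steps. -/

section Scheme

variable {d N : ℕ} [NeZero N] {a γ μ lam α dt : ℝ} {Nt : ℕ} {ρ₀ : (Fin d → ℝ) → ℝ}
  {u₀ : (Fin d → ℝ) → Fin d → ℝ} {ρ : ℕ → Grid d N → ℝ} {u ubar : ℕ → Fin d → Grid d N → ℝ}

lemma IsMACSolution.density_step (h : IsMACSolution a γ μ lam α dt Nt ρ₀ u₀ ρ u ubar) {m : ℕ}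
    (hm : m < Nt) (k : Grid d N) :
    (ρ (m + 1) k - ρ m k) / dt + divUp (ρ (m + 1)) (u (m + 1)) k
      - mesh N ^ α * lapCell (ρ (m + 1)) k = 0 :=
  h.density_eq (m + 1) (by omega) (by omega) k

lemma IsMACSolution.ubar_succ (h : IsMACSolution a γ μ lam α dt Nt ρ₀ u₀ ρ u ubar) (m : ℕ) :
    ubar (m + 1) = avgCell (u (m + 1)) := by
  rw [h.cell_velocity]; rfl

lemma IsMACSolution.momentum_step (h : IsMACSolution a γ μ lam α dt Nt ρ₀ u₀ ρ u ubar) {m : ℕ}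
    (hm : m < Nt) (i : Fin d) (k : Grid d N) :
    avgFace i (fun l => (ρ (m + 1) l * avgCell (u (m + 1)) i l - ρ m l * ubar m i l) / dt) k
        + avgFace i (divUp (fun l => ρ (m + 1) l * avgCell (u (m + 1)) i l) (u (m + 1))) k
        + diffFace i (fun l => pressure a γ (ρ (m + 1) l)) k
        - μ * lapFace (u (m + 1) i) k
        - (μ + lam) * diffFace i (divh (u (m + 1))) k
      = mesh N ^ α * ∑ j, avgFace i
          (diffCell j (fun l => avgFace j (avgCell (u (m + 1)) i) l
            * diffFace j (ρ (m + 1)) l)) k := by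
  have := h.momentum_eq (m + 1) (by omega) (by omega) i k
  rw [h.ubar_succ] at this
  exact this

lemma IsMACSolution.density_pos (h : IsMACSolution a γ μ lam α dt Nt ρ₀ u₀ ρ u ubar)
    (hdt : 0 < dt) (h0 : ∀ k, 0 < ρ 0 k) {n : ℕ} (hn : n ≤ Nt) (k : Grid d N) : 0 < ρ n k := by
  induction n generalizing k with
  | zero => exact h0 k
  | succ m ih =>
    exact _root_.MACNS.density_pos hdt (Real.rpow_nonneg (mesh_pos N).le α)
      (h.density_step hn) (ih (by omega)) k

lemma IsMACSolution.mass (h : IsMACSolution a γ μ lam α dt Nt ρ₀ u₀ ρ u ubar)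
    (hdt : 0 < dt) {n : ℕ} (hn : n ≤ Nt) : gridInt (ρ n) = gridInt (ρ 0) := by
  induction n with
  | zero => rfl
  | succ m ih => rw [gridInt_eq_of_density hdt (h.density_step hn), ih (by omega)]

/-- The energy estimate of the scheme. -/
lemma IsMACSolution.energy (h : IsMACSolution a γ μ lam α dt Nt ρ₀ u₀ ρ u ubar) (ha : 0 < a)
    (hγ : 1 < γ) (hdt : 0 < dt) (h0 : ∀ k, 0 < ρ 0 k) {n : ℕ} (hn : n ≤ Nt) :
    gridRelEnergy a γ (ρ n) (ubar n) 1 0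
      + dt * ∑ m ∈ Finset.range n, (μ * gradSq (u (m + 1)) + (μ + lam) * divSq (u (m + 1)))
      ≤ gridRelEnergy a γ (ρ 0) (ubar 0) 1 0 := by
  induction n with
  | zero => simp
  | succ m ih =>
    have h1 := energy_step ha hγ hdt (Real.rpow_nonneg (mesh_pos N).le α)
      (h.density_pos hdt h0 hn) (h.density_pos hdt h0 (by omega)) (h.density_step hn)
      (h.momentum_step hn)
    have h2 := ih (by omega)
    rw [Finset.sum_range_succ, h.ubar_succ]
    linarith

end Scheme

/-! ### The error estimate. -/

section ErrorBound

variable {d : ℕ} {a γ μ lam T rlo : ℝ}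

/-- The dissipation of the error is controlled by the initial energy. -/
lemma IsMACSolution.dissipation_le {N : ℕ} [NeZero N] {α dt E₁ L : ℝ} {Nt : ℕ}
    {ρ₀ : (Fin d → ℝ) → ℝ} {u₀ : (Fin d → ℝ) → Fin d → ℝ} {ρ : ℕ → Grid d N → ℝ}
    {u ubar V : ℕ → Fin d → Grid d N → ℝ}
    (h : IsMACSolution a γ μ lam α dt Nt ρ₀ u₀ ρ u ubar) (ha : 0 < a) (hγ : 1 < γ) (hμ : 0 < μ)
    (hlam : 0 ≤ μ + lam) (hdt : 0 < dt) (h0 : ∀ k, 0 < ρ 0 k)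
    (hE : gridRelEnergy a γ (ρ 0) (ubar 0) 1 0 ≤ E₁)
    (hV : ∀ m < Nt, ∀ i j k, |diffFace j (V (m + 1) i) k| ≤ L)
    (hV' : ∀ m < Nt, ∀ k, |divh (V (m + 1)) k| ≤ d * L) {n : ℕ} (hn : n ≤ Nt) :
    dt * ∑ m ∈ Finset.range n, (μ / 2 * gradSq (u (m + 1) - V (m + 1))
        + (μ + lam) * divSq (u (m + 1) - V (m + 1)))
      ≤ 2 * E₁ + Nt * dt * (μ * (d * (d * L ^ 2)) + 2 * (μ + lam) * (d * L) ^ 2) := by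
  set c := μ * (d * (d * L ^ 2)) + 2 * (μ + lam) * (d * L) ^ 2 with hc
  have hc0 : 0 ≤ c := by positivity
  have h1 : ∀ m ∈ Finset.range n, μ / 2 * gradSq (u (m + 1) - V (m + 1))
        + (μ + lam) * divSq (u (m + 1) - V (m + 1))
      ≤ 2 * (μ * gradSq (u (m + 1)) + (μ + lam) * divSq (u (m + 1))) + c := by
    intro m hm
    have hm' : m < Nt := (Finset.mem_range.1 hm).trans_le hn
    have e1 := mul_le_mul_of_nonneg_left (gradSq_sub_le (u (m + 1)) (V (m + 1)) (hV m hm'))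
      (half_pos hμ).le
    have e2 := mul_le_mul_of_nonneg_left (divSq_sub_le (u (m + 1)) (V (m + 1)) (hV' m hm')) hlam
    have e3 := mul_nonneg hμ.le (gradSq_nonneg (u (m + 1)))
    rw [hc]
    linarith
  have h2 := h.energy ha hγ hdt h0 hn
  have h3 : 0 ≤ gridRelEnergy a γ (ρ n) (ubar n) 1 0 :=
    gridRelEnergy_nonneg ha hγ (h.density_pos hdt h0 hn) fun _ => one_pos
  have h4 : (n : ℝ) * dt * c ≤ Nt * dt * c := by
    have : (n : ℝ) ≤ Nt := by exact_mod_cast hn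
    gcongr
  have h5 := mul_le_mul_of_nonneg_left (Finset.sum_le_sum h1) hdt.le
  have h6 : ∑ m ∈ Finset.range n, (2 * (μ * gradSq (u (m + 1)) + (μ + lam) * divSq (u (m + 1))) + c)
      = 2 * ∑ m ∈ Finset.range n, (μ * gradSq (u (m + 1)) + (μ + lam) * divSq (u (m + 1)))
        + n * c := by
    rw [Finset.sum_add_distrib, ← Finset.mul_sum, Finset.sum_const, Finset.card_range,
      nsmul_eq_mul]
  rw [h6] at h5
  linarith

/-- Consistency between two consecutive time levels; `m < Nt` keeps both of them in `[0, T]`. -/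
lemma stepData_level {N : ℕ} [NeZero N] {dt : ℝ} {Nt : ℕ} {rhi L : ℝ}
    {r : ℝ → (Fin d → ℝ) → ℝ} {U : ℝ → (Fin d → ℝ) → Fin d → ℝ}
    (hdata : ∀ s t, s ∈ Icc 0 T → t ∈ Icc 0 T → s < t →
          StepData a γ μ lam L rlo rhi (t - s) (cellProj N (r t)) (cellProj N (r s))
            (fun i => faceProj N i fun x => U t x i) (avgCell fun i => faceProj N i fun x => U s x i)
            fun j => faceProj N j fun x => potentialDeriv a γ (r s x))
    (hdt : 0 < dt) (hT : Nt * dt = T) {m : ℕ} (hm : m < Nt) :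
    StepData a γ μ lam L rlo rhi dt (projDensity N dt r (m + 1)) (projDensity N dt r m)
      (projVelocity N dt U (m + 1)) (avgCell (projVelocity N dt U m))
      (fun j => faceProj N j fun x => potentialDeriv a γ (r (m * dt) x)) := by
  have h1 : ((m + 1 : ℕ) : ℝ) * dt - m * dt = dt := by push_cast; ring
  have hmT : ((m + 1 : ℕ) : ℝ) ≤ Nt := by exact_mod_cast hm
  have h2 : ((m + 1 : ℕ) : ℝ) * dt ≤ T := by
    rw [← hT]
    gcongr
  have := hdata (m * dt) ((m + 1 : ℕ) * dt) ⟨by positivity, by linarith⟩ ⟨by positivity, h2⟩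
    (by linarith)
  rw [h1] at this
  exact this

/-- The error estimate at a fixed time level. -/
lemma exists_error_bound (d : ℕ) (ha : 0 < a) (hγ : 1 < γ) (hγd : (d : ℝ) / 2 ≤ γ) (hμ : 0 < μ)
    (hlam : 0 ≤ μ + lam) (hT : 0 < T) {M : ℝ} (hM : 0 < M) (E rhi K : ℝ) (hlo : 0 < rlo) :
    ∃ c, 0 ≤ c ∧ ∀ (r : ℝ → (Fin d → ℝ) → ℝ) (U : ℝ → (Fin d → ℝ) → Fin d → ℝ),
      BoundedSolution T a γ μ lam rlo rhi K r U → ∀ α : ℝ, 1 < α →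
      ∀ (ρ₀ : (Fin d → ℝ) → ℝ) (u₀ : (Fin d → ℝ) → Fin d → ℝ)
        (N : ℕ) [NeZero N] (Nt : ℕ) (dt : ℝ), 0 < dt → Nt * dt = T →
      ∀ (ρ : ℕ → Grid d N → ℝ) (u ubar : ℕ → Fin d → Grid d N → ℝ),
        IsMACSolution a γ μ lam α dt Nt ρ₀ u₀ ρ u ubar → (∀ k, 0 < ρ 0 k) →
        gridInt (ρ 0) = M → initEnergy a γ (ρ 0) (ubar 0) ≤ E → ∀ n ≤ Nt,
        gridRelEnergy a γ (ρ n) (ubar n) (projDensity N dt r n) (avgCell (projVelocity N dt U n))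
          + dt * ∑ m ∈ Finset.range n,
            (μ / 2 * gradSq (u (m + 1) - projVelocity N dt U (m + 1))
              + (μ + lam) * divSq (u (m + 1) - projVelocity N dt U (m + 1)))
          ≤ c * (mesh N ^ min ((2 * γ - d) / γ) (1 / 2) + Real.sqrt dt
              + relEnergy a γ (pc (ρ 0)) (pcVec (ubar 0)) (r 0) (U 0)) := by
  obtain ⟨L₀, hL₀⟩ := exists_stepData d hγ a μ lam T rhi K hlo
  obtain ⟨CP, hCP0, hCP⟩ := rpow_le_relPotential ha hγ 1
  obtain ⟨Cc, hCc⟩ := exists_coeffBound a γ rhi hlo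
  obtain ⟨Cb, hCb⟩ := exists_coeffBound a γ (max rhi 1) (lt_min hlo one_pos)
  set E₁ := max (E - a * (M - 1)) 0 with hE₁
  have hE₁0 : 0 ≤ E₁ := le_max_right _ _
  set CE := CP * (1 + E₁) with hCE
  have hCE0 : 0 ≤ CE := by positivity
  -- One constant for three purposes: the consistency bounds, the normalisation `1 ≤ L`, and the
  -- factor of the inverse estimate.
  set L := max (max L₀ 1) (CE ^ (1 / γ)) with hL
  have hL1 : 1 ≤ L := (le_max_right L₀ 1).trans (le_max_left _ _)
  have hLL₀ : L₀ ≤ L := (le_max_left L₀ 1).trans (le_max_left _ _)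
  have hLCE : CE ^ (1 / γ) ≤ L := le_max_right _ _
  -- The bound `2 + T` for `ε` comes from `h ≤ 1`, `dt ≤ T` and `h ^ ((2γ-d)/γ) ≤ 1`.
  obtain ⟨C, hC0, hC⟩ := step_estimate (lam := lam) d ha hγ hμ hlo rhi hL1 hT hM CE
    (E₀ := 2 + T) (by linarith)
  set c₀ := μ * (d * (d * L ^ 2)) + 2 * (μ + lam) * (d * L) ^ 2 with hc₀
  have hc₀0 : 0 ≤ c₀ := by positivity
  set D := 2 * E₁ + T * c₀ with hD
  have hD0 : 0 ≤ D := by positivity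
  set Ci := |d * (3 * (d * K) + K) ^ 2 + Cc * (3 * (d * K) + K)| * (1 + M) with hCi
  have hCi0 : 0 ≤ Ci := by positivity
  set X₁ := 2 * E₁ + d * L ^ 2 * M + Cb * (2 * Cb) * (1 + M) with hX₁
  have hX₁0 : 0 ≤ X₁ := by
    have := hCb.nonneg
    positivity
  set G₀ := 2 / μ * D with hG₀
  have hG₀0 : 0 ≤ G₀ := by positivity
  -- `c₁` is the constant for small time steps, obtained from Gronwall; `c₂` below is the one for
  -- large time steps, obtained from the a priori bounds.
  set c₁ := Real.exp (4 * C * T) * (2 + Ci + 2 * (C * (2 + √T) * (T + G₀))) with hc₁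
  have hc₁0 : 0 ≤ c₁ := by positivity
  set c₂ := 2 + Ci + (X₁ + D) * (2 * C * √T) with hc₂
  have hc₂0 : 0 ≤ c₂ := by positivity
  refine ⟨max c₁ c₂, le_max_of_le_left hc₁0, ?_⟩
  intro r U hrU α hα ρ₀ u₀ N _ Nt dt hdt hNt ρ u ubar h h0 hmass hE n hn
  have hm0 := mesh_pos N
  have hm1 := mesh_le_one N
  have hγ0 : 0 < γ := by linarith
  set A := min ((2 * γ - d) / γ) (1 / 2) with hA
  -- This is where `γ ≥ d / 2` is used: the inverse estimate must not contribute a negative power of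
  -- the mesh size.
  have hAe : 0 ≤ (2 * γ - d) / γ := div_nonneg (by linarith) hγ0.le
  have hs1 : mesh N ≤ mesh N ^ A := by
    have := Real.rpow_le_rpow_of_exponent_ge hm0 hm1
      (show A ≤ 1 from (min_le_right _ _).trans (by norm_num))
    rwa [Real.rpow_one] at this
  have hs2 : mesh N ^ ((2 * γ - d) / γ) ≤ mesh N ^ A :=
    Real.rpow_le_rpow_of_exponent_ge hm0 hm1 (min_le_left _ _)
  have hs3 : mesh N ^ ((2 * γ - d) / γ) ≤ 1 := Real.rpow_le_one hm0.le hm1 hAe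
  have hs4 : 0 < mesh N ^ ((2 * γ - d) / γ) := Real.rpow_pos_of_pos hm0 _
  have hNt1 : (1 : ℝ) ≤ Nt := by
    rcases Nat.eq_zero_or_pos Nt with h' | h'
    · rw [h'] at hNt
      simp at hNt
      linarith
    · exact_mod_cast h'
  have hdtT : dt ≤ T := by
    rw [← hNt]
    exact le_mul_of_one_le_left hdt.le hNt1
  have hdts : dt ≤ √T * √dt := by
    calc dt = √dt * √dt := (Real.mul_self_sqrt hdt.le).symm
      _ ≤ √T * √dt := by gcongr
  have hS := Real.sqrt_pos.2 hdt
  obtain ⟨hR0, hX0⟩ := hrU.initial_le ha hγ hCc rfl (ρ 0) h0 (ubar 0)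
  set 𝓡 := relEnergy a γ (pc (ρ 0)) (pcVec (ubar 0)) (r 0) (U 0) with h𝓡
  set X : ℕ → ℝ := fun n => gridRelEnergy a γ (ρ n) (ubar n) (projDensity N dt r n)
    (avgCell (projVelocity N dt U n)) with hX
  set g : ℕ → ℝ := fun m => gradSq (u (m + 1) - projVelocity N dt U (m + 1)) with hg
  set y : ℕ → ℝ := fun m => divSq (u (m + 1) - projVelocity N dt U (m + 1)) with hy
  have hX0' : X 0 ≤ 2 * 𝓡 + Ci * mesh N := by
    have e0 : X 0 = gridRelEnergy a γ (ρ 0) (ubar 0) (cellProj N (r 0))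
        (avgCell fun i => faceProj N i fun x => U 0 x i) := by
      have e1 : projVelocity N dt U 0 = fun i => faceProj N i fun x => U 0 x i := by
        funext i
        simp only [projVelocity, Nat.cast_zero, zero_mul]
      simp only [hX, e1, projDensity, Nat.cast_zero, zero_mul]
    rw [e0]
    refine hX0.trans ?_
    rw [hmass, hCi]
    gcongr
    exact le_abs_self _
  have hpos := fun {n : ℕ} (hn : n ≤ Nt) => h.density_pos hdt h0 hn
  have hE' : gridRelEnergy a γ (ρ 0) (ubar 0) 1 0 ≤ E₁ := by
    rw [gridRelEnergy_one_zero hγ, hmass]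
    exact (by linarith : _ ≤ E - a * (M - 1)).trans (le_max_left _ _)
  have hEn : ∀ n ≤ Nt, gridRelEnergy a γ (ρ n) (ubar n) 1 0 ≤ E₁ := by
    intro n hn
    have e1 := h.energy ha hγ hdt h0 hn
    have e2 : 0 ≤ dt * ∑ m ∈ Finset.range n,
        (μ * gradSq (u (m + 1)) + (μ + lam) * divSq (u (m + 1))) :=
      mul_nonneg hdt.le (Finset.sum_nonneg fun m _ => add_nonneg
        (mul_nonneg hμ.le (gradSq_nonneg _)) (mul_nonneg hlam (divSq_nonneg _)))
    linarith
  have hdata := fun {m : ℕ} (hm : m < Nt) =>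
    stepData_level (hL₀ r U hrU L hLL₀ N) hdt hNt hm
  have hdiss := fun {n : ℕ} (hn : n ≤ Nt) =>
    h.dissipation_le (V := projVelocity N dt U) ha hγ hμ hlam hdt h0 hE'
      (fun m hm => (hdata hm).grad) (fun m hm => (hdata hm).divh_le) hn
  rw [hNt] at hdiss
  have hXpos : ∀ n ≤ Nt, 0 ≤ X n := by
    intro n hn
    refine gridRelEnergy_nonneg ha hγ (hpos hn) fun k => ?_
    -- The density range at a positive level is read off from the step ending there; level `0` is
    -- the starting level of the first step.
    rcases n with _ | m
    · exact hlo.trans_le ((hdata (Nat.one_le_cast.1 hNt1)).density_prev k).1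
    · exact hlo.trans_le ((hdata hn).density k).1
  have hg0 : ∀ m, 0 ≤ g m := fun m => gradSq_nonneg _
  have hy0 : ∀ m, 0 ≤ y m := fun m => divSq_nonneg _
  have hmA : 0 < mesh N ^ A := Real.rpow_pos_of_pos hm0 _
  set B := mesh N ^ A + √dt + 𝓡 with hB
  have hB0 : 0 ≤ B := by positivity
  have hX0B : X 0 ≤ (2 + Ci) * B := by
    have e1 : Ci * mesh N ≤ Ci * B := by
      refine mul_le_mul_of_nonneg_left ?_ hCi0
      linarith
    have e2 : 2 * 𝓡 ≤ 2 * B := by linarith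
    linarith
  change X n + dt * ∑ m ∈ Finset.range n, (μ / 2 * g m + (μ + lam) * y m) ≤ max c₁ c₂ * B
  -- `C` depends only on the data, so a step violating this condition is bounded below and `√dt`
  -- dominates a constant.
  by_cases hCdt : C * dt ≤ 1 / 2
  · have hG : dt * ∑ m ∈ Finset.range Nt, g m ≤ G₀ := by
      have e1 := hdiss le_rfl
      have e2 : μ / 2 * (dt * ∑ m ∈ Finset.range Nt, g m)
          ≤ dt * ∑ m ∈ Finset.range Nt, (μ / 2 * g m + (μ + lam) * y m) := by
        rw [mul_left_comm, Finset.mul_sum]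
        refine mul_le_mul_of_nonneg_left (Finset.sum_le_sum fun m _ => ?_) hdt.le
        exact le_add_of_nonneg_right (mul_nonneg hlam (hy0 m))
      calc dt * ∑ m ∈ Finset.range Nt, g m
          = 2 / μ * (μ / 2 * (dt * ∑ m ∈ Finset.range Nt, g m)) := by field_simp
        _ ≤ 2 / μ * D := by
            refine mul_le_mul_of_nonneg_left (e2.trans e1) (by positivity)
    -- The error of one step is linear in `h` and `dt`; it is weakened to the stated powers through
    -- `h ≤ h ^ A` and `dt ≤ √T * √dt`.
    set ε := mesh N + dt + mesh N ^ ((2 * γ - d) / γ) with hε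
    have hε0 : 0 ≤ ε := by positivity
    have hεB : ε ≤ (2 + √T) * B := by
      have e1 : √T * √dt ≤ √T * B :=
        mul_le_mul_of_nonneg_left (by linarith) (Real.sqrt_nonneg T)
      have e2 : mesh N + mesh N ^ ((2 * γ - d) / γ) ≤ 2 * B := by linarith
      linarith
    have hκ : mesh N ^ α ≤ mesh N := by
      have := Real.rpow_le_rpow_of_exponent_ge hm0 hm1 hα.le
      rwa [Real.rpow_one] at this
    have hstep : ∀ m < Nt, X (m + 1) - X m + dt * (μ / 2 * g m + (μ + lam) * y m)
        ≤ dt * (C * (X (m + 1) + X m + ε * (1 + g m))) := by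
      intro m hm
      have hγint : gridInt (fun k => ρ (m + 1) k ^ γ) ≤ CE := by
        refine (gridInt_rpow_le (w := ubar (m + 1)) hCP hCP0.le (hpos hm)).trans ?_
        have := hEn (m + 1) hm
        rw [hCE]
        gcongr
      have := hC N ε dt (mesh N ^ α) (ρ (m + 1)) (ρ m) _ _ (u (m + 1)) _ (ubar m) _ _
        (hpos hm) (hpos hm.le) hdt hdtT (by linarith) (by linarith) (by linarith)
        (Real.rpow_nonneg hm0.le _) hκ (fun k => by
          refine (inverse_estimate hγ _ (hpos hm) hγint k).trans ?_
          have : mesh N ^ ((2 * γ - d) / γ) ≤ ε := by linarith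
          gcongr) ((h.mass hdt hm).trans hmass) hγint (hdata hm) (h.density_step hm)
        (h.momentum_step hm)
      rw [← h.ubar_succ] at this
      exact this
    refine (gronwall_of_step hdt hNt hC0 hε0 (half_pos hμ).le hlam hXpos hg0 hy0 hCdt hG hstep
      hn).trans ?_
    refine le_trans ?_ (mul_le_mul_of_nonneg_right (le_max_left c₁ c₂) hB0)
    rw [hc₁, mul_assoc (Real.exp _)]
    refine mul_le_mul_of_nonneg_left ?_ (Real.exp_pos _).le
    have : C * ε * (T + G₀) ≤ C * ((2 + √T) * B) * (T + G₀) := by gcongr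
    linarith
  · push Not at hCdt
    refine le_trans ?_ (mul_le_mul_of_nonneg_right (le_max_right c₁ c₂) hB0)
    rcases n with _ | m
    · simp only [Finset.range_zero, Finset.sum_empty, mul_zero, add_zero]
      refine hX0B.trans (mul_le_mul_of_nonneg_right ?_ hB0)
      rw [hc₂]
      exact le_add_of_nonneg_right (by positivity)
    · have e1 := hdiss hn
      have e2 : X (m + 1) ≤ X₁ := by
        have f1 := gridRelEnergy_le (w := ubar (m + 1)) ha hγ hCb hlo (hpos hn)
          (hdata hn).density (hdata hn).velCell
        have f2 := hEn _ hn
        rw [(h.mass hdt hn).trans hmass] at f1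
        exact f1.trans (by rw [hX₁]; linarith)
      -- From `1 / 2 < C * dt ≤ C * √T * √dt`; a bounded error may therefore be multiplied by this
      -- factor.
      have e3 : 1 ≤ 2 * C * √T * B := by
        have f1 : C * dt ≤ C * (√T * √dt) := by gcongr
        have f2 : C * √T * √dt ≤ C * √T * B := by
          gcongr
          linarith
        linarith
      have e4 : X₁ + D ≤ (X₁ + D) * (2 * C * √T * B) :=
        le_mul_of_one_le_right (by linarith) e3
      calc _ ≤ X₁ + D := add_le_add e2 e1
        _ ≤ (X₁ + D) * (2 * C * √T * B) := e4
        _ ≤ (2 + Ci) * B + (X₁ + D) * (2 * C * √T * B) := le_add_of_nonneg_left (by positivity)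
        _ = c₂ * B := by rw [hc₂]; ring

end ErrorBound

end MACNS

theorem theorem2p2 (d : ℕ) (hd : d = 2 ∨ d = 3)
    (γ a μ lam T : ℝ) (hγ : 1 < γ) (hγd : (d : ℝ) / 2 ≤ γ) (ha : 0 < a) (hμ : 0 < μ)
    (hlam : 0 ≤ μ + lam) (hT : 0 < T)
    (M E rlo rhi K : ℝ) (hrlo : 0 < rlo) :
    ∃ c : ℝ, 0 < c ∧
      ∀ (r : ℝ → (Fin d → ℝ) → ℝ) (U : ℝ → (Fin d → ℝ) → Fin d → ℝ),
        IsStrongSolution T a γ μ lam r U →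
        (∀ t ∈ Set.Icc 0 T, ∀ x, rlo ≤ r t x ∧ r t x ≤ rhi) →
        DerivBound T K r U →
      ∀ α : ℝ, 1 < α → (γ < 2 → α < 2 * γ - (d : ℝ) / 3) →
      ∀ (ρ₀ : (Fin d → ℝ) → ℝ) (u₀ : (Fin d → ℝ) → Fin d → ℝ),
        MeasureTheory.IntegrableOn ρ₀ (cube d) →
        (∀ᵐ x ∂(MeasureTheory.volume.restrict (cube d)), 0 < ρ₀ x) →
        (∀ i, MeasureTheory.IntegrableOn (fun x => u₀ x i) (cube d)) →
      ∀ (N : ℕ) [NeZero N] (Nt : ℕ) (dt : ℝ), 0 < Nt → dt = T / Nt →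
      ∀ (ρ : ℕ → Grid d N → ℝ) (u ubar : ℕ → Fin d → Grid d N → ℝ),
        IsMACSolution a γ μ lam α dt Nt ρ₀ u₀ ρ u ubar →
        initMass (ρ 0) = M →
        initEnergy a γ (ρ 0) (ubar 0) ≤ E →
        (⨆ n : Fin (Nt + 1), discreteRelEnergy a γ (ρ n) (ubar n)
            (projDensity N dt r n) (avgCell (projVelocity N dt U n)))
          + dt * ∑ n ∈ Finset.Icc 1 Nt, μ / 2 * gradSq (u n - projVelocity N dt U n)
          + dt * ∑ n ∈ Finset.Icc 1 Nt, (μ + lam) * divSq (u n - projVelocity N dt U n)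
        ≤ c * (mesh N ^ min ((2 * γ - d) / γ) (1 / 2) + Real.sqrt dt
            + relEnergy a γ (pc (ρ 0)) (pcVec (ubar 0)) (r 0) (U 0)) := by
  -- The constant is chosen after `M`. If `M ≤ 0` there is nothing to estimate, because cell
  -- averages of an almost everywhere positive density have positive mass.
  by_cases hM : 0 < M
  · obtain ⟨c, hc0, hc⟩ := exists_error_bound d ha hγ hγd hμ hlam hT hM E rhi K hrlo
    -- The supremum and the total dissipation are bounded separately, each by `c * B`; the added one
    -- makes the constant positive.
    refine ⟨2 * c + 1, by linarith, ?_⟩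
    intro r U hsol hrange hbound α hα _ ρ₀ u₀ hρ₀ hρ₀pos _ N _ Nt dt hNt hdt ρ u ubar h hmass hE
    have hrU : BoundedSolution T a γ μ lam rlo rhi K r U :=
      ⟨hsol, fun t ht x => hrange t ht x, hbound, hT, hrlo⟩
    have hNt' : (0 : ℝ) < Nt := by exact_mod_cast hNt
    have hdt0 : 0 < dt := by rw [hdt]; positivity
    have hNdt : Nt * dt = T := by rw [hdt]; field_simp
    have h0 : ∀ k, 0 < ρ 0 k := by
      rw [h.initial_density]
      exact cellProj_pos hρ₀ hρ₀pos
    have key := hc r U hrU α hα ρ₀ u₀ N Nt dt hdt0 hNdt ρ u ubar h h0 hmass hE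
    obtain ⟨Cc, hCc⟩ := exists_coeffBound a γ rhi hrlo
    have hR0 := (hrU.initial_le ha hγ hCc rfl (ρ 0) h0 (ubar 0)).1
    have hm : 0 ≤ mesh N ^ min ((2 * γ - d) / γ) (1 / 2) := Real.rpow_nonneg (mesh_pos N).le _
    have hs := Real.sqrt_nonneg dt
    set B := mesh N ^ min ((2 * γ - d) / γ) (1 / 2) + Real.sqrt dt
      + relEnergy a γ (pc (ρ 0)) (pcVec (ubar 0)) (r 0) (U 0) with hB
    have hB0 : 0 ≤ B := by positivity
    have hdiss : ∀ n, 0 ≤ dt * ∑ m ∈ Finset.range n,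
        (μ / 2 * gradSq (u (m + 1) - projVelocity N dt U (m + 1))
          + (μ + lam) * divSq (u (m + 1) - projVelocity N dt U (m + 1))) := fun n =>
      mul_nonneg hdt0.le (Finset.sum_nonneg fun m _ => add_nonneg
        (mul_nonneg (half_pos hμ).le (gradSq_nonneg _)) (mul_nonneg hlam (divSq_nonneg _)))
    have hsup : (⨆ n : Fin (Nt + 1), discreteRelEnergy a γ (ρ n) (ubar n)
        (projDensity N dt r n) (avgCell (projVelocity N dt U n))) ≤ c * B := by
      refine ciSup_le fun n => ?_
      rw [discreteRelEnergy_eq]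
      have := hdiss n
      linarith [key n (by omega)]
    have hsum : dt * ∑ n ∈ Finset.Icc 1 Nt, μ / 2 * gradSq (u n - projVelocity N dt U n)
        + dt * ∑ n ∈ Finset.Icc 1 Nt, (μ + lam) * divSq (u n - projVelocity N dt U n)
        ≤ c * B := by
      have e1 : ∀ f : ℕ → ℝ, ∑ n ∈ Finset.Icc 1 Nt, f n
          = ∑ m ∈ Finset.range Nt, f (m + 1) := fun f => by
        rw [Finset.range_eq_Ico, Finset.sum_Ico_add' f 0 Nt 1]
        rfl
      rw [e1, e1, ← mul_add, ← Finset.sum_add_distrib]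
      have := key Nt le_rfl
      have e2 : 0 ≤ gridRelEnergy a γ (ρ Nt) (ubar Nt) (projDensity N dt r Nt)
          (avgCell (projVelocity N dt U Nt)) := by
        refine gridRelEnergy_nonneg ha hγ (h.density_pos hdt0 h0 le_rfl) fun k => ?_
        obtain ⟨L₀, hL₀⟩ := exists_stepData d hγ a μ lam T rhi K hrlo
        obtain ⟨m, rfl⟩ : ∃ m, Nt = m + 1 := ⟨Nt - 1, by omega⟩
        exact hrlo.trans_le ((stepData_level (hL₀ r U hrU L₀ le_rfl N) hdt0 hNdt
          (Nat.lt_succ_self m)).density k).1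
      linarith
    linarith
  · refine ⟨1, one_pos, ?_⟩
    intro r U _ _ _ α _ _ ρ₀ u₀ hρ₀ hρ₀pos _ N _ Nt dt _ _ ρ u ubar h hmass _
    have h0 : ∀ k, 0 < ρ 0 k := by
      rw [h.initial_density]
      exact cellProj_pos hρ₀ hρ₀pos
    refine absurd ?_ hM
    rw [← hmass]
    exact mul_pos (pow_pos (mesh_pos N) d)
      (Finset.sum_pos (fun k _ => h0 k) Finset.univ_nonempty)
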